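/- Let $1<p<\infty$, let $F(t)=t^{p/2}$, and consider in $\mathbb R^3$ the energy $$J_U(v)=\int_U |\nabla v|^p+(p-1)\,\chi_{\{v>0\}}\,dx$$ (the constant $\lambda^2=2F'(1)-F(1)=p-1$ corresponds to the free boundary condition $|\nabla u|=1$). Write $x=\rho(\cos\phi\sin\theta,\sin\phi\sin\theta,\cos\theta)$. Let $f$ be a solution on $(0,\pi)$ of the $p$-Legendre equation $$\ddot f+(f+\cot\theta\,\dot f)\,\frac{f^2+\dot f^2}{f^2+(p-1)\dot f^2}+f=0$$ that is symmetric about the equator, $f(\pi-\theta)=f(\theta)$, and suppose that $\theta_0\in(0,\pi/2]$ is the only zero of $f$ in $(0,\pi/2]$. Put $$u(x)=\rho\,\max\Big(\frac{f(\theta)}{\dot f(\theta_0)},0\Big)\quad(0<\theta<\pi),\qquad u=0\ \text{ on the } x_3\text{-axis},$$ and $\Gamma=\partial\{u>0\}$. Then: 1. $u$ is a weak solution in $\mathbb R^3$ of the free boundary problem $\Delta_pu=0$ in $\{u>0\}$, $|\nabla u|=1$ on $\partial\{u>0\}$, in the sense of Alt and Caffarelli: $u\ge0$ is continuous and lies in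 $W^{1,p}_{loc}(\mathbb R^3)$; $\Delta_pu=0$ weakly in $\{u>0\}$; for every bounded open $D$ there are $0<c\le C$ with $cr\le \sup_{B_r(x)}u\le Cr$ whenever $x\in\Gamma$ and $B_r(x)\subset D$; the set $\{u>0\}$ has locally finite perimeter; and $-\int|\nabla u|^{p-2}\nabla u\cdot\nabla\zeta\,dx=\int_{\partial_{red}\{u>0\}}\zeta\,d\mathcal H^2$ for all $\zeta\in C_c^\infty(\mathbb R^3)$. Moreover $|\nabla u(y)|\to1$ as $y\to x$, $y\in\{u>0\}$, for every $x\in\Gamma\setminus\{0\}$. 2. $\theta_0<\pi/2$, and the free boundary is the double cone $\Gamma=\{x:\ |x_3|=|x|\cos\theta_0\}$. 3. $u$ is not a minimizer: for no bounded open set $U\ni0$ does $u$ minimize $J_U$ among all $v\in W^{1,p}(U)$ with $v-u\in W^{1,p}_0(U)$. 4. $\Gamma\setminus\{0\}$ is a surface of class $C^2$. Let $H$ be its mean curvature, i.e. the sum of the principal curvatures, positive where $\{u=0\}$ is strictly convex, and let $$I(\psi)=\int_{\{u>0\}}|\nabla u|^{p-2}\Big\{|\nabla\psi|^2+(p-2)\frac{(\nabla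 u\cdot\nabla\psi)^2}{|\nabla u|^2}\Big\}dx-\int_\Gamma H\psi^2\,d\mathcal H^2 .$$ Then there is $\psi\in C_c^\infty(\mathbb R^3\setminus\{0\})$ such that both integrals converge and $I(\psi)<0$. If $2\le p<5$, truncations of $1/|x|$ have this property as well: let $\delta>0$, let $\eta_\delta(x)=1/|x|$ for $|x|>\delta$ and $\eta_\delta(x)=1/\delta$ for $|x|\le\delta$, and let $\xi\in C_c^\infty((-1,1))$ with $0\le\xi\le1$ and $\xi=1$ on $[-\frac12,\frac12]$; then for all sufficiently large $R$ both integrals converge for $\psi_{R,\delta}(x)=\eta_\delta(x)\,\xi(|x|/R)$ and $I(\psi_{R,\delta})<0$. -/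

import Mathlib

open MeasureTheory Set Filter Topology
open scoped ContDiff RealInnerProductSpace

noncomputable section

/-- Euclidean three-space. -/
abbrev E3 : Type := EuclideanSpace ℝ (Fin 3)

/-- The standard basis vectors of `ℝ³`. -/
def basisVec (i : Fin 3) : E3 := EuclideanSpace.single i (1 : ℝ)

/-! ### The function `u` -/

/-- The polar angle `θ ∈ [0, π]` of `x = ρ (cos φ sin θ, sin φ sin θ, cos θ)`. -/
def polarAngle (x : E3) : ℝ := InnerProductGeometry.angle x (basisVec 2)

/-- `f` solves the `p`-Legendre equation
`f'' + (f + cot θ f') (f² + f'²) / (f² + (p - 1) f'²) + f = 0` on `(0, π)`. -/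
def SolvesPLegendre (p : ℝ) (f : ℝ → ℝ) : Prop :=
  ∀ θ ∈ Ioo 0 Real.pi,
    DifferentiableAt ℝ f θ ∧ DifferentiableAt ℝ (deriv f) θ ∧
    deriv (deriv f) θ
      + (f θ + Real.cot θ * deriv f θ)
          * ((f θ ^ 2 + deriv f θ ^ 2) / (f θ ^ 2 + (p - 1) * deriv f θ ^ 2))
      + f θ = 0

/-- `u = ρ max (f(θ) / f'(θ₀), 0)`. The equation is singular at the poles `θ = 0, π`
(where `f` may be unbounded), and `u` is set to `0` on the polar axis. -/
def coneFun (f : ℝ → ℝ) (θ₀ : ℝ) (x : E3) : ℝ :=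
  if polarAngle x ∈ Ioo 0 Real.pi then
    ‖x‖ * max (f (polarAngle x) / deriv f θ₀) 0
  else 0

/-! ### Sobolev spaces, the energy and minimizers -/

/-- `ζ ∈ C_c^∞(U)`. -/
def IsTestFunction (U : Set E3) (ζ : E3 → ℝ) : Prop :=
  ContDiff ℝ ∞ ζ ∧ HasCompactSupport ζ ∧ tsupport ζ ⊆ U

/-- `V` is the weak gradient of `v` in the open set `U`. -/
def HasWeakGradientOn (U : Set E3) (v : E3 → ℝ) (V : E3 → E3) : Prop :=
  LocallyIntegrableOn v U ∧ LocallyIntegrableOn V U ∧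
  ∀ ζ : E3 → ℝ, IsTestFunction U ζ → ∀ e : E3,
    ∫ x, v x * fderiv ℝ ζ x e = - ∫ x, ζ x * ⟪V x, e⟫

/-- `v ∈ W^{1,p}(U)` with weak gradient `V`. -/
def MemW1p (p : ℝ) (U : Set E3) (v : E3 → ℝ) (V : E3 → E3) : Prop :=
  MemLp v (ENNReal.ofReal p) (volume.restrict U) ∧
  MemLp V (ENNReal.ofReal p) (volume.restrict U) ∧
  HasWeakGradientOn U v V

/-- `w ∈ W^{1,p}_0(U)` with weak gradient `W`: the closure of `C_c^∞(U)` in `W^{1,p}(U)`. -/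
def MemW1pZero (p : ℝ) (U : Set E3) (w : E3 → ℝ) (W : E3 → E3) : Prop :=
  MemW1p p U w W ∧
  ∃ ζ : ℕ → E3 → ℝ, (∀ k, IsTestFunction U (ζ k)) ∧
    Tendsto (fun k => eLpNorm (fun x => ζ k x - w x) (ENNReal.ofReal p) (volume.restrict U))
      atTop (𝓝 0) ∧
    Tendsto
      (fun k => eLpNorm (fun x => gradient (ζ k) x - W x) (ENNReal.ofReal p) (volume.restrict U))
      atTop (𝓝 0)

/-- The energy `J_F(v) = ∫_U F(|∇v|²) + λ² χ_{v > 0}` for `F(t) = t^{p/2}`, with the normalization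
`λ² = 2 F'(1) - F(1) = p - 1`, for `v` with weak gradient `V`. -/
def energy (p : ℝ) (U : Set E3) (v : E3 → ℝ) (V : E3 → E3) : ℝ :=
  ∫ x in U, ((‖V x‖ ^ 2) ^ (p / 2) + (p - 1) * indicator {y | 0 < v y} (fun _ => (1 : ℝ)) x)

/-- `u` minimizes the energy in `U` among all `v ∈ W^{1,p}(U)` with `v - u ∈ W^{1,p}_0(U)`. -/
def IsMinimizer (p : ℝ) (U : Set E3) (u : E3 → ℝ) : Prop :=
  ∃ Du : E3 → E3, MemW1p p U u Du ∧
    ∀ (v : E3 → ℝ) (Dv : E3 → E3), MemW1p p U v Dv →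
      MemW1pZero p U (fun x => v x - u x) (fun x => Dv x - Du x) →
      energy p U u Du ≤ energy p U v Dv

/-! ### Weak solutions -/

/-- The divergence of a vector field. -/
def divergence (X : E3 → E3) (x : E3) : ℝ := ∑ i, (fderiv ℝ X x (basisVec i)) i

/-- `E` has locally finite perimeter in `ℝ³`. -/
def HasLocallyFinitePerimeter (E : Set E3) : Prop :=
  ∀ D : Set E3, IsOpen D → Bornology.IsBounded D → ∃ M : ℝ, ∀ X : E3 → E3,
    ContDiff ℝ ∞ X → HasCompactSupport X → tsupport X ⊆ D → (∀ x, ‖X x‖ ≤ 1) →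
    ∫ x in E, divergence X x ≤ M

/-- The reduced boundary: the points at which `E` has a measure theoretic outer unit normal `ν`, i.e.
`|(E ∆ {y : ⟨y - x, ν⟩ < 0}) ∩ B_r(x)| = o(r³)` as `r → 0`. -/
def reducedBoundary (E : Set E3) : Set E3 :=
  {x | ∃ ν : E3, ‖ν‖ = 1 ∧
    Tendsto
      (fun r : ℝ =>
        (volume (symmDiff E {y | ⟪y - x, ν⟫ < 0} ∩ Metric.ball x r)).toReal / r ^ 3)
      (𝓝[>] 0) (𝓝 0)}

/-- `u` is a weak solution in `ℝ³` of the one-phase problem for the `p`-Laplacian,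
`Δ_p u = 0` in `{u > 0}`, `|∇u| = l` on `∂{u > 0}`, in the sense of Alt and Caffarelli:
`u ≥ 0` is continuous and in `W^{1,p}_loc`, it is `p`-harmonic in its positivity set, it grows
linearly away from the free boundary, its positivity set has locally finite perimeter, and
`Δ_p u = l^{p-1} ℋ² ⌊ ∂_red {u > 0}` in the sense of distributions. -/
def IsWeakSolution (p l : ℝ) (u : E3 → ℝ) : Prop :=
  (∀ x, 0 ≤ u x) ∧ Continuous u ∧
  (∀ D : Set E3, IsOpen D → Bornology.IsBounded D → ∃ c C : ℝ, 0 < c ∧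
    ∀ x ∈ frontier {y | 0 < u y}, ∀ r : ℝ, 0 < r → Metric.ball x r ⊆ D →
      (∃ y ∈ Metric.ball x r, c * r ≤ u y) ∧ (∀ y ∈ Metric.ball x r, u y ≤ C * r)) ∧
  HasLocallyFinitePerimeter {x | 0 < u x} ∧
  ∃ V : E3 → E3, (∀ R : ℝ, 0 < R → MemW1p p (Metric.ball 0 R) u V) ∧
    (∀ ζ : E3 → ℝ, IsTestFunction {x | 0 < u x} ζ →
      ∫ x, ‖V x‖ ^ (p - 2) * ⟪V x, gradient ζ x⟫ = 0) ∧
    (∀ ζ : E3 → ℝ, IsTestFunction univ ζ →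
      IntegrableOn ζ (reducedBoundary {x | 0 < u x}) (μHE[2]) ∧
      - ∫ x, ‖V x‖ ^ (p - 2) * ⟪V x, gradient ζ x⟫
        = l ^ (p - 1) * ∫ x in reducedBoundary {x | 0 < u x}, ζ x ∂(μHE[2]))

/-! ### Mean curvature and the second variation -/

/-- Near `x ∈ ∂E` the set `E` is `{φ > 0}` for a `C²` function `φ` with `φ(x) = 0`, `∇φ(x) ≠ 0`, and `κ`
is the mean curvature (the sum of the principal curvatures, with the sign for which `κ > 0` where the
complement of `E` is strictly convex)
`κ = |∇φ|⁻¹ (Δφ - D²φ(∇φ, ∇φ) / |∇φ|²)` of `∂E` at `x`. -/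
def HasMeanCurvatureAt (E : Set E3) (x : E3) (κ : ℝ) : Prop :=
  ∃ φ : E3 → ℝ, ContDiffAt ℝ 2 φ x ∧ φ x = 0 ∧ gradient φ x ≠ 0 ∧
    (∀ᶠ y in 𝓝 x, y ∈ E ↔ 0 < φ y) ∧
    κ = ((∑ i, fderiv ℝ (fderiv ℝ φ) x (basisVec i) (basisVec i))
          - fderiv ℝ (fderiv ℝ φ) x (gradient φ x) (gradient φ x) / ‖gradient φ x‖ ^ 2)
        / ‖gradient φ x‖

/-- The integrand `|∇u|^{p-2} (|∇ψ|² + (p - 2) (∇u · ∇ψ)² / |∇u|²)`. -/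
def stabilityDensity (p : ℝ) (u ψ : E3 → ℝ) (x : E3) : ℝ :=
  ‖gradient u x‖ ^ (p - 2) *
    (‖gradient ψ x‖ ^ 2 + (p - 2) * (⟪gradient u x, gradient ψ x⟫ ^ 2 / ‖gradient u x‖ ^ 2))

/-- The stability quantity
`I(ψ) = ∫_{u > 0} |∇u|^{p-2} (|∇ψ|² + (p - 2) (∇u · ∇ψ)² / |∇u|²) - ∫_Γ H ψ² dℋ²`, `Γ = ∂{u > 0}`,
is well defined (both integrals converge) and negative. -/
def StabilityNegative (p : ℝ) (u : E3 → ℝ) (H : E3 → ℝ) (ψ : E3 → ℝ) : Prop :=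
  IntegrableOn (stabilityDensity p u ψ) {x | 0 < u x} ∧
  IntegrableOn (fun x => H x * ψ x ^ 2) (frontier {x | 0 < u x}) (μHE[2]) ∧
  (∫ x in {x | 0 < u x}, stabilityDensity p u ψ x)
    - ∫ x in frontier {x | 0 < u x}, H x * ψ x ^ 2 ∂(μHE[2]) < 0

/-- `η_δ(x) ξ(|x| / R)`, where `η_δ(x) = 1/|x|` for `|x| > δ` and `η_δ(x) = 1/δ` for `|x| ≤ δ`. -/
def truncatedFundamental (ξ : ℝ → ℝ) (δ R : ℝ) (x : E3) : ℝ :=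
  (if δ < ‖x‖ then 1 / ‖x‖ else 1 / δ) * ξ (‖x‖ / R)

/-- A standard cut-off profile: `ξ` is smooth, `0 ≤ ξ ≤ 1`, `ξ = 1` on `[-1/2, 1/2]`, and `ξ` is compactly
supported in `(-1, 1)`. -/
def IsCutoff (ξ : ℝ → ℝ) : Prop :=
  ContDiff ℝ ∞ ξ ∧ (∀ t, 0 ≤ ξ t ∧ ξ t ≤ 1) ∧ (∀ t, |t| ≤ 1 / 2 → ξ t = 1) ∧
    tsupport ξ ⊆ Ioo (-1) 1

end

/-! Let `g = f / f'(θ₀)` and write `S = g² + g'²`, `N = g² + (p-1) g'²`, `m = g + cot θ g'`, `n = g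
+ g''` and `A = S^((p-2)/2)`. The equation reads `n N = -m S`, and in divergence form `(A g' sin θ)'
= -2 A g sin θ`. Evenness forces `g' = 0` at the equator, so the divergence form gives `g' > 0` on
`[θ₀, π/2)`; hence `m ≥ g ≥ 0 ≥ n` there, and `S = |∇u|²` decreases from 1 on the cone to a positive
minimum at the equator. In particular `|∇u| ≤ 1`, `u` is Lipschitz, and `g` is concave between the
cone and the equator.

Weak solution. In a meridian half plane the divergence theorem, with the divergence form of the
equation, turns the flux of `∇u` against a test function into the integral over the two nappes
(`planar_flux`, `integral_flux`); mollification extends this to Lipschitz test functions. Testing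
with a cutoff times `u / (u + ε)` gives a bound uniform in `ε` (`caccioppoli`), hence finite
perimeter. The reduced boundary differs from the double cone at most at the vertex, which is null
for the area.

Instability. Insert `ψ = κ(ρ) c(θ)` into the second variation. Choosing `κ` close to `ρ^(-1/2)` on a
long logarithmic scale makes Hardy's inequality almost sharp, so it suffices to find an even `c > 0`
for which the meridian form `angForm` has integral over `(θ₀, π/2)` below `cos θ₀ c(θ₀)²`
(`exists_angular`). For `p ≤ 2` the choice `c = |∇u| = √S` works: the form is an exact derivative,
with the right boundary value, minus a positive quantity. For `p ≥ 2` the choice `c = (A sin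
θ)^(-1/2)` turns the form into `S/N (p - 1 + cot² θ) / 4`. Comparison with the linear solution `x₁`
bounds this by an explicit integral, and an upper bound on `θ₀` obtained from `∂u/∂x₃` reduces the
claim to an elementary inequality (`sin_mul_sqrt_le`, `arctan_bound`).

Truncations of `1/|x|`. As the truncation radius grows, the claim becomes `∫ A (1 + (p-2) g²/S) sin
θ < 2 cos θ₀` on `(θ₀, π/2)`. Two integrations by parts and the bound `g g'/S ≤ 3 cot θ` prove it
for `2 ≤ p < 5` (`integral_radial_lt`).

Non-minimality. The competitor is `max(u - εψ, 0)` with the unstable `ψ` supported near the vertex.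
First order terms cancel by the flux identity. The bulk contributes `(p/2) ε²` times the Dirichlet
part of the second variation, while the layer `{0 < u ≤ εψ}` gains at least nearly `(p/2) ε² ∫ H
ψ²`, because `1 - |∇u|^p` grows linearly away from the cone at a rate fixed by the mean curvature
(`energy_balance`, `eventually_layer_le`, `tendsto_integral_energyRemainder`). Minimality would
therefore contradict the instability. -/

noncomputable section

/-! ### The ordinary differential equation -/

/-- `f² + f'²`, the squared length of the gradient of `ρ f(θ)`. -/
def gradSq (g : ℝ → ℝ) (θ : ℝ) : ℝ := g θ ^ 2 + deriv g θ ^ 2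

/-- `f² + (p - 1) f'²`. -/
def ellipSq (p : ℝ) (g : ℝ → ℝ) (θ : ℝ) : ℝ := g θ ^ 2 + (p - 1) * deriv g θ ^ 2

/-- `f + cot θ f'`, which is `ρ` times the second derivative of `ρ f(θ)` in the direction of `φ`. -/
def latCurv (g : ℝ → ℝ) (θ : ℝ) : ℝ := g θ + Real.cot θ * deriv g θ

/-- `f + f''`, computed from the `p`-Legendre equation. -/
def merCurv (p : ℝ) (g : ℝ → ℝ) (θ : ℝ) : ℝ := -(latCurv g θ * (gradSq g θ / ellipSq p g θ))

/-- The weight `|∇u|^{p-2}`. -/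
def pWeight (p : ℝ) (g : ℝ → ℝ) (θ : ℝ) : ℝ := gradSq g θ ^ ((p - 2) / 2)

/-- The even solution of the `p`-Legendre equation normalized by `g'(θ₀) = 1` at its zero `θ₀`. -/
structure ConeProfile (p θ₀ : ℝ) (g : ℝ → ℝ) : Prop where
  one_lt : 1 < p
  angle_pos : 0 < θ₀
  angle_lt : θ₀ < Real.pi / 2
  hasDerivAt : ∀ θ ∈ Ioo 0 Real.pi, HasDerivAt g (deriv g θ) θ
  hasDerivAt_deriv : ∀ θ ∈ Ioo 0 Real.pi, HasDerivAt (deriv g) (merCurv p g θ - g θ) θ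
  symm : ∀ θ ∈ Ioo 0 Real.pi, g (Real.pi - θ) = g θ
  zero : g θ₀ = 0
  one : deriv g θ₀ = 1
  gradSq_pos : ∀ θ ∈ Ioo 0 Real.pi, 0 < gradSq g θ
  pos_half : ∀ θ ∈ Ioc θ₀ (Real.pi / 2), 0 < g θ
  neg_left : ∀ θ ∈ Ioo 0 θ₀, g θ < 0

theorem sin_pos_of_mem {θ : ℝ} (h : θ ∈ Ioo 0 Real.pi) : 0 < Real.sin θ :=
  Real.sin_pos_of_pos_of_lt_pi h.1 h.2

theorem hasDerivAt_cot {θ : ℝ} (h : θ ∈ Ioo 0 Real.pi) :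
    HasDerivAt Real.cot (-(1 / Real.sin θ ^ 2)) θ := by
  have hs := (sin_pos_of_mem h).ne'
  have h1 := (Real.hasDerivAt_cos θ).div (Real.hasDerivAt_sin θ) hs
  have h2 : Real.cot = fun y => Real.cos y / Real.sin y := by
    funext y; exact Real.cot_eq_cos_div_sin y
  rw [h2]
  convert! h1 using 1
  have := Real.sin_sq_add_cos_sq θ
  field_simp
  linarith

theorem continuousOn_cot : ContinuousOn Real.cot (Ioo 0 Real.pi) := fun _ h =>
  (hasDerivAt_cot h).continuousAt.continuousWithinAt

/-- A nonnegative function with `|E'| ≤ K E` that vanishes somewhere vanishes identically. -/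
theorem eq_zero_of_abs_deriv_le {E E' : ℝ → ℝ} {a b c K : ℝ}
    (hd : ∀ θ ∈ Icc a b, HasDerivAt E (E' θ) θ) (h0 : ∀ θ ∈ Icc a b, 0 ≤ E θ)
    (hK : ∀ θ ∈ Icc a b, |E' θ| ≤ K * E θ) (hc : c ∈ Icc a b) (hE : E c = 0)
    {θ : ℝ} (hθ : θ ∈ Icc a b) : E θ = 0 := by
  refine le_antisymm ?_ (h0 θ hθ)
  rcases le_total c θ with h | h
  · have hanti : AntitoneOn (fun x => E x * Real.exp (-K * x)) (Icc a b) := by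
      have hder : ∀ x ∈ Icc a b, HasDerivAt (fun x => E x * Real.exp (-K * x))
          (E' x * Real.exp (-K * x) + E x * (Real.exp (-K * x) * -K)) x := fun x hx => by
        have := ((hasDerivAt_id x).const_mul (-K)).exp
        simp only [id, mul_one] at this
        exact (hd x hx).mul this
      refine antitoneOn_of_hasDerivWithinAt_nonpos (convex_Icc a b)
        (fun x hx => (hder x hx).continuousAt.continuousWithinAt)
        (fun x hx => (hder x (interior_subset hx)).hasDerivWithinAt) fun x hx => ?_
      have h1 := hK x (interior_subset hx)
      have h2 := le_abs_self (E' x)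
      have h3 := Real.exp_pos (-K * x)
      nlinarith
    have := hanti hc hθ h
    simp only [hE, zero_mul] at this
    exact nonpos_of_mul_nonpos_left this (Real.exp_pos _)
  · have hmono : MonotoneOn (fun x => E x * Real.exp (K * x)) (Icc a b) := by
      have hder : ∀ x ∈ Icc a b, HasDerivAt (fun x => E x * Real.exp (K * x))
          (E' x * Real.exp (K * x) + E x * (Real.exp (K * x) * K)) x := fun x hx => by
        have := ((hasDerivAt_id x).const_mul K).exp
        simp only [id, mul_one] at this
        exact (hd x hx).mul this
      refine monotoneOn_of_hasDerivWithinAt_nonneg (convex_Icc a b)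
        (fun x hx => (hder x hx).continuousAt.continuousWithinAt)
        (fun x hx => (hder x (interior_subset hx)).hasDerivWithinAt) fun x hx => ?_
      have h1 := hK x (interior_subset hx)
      have h2 := neg_abs_le (E' x)
      have h3 := Real.exp_pos (K * x)
      nlinarith
    have := hmono hθ hc h
    simp only [hE, zero_mul] at this
    exact nonpos_of_mul_nonpos_left this (Real.exp_pos _)

section
variable {p : ℝ} {f : ℝ → ℝ} {θ₀ : ℝ}

theorem SolvesPLegendre.hasDerivAt (hf : SolvesPLegendre p f) {θ : ℝ} (h : θ ∈ Ioo 0 Real.pi) :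
    HasDerivAt f (deriv f θ) θ := (hf θ h).1.hasDerivAt

theorem SolvesPLegendre.hasDerivAt_deriv (hf : SolvesPLegendre p f) {θ : ℝ}
    (h : θ ∈ Ioo 0 Real.pi) : HasDerivAt (deriv f) (merCurv p f θ - f θ) θ := by
  have h1 := (hf θ h).2.1.hasDerivAt
  have h2 := (hf θ h).2.2
  have h3 : merCurv p f θ - f θ = deriv (deriv f) θ := by
    simp only [merCurv, latCurv, gradSq, ellipSq]
    linarith
  rwa [h3]

theorem hasDerivAt_gradSq {g : ℝ → ℝ} {θ : ℝ} (h1 : HasDerivAt g (deriv g θ) θ)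
    (h2 : HasDerivAt (deriv g) (merCurv p g θ - g θ) θ) :
    HasDerivAt (gradSq g) (2 * deriv g θ * merCurv p g θ) θ := by
  have := (h1.pow 2).add (h2.pow 2)
  convert! this using 1
  push_cast
  ring

/-- This controls the nonlinear factor of the equation before anything is known about zeros of `(g,
g')`: if the denominator vanishes, the quotient is 0 by convention and the bounds still hold. -/
theorem ellipSq_ratio_le (hp : 1 < p) (g : ℝ → ℝ) (θ : ℝ) :
    0 ≤ gradSq g θ / ellipSq p g θ ∧ gradSq g θ / ellipSq p g θ ≤ 1 + 1 / (p - 1) := by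
  have hP : 0 < p - 1 := by linarith
  have hN : 0 ≤ ellipSq p g θ := by unfold ellipSq; positivity
  have hS : 0 ≤ gradSq g θ := by unfold gradSq; positivity
  refine ⟨by positivity, ?_⟩
  refine div_le_of_le_mul₀ hN (by positivity) ?_
  unfold gradSq ellipSq
  have : (1 + 1 / (p - 1)) * (g θ ^ 2 + (p - 1) * deriv g θ ^ 2)
    = g θ ^ 2 + deriv g θ ^ 2 + ((p - 1) * deriv g θ ^ 2 + 1 / (p - 1) * g θ ^ 2) := by
    field_simp; ring
  rw [this]
  have : 0 ≤ (p - 1) * deriv g θ ^ 2 + 1 / (p - 1) * g θ ^ 2 := by positivity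
  linarith

/-- Uniqueness of the zero solution, by Grönwall. Although the equation is nonlinear, the derivative
`2 f' (f + f'')` of `f² + f'²` is bounded by a multiple of `f² + f'²` on compact subintervals, where
`cot` is bounded. -/
theorem SolvesPLegendre.gradSq_eq_zero (hp : 1 < p) (hf : SolvesPLegendre p f) {c θ : ℝ}
    (hc : c ∈ Ioo 0 Real.pi) (hθ : θ ∈ Ioo 0 Real.pi) (h : gradSq f c = 0) : gradSq f θ = 0 := by
  set a := min c θ
  set b := max c θ
  have hsub : Icc a b ⊆ Ioo 0 Real.pi := fun x hx =>
    ⟨lt_of_lt_of_le (lt_min hc.1 hθ.1) hx.1, lt_of_le_of_lt hx.2 (max_lt hc.2 hθ.2)⟩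
  obtain ⟨M, hM⟩ := isCompact_Icc.exists_bound_of_continuousOn (continuousOn_cot.mono hsub)
  refine eq_zero_of_abs_deriv_le (E := gradSq f) (c := c) (a := a) (b := b)
    (E' := fun θ => 2 * deriv f θ * merCurv p f θ)
    (K := 2 * (1 + M) * (1 + 1 / (p - 1)))
    (fun x hx => hasDerivAt_gradSq (hf.hasDerivAt (hsub hx)) (hf.hasDerivAt_deriv (hsub hx)))
    (fun x _ => by unfold gradSq; positivity) (fun x hx => ?_)
    ⟨min_le_left _ _, le_max_left _ _⟩ h ⟨min_le_right _ _, le_max_right _ _⟩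
  have hcot : |Real.cot x| ≤ M := hM x hx
  have hM0 : 0 ≤ M := (abs_nonneg _).trans hcot
  obtain ⟨hq0, hq1⟩ := ellipSq_ratio_le hp f x
  unfold merCurv
  set Q := gradSq f x / ellipSq p f x
  have hm : |deriv f x * latCurv f x| ≤ (1 + M) * gradSq f x := by
    unfold latCurv gradSq
    have h1 : |deriv f x * (f x + Real.cot x * deriv f x)|
        ≤ |deriv f x| * |f x| + M * |deriv f x| ^ 2 := by
      rw [mul_add]
      refine (abs_add_le _ _).trans ?_
      rw [abs_mul, abs_mul, abs_mul]
      nlinarith [abs_nonneg (deriv f x), sq_nonneg (deriv f x)]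
    rw [← sq_abs (f x), ← sq_abs (deriv f x)]
    nlinarith [sq_nonneg (|f x| - |deriv f x|), sq_nonneg (|f x|), sq_nonneg |deriv f x|]
  calc |2 * deriv f x * -(latCurv f x * Q)| = 2 * |deriv f x * latCurv f x| * Q := by
        rw [show 2 * deriv f x * -(latCurv f x * Q) = -(2 * (deriv f x * latCurv f x) * Q) by ring,
          abs_neg, abs_mul, abs_mul, abs_of_nonneg hq0, abs_of_pos (two_pos : (0:ℝ) < 2)]
    _ ≤ 2 * ((1 + M) * gradSq f x) * (1 + 1 / (p - 1)) := by
        have : 0 ≤ (1 + M) * gradSq f x := by unfold gradSq; positivity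
        gcongr
    _ = _ := by ring

theorem deriv_reflect (hf : ∀ θ ∈ Ioo 0 Real.pi, HasDerivAt f (deriv f θ) θ)
    (hsymm : ∀ θ ∈ Ioo 0 Real.pi, f (Real.pi - θ) = f θ) {θ : ℝ} (h : θ ∈ Ioo 0 Real.pi) :
    deriv f (Real.pi - θ) = - deriv f θ := by
  have h' : Real.pi - θ ∈ Ioo 0 Real.pi := ⟨by linarith [h.2], by linarith [h.1]⟩
  have h1 : HasDerivAt (fun t => f (Real.pi - t)) (deriv f (Real.pi - θ) * -1) θ :=
    HasDerivAt.comp θ (hf _ h') ((hasDerivAt_id θ).const_sub Real.pi)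
  have h2 : (fun t => f (Real.pi - t)) =ᶠ[𝓝 θ] f := by
    filter_upwards [isOpen_Ioo.mem_nhds h] with t ht using hsymm t ht
  have := (h1.congr_of_eventuallyEq h2.symm).unique (hf θ h)
  linarith

/-- If `f² + f'²` vanished anywhere it would vanish everywhere, giving a second zero at `θ₀/2`; so
`f'(θ₀) ≠ 0` and the normalization makes sense. The equation is homogeneous, so dividing by `f'(θ₀)`
preserves it. The slope 1 at `θ₀` fixes the signs on both sides, and the intermediate value theorem
propagates them. -/
theorem coneProfile_of_solvesPLegendre (hp : 1 < p) (hf : SolvesPLegendre p f)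
    (hsymm : ∀ θ ∈ Ioo 0 Real.pi, f (Real.pi - θ) = f θ)
    (hθ₀ : θ₀ ∈ Ioc 0 (Real.pi / 2)) (hzero : f θ₀ = 0)
    (honly : ∀ θ ∈ Ioc 0 (Real.pi / 2), f θ = 0 → θ = θ₀) :
    ConeProfile p θ₀ (fun θ => f θ / deriv f θ₀) := by
  have hpi := Real.pi_pos
  have hmem : θ₀ ∈ Ioo 0 Real.pi := ⟨hθ₀.1, by linarith [hθ₀.2]⟩
  have hpos : ∀ θ ∈ Ioo 0 Real.pi, 0 < gradSq f θ := fun θ hθ => by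
    refine lt_of_le_of_ne (by unfold gradSq; positivity) fun h => ?_
    have h1 : gradSq f (θ₀ / 2) = 0 :=
      hf.gradSq_eq_zero hp hθ ⟨by linarith [hθ₀.1], by linarith [hθ₀.2]⟩ h.symm
    have h2 : f (θ₀ / 2) = 0 := by
      unfold gradSq at h1
      nlinarith [sq_nonneg (f (θ₀ / 2)), sq_nonneg (deriv f (θ₀ / 2))]
    have := honly (θ₀ / 2) ⟨by linarith [hθ₀.1], by linarith [hθ₀.1, hθ₀.2]⟩ h2
    linarith [hθ₀.1]
  have hd0 : deriv f θ₀ ≠ 0 := fun h => by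
    have := hpos θ₀ hmem
    simp [gradSq, hzero, h] at this
  -- By symmetry `f'` vanishes at the equator, where `f` therefore cannot vanish too.
  have hlt : θ₀ < Real.pi / 2 := by
    refine lt_of_le_of_ne hθ₀.2 fun h => hd0 ?_
    have h1 := deriv_reflect (fun θ h => hf.hasDerivAt h) hsymm hmem
    rw [h, show Real.pi - Real.pi / 2 = Real.pi / 2 by ring] at h1
    rw [h]; linarith
  set k := deriv f θ₀ with hk
  have hdg : ∀ θ, deriv (fun θ => f θ / k) θ = deriv f θ / k := fun θ => deriv_div_const k
  have hgS : ∀ θ, gradSq (fun θ => f θ / k) θ = gradSq f θ / k ^ 2 := fun θ => by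
    simp only [gradSq, hdg]; ring
  have hgN : ∀ θ, ellipSq p (fun θ => f θ / k) θ = ellipSq p f θ / k ^ 2 := fun θ => by
    simp only [ellipSq, hdg]; ring
  have hgm : ∀ θ, latCurv (fun θ => f θ / k) θ = latCurv f θ / k := fun θ => by
    simp only [latCurv, hdg]; ring
  have hgn : ∀ θ, merCurv p (fun θ => f θ / k) θ = merCurv p f θ / k := fun θ => by
    simp only [merCurv, hgS, hgN, hgm]
    rw [div_div_div_cancel_right₀ (pow_ne_zero 2 hd0)]; ring
  have hd1 : ∀ θ ∈ Ioo 0 Real.pi, HasDerivAt (fun θ => f θ / k) (deriv (fun θ => f θ / k) θ) θ :=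
    fun θ h => by rw [hdg]; exact (hf.hasDerivAt h).div_const k
  have hcont : ContinuousOn (fun θ => f θ / k) (Ioo 0 Real.pi) := fun θ h =>
    (hd1 θ h).continuousAt.continuousWithinAt
  have hg0 : f θ₀ / k = 0 := by rw [hzero, zero_div]
  have hg1 : HasDerivAt (fun θ => f θ / k) 1 θ₀ := by
    have := hd1 θ₀ hmem
    rwa [hdg, ← hk, div_self hd0] at this
  have hsign := hasDerivAt_iff_tendsto_slope.1 hg1
  have hev : ∀ᶠ t in 𝓝[≠] θ₀, 0 < slope (fun θ => f θ / k) θ₀ t :=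
    hsign.eventually (lt_mem_nhds one_pos)
  have hr : ∃ t ∈ Ioo θ₀ (Real.pi / 2), 0 < f t / k := by
    have h1 : ∀ᶠ t in 𝓝[>] θ₀, 0 < slope (fun θ => f θ / k) θ₀ t :=
      hev.filter_mono (nhdsWithin_mono _ fun t ht => ne_of_gt ht)
    obtain ⟨t, ht, ht'⟩ := (h1.and (Ioo_mem_nhdsGT hlt)).exists
    refine ⟨t, ht', ?_⟩
    rw [slope_def_field, hg0, sub_zero] at ht
    have := mul_pos ht (sub_pos.2 ht'.1)
    rwa [div_mul_cancel₀ _ (sub_pos.2 ht'.1).ne'] at this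
  have hl : ∃ t ∈ Ioo 0 θ₀, f t / k < 0 := by
    have h1 : ∀ᶠ t in 𝓝[<] θ₀, 0 < slope (fun θ => f θ / k) θ₀ t :=
      hev.filter_mono (nhdsWithin_mono _ fun t ht => ne_of_lt ht)
    obtain ⟨t, ht, ht'⟩ := (h1.and (Ioo_mem_nhdsLT hθ₀.1)).exists
    refine ⟨t, ht', ?_⟩
    rw [slope_def_field, hg0, sub_zero] at ht
    have := mul_neg_of_pos_of_neg ht (sub_neg.2 ht'.2)
    rwa [div_mul_cancel₀ _ (sub_neg.2 ht'.2).ne] at this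
  have hne : ∀ θ ∈ Ioc 0 (Real.pi / 2), θ ≠ θ₀ → f θ / k ≠ 0 := fun θ h h' h0 =>
    h' (honly θ h ((div_eq_zero_iff.1 h0).resolve_right hd0))
  refine ⟨hp, hθ₀.1, hlt, hd1, fun θ h => ?_, fun θ h => by simp only [hsymm θ h], hg0,
    by rw [hdg]; exact div_self hd0, fun θ h => by rw [hgS]; have := hpos θ h; positivity,
    fun θ h => ?_, fun θ h => ?_⟩
  · rw [hgn]
    have h1 : deriv (fun θ => f θ / k) = fun θ => deriv f θ / k := funext hdg
    rw [h1, ← sub_div]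
    exact (hf.hasDerivAt_deriv h).div_const k
  · by_contra! hneg
    obtain ⟨t, ht, ht'⟩ := hr
    have hsub : uIcc t θ ⊆ Ioc θ₀ (Real.pi / 2) :=
      (ordConnected_Ioc).uIcc_subset ⟨ht.1, ht.2.le⟩ h
    have hivt := intermediate_value_uIcc (hcont.mono (hsub.trans fun x hx =>
      ⟨hθ₀.1.trans hx.1, by linarith [hx.2]⟩))
    obtain ⟨x, hx, hx0⟩ := hivt (mem_uIcc.2 (Or.inr ⟨hneg, ht'.le⟩))
    exact hne x ⟨hθ₀.1.trans (hsub hx).1, (hsub hx).2⟩ (hsub hx).1.ne' hx0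
  · by_contra! hneg
    obtain ⟨t, ht, ht'⟩ := hl
    have hsub : uIcc t θ ⊆ Ioo 0 θ₀ := (ordConnected_Ioo).uIcc_subset ht h
    have hivt := intermediate_value_uIcc (hcont.mono (hsub.trans fun x hx =>
      ⟨hx.1, by linarith [hx.2, hθ₀.2]⟩))
    obtain ⟨x, hx, hx0⟩ := hivt (mem_uIcc.2 (Or.inl ⟨ht'.le, hneg⟩))
    exact hne x ⟨(hsub hx).1, by linarith [(hsub hx).2, hθ₀.2]⟩ (hsub hx).2.ne hx0

/-- Since `g'(θ₀) = 1`, normalizing a second time changes nothing, so everything may be proved for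
the normalized profile. -/
theorem ConeProfile.coneFun_eq {g : ℝ → ℝ} (_h : ConeProfile p θ₀ (fun θ => f θ / deriv f θ₀))
    (hg : g = fun θ => f θ / deriv f θ₀) : coneFun f θ₀ = coneFun g θ₀ := by
  have h1 : deriv g θ₀ = 1 := by rw [hg]; exact _h.one
  funext x
  simp only [coneFun, h1, div_one]
  rw [hg]

end
end

/-! ### Signs, monotonicity and smoothness of the normalized profile. -/

noncomputable section

namespace ConeProfile

variable {p θ₀ : ℝ} {g : ℝ → ℝ}

theorem exp_pos (h : ConeProfile p θ₀ g) : 0 < p - 1 := by linarith [h.one_lt]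

theorem mem_angle (h : ConeProfile p θ₀ g) : θ₀ ∈ Ioo 0 Real.pi :=
  ⟨h.angle_pos, by linarith [h.angle_lt, Real.pi_pos]⟩

theorem reflect_mem {θ : ℝ} (hθ : θ ∈ Ioo 0 Real.pi) : Real.pi - θ ∈ Ioo 0 Real.pi :=
  ⟨by linarith [hθ.2], by linarith [hθ.1]⟩

theorem half_subset (h : ConeProfile p θ₀ g) : Icc θ₀ (Real.pi / 2) ⊆ Ioo 0 Real.pi := fun _ hx =>
  ⟨h.angle_pos.trans_le hx.1, by linarith [hx.2, Real.pi_pos]⟩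

theorem full_subset (h : ConeProfile p θ₀ g) : Icc θ₀ (Real.pi - θ₀) ⊆ Ioo 0 Real.pi := fun _ hx =>
  ⟨h.angle_pos.trans_le hx.1, by linarith [hx.2, h.angle_pos]⟩

theorem half_mem (h : ConeProfile p θ₀ g) : Real.pi / 2 ∈ Ioo 0 Real.pi :=
  h.half_subset ⟨h.angle_lt.le, le_rfl⟩

theorem deriv_reflect (h : ConeProfile p θ₀ g) {θ : ℝ} (hθ : θ ∈ Ioo 0 Real.pi) :
    deriv g (Real.pi - θ) = - deriv g θ := _root_.deriv_reflect h.hasDerivAt h.symm hθ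

theorem deriv_half (h : ConeProfile p θ₀ g) : deriv g (Real.pi / 2) = 0 := by
  have := h.deriv_reflect h.half_mem
  rw [show Real.pi - Real.pi / 2 = Real.pi / 2 by ring] at this
  linarith

theorem pos_iff (h : ConeProfile p θ₀ g) {θ : ℝ} (hθ : θ ∈ Ioo 0 Real.pi) :
    0 < g θ ↔ θ ∈ Ioo θ₀ (Real.pi - θ₀) := by
  have key : ∀ θ, θ ∈ Ioc 0 (Real.pi / 2) → (0 < g θ ↔ θ₀ < θ) := fun θ hθ => by
    rcases lt_trichotomy θ θ₀ with hlt | heq | hgt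
    · exact iff_of_false (h.neg_left θ ⟨hθ.1, hlt⟩).not_gt hlt.not_gt
    · subst heq; simp [h.zero]
    · exact iff_of_true (h.pos_half θ ⟨hgt, hθ.2⟩) hgt
  have hlt := h.angle_lt
  rcases le_total θ (Real.pi / 2) with hle | hle
  · rw [key θ ⟨hθ.1, hle⟩]
    exact ⟨fun h' => ⟨h', by linarith⟩, fun h' => h'.1⟩
  · rw [← h.symm θ hθ, key (Real.pi - θ) ⟨by linarith [hθ.2], by linarith⟩]
    exact ⟨fun h' => ⟨by linarith, by linarith⟩, fun h' => by linarith [h'.2]⟩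

theorem zero_reflect (h : ConeProfile p θ₀ g) : g (Real.pi - θ₀) = 0 := by
  rw [h.symm _ h.mem_angle, h.zero]

theorem continuousOn (h : ConeProfile p θ₀ g) : ContinuousOn g (Ioo 0 Real.pi) := fun θ hθ =>
  (h.hasDerivAt θ hθ).continuousAt.continuousWithinAt

theorem continuousOn_deriv (h : ConeProfile p θ₀ g) : ContinuousOn (deriv g) (Ioo 0 Real.pi) :=
  fun θ hθ => (h.hasDerivAt_deriv θ hθ).continuousAt.continuousWithinAt

theorem ellipSq_pos (h : ConeProfile p θ₀ g) {θ : ℝ} (hθ : θ ∈ Ioo 0 Real.pi) :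
    0 < ellipSq p g θ := by
  have h1 := h.gradSq_pos θ hθ
  have h2 := h.exp_pos
  unfold gradSq at h1
  unfold ellipSq
  rcases eq_or_ne (g θ) 0 with h0 | h0
  · have : 0 < deriv g θ ^ 2 := by simpa [h0] using h1
    positivity
  · positivity

theorem continuousOn_gradSq (h : ConeProfile p θ₀ g) : ContinuousOn (gradSq g) (Ioo 0 Real.pi) :=
  (h.continuousOn.pow 2).add (h.continuousOn_deriv.pow 2)

theorem continuousOn_ellipSq (h : ConeProfile p θ₀ g) :
    ContinuousOn (ellipSq p g) (Ioo 0 Real.pi) :=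
  (h.continuousOn.pow 2).add ((h.continuousOn_deriv.pow 2).const_mul _)

theorem continuousOn_latCurv (h : ConeProfile p θ₀ g) : ContinuousOn (latCurv g) (Ioo 0 Real.pi) :=
  h.continuousOn.add (continuousOn_cot.mul h.continuousOn_deriv)

theorem continuousOn_merCurv (h : ConeProfile p θ₀ g) :
    ContinuousOn (merCurv p g) (Ioo 0 Real.pi) :=
  (h.continuousOn_latCurv.mul (h.continuousOn_gradSq.div h.continuousOn_ellipSq
    fun _ hθ => (h.ellipSq_pos hθ).ne')).neg

theorem continuousOn_pWeight (h : ConeProfile p θ₀ g) :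
    ContinuousOn (pWeight p g) (Ioo 0 Real.pi) :=
  h.continuousOn_gradSq.rpow_const fun θ hθ => Or.inl (h.gradSq_pos θ hθ).ne'

theorem pWeight_pos (h : ConeProfile p θ₀ g) {θ : ℝ} (hθ : θ ∈ Ioo 0 Real.pi) :
    0 < pWeight p g θ := Real.rpow_pos_of_pos (h.gradSq_pos θ hθ) _

theorem gradSq_reflect (h : ConeProfile p θ₀ g) {θ : ℝ} (hθ : θ ∈ Ioo 0 Real.pi) :
    gradSq g (Real.pi - θ) = gradSq g θ := by
  simp [gradSq, h.symm θ hθ, h.deriv_reflect hθ]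

theorem pWeight_reflect (h : ConeProfile p θ₀ g) {θ : ℝ} (hθ : θ ∈ Ioo 0 Real.pi) :
    pWeight p g (Real.pi - θ) = pWeight p g θ := by
  simp [pWeight, h.gradSq_reflect hθ]

theorem gradSq_zero (h : ConeProfile p θ₀ g) : gradSq g θ₀ = 1 := by
  simp [gradSq, h.zero, h.one]

theorem pWeight_zero (h : ConeProfile p θ₀ g) : pWeight p g θ₀ = 1 := by
  simp [pWeight, h.gradSq_zero]

theorem hasDerivAt_gradSq (h : ConeProfile p θ₀ g) {θ : ℝ} (hθ : θ ∈ Ioo 0 Real.pi) :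
    HasDerivAt (gradSq g) (2 * deriv g θ * merCurv p g θ) θ :=
  _root_.hasDerivAt_gradSq (h.hasDerivAt θ hθ) (h.hasDerivAt_deriv θ hθ)

theorem hasDerivAt_pWeight (h : ConeProfile p θ₀ g) {θ : ℝ} (hθ : θ ∈ Ioo 0 Real.pi) :
    HasDerivAt (pWeight p g)
      (pWeight p g θ * ((p - 2) * deriv g θ * merCurv p g θ / gradSq g θ)) θ := by
  have hS := h.gradSq_pos θ hθ
  have := (h.hasDerivAt_gradSq hθ).rpow_const (p := (p - 2) / 2) (Or.inl hS.ne')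
  convert! this using 1
  rw [Real.rpow_sub_one hS.ne']
  unfold pWeight
  field_simp

theorem merCurv_mul (h : ConeProfile p θ₀ g) {θ : ℝ} (hθ : θ ∈ Ioo 0 Real.pi) :
    merCurv p g θ * ellipSq p g θ = - (latCurv g θ * gradSq g θ) := by
  have := (h.ellipSq_pos hθ).ne'
  unfold merCurv
  field_simp

theorem latCurv_mul_sin {θ : ℝ} (hθ : θ ∈ Ioo 0 Real.pi) :
    latCurv g θ * Real.sin θ = g θ * Real.sin θ + Real.cos θ * deriv g θ := by
  have := (sin_pos_of_mem hθ).ne'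
  unfold latCurv
  rw [Real.cot_eq_cos_div_sin]
  field_simp

/-- The `p`-Legendre equation in divergence form. -/
theorem hasDerivAt_flux (h : ConeProfile p θ₀ g) {θ : ℝ} (hθ : θ ∈ Ioo 0 Real.pi) :
    HasDerivAt (fun t => pWeight p g t * deriv g t * Real.sin t)
      (-(2 * pWeight p g θ * g θ * Real.sin θ)) θ := by
  have hS := h.gradSq_pos θ hθ
  have := ((h.hasDerivAt_pWeight hθ).mul (h.hasDerivAt_deriv θ hθ)).mul (Real.hasDerivAt_sin θ)
  convert! this using 1
  have h1 := h.merCurv_mul hθ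
  have h2 := latCurv_mul_sin (g := g) hθ
  simp only [Pi.mul_apply]
  -- This uses `(p - 2) g'² = N - S` together with the equation `n N = -m S`; it turns the
  -- derivative of the weight into curvature terms.
  have h3 : (p - 2) * deriv g θ ^ 2 * merCurv p g θ
      = - (latCurv g θ * gradSq g θ) - merCurv p g θ * gradSq g θ := by
    rw [← h1]; unfold ellipSq gradSq; ring
  have h4 : pWeight p g θ * ((p - 2) * deriv g θ * merCurv p g θ / gradSq g θ) * deriv g θ
      = pWeight p g θ * (-latCurv g θ - merCurv p g θ) := by
    have : (p - 2) * deriv g θ * merCurv p g θ / gradSq g θ * deriv g θ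
        = -latCurv g θ - merCurv p g θ := by
      field_simp
      linarith
    rw [mul_assoc, this]
  rw [h4]
  linear_combination pWeight p g θ * h2

theorem continuousOn_of_hasDerivAt {F F' : ℝ → ℝ} (hF : ∀ θ ∈ Ioo 0 Real.pi, HasDerivAt F (F' θ) θ)
    {s : Set ℝ} (hs : s ⊆ Ioo 0 Real.pi) : ContinuousOn F s := fun θ hθ =>
  (hF θ (hs hθ)).continuousAt.continuousWithinAt

/-- The flux `A g' sin θ` strictly decreases while `g > 0`, and it vanishes at the equator; hence it
is positive before. -/
theorem deriv_pos (h : ConeProfile p θ₀ g) {θ : ℝ} (hθ : θ ∈ Ico θ₀ (Real.pi / 2)) :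
    0 < deriv g θ := by
  have hanti : StrictAntiOn (fun t => pWeight p g t * deriv g t * Real.sin t)
      (Icc θ₀ (Real.pi / 2)) := by
    refine strictAntiOn_of_hasDerivWithinAt_neg (convex_Icc _ _)
      (continuousOn_of_hasDerivAt (fun t ht => h.hasDerivAt_flux ht) h.half_subset)
      (fun t ht => (h.hasDerivAt_flux (h.half_subset (interior_subset ht))).hasDerivWithinAt)
      fun t ht => ?_
    rw [interior_Icc] at ht
    have ht' := h.half_subset (Ioo_subset_Icc_self ht)
    have h1 := h.pWeight_pos ht'
    have h2 := h.pos_half t ⟨ht.1, ht.2.le⟩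
    have h3 := sin_pos_of_mem ht'
    have : 0 < 2 * pWeight p g t * g t * Real.sin t := by positivity
    linarith
  have := hanti (Ico_subset_Icc_self hθ) ⟨h.angle_lt.le, le_rfl⟩ hθ.2
  simp only [h.deriv_half, mul_zero, zero_mul] at this
  have hθ' := h.half_subset (Ico_subset_Icc_self hθ)
  exact pos_of_mul_pos_right (pos_of_mul_pos_left this (sin_pos_of_mem hθ').le)
    (h.pWeight_pos hθ').le

theorem deriv_nonneg (h : ConeProfile p θ₀ g) {θ : ℝ} (hθ : θ ∈ Icc θ₀ (Real.pi / 2)) :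
    0 ≤ deriv g θ := by
  rcases hθ.2.eq_or_lt with rfl | hlt
  · exact h.deriv_half.ge
  · exact (h.deriv_pos ⟨hθ.1, hlt⟩).le

theorem nonneg_half (h : ConeProfile p θ₀ g) {θ : ℝ} (hθ : θ ∈ Icc θ₀ (Real.pi / 2)) :
    0 ≤ g θ := by
  rcases hθ.1.eq_or_lt with rfl | hlt
  · exact h.zero.ge
  · exact (h.pos_half θ ⟨hlt, hθ.2⟩).le

theorem cot_nonneg (h : ConeProfile p θ₀ g) {θ : ℝ} (hθ : θ ∈ Icc θ₀ (Real.pi / 2)) :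
    0 ≤ Real.cot θ := by
  rw [Real.cot_eq_cos_div_sin]
  exact div_nonneg (Real.cos_nonneg_of_mem_Icc ⟨by linarith [h.angle_pos, hθ.1, Real.pi_pos], hθ.2⟩)
    (sin_pos_of_mem (h.half_subset hθ)).le

theorem le_latCurv (h : ConeProfile p θ₀ g) {θ : ℝ} (hθ : θ ∈ Icc θ₀ (Real.pi / 2)) :
    g θ ≤ latCurv g θ :=
  le_add_of_nonneg_right (mul_nonneg (h.cot_nonneg hθ) (h.deriv_nonneg hθ))

theorem latCurv_nonneg (h : ConeProfile p θ₀ g) {θ : ℝ} (hθ : θ ∈ Icc θ₀ (Real.pi / 2)) :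
    0 ≤ latCurv g θ := (h.nonneg_half hθ).trans (h.le_latCurv hθ)

theorem merCurv_nonpos (h : ConeProfile p θ₀ g) {θ : ℝ} (hθ : θ ∈ Icc θ₀ (Real.pi / 2)) :
    merCurv p g θ ≤ 0 :=
  neg_nonpos.2 (mul_nonneg (h.latCurv_nonneg hθ) (ellipSq_ratio_le h.one_lt g θ).1)

/-- The derivative is `2 g' n`, with `g' ≥ 0 ≥ n`. Thus `|∇u|` is largest, equal to 1, on the cone
and smallest at the equator; this supplies the Lipschitz bound as well as the uniform ellipticity in
the positivity set. -/
theorem gradSq_antitone (h : ConeProfile p θ₀ g) :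
    AntitoneOn (gradSq g) (Icc θ₀ (Real.pi / 2)) := by
  refine antitoneOn_of_hasDerivWithinAt_nonpos (convex_Icc _ _)
    (h.continuousOn_gradSq.mono h.half_subset)
    (fun t ht => (h.hasDerivAt_gradSq (h.half_subset (interior_subset ht))).hasDerivWithinAt)
    fun t ht => ?_
  have ht' := interior_subset ht
  have := mul_nonneg (h.deriv_nonneg ht') (neg_nonneg.2 (h.merCurv_nonpos ht'))
  linarith

theorem gradSq_le_one_half (h : ConeProfile p θ₀ g) {θ : ℝ} (hθ : θ ∈ Icc θ₀ (Real.pi / 2)) :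
    gradSq g θ ≤ 1 := by
  rw [← h.gradSq_zero]
  exact h.gradSq_antitone ⟨le_rfl, h.angle_lt.le⟩ hθ hθ.1

/-- Even functions of the angle to the equator are determined by their values on one half. -/
theorem half_of_reflect (_h : ConeProfile p θ₀ g) {q : ℝ → Prop}
    (hq : ∀ θ ∈ Icc θ₀ (Real.pi - θ₀), q (Real.pi - θ) → q θ)
    (hh : ∀ θ ∈ Icc θ₀ (Real.pi / 2), q θ) {θ : ℝ} (hθ : θ ∈ Icc θ₀ (Real.pi - θ₀)) : q θ := by
  rcases le_total θ (Real.pi / 2) with hle | hle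
  · exact hh θ ⟨hθ.1, hle⟩
  · exact hq θ hθ (hh _ ⟨by linarith [hθ.2], by linarith⟩)

theorem gradSq_le_one (h : ConeProfile p θ₀ g) {θ : ℝ} (hθ : θ ∈ Icc θ₀ (Real.pi - θ₀)) :
    gradSq g θ ≤ 1 :=
  h.half_of_reflect (fun _ ht h' => by rwa [h.gradSq_reflect (h.full_subset ht)] at h')
    (fun _ ht => h.gradSq_le_one_half ht) hθ

theorem gradSq_half_le (h : ConeProfile p θ₀ g) {θ : ℝ} (hθ : θ ∈ Icc θ₀ (Real.pi - θ₀)) :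
    gradSq g (Real.pi / 2) ≤ gradSq g θ :=
  h.half_of_reflect (fun _ ht h' => by rwa [h.gradSq_reflect (h.full_subset ht)] at h')
    (fun _ ht => h.gradSq_antitone ht ⟨h.angle_lt.le, le_rfl⟩ ht.2) hθ

theorem deriv_le_one (h : ConeProfile p θ₀ g) {θ : ℝ} (hθ : θ ∈ Icc θ₀ (Real.pi - θ₀)) :
    |deriv g θ| ≤ 1 := by
  have := h.gradSq_le_one hθ
  unfold gradSq at this
  exact abs_le_one_iff_mul_self_le_one.2 (by nlinarith [sq_nonneg (g θ)])

theorem abs_le_one (h : ConeProfile p θ₀ g) {θ : ℝ} (hθ : θ ∈ Icc θ₀ (Real.pi - θ₀)) :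
    |g θ| ≤ 1 := by
  have := h.gradSq_le_one hθ
  unfold gradSq at this
  exact abs_le_one_iff_mul_self_le_one.2 (by nlinarith [sq_nonneg (deriv g θ)])

/-- A consequence of `|g'| ≤ 1`. It guarantees that the layer `{u ≤ εψ}` is at least as thick as its
linear model. -/
theorem le_sub_angle (h : ConeProfile p θ₀ g) {θ : ℝ} (hθ : θ ∈ Icc θ₀ (Real.pi - θ₀)) :
    g θ ≤ θ - θ₀ := by
  have hsub : Icc θ₀ θ ⊆ Icc θ₀ (Real.pi - θ₀) := Icc_subset_Icc le_rfl hθ.2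
  have := Convex.norm_image_sub_le_of_norm_hasDerivWithin_le (f := g) (f' := deriv g) (C := 1)
    (s := Icc θ₀ θ) (fun x hx => (h.hasDerivAt x (h.full_subset (hsub hx))).hasDerivWithinAt)
    (fun x hx => h.deriv_le_one (hsub hx)) (convex_Icc _ _) ⟨le_rfl, hθ.1⟩ ⟨hθ.1, le_rfl⟩
  rw [h.zero, sub_zero, one_mul, Real.norm_eq_abs, Real.norm_eq_abs,
    abs_of_nonneg (sub_nonneg.2 hθ.1)] at this
  exact (le_abs_self _).trans this

/-- The function is `∂u/∂x₃` in polar form. All terms without `g + g''` cancel, as they must since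
linear functions satisfy `g + g'' = 0`. -/
theorem hasDerivAt_vertical (h : ConeProfile p θ₀ g) {θ : ℝ} (hθ : θ ∈ Ioo 0 Real.pi) :
    HasDerivAt (fun t => g t * Real.cos t - deriv g t * Real.sin t)
      (-(Real.sin θ * merCurv p g θ)) θ := by
  have := ((h.hasDerivAt θ hθ).mul (Real.hasDerivAt_cos θ)).sub
    ((h.hasDerivAt_deriv θ hθ).mul (Real.hasDerivAt_sin θ))
  convert! this using 1
  ring

/-- `∂u/∂x₃ ≤ 0` in the upper half space. -/
theorem mul_cos_le (h : ConeProfile p θ₀ g) {θ : ℝ} (hθ : θ ∈ Icc θ₀ (Real.pi / 2)) :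
    g θ * Real.cos θ ≤ deriv g θ * Real.sin θ := by
  have hmono : MonotoneOn (fun t => g t * Real.cos t - deriv g t * Real.sin t)
      (Icc θ₀ (Real.pi / 2)) := by
    refine monotoneOn_of_hasDerivWithinAt_nonneg (convex_Icc _ _)
      (continuousOn_of_hasDerivAt (fun t ht => h.hasDerivAt_vertical ht) h.half_subset)
      (fun t ht => (h.hasDerivAt_vertical (h.half_subset (interior_subset ht))).hasDerivWithinAt)
      fun t ht => ?_
    have ht' := interior_subset ht
    have h1 := mul_nonneg (sin_pos_of_mem (h.half_subset ht')).le
      (neg_nonneg.2 (h.merCurv_nonpos ht'))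
    linarith
  have := hmono hθ ⟨h.angle_lt.le, le_rfl⟩ hθ.2
  simp only [h.deriv_half, Real.cos_pi_div_two] at this
  linarith

theorem intervalIntegrable_half (h : ConeProfile p θ₀ g) {F : ℝ → ℝ}
    (hF : ContinuousOn F (Ioo 0 Real.pi)) : IntervalIntegrable F volume θ₀ (Real.pi / 2) :=
  (hF.mono (by rw [uIcc_of_le h.angle_lt.le]; exact h.half_subset)).intervalIntegrable

theorem integral_half (h : ConeProfile p θ₀ g) {F F' : ℝ → ℝ}
    (hF : ∀ θ ∈ Ioo 0 Real.pi, HasDerivAt F (F' θ) θ) (hF' : ContinuousOn F' (Ioo 0 Real.pi)) :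
    ∫ θ in θ₀..Real.pi / 2, F' θ = F (Real.pi / 2) - F θ₀ :=
  intervalIntegral.integral_eq_sub_of_hasDerivAt
    (fun t ht => hF t (by rw [uIcc_of_le h.angle_lt.le] at ht; exact h.half_subset ht))
    (h.intervalIntegrable_half hF')

/-- Integrals of functions symmetric about the equator. -/
theorem integral_full (h : ConeProfile p θ₀ g) {F : ℝ → ℝ} (hF : ContinuousOn F (Ioo 0 Real.pi))
    (hsymm : ∀ θ ∈ Ioo 0 Real.pi, F (Real.pi - θ) = F θ) :
    ∫ θ in θ₀..Real.pi - θ₀, F θ = 2 * ∫ θ in θ₀..Real.pi / 2, F θ := by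
  have h1 := h.intervalIntegrable_half hF
  have hle : Real.pi / 2 ≤ Real.pi - θ₀ := by linarith [h.angle_lt]
  have h2 : IntervalIntegrable F volume (Real.pi / 2) (Real.pi - θ₀) :=
    (hF.mono (by
      rw [uIcc_of_le hle]
      exact (Icc_subset_Icc h.angle_lt.le le_rfl).trans h.full_subset)).intervalIntegrable
  rw [← intervalIntegral.integral_add_adjacent_intervals h1 h2, two_mul]
  congr 1
  have h3 := intervalIntegral.integral_comp_sub_left F Real.pi (a := θ₀) (b := Real.pi / 2)
  rw [show Real.pi - Real.pi / 2 = Real.pi / 2 by ring] at h3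
  rw [← h3]
  refine intervalIntegral.integral_congr fun t ht => hsymm t ?_
  rw [uIcc_of_le h.angle_lt.le] at ht
  exact h.half_subset ht

theorem contDiffOn_cot {n : ℕ∞} : ContDiffOn ℝ n Real.cot (Ioo 0 Real.pi) := by
  have : Real.cot = fun y => Real.cos y / Real.sin y := by
    funext y; exact Real.cot_eq_cos_div_sin y
  rw [this]
  exact Real.contDiff_cos.contDiffOn.div Real.contDiff_sin.contDiffOn
    fun θ hθ => (sin_pos_of_mem hθ).ne'

/-- Solutions of the `p`-Legendre equation are smooth. -/
theorem contDiffOn_nat (h : ConeProfile p θ₀ g) (n : ℕ) :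
    ContDiffOn ℝ n g (Ioo 0 Real.pi) ∧ ContDiffOn ℝ n (deriv g) (Ioo 0 Real.pi) := by
  -- Bootstrap `g` and `g'` together: once both are `C^n`, the equation writes `g''` as a smooth
  -- expression in `cot`, `g` and `g'` with nonvanishing denominator `N`.
  induction n with
  | zero => exact ⟨contDiffOn_zero.2 h.continuousOn, contDiffOn_zero.2 h.continuousOn_deriv⟩
  | succ n ih =>
    obtain ⟨h1, h2⟩ := ih
    have hd : ∀ F : ℝ → ℝ, ∀ F' : ℝ → ℝ, (∀ θ ∈ Ioo 0 Real.pi, HasDerivAt F (F' θ) θ) →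
        ContDiffOn ℝ n F' (Ioo 0 Real.pi) → ContDiffOn ℝ (n + 1 : ℕ) F (Ioo 0 Real.pi) := by
      intro F F' hF hF'
      push_cast
      rw [contDiffOn_succ_iff_deriv_of_isOpen isOpen_Ioo]
      refine ⟨fun θ hθ => (hF θ hθ).differentiableAt.differentiableWithinAt, by simp, ?_⟩
      exact hF'.congr fun θ hθ => (hF θ hθ).deriv
    refine ⟨hd g (deriv g) h.hasDerivAt h2, hd (deriv g) _ h.hasDerivAt_deriv ?_⟩
    have hcot : ContDiffOn ℝ n Real.cot (Ioo 0 Real.pi) := contDiffOn_cot (n := n)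
    have hS : ContDiffOn ℝ n (gradSq g) (Ioo 0 Real.pi) := (h1.pow 2).add (h2.pow 2)
    have hN : ContDiffOn ℝ n (ellipSq p g) (Ioo 0 Real.pi) :=
      (h1.pow 2).add (contDiffOn_const.mul (h2.pow 2))
    have hm : ContDiffOn ℝ n (latCurv g) (Ioo 0 Real.pi) := h1.add (hcot.mul h2)
    exact (hm.mul (hS.div hN fun θ hθ => (h.ellipSq_pos hθ).ne')).neg.sub h1

theorem contDiffOn (h : ConeProfile p θ₀ g) : ContDiffOn ℝ ∞ g (Ioo 0 Real.pi) :=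
  contDiffOn_infty.2 fun n => (h.contDiffOn_nat n).1

theorem contDiffOn_deriv (h : ConeProfile p θ₀ g) : ContDiffOn ℝ ∞ (deriv g) (Ioo 0 Real.pi) :=
  contDiffOn_infty.2 fun n => (h.contDiffOn_nat n).2

theorem contDiffOn_gradSq (h : ConeProfile p θ₀ g) : ContDiffOn ℝ ∞ (gradSq g) (Ioo 0 Real.pi) :=
  (h.contDiffOn.pow 2).add (h.contDiffOn_deriv.pow 2)

end ConeProfile
end

/-! ### Angular inequalities behind the instability. -/

noncomputable section

/-- The quadratic form `|η|² + (p - 2) (e · η)²` with `e = (g, g') / |(g, g')|`, in terms of the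
components of `η`. -/
def dirForm (p : ℝ) (g : ℝ → ℝ) (θ a b : ℝ) : ℝ :=
  a ^ 2 + b ^ 2 + (p - 2) * ((g θ * a + deriv g θ * b) ^ 2 / gradSq g θ)

/-- The density on the meridian of the second variation along `ρ^{-1/2} c(θ)`. -/
def angForm (p : ℝ) (g c : ℝ → ℝ) (θ : ℝ) : ℝ :=
  pWeight p g θ * dirForm p g θ (-(1 / 2) * c θ) (deriv c θ) * Real.sin θ

namespace ConeProfile

variable {p θ₀ : ℝ} {g : ℝ → ℝ}

theorem hasDerivAt_latCurv (h : ConeProfile p θ₀ g) {θ : ℝ} (hθ : θ ∈ Ioo 0 Real.pi) :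
    HasDerivAt (latCurv g) (Real.cot θ * (merCurv p g θ - latCurv g θ)) θ := by
  have := (h.hasDerivAt θ hθ).add ((hasDerivAt_cot hθ).mul (h.hasDerivAt_deriv θ hθ))
  convert! this using 1
  have hs := (sin_pos_of_mem hθ).ne'
  have h1 := Real.sin_sq_add_cos_sq θ
  unfold latCurv
  rw [Real.cot_eq_cos_div_sin]
  field_simp
  linear_combination (- deriv g θ) * h1

/-- This primitive vanishes at the equator and equals `-cos θ₀` at `θ₀`, so its derivative
integrates to exactly the curvature term. -/
theorem hasDerivAt_curvFlux (h : ConeProfile p θ₀ g) {θ : ℝ} (hθ : θ ∈ Ioo 0 Real.pi) :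
    HasDerivAt (fun t => -(pWeight p g t * deriv g t * Real.sin t * latCurv g t))
      (pWeight p g θ * Real.sin θ * (2 * g θ * latCurv g θ
        - (latCurv g θ - g θ) * (merCurv p g θ - latCurv g θ))) θ := by
  have := ((h.hasDerivAt_flux hθ).mul (h.hasDerivAt_latCurv hθ)).neg
  convert! this using 1
  unfold latCurv
  ring

/-- The primitive vanishes at both ends of `[θ₀, π/2]`, so multiples of this derivative can be added
without changing an integral. -/
theorem hasDerivAt_mulFlux (h : ConeProfile p θ₀ g) {θ : ℝ} (hθ : θ ∈ Ioo 0 Real.pi) :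
    HasDerivAt (fun t => pWeight p g t * deriv g t * Real.sin t * g t)
      (pWeight p g θ * Real.sin θ * (deriv g θ ^ 2 - 2 * g θ ^ 2)) θ := by
  have := (h.hasDerivAt_flux hθ).mul (h.hasDerivAt θ hθ)
  convert! this using 1
  ring

theorem continuousOn_angForm (h : ConeProfile p θ₀ g) {c : ℝ → ℝ}
    (hc : ContDiffOn ℝ ∞ c (Ioo 0 Real.pi)) : ContinuousOn (angForm p g c) (Ioo 0 Real.pi) := by
  have h1 := hc.continuousOn
  have h2 : ContinuousOn (deriv c) (Ioo 0 Real.pi) :=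
    hc.continuousOn_deriv_of_isOpen isOpen_Ioo (by simp)
  have h3 : ContinuousOn (fun θ => dirForm p g θ (-(1 / 2) * c θ) (deriv c θ)) (Ioo 0 Real.pi) := by
    refine (((h1.const_mul _).pow 2).add (h2.pow 2)).add (ContinuousOn.const_mul ?_ _)
    exact (((h.continuousOn.mul (h1.const_mul _)).add (h.continuousOn_deriv.mul h2)).pow 2).div
      h.continuousOn_gradSq fun θ hθ => (h.gradSq_pos θ hθ).ne'
  exact (h.continuousOn_pWeight.mul h3).mul Real.continuous_sin.continuousOn

/-- The choice is `c = √S = |∇u|`, with `c(θ₀) = 1`. Substituting the equation writes the form as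
the derivative from `hasDerivAt_curvFlux`, plus a quarter of the one from `hasDerivAt_mulFlux`,
minus `W`. The exact parts integrate to `cos θ₀`, and `W > 0` because `m ≥ g` and `(p + 1)/4 < 1`.
-/
theorem exists_angular_le_two (h : ConeProfile p θ₀ g) (hp : p ≤ 2) :
    ∃ c : ℝ → ℝ, ContDiffOn ℝ ∞ c (Ioo 0 Real.pi) ∧ (∀ θ ∈ Ioo 0 Real.pi, 0 < c θ) ∧
      (∀ θ ∈ Ioo 0 Real.pi, c (Real.pi - θ) = c θ) ∧
      ∫ θ in θ₀..Real.pi / 2, angForm p g c θ < Real.cos θ₀ * c θ₀ ^ 2 := by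
  have hcd : ContDiffOn ℝ ∞ (fun θ => √(gradSq g θ)) (Ioo 0 Real.pi) :=
    h.contDiffOn_gradSq.sqrt fun θ hθ => (h.gradSq_pos θ hθ).ne'
  refine ⟨fun θ => √(gradSq g θ), hcd, fun θ hθ => Real.sqrt_pos.2 (h.gradSq_pos θ hθ),
    fun θ hθ => by simp only [h.gradSq_reflect hθ], ?_⟩
  set W : ℝ → ℝ := fun θ => pWeight p g θ * Real.sin θ *
    (latCurv g θ ^ 2 * (1 + g θ ^ 2 / ellipSq p g θ) - 1 / 4 * (p + 1) * g θ ^ 2) with hW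
  have hWc : ContinuousOn W (Ioo 0 Real.pi) := by
    refine (h.continuousOn_pWeight.mul Real.continuous_sin.continuousOn).mul
      (((h.continuousOn_latCurv.pow 2).mul (continuousOn_const.add
        ((h.continuousOn.pow 2).div h.continuousOn_ellipSq fun θ hθ => (h.ellipSq_pos hθ).ne'))).sub
      (continuousOn_const.mul (h.continuousOn.pow 2)))
  have hpt : ∀ θ ∈ Ioo 0 Real.pi, angForm p g (fun θ => √(gradSq g θ)) θ =
      (pWeight p g θ * Real.sin θ * (2 * g θ * latCurv g θ
        - (latCurv g θ - g θ) * (merCurv p g θ - latCurv g θ)))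
      + 1 / 4 * (pWeight p g θ * Real.sin θ * (deriv g θ ^ 2 - 2 * g θ ^ 2)) - W θ := by
    intro θ hθ
    have hS := h.gradSq_pos θ hθ
    have hN := h.ellipSq_pos hθ
    have hd : deriv (fun θ => √(gradSq g θ)) θ = deriv g θ * merCurv p g θ / √(gradSq g θ) := by
      rw [((h.hasDerivAt_gradSq hθ).sqrt hS.ne').deriv]
      field_simp
    simp only [angForm, dirForm, hd, hW]
    have hq : √(gradSq g θ) ^ 2 = gradSq g θ := Real.sq_sqrt hS.le
    have hq0 : √(gradSq g θ) ≠ 0 := (Real.sqrt_pos.2 hS).ne'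
    have e1 : (-(1 / 2) * √(gradSq g θ)) ^ 2 = 1 / 4 * gradSq g θ := by
      rw [mul_pow, hq]; ring
    have e2 : (deriv g θ * merCurv p g θ / √(gradSq g θ)) ^ 2
        = deriv g θ ^ 2 * merCurv p g θ ^ 2 / gradSq g θ := by
      rw [div_pow, hq]; ring
    have e3 : (g θ * (-(1 / 2) * √(gradSq g θ))
        + deriv g θ * (deriv g θ * merCurv p g θ / √(gradSq g θ))) ^ 2
        = 1 / 4 * g θ ^ 2 * gradSq g θ - g θ * deriv g θ ^ 2 * merCurv p g θ
          + deriv g θ ^ 4 * merCurv p g θ ^ 2 / gradSq g θ := by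
      have : ∀ t : ℝ, t ≠ 0 → (g θ * (-(1 / 2) * t) + deriv g θ * (deriv g θ * merCurv p g θ / t)) ^ 2
          = 1 / 4 * g θ ^ 2 * t ^ 2 - g θ * deriv g θ ^ 2 * merCurv p g θ
            + deriv g θ ^ 4 * merCurv p g θ ^ 2 / t ^ 2 := fun t ht => by
        field_simp
        ring
      rw [this _ hq0, hq]
    rw [e1, e2, e3]
    have hn : merCurv p g θ = -(latCurv g θ * gradSq g θ) / ellipSq p g θ := by
      rw [eq_div_iff hN.ne', h.merCurv_mul hθ]
    rw [hn]
    -- With `m`, the weight and the sine as free variables, what remains is a rational identity in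
    -- `g` and `g'`.
    have hm : ∀ m A s : ℝ, A * (1 / 4 * gradSq g θ +
        deriv g θ ^ 2 * (-(m * gradSq g θ) / ellipSq p g θ) ^ 2 / gradSq g θ +
        (p - 2) * ((1 / 4 * g θ ^ 2 * gradSq g θ -
          g θ * deriv g θ ^ 2 * (-(m * gradSq g θ) / ellipSq p g θ) +
          deriv g θ ^ 4 * (-(m * gradSq g θ) / ellipSq p g θ) ^ 2 / gradSq g θ)
            / gradSq g θ)) * s =
      A * s * (2 * g θ * m - (m - g θ) * (-(m * gradSq g θ) / ellipSq p g θ - m)) +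
      1 / 4 * (A * s * (deriv g θ ^ 2 - 2 * g θ ^ 2)) -
      A * s * (m ^ 2 * (1 + g θ ^ 2 / ellipSq p g θ) - 1 / 4 * (p + 1) * g θ ^ 2) := by
      intro m A s
      field_simp
      unfold gradSq ellipSq
      ring
    exact hm _ _ _
  have hB : ContinuousOn (fun θ => pWeight p g θ * Real.sin θ * (2 * g θ * latCurv g θ
        - (latCurv g θ - g θ) * (merCurv p g θ - latCurv g θ))) (Ioo 0 Real.pi) :=
    (h.continuousOn_pWeight.mul Real.continuous_sin.continuousOn).mul
      (((h.continuousOn.const_mul _).mul h.continuousOn_latCurv).sub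
        ((h.continuousOn_latCurv.sub h.continuousOn).mul
          (h.continuousOn_merCurv.sub h.continuousOn_latCurv)))
  have hY : ContinuousOn (fun θ => pWeight p g θ * Real.sin θ * (deriv g θ ^ 2 - 2 * g θ ^ 2))
      (Ioo 0 Real.pi) :=
    (h.continuousOn_pWeight.mul Real.continuous_sin.continuousOn).mul
      ((h.continuousOn_deriv.pow 2).sub ((h.continuousOn.pow 2).const_mul _))
  have hint : ∫ θ in θ₀..Real.pi / 2, angForm p g (fun θ => √(gradSq g θ)) θ =
      Real.cos θ₀ - ∫ θ in θ₀..Real.pi / 2, W θ := by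
    rw [intervalIntegral.integral_congr (g := fun θ =>
      (pWeight p g θ * Real.sin θ * (2 * g θ * latCurv g θ
        - (latCurv g θ - g θ) * (merCurv p g θ - latCurv g θ)))
      + 1 / 4 * (pWeight p g θ * Real.sin θ * (deriv g θ ^ 2 - 2 * g θ ^ 2)) - W θ)
      fun θ hθ => hpt θ (h.half_subset (by rwa [uIcc_of_le h.angle_lt.le] at hθ))]
    rw [intervalIntegral.integral_sub ((h.intervalIntegrable_half hB).add
      ((h.intervalIntegrable_half hY).const_mul _)) (h.intervalIntegrable_half hWc),
      intervalIntegral.integral_add (h.intervalIntegrable_half hB)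
      ((h.intervalIntegrable_half hY).const_mul _), intervalIntegral.integral_const_mul,
      h.integral_half (fun θ hθ => h.hasDerivAt_curvFlux hθ) hB,
      h.integral_half (fun θ hθ => h.hasDerivAt_mulFlux hθ) hY]
    have := (sin_pos_of_mem h.mem_angle).ne'
    simp only [h.deriv_half, h.zero, h.one, h.pWeight_zero, latCurv, Real.cot_eq_cos_div_sin]
    field_simp
    ring
  have hpos : 0 < ∫ θ in θ₀..Real.pi / 2, W θ := by
    refine intervalIntegral.intervalIntegral_pos_of_pos_on (h.intervalIntegrable_half hWc)
      (fun θ hθ => ?_) h.angle_lt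
    have hθ' := Ioo_subset_Icc_self hθ
    have hθ'' := h.half_subset hθ'
    have h1 := h.pos_half θ ⟨hθ.1, hθ.2.le⟩
    have h2 := h.le_latCurv hθ'
    have h3 : 0 ≤ g θ ^ 2 / ellipSq p g θ := div_nonneg (sq_nonneg _) (h.ellipSq_pos hθ'').le
    refine mul_pos (mul_pos (h.pWeight_pos hθ'') (sin_pos_of_mem hθ'')) ?_
    have h4 : g θ ^ 2 ≤ latCurv g θ ^ 2 := by gcongr
    have h5 : 0 < g θ ^ 2 := by positivity
    nlinarith [mul_nonneg (sq_nonneg (latCurv g θ)) h3]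
  rw [hint]
  simp only [h.gradSq_zero, Real.sqrt_one]
  linarith

/-- `gradSq / ellipSq` is controlled by its value for a plane solution. -/
theorem gradSq_div_ellipSq_le (h : ConeProfile p θ₀ g) (hp : 2 ≤ p) {θ : ℝ}
    (hθ : θ ∈ Icc θ₀ (Real.pi / 2)) :
    gradSq g θ / ellipSq p g θ ≤ 1 / (Real.sin θ ^ 2 + (p - 1) * Real.cos θ ^ 2) := by
  have hθ' := h.half_subset hθ
  have hs := sin_pos_of_mem hθ'
  have hP := h.exp_pos
  rw [div_le_div_iff₀ (h.ellipSq_pos hθ') (by positivity)]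
  have hc : 0 ≤ Real.cos θ :=
    Real.cos_nonneg_of_mem_Icc ⟨by linarith [h.angle_pos, hθ.1, Real.pi_pos], hθ.2⟩
  -- For `p ≥ 2` the quotient `S/N` decreases with `g'²/g²`, and `∂u/∂x₃ ≤ 0` says `g'/g ≥ cot θ`,
  -- the value for the profile `sin θ` of a linear function.
  have h1 : (g θ * Real.cos θ) ^ 2 ≤ (deriv g θ * Real.sin θ) ^ 2 := by
    have := h.mul_cos_le hθ
    have := mul_nonneg (h.nonneg_half hθ) hc
    gcongr
  have h2 := Real.sin_sq_add_cos_sq θ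
  have h3 : Real.sin θ ^ 2 = 1 - Real.cos θ ^ 2 := by linarith
  rw [mul_pow, mul_pow, h3] at h1
  rw [h3]
  unfold gradSq ellipSq
  nlinarith [mul_nonneg (sub_nonneg.2 hp) (sub_nonneg.2 h1)]

theorem hasDerivAt_arctan_cot {P : ℝ} (hP : 0 < P) {θ : ℝ} (hθ : θ ∈ Ioo 0 Real.pi) :
    HasDerivAt (fun t => -(Real.arctan (√P * Real.cot t) / √P))
      (1 / (Real.sin θ ^ 2 + P * Real.cos θ ^ 2)) θ := by
  have := (((hasDerivAt_cot hθ).const_mul √P).arctan.div_const √P).neg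
  convert! this using 1
  have hs := sin_pos_of_mem hθ
  have hr := Real.sqrt_pos.2 hP
  have hq := Real.sq_sqrt hP.le
  rw [Real.cot_eq_cos_div_sin]
  have e : 1 + (√P * (Real.cos θ / Real.sin θ)) ^ 2
      = (Real.sin θ ^ 2 + P * Real.cos θ ^ 2) / Real.sin θ ^ 2 := by
    rw [mul_pow, hq]; field_simp
  rw [e]
  have : 0 < Real.sin θ ^ 2 + P * Real.cos θ ^ 2 := by positivity
  field_simp

/-- An upper bound for the angle `θ₀`. -/
theorem sin_mul_sqrt_le (h : ConeProfile p θ₀ g) (hp : 2 ≤ p) :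
    Real.sin θ₀ * √(p - 1) ≤ Real.arctan (√(p - 1) * Real.cot θ₀) := by
  have hP := h.exp_pos
  have hr := Real.sqrt_pos.2 hP
  have hc1 : ContinuousOn (fun θ => -(Real.sin θ * merCurv p g θ)) (Ioo 0 Real.pi) :=
    (Real.continuous_sin.continuousOn.mul h.continuousOn_merCurv).neg
  have hc2 : ContinuousOn (fun θ => 1 / (Real.sin θ ^ 2 + (p - 1) * Real.cos θ ^ 2))
      (Ioo 0 Real.pi) := by
    refine continuousOn_const.div (by fun_prop) fun θ hθ => ?_
    have := sin_pos_of_mem hθ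
    positivity
  have h1 := h.integral_half (fun θ hθ => h.hasDerivAt_vertical hθ) hc1
  have h2 := h.integral_half (fun θ hθ => hasDerivAt_arctan_cot hP hθ) hc2
  have hle := intervalIntegral.integral_mono_on h.angle_lt.le (h.intervalIntegrable_half hc1)
    (h.intervalIntegrable_half hc2) fun θ hθ => ?_
  · rw [h1, h2] at hle
    simp only [h.deriv_half, Real.cos_pi_div_two, h.zero, h.one, Real.cot_eq_cos_div_sin,
      zero_div, mul_zero, Real.arctan_zero] at hle ⊢
    rw [← le_div_iff₀ hr]
    linarith
  · refine le_trans ?_ (h.gradSq_div_ellipSq_le hp hθ)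
    have hθ' := h.half_subset hθ
    have hq := (ellipSq_ratio_le h.one_lt g θ).1
    have e : -(Real.sin θ * merCurv p g θ) =
        (latCurv g θ * Real.sin θ) * (gradSq g θ / ellipSq p g θ) := by
      unfold merCurv; ring
    rw [e]
    -- Cauchy–Schwarz: `m sin θ = g sin θ + g' cos θ` is at most `√S ≤ 1`. The left side is the
    -- derivative of `∂u/∂x₃`, whose total variation up to the equator is `sin θ₀`.
    refine mul_le_of_le_one_left hq ?_
    rw [latCurv_mul_sin hθ']
    have h3 := h.gradSq_le_one_half hθ
    unfold gradSq at h3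
    nlinarith [sq_nonneg (g θ - Real.sin θ), sq_nonneg (deriv g θ - Real.cos θ),
      Real.sin_sq_add_cos_sq θ]

/-- Read `P = p - 1`, `s = sin θ₀`, `y = cot θ₀`, `r = √P`. For `P < 4` the bound `arctan x ≤ x`
already gives `P y < 4 y`. For `P ≥ 4` the arctangent is bounded by `π/2`, and the hypothesis `s r ≤
a`, which prevents `θ₀` from being too large, gives the needed lower bound for `y`. -/
theorem arctan_bound {P y s a r : ℝ} (hP : 1 ≤ P) (hy : 0 < y) (hs : 0 < s)
    (hsy : s ^ 2 * (1 + y ^ 2) = 1) (hr : 0 < r) (hrP : r ^ 2 = P) (ha : a = Real.arctan (r * y))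
    (hsa : s * r ≤ a) : y / P + (P ^ 2 - 1) / (P * r) * a < 4 * y := by
  have hP0 : 0 < P := by linarith
  have ha0 : 0 < a := by rw [ha]; exact Real.arctan_pos.2 (by positivity)
  have hC : 0 ≤ (P ^ 2 - 1) / (P * r) := div_nonneg (by nlinarith) (by positivity)
  rcases lt_or_ge P 4 with h4 | h4
  · have ha1 : a ≤ r * y := by
      have := Real.le_tan ha0.le (by rw [ha]; exact Real.arctan_lt_pi_div_two _)
      rwa [ha, Real.tan_arctan, ← ha] at this
    calc y / P + (P ^ 2 - 1) / (P * r) * a ≤ y / P + (P ^ 2 - 1) / (P * r) * (r * y) := by gcongr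
      _ = P * y := by field_simp; ring
      _ < 4 * y := by gcongr
  · have ha2 : a < Real.pi / 2 := by rw [ha]; exact Real.arctan_lt_pi_div_two _
    -- `2.4675` is slightly larger than `π²/4`.
    have haB : a ^ 2 < 2.4675 := by
      have h1 : a < 1.5708 := by linarith [Real.pi_lt_d6]
      nlinarith
    have h1 : P ≤ a ^ 2 * (1 + y ^ 2) := by
      have : (s * r) ^ 2 ≤ a ^ 2 := by gcongr
      calc P = (s * r) ^ 2 * (1 + y ^ 2) := by rw [mul_pow, hrP]; linear_combination (-P) * hsy
        _ ≤ _ := by gcongr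
    have h2 : P - 2.4675 < 2.4675 * y ^ 2 := by nlinarith [sq_nonneg y]
    -- This is the square of the goal after inserting the bounds on `a²` and `y²`. Expanded in `x =
    -- P - 4`, the difference has positive coefficients only.
    have hkey : 2.4675 ^ 2 * (P ^ 2 - 1) ^ 2 < P * (P - 2.4675) * (4 * P - 1) ^ 2 := by
      obtain ⟨x, hx⟩ : ∃ x, P = 4 + x := ⟨P - 4, by ring⟩
      have hx0 : 0 ≤ x := by linarith
      subst hx
      rw [← sub_pos]
      ring_nf
      positivity
    have h3 : ((P ^ 2 - 1) * a) ^ 2 < (r * (4 * P - 1) * y) ^ 2 := by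
      have e1 : ((P ^ 2 - 1) * a) ^ 2 ≤ (P ^ 2 - 1) ^ 2 * 2.4675 := by
        rw [mul_pow]; gcongr
      have e2 : (r * (4 * P - 1) * y) ^ 2 = P * (4 * P - 1) ^ 2 * y ^ 2 := by
        rw [mul_pow, mul_pow, hrP]
      rw [e2]
      refine e1.trans_lt ?_
      have e3 : P * (P - 2.4675) * (4 * P - 1) ^ 2 < 2.4675 * (P * (4 * P - 1) ^ 2 * y ^ 2) := by
        have : 0 < P * (4 * P - 1) ^ 2 := mul_pos hP0 (pow_pos (by linarith) 2)
        nlinarith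
      linarith
    have h4' : (P ^ 2 - 1) * a < r * (4 * P - 1) * y :=
      lt_of_pow_lt_pow_left₀ 2 (mul_nonneg (mul_nonneg hr.le (by linarith)) hy.le) h3
    have e : 4 * y - (y / P + (P ^ 2 - 1) / (P * r) * a)
        = (r * (4 * P - 1) * y - (P ^ 2 - 1) * a) / (P * r) := by
      field_simp; ring
    have : 0 < 4 * y - (y / P + (P ^ 2 - 1) / (P * r) * a) := by
      rw [e]; exact div_pos (sub_pos.2 h4') (by positivity)
    linarith

/-- The choice `c = (A sin θ)^(-1/2)` normalizes the weight `A sin θ c²` to 1. The form becomes `S/N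
(p - 1 + cot² θ)/4`, and the target `cos θ₀ c(θ₀)²` becomes `cot θ₀`. The bound on `S/N` leaves an
elementary integral, which `arctan_bound` compares with `4 cot θ₀`. -/
theorem exists_angular_two_le (h : ConeProfile p θ₀ g) (hp : 2 ≤ p) :
    ∃ c : ℝ → ℝ, ContDiffOn ℝ ∞ c (Ioo 0 Real.pi) ∧ (∀ θ ∈ Ioo 0 Real.pi, 0 < c θ) ∧
      (∀ θ ∈ Ioo 0 Real.pi, c (Real.pi - θ) = c θ) ∧
      ∫ θ in θ₀..Real.pi / 2, angForm p g c θ < Real.cos θ₀ * c θ₀ ^ 2 := by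
  have hP := h.exp_pos
  have hr := Real.sqrt_pos.2 hP
  have hw : ∀ θ ∈ Ioo 0 Real.pi, 0 < pWeight p g θ * Real.sin θ := fun θ hθ =>
    mul_pos (h.pWeight_pos hθ) (sin_pos_of_mem hθ)
  have hAc : ContDiffOn ℝ ∞ (pWeight p g) (Ioo 0 Real.pi) :=
    h.contDiffOn_gradSq.rpow_const_of_ne fun θ hθ => (h.gradSq_pos θ hθ).ne'
  have hwc : ContDiffOn ℝ ∞ (fun θ => pWeight p g θ * Real.sin θ) (Ioo 0 Real.pi) :=
    hAc.mul Real.contDiff_sin.contDiffOn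
  have hcd : ContDiffOn ℝ ∞ (fun θ => (√(pWeight p g θ * Real.sin θ))⁻¹) (Ioo 0 Real.pi) :=
    (hwc.sqrt fun θ hθ => (hw θ hθ).ne').inv fun θ hθ => (Real.sqrt_pos.2 (hw θ hθ)).ne'
  refine ⟨fun θ => (√(pWeight p g θ * Real.sin θ))⁻¹, hcd,
    fun θ hθ => inv_pos.2 (Real.sqrt_pos.2 (hw θ hθ)),
    fun θ hθ => by simp only [h.pWeight_reflect hθ, Real.sin_pi_sub], ?_⟩
  have hpt : ∀ θ ∈ Ioo 0 Real.pi, angForm p g (fun θ => (√(pWeight p g θ * Real.sin θ))⁻¹) θ =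
      1 / 4 * (gradSq g θ / ellipSq p g θ * (p - 1 + Real.cot θ ^ 2)) := by
    intro θ hθ
    have hS := h.gradSq_pos θ hθ
    have hN := h.ellipSq_pos hθ
    have hs := sin_pos_of_mem hθ
    have hA := h.pWeight_pos hθ
    have hsq := Real.sqrt_pos.2 (hw θ hθ)
    -- The logarithmic derivative of `A sin θ`, so that `c' = -(e/2) c`.
    set e := Real.cot θ + (p - 2) * deriv g θ * merCurv p g θ / gradSq g θ with he
    have hwd : HasDerivAt (fun θ => pWeight p g θ * Real.sin θ)
        (pWeight p g θ * Real.sin θ * e) θ := by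
      have := (h.hasDerivAt_pWeight hθ).mul (Real.hasDerivAt_sin θ)
      convert! this using 1
      rw [he, Real.cot_eq_cos_div_sin]
      field_simp
      ring
    have hd : deriv (fun θ => (√(pWeight p g θ * Real.sin θ))⁻¹) θ =
        -(1 / 2) * e * (√(pWeight p g θ * Real.sin θ))⁻¹ := by
      have hdd : deriv (fun θ => (√(pWeight p g θ * Real.sin θ))⁻¹) θ = _ :=
        ((hwd.sqrt (hw θ hθ).ne').inv hsq.ne').deriv
      rw [hdd]
      have := Real.sq_sqrt (hw θ hθ).le
      set t := √(pWeight p g θ * Real.sin θ)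
      rw [← this]
      field_simp
    simp only [angForm, dirForm, hd]
    have hq := Real.sq_sqrt (hw θ hθ).le
    set t := √(pWeight p g θ * Real.sin θ)
    have e1 : pWeight p g θ * ((-(1 / 2) * t⁻¹) ^ 2 + (-(1 / 2) * e * t⁻¹) ^ 2 +
        (p - 2) * ((g θ * (-(1 / 2) * t⁻¹) + deriv g θ * (-(1 / 2) * e * t⁻¹)) ^ 2 / gradSq g θ))
          * Real.sin θ
        = (pWeight p g θ * Real.sin θ) / t ^ 2 * (1 / 4 * (1 + e ^ 2 +
          (p - 2) * ((g θ + deriv g θ * e) ^ 2 / gradSq g θ))) := by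
      field_simp
      ring
    have he2 : e = Real.cot θ - (p - 2) * deriv g θ * latCurv g θ / ellipSq p g θ := by
      rw [he]; unfold merCurv; field_simp; ring
    rw [e1, hq, div_self (hw θ hθ).ne', one_mul, he2]
    unfold latCurv
    generalize Real.cot θ = k
    field_simp
    unfold gradSq ellipSq
    ring
  have hcot : ContinuousOn (fun θ => Real.cot θ ^ 2) (Ioo 0 Real.pi) := continuousOn_cot.pow 2
  have hc1 : ContinuousOn (fun θ => gradSq g θ / ellipSq p g θ * (p - 1 + Real.cot θ ^ 2))
      (Ioo 0 Real.pi) :=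
    (h.continuousOn_gradSq.div h.continuousOn_ellipSq fun θ hθ => (h.ellipSq_pos hθ).ne').mul
      (continuousOn_const.add hcot)
  have hc2 : ContinuousOn (fun θ => 1 / (p - 1) * (1 / Real.sin θ ^ 2) + ((p - 1) - 1 / (p - 1)) *
      (1 / (Real.sin θ ^ 2 + (p - 1) * Real.cos θ ^ 2))) (Ioo 0 Real.pi) := by
    refine (continuousOn_const.mul (continuousOn_const.div (by fun_prop) fun θ hθ => ?_)).add
      (continuousOn_const.mul (continuousOn_const.div (by fun_prop) fun θ hθ => ?_))
    · have := sin_pos_of_mem hθ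
      positivity
    · have := sin_pos_of_mem hθ
      positivity
  -- With `P = p - 1`, the integrand splits as `(P + cot²)/(sin² + P cos²) = P⁻¹/sin² + (P -
  -- P⁻¹)/(sin² + P cos²)`, with primitives `-cot` and an arctangent.
  have hI := h.integral_half (F := fun t => 1 / (p - 1) * -Real.cot t + ((p - 1) - 1 / (p - 1)) *
    -(Real.arctan (√(p - 1) * Real.cot t) / √(p - 1))) (fun θ hθ => by
      have := ((hasDerivAt_cot hθ).neg.const_mul (1 / (p - 1))).add
        ((hasDerivAt_arctan_cot hP hθ).const_mul ((p - 1) - 1 / (p - 1)))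
      rw [neg_neg] at this
      exact this) hc2
  have hle : ∫ θ in θ₀..Real.pi / 2, gradSq g θ / ellipSq p g θ * (p - 1 + Real.cot θ ^ 2) ≤ _ :=
    intervalIntegral.integral_mono_on h.angle_lt.le (h.intervalIntegrable_half hc1)
    (h.intervalIntegrable_half hc2) fun θ hθ => by
      have hs := sin_pos_of_mem (h.half_subset hθ)
      have : 0 ≤ p - 1 + Real.cot θ ^ 2 := by positivity
      refine (mul_le_mul_of_nonneg_right (h.gradSq_div_ellipSq_le hp hθ) this).trans_eq ?_
      have hD : 0 < Real.sin θ ^ 2 + (p - 1) * Real.cos θ ^ 2 := by positivity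
      have h1 := Real.sin_sq_add_cos_sq θ
      have h2 : Real.cos θ ^ 2 = 1 - Real.sin θ ^ 2 := by linarith
      rw [Real.cot_eq_cos_div_sin]
      field_simp
      rw [h2]
      ring
  rw [hI] at hle
  rw [intervalIntegral.integral_congr (g := fun θ =>
    1 / 4 * (gradSq g θ / ellipSq p g θ * (p - 1 + Real.cot θ ^ 2)))
    fun θ hθ => hpt θ (h.half_subset (by rwa [uIcc_of_le h.angle_lt.le] at hθ)),
    intervalIntegral.integral_const_mul]
  have hs0 := sin_pos_of_mem h.mem_angle
  have hc0 : 0 < Real.cos θ₀ :=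
    Real.cos_pos_of_mem_Ioo ⟨by linarith [h.angle_pos, Real.pi_pos], h.angle_lt⟩
  have hy : Real.cot θ₀ = Real.cos θ₀ / Real.sin θ₀ := Real.cot_eq_cos_div_sin θ₀
  have hsy : Real.sin θ₀ ^ 2 * (1 + Real.cot θ₀ ^ 2) = 1 := by
    rw [hy]; field_simp; exact Real.sin_sq_add_cos_sq θ₀
  have hfin := arctan_bound (P := p - 1) (by linarith) (by rw [hy]; positivity) hs0 hsy hr
    (Real.sq_sqrt hP.le) rfl (h.sin_mul_sqrt_le hp)
  have hc2' : ((√(pWeight p g θ₀ * Real.sin θ₀))⁻¹) ^ 2 = 1 / Real.sin θ₀ := by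
    rw [inv_pow, Real.sq_sqrt (hw θ₀ h.mem_angle).le, h.pWeight_zero, one_mul, one_div]
  simp only [hc2']
  have hcot0 : Real.cot (Real.pi / 2) = 0 := by
    rw [Real.cot_eq_cos_div_sin, Real.cos_pi_div_two, zero_div]
  simp only [hcot0, mul_zero, Real.arctan_zero, zero_div, neg_zero] at hle
  have e : Real.cos θ₀ * (1 / Real.sin θ₀) = Real.cot θ₀ := by rw [hy]; ring
  rw [e]
  have e2 : (p - 1 - 1 / (p - 1)) * -(Real.arctan (√(p - 1) * Real.cot θ₀) / √(p - 1))
      = -(((p - 1) ^ 2 - 1) / ((p - 1) * √(p - 1)) * Real.arctan (√(p - 1) * Real.cot θ₀)) := by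
    field_simp
  rw [e2] at hle
  have e3 : 1 / (p - 1) * -Real.cot θ₀ = -(Real.cot θ₀ / (p - 1)) := by ring
  rw [e3] at hle
  linarith

theorem exists_angular (h : ConeProfile p θ₀ g) :
    ∃ c : ℝ → ℝ, ContDiffOn ℝ ∞ c (Ioo 0 Real.pi) ∧ (∀ θ ∈ Ioo 0 Real.pi, 0 < c θ) ∧
      (∀ θ ∈ Ioo 0 Real.pi, c (Real.pi - θ) = c θ) ∧
      ∫ θ in θ₀..Real.pi / 2, angForm p g c θ < Real.cos θ₀ * c θ₀ ^ 2 :=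
  (le_total p 2).elim h.exists_angular_le_two h.exists_angular_two_le

/-- The radial energy of `1/|x|` is controlled by the curvature term when `2 ≤ p < 5`. -/
theorem integral_radial_lt (h : ConeProfile p θ₀ g) (hp : 2 ≤ p) (hp5 : p < 5) :
    ∫ θ in θ₀..Real.pi / 2, pWeight p g θ * dirForm p g θ 1 0 * Real.sin θ
      < 2 * Real.cos θ₀ := by
  have hP := h.exp_pos
  have hsin := Real.continuous_sin.continuousOn (s := Ioo 0 Real.pi)
  have hne : ∀ θ ∈ Ioo 0 Real.pi, gradSq g θ ≠ 0 := fun θ hθ => (h.gradSq_pos θ hθ).ne'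
  have hnN : ∀ θ ∈ Ioo 0 Real.pi, ellipSq p g θ ≠ 0 := fun θ hθ => (h.ellipSq_pos hθ).ne'
  -- `g g' / (g² + g'²)`
  set T : ℝ → ℝ := fun θ => g θ * deriv g θ / gradSq g θ with hT
  have hTd : ∀ θ ∈ Ioo 0 Real.pi, HasDerivAt T ((g θ ^ 2 - deriv g θ ^ 2) / gradSq g θ *
      (-1 - g θ * latCurv g θ / ellipSq p g θ)) θ := fun θ hθ => by
    have := ((h.hasDerivAt θ hθ).mul (h.hasDerivAt_deriv θ hθ)).div (h.hasDerivAt_gradSq hθ)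
      (hne θ hθ)
    convert! this using 1
    have h1 := hne θ hθ
    have h2 := hnN θ hθ
    simp only [Pi.mul_apply]
    unfold merCurv
    generalize latCurv g θ = m
    field_simp
    unfold gradSq
    ring
  -- Both sides vanish at the equator. The factor multiplying `(g'² - g²)/S` in `T'` is `1 + g m/N ≤
  -- 2`, so `T' ≥ -2`, whereas `(3 cot)' ≤ -3`.
  have hT3 : ∀ θ ∈ Icc θ₀ (Real.pi / 2), T θ ≤ 3 * Real.cot θ := by
    have hanti : AntitoneOn (fun t => 3 * Real.cot t - T t) (Icc θ₀ (Real.pi / 2)) := by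
      have hd := fun θ (hθ : θ ∈ Ioo 0 Real.pi) => ((hasDerivAt_cot hθ).const_mul 3).sub (hTd θ hθ)
      refine antitoneOn_of_hasDerivWithinAt_nonpos (convex_Icc _ _)
        (continuousOn_of_hasDerivAt hd h.half_subset)
        (fun t ht => (hd t (h.half_subset (interior_subset ht))).hasDerivWithinAt)
        fun t ht => ?_
      have ht' := interior_subset ht
      have ht'' := h.half_subset ht'
      have hs := sin_pos_of_mem ht''
      have h1 : 1 ≤ 1 / Real.sin t ^ 2 := by
        rw [le_div_iff₀ (by positivity), one_mul]
        exact pow_le_one₀ hs.le (Real.sin_le_one t)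
      have hS := h.gradSq_pos t ht''
      have hN := h.ellipSq_pos ht''
      have h2 : (deriv g t ^ 2 - g t ^ 2) / gradSq g t ≤ 1 := by
        rw [div_le_one hS]; unfold gradSq; nlinarith [sq_nonneg (g t)]
      have h2' : -1 ≤ (deriv g t ^ 2 - g t ^ 2) / gradSq g t := by
        rw [le_div_iff₀ hS]; unfold gradSq; nlinarith [sq_nonneg (deriv g t)]
      have h3 : 0 ≤ g t * latCurv g t / ellipSq p g t :=
        div_nonneg (mul_nonneg (h.nonneg_half ht') (h.latCurv_nonneg ht')) hN.le
      have h4 : g t * latCurv g t / ellipSq p g t ≤ 1 := by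
        rw [div_le_one hN]
        have h5 := h.mul_cos_le ht'
        have h6 : g t * Real.cot t ≤ deriv g t := by
          rw [Real.cot_eq_cos_div_sin, ← mul_div_assoc, div_le_iff₀ hs]; exact h5
        unfold latCurv ellipSq
        nlinarith [mul_le_mul_of_nonneg_right h6 (h.deriv_nonneg ht'),
          mul_nonneg (sub_nonneg.2 hp) (sq_nonneg (deriv g t))]
      have h7 : -((g t ^ 2 - deriv g t ^ 2) / gradSq g t *
          (-1 - g t * latCurv g t / ellipSq p g t))
          = -((deriv g t ^ 2 - g t ^ 2) / gradSq g t * (1 + g t * latCurv g t / ellipSq p g t)) := by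
        ring
      nlinarith
    intro θ hθ
    have := hanti hθ ⟨h.angle_lt.le, le_rfl⟩ hθ.2
    simp only [hT, h.deriv_half, mul_zero, zero_div, Real.cot_eq_cos_div_sin,
      Real.cos_pi_div_two, sub_zero] at this
    simp only [hT, Real.cot_eq_cos_div_sin]
    linarith
  -- the two integral identities
  have hd1 : ∀ θ ∈ Ioo 0 Real.pi, HasDerivAt (fun t => pWeight p g t * Real.cos t)
      (-(pWeight p g θ * Real.sin θ * (1 + (p - 2) * (Real.cot θ * deriv g θ * latCurv g θ
        / ellipSq p g θ)))) θ := fun θ hθ => by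
    have := (h.hasDerivAt_pWeight hθ).mul (Real.hasDerivAt_cos θ)
    convert! this using 1
    have h1 := hne θ hθ
    have h2 := hnN θ hθ
    have h3 := (sin_pos_of_mem hθ).ne'
    unfold merCurv
    rw [Real.cot_eq_cos_div_sin]
    generalize latCurv g θ = m
    field_simp
    ring
  have hd2 : ∀ θ ∈ Ioo 0 Real.pi, HasDerivAt (fun t => pWeight p g t * deriv g t * Real.sin t * g t
        / gradSq g t)
      (pWeight p g θ * Real.sin θ * ((deriv g θ ^ 2 - 2 * g θ ^ 2) / gradSq g θ
        + 2 * (g θ * deriv g θ ^ 2 * latCurv g θ / (gradSq g θ * ellipSq p g θ)))) θ :=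
    fun θ hθ => by
    have := (h.hasDerivAt_mulFlux hθ).div (h.hasDerivAt_gradSq hθ) (hne θ hθ)
    convert! this using 1
    have h1 := hne θ hθ
    have h2 := hnN θ hθ
    unfold merCurv
    generalize latCurv g θ = m
    field_simp
    ring
  have hw := h.continuousOn_pWeight.mul hsin
  have hc1 : ContinuousOn (fun θ => -(pWeight p g θ * Real.sin θ * (1 + (p - 2) *
      (Real.cot θ * deriv g θ * latCurv g θ / ellipSq p g θ)))) (Ioo 0 Real.pi) :=
    (hw.mul (continuousOn_const.add (continuousOn_const.mul
      (((continuousOn_cot.mul h.continuousOn_deriv).mul h.continuousOn_latCurv).div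
        h.continuousOn_ellipSq hnN)))).neg
  have hc2 : ContinuousOn (fun θ => pWeight p g θ * Real.sin θ * ((deriv g θ ^ 2 - 2 * g θ ^ 2)
      / gradSq g θ + 2 * (g θ * deriv g θ ^ 2 * latCurv g θ / (gradSq g θ * ellipSq p g θ))))
      (Ioo 0 Real.pi) :=
    hw.mul ((((h.continuousOn_deriv.pow 2).sub ((h.continuousOn.pow 2).const_mul _)).div
      h.continuousOn_gradSq hne).add (continuousOn_const.mul
      (((h.continuousOn.mul (h.continuousOn_deriv.pow 2)).mul h.continuousOn_latCurv).div
        (h.continuousOn_gradSq.mul h.continuousOn_ellipSq)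
        fun θ hθ => mul_ne_zero (hne θ hθ) (hnN θ hθ))))
  have hc3 : ContinuousOn (fun θ => pWeight p g θ * dirForm p g θ 1 0 * Real.sin θ)
      (Ioo 0 Real.pi) := by
    refine (h.continuousOn_pWeight.mul (continuousOn_const.add (continuousOn_const.mul
      (ContinuousOn.div ?_ h.continuousOn_gradSq hne)))).mul hsin
    simp only [mul_one, mul_zero, add_zero]
    exact h.continuousOn.pow 2
  have hc4 : ContinuousOn (fun θ => pWeight p g θ * Real.sin θ * ((5 - p) / 3)) (Ioo 0 Real.pi) :=
    hw.mul continuousOn_const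
  have hI1 := h.integral_half hd1 hc1
  have hI2 := h.integral_half hd2 hc2
  simp only [h.pWeight_zero, Real.cos_pi_div_two, h.deriv_half, h.zero, mul_zero, zero_mul,
    zero_div, sub_zero, zero_sub, one_mul] at hI1 hI2
  -- The bound is `-2 (A cos θ)'`, with integral `2 cos θ₀`, minus `(p-2)/3` times a derivative of
  -- zero integral, minus `(5-p)/3 A sin θ`. The combination is chosen so that the error is a
  -- nonnegative multiple of `3 cot θ - T`; the last term yields strictness when `p < 5`.
  have hle : ∫ θ in θ₀..Real.pi / 2, pWeight p g θ * dirForm p g θ 1 0 * Real.sin θ ≤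
      ∫ θ in θ₀..Real.pi / 2, (-(2 * -(pWeight p g θ * Real.sin θ * (1 + (p - 2) *
      (Real.cot θ * deriv g θ * latCurv g θ / ellipSq p g θ)))) - (p - 2) / 3 *
      (pWeight p g θ * Real.sin θ * ((deriv g θ ^ 2 - 2 * g θ ^ 2) / gradSq g θ
        + 2 * (g θ * deriv g θ ^ 2 * latCurv g θ / (gradSq g θ * ellipSq p g θ))))
      - pWeight p g θ * Real.sin θ * ((5 - p) / 3)) := by
    refine intervalIntegral.integral_mono_on h.angle_lt.le (h.intervalIntegrable_half hc3)
      (h.intervalIntegrable_half (((hc1.const_mul 2).neg.sub (hc2.const_mul _)).sub hc4))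
      fun θ hθ => ?_
    have hθ' := h.half_subset hθ
    have h1 := hne θ hθ'
    have h2 := hnN θ hθ'
    have e : -(2 * -(pWeight p g θ * Real.sin θ * (1 + (p - 2) *
      (Real.cot θ * deriv g θ * latCurv g θ / ellipSq p g θ)))) - (p - 2) / 3 *
      (pWeight p g θ * Real.sin θ * ((deriv g θ ^ 2 - 2 * g θ ^ 2) / gradSq g θ
        + 2 * (g θ * deriv g θ ^ 2 * latCurv g θ / (gradSq g θ * ellipSq p g θ))))
      - pWeight p g θ * Real.sin θ * ((5 - p) / 3)
      - pWeight p g θ * dirForm p g θ 1 0 * Real.sin θ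
      = pWeight p g θ * Real.sin θ * (2 * (p - 2) / 3 * (deriv g θ * latCurv g θ / ellipSq p g θ)
        * (3 * Real.cot θ - T θ)) := by
      have hdiv : g θ ^ 2 / gradSq g θ = 1 - deriv g θ ^ 2 / gradSq g θ := by
        rw [eq_sub_iff_add_eq, ← add_div]; exact div_self h1
      simp only [hT, dirForm, mul_one, mul_zero, add_zero]
      generalize latCurv g θ = m
      generalize Real.cot θ = k
      have e1 : (deriv g θ ^ 2 - 2 * g θ ^ 2) / gradSq g θ
          = 3 * (deriv g θ ^ 2 / gradSq g θ) - 2 := by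
        rw [sub_div, mul_div_assoc, hdiv]; ring
      rw [e1, hdiv]
      field_simp
      ring
    have hpos : 0 ≤ pWeight p g θ * Real.sin θ * (2 * (p - 2) / 3 *
        (deriv g θ * latCurv g θ / ellipSq p g θ) * (3 * Real.cot θ - T θ)) := by
      have a1 := (h.pWeight_pos hθ').le
      have a2 := (sin_pos_of_mem hθ').le
      have a3 := div_nonneg (mul_nonneg (h.deriv_nonneg hθ) (h.latCurv_nonneg hθ))
        (h.ellipSq_pos hθ').le
      have a4 := sub_nonneg.2 (hT3 θ hθ)
      have a5 : 0 ≤ 2 * (p - 2) / 3 := by linarith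
      exact mul_nonneg (mul_nonneg a1 a2) (mul_nonneg (mul_nonneg a5 a3) a4)
    linarith
  have hlin : ∀ F₁ F₂ F₃ : ℝ → ℝ, ContinuousOn F₁ (Ioo 0 Real.pi) →
      ContinuousOn F₂ (Ioo 0 Real.pi) → ContinuousOn F₃ (Ioo 0 Real.pi) →
      ∫ θ in θ₀..Real.pi / 2, (-(2 * F₁ θ) - (p - 2) / 3 * F₂ θ - F₃ θ) =
      -(2 * ∫ θ in θ₀..Real.pi / 2, F₁ θ) - (p - 2) / 3 * (∫ θ in θ₀..Real.pi / 2, F₂ θ)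
        - ∫ θ in θ₀..Real.pi / 2, F₃ θ := fun F₁ F₂ F₃ h₁ h₂ h₃ => by
    have i₁ : IntervalIntegrable (fun x => -(2 * F₁ x)) volume θ₀ (Real.pi / 2) :=
      ((h.intervalIntegrable_half h₁).const_mul 2).neg
    have i₂ := (h.intervalIntegrable_half h₂).const_mul ((p - 2) / 3)
    have i₃ := h.intervalIntegrable_half h₃
    have i₁₂ : IntervalIntegrable (fun x => -(2 * F₁ x) - (p - 2) / 3 * F₂ x) volume θ₀
      (Real.pi / 2) := i₁.sub i₂
    rw [← intervalIntegral.integral_const_mul, ← intervalIntegral.integral_const_mul,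
      ← intervalIntegral.integral_neg, ← intervalIntegral.integral_sub i₁ i₂,
      ← intervalIntegral.integral_sub i₁₂ i₃]
  rw [hlin _ _ _ hc1 hc2 hc4, hI1, hI2] at hle
  have hpos : 0 < ∫ θ in θ₀..Real.pi / 2, pWeight p g θ * Real.sin θ * ((5 - p) / 3) :=
    intervalIntegral.intervalIntegral_pos_of_pos_on (h.intervalIntegrable_half hc4)
      (fun θ hθ => by
        have hθ' := h.half_subset (Ioo_subset_Icc_self hθ)
        have := h.pWeight_pos hθ'
        have := sin_pos_of_mem hθ'
        have : 0 < (5 - p) / 3 := by linarith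
        positivity) h.angle_lt
  linarith

end ConeProfile
end

noncomputable section

/-! ### Spherical coordinates -/

/-- Spherical coordinates `ρ (cos φ sin θ, sin φ sin θ, cos θ)`. -/
def sph (ρ θ φ : ℝ) : E3 :=
  !₂[ρ * Real.sin θ * Real.cos φ, ρ * Real.sin θ * Real.sin φ, ρ * Real.cos θ]

theorem continuous_sph : Continuous fun q : ℝ × ℝ × ℝ => sph q.2.1 q.2.2 q.1 := by
  unfold sph
  refine (PiLp.continuous_toLp 2 _).comp (continuous_pi fun i => ?_)
  fin_cases i <;> simp <;> fun_prop

theorem sph_apply_two (ρ θ φ : ℝ) : sph ρ θ φ 2 = ρ * Real.cos θ := by simp [sph]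

theorem norm_sq_eq_sum (x : E3) : ‖x‖ ^ 2 = x 0 ^ 2 + x 1 ^ 2 + x 2 ^ 2 := by
  rw [EuclideanSpace.norm_sq_eq, Fin.sum_univ_three]
  simp

theorem norm_sph {ρ : ℝ} (hρ : 0 ≤ ρ) (θ φ : ℝ) : ‖sph ρ θ φ‖ = ρ := by
  have h : ‖sph ρ θ φ‖ ^ 2 = ρ ^ 2 := by
    rw [norm_sq_eq_sum]
    simp only [sph]
    have h1 := Real.sin_sq_add_cos_sq θ
    have h2 := Real.sin_sq_add_cos_sq φ
    simp
    linear_combination (ρ ^ 2) * h1 + ρ ^ 2 * Real.sin θ ^ 2 * h2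
  exact (pow_left_inj₀ (norm_nonneg _) hρ two_ne_zero).1 h

theorem inner_basisVec_two (x : E3) : ⟪x, basisVec 2⟫ = x 2 := by
  simp [basisVec, EuclideanSpace.inner_single_right]

theorem norm_basisVec (i : Fin 3) : ‖basisVec i‖ = 1 := by simp [basisVec]

theorem polarAngle_eq (x : E3) : polarAngle x = Real.arccos (x 2 / ‖x‖) := by
  rw [polarAngle, InnerProductGeometry.angle, inner_basisVec_two, norm_basisVec, mul_one]

theorem polarAngle_sph {ρ θ : ℝ} (hρ : 0 < ρ) (hθ : θ ∈ Icc 0 Real.pi) (φ : ℝ) :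
    polarAngle (sph ρ θ φ) = θ := by
  rw [polarAngle_eq, norm_sph hρ.le, sph_apply_two, mul_div_cancel_left₀ _ hρ.ne',
    Real.arccos_cos hθ.1 hθ.2]

/-- The parameter domain of spherical coordinates `(φ, (ρ, θ))`. -/
def sphDomain : Set (ℝ × ℝ × ℝ) := Ioo (-Real.pi) Real.pi ×ˢ (Ioi 0 ×ˢ Ioo 0 Real.pi)

theorem measurableSet_sphDomain : MeasurableSet sphDomain :=
  measurableSet_Ioo.prod (measurableSet_Ioi.prod measurableSet_Ioo)

/-- Plane polar coordinates twice: first in `(x₁, x₂)` at fixed `x₃`, producing `(r, φ)`, then in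
the half plane `(x₃, r) = (ρ cos θ, ρ sin θ)`. The two Jacobians multiply to `ρ² sin θ`. -/
theorem lintegral_sph {F : E3 → ENNReal} (hF : Measurable F) :
    ∫⁻ x, F x = ∫⁻ q in sphDomain, ENNReal.ofReal (q.2.1 ^ 2 * Real.sin q.2.2) *
      F (sph q.2.1 q.2.2 q.1) := by
  -- Cartesian coordinates
  have hvec : Measurable fun q : ℝ × ℝ × ℝ => (!₂[q.2.1, q.2.2, q.1] : E3) := by
    refine ((PiLp.continuous_toLp 2 _).comp (continuous_pi fun i => ?_)).measurable
    fin_cases i <;> simp <;> fun_prop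
  have hcart : ∫⁻ x, F x = ∫⁻ q : ℝ × ℝ × ℝ, F !₂[q.2.1, q.2.2, q.1] := by
    -- The third coordinate is split off, leaving the pair that is put in polar form.
    have e1 := (EuclideanSpace.volume_preserving_symm_measurableEquiv_toLp (Fin 3)).symm
    have e2 := (volume_preserving_piFinSuccAbove (fun _ : Fin 3 => ℝ) 2).symm
    have e3 := ((MeasurePreserving.id (volume : Measure ℝ)).prod
      (volume_preserving_finTwoArrow ℝ)).symm
        (e := (MeasurableEquiv.refl ℝ).prodCongr MeasurableEquiv.finTwoArrow)
    have e := e1.comp (e2.comp e3)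
    rw [← e.lintegral_comp hF]
    refine lintegral_congr fun q => ?_
    congr 1
    ext i
    fin_cases i <;> simp [MeasurableEquiv.toLp, Fin.insertNthEquiv] <;> rfl
  set G : ℝ × ℝ × ℝ → ENNReal := fun q => F !₂[q.2.1, q.2.2, q.1] with hG
  have hGm : Measurable G := hF.comp hvec
  have hpi := Real.pi_pos
  rw [hcart]
  have s1 : ∫⁻ q, G q = ∫⁻ z : ℝ, ∫⁻ φ in Ioo (-Real.pi) Real.pi, ∫⁻ r : ℝ,
      ENNReal.ofReal r * G (z, r * Real.cos φ, r * Real.sin φ) := by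
    rw [Measure.volume_eq_prod, lintegral_prod _ hGm.aemeasurable]
    refine lintegral_congr fun z => ?_
    rw [← lintegral_comp_polarCoord_symm]
    have : polarCoord.target = Ioi (0 : ℝ) ×ˢ Ioo (-Real.pi) Real.pi := rfl
    rw [this, Measure.volume_eq_prod, ← Measure.prod_restrict, lintegral_prod_symm]
    · refine lintegral_congr fun φ => ?_
      rw [← lintegral_indicator measurableSet_Ioi]
      refine lintegral_congr fun r => ?_
      by_cases hr : r ∈ Ioi (0 : ℝ)
      · rw [indicator_of_mem hr]; rfl
      · rw [indicator_of_notMem hr, ENNReal.ofReal_of_nonpos (not_lt.1 hr), zero_mul]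
    · refine Measurable.aemeasurable ?_
      refine (ENNReal.measurable_ofReal.comp measurable_fst).smul ?_
      exact (hGm.comp measurable_prodMk_left).comp continuous_polarCoord_symm.measurable
  have hm2 : Measurable fun w : ℝ × ℝ × ℝ => ENNReal.ofReal w.2.2 *
      G (w.2.1, w.2.2 * Real.cos w.1, w.2.2 * Real.sin w.1) := by
    refine (ENNReal.measurable_ofReal.comp (by fun_prop)).mul (hGm.comp ?_)
    fun_prop
  have s2 : ∫⁻ q, G q = ∫⁻ φ in Ioo (-Real.pi) Real.pi, ∫⁻ w : ℝ × ℝ,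
      ENNReal.ofReal w.2 * G (w.1, w.2 * Real.cos φ, w.2 * Real.sin φ) := by
    rw [s1, lintegral_lintegral_swap]
    · refine lintegral_congr fun φ => ?_
      rw [Measure.volume_eq_prod, lintegral_prod]
      exact (hm2.comp measurable_prodMk_left).aemeasurable
    · refine Measurable.aemeasurable ?_
      have : Measurable fun v : (ℝ × ℝ) × ℝ => ENNReal.ofReal v.2 *
          G (v.1.1, v.2 * Real.cos v.1.2, v.2 * Real.sin v.1.2) :=
        hm2.comp (g := fun w : ℝ × ℝ × ℝ => ENNReal.ofReal w.2.2 *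
          G (w.2.1, w.2.2 * Real.cos w.1, w.2.2 * Real.sin w.1))
          (f := fun v : (ℝ × ℝ) × ℝ => (v.1.2, v.1.1, v.2)) (by fun_prop)
      exact this.lintegral_prod_right'
  have s3 : ∫⁻ q in sphDomain, ENNReal.ofReal (q.2.1 ^ 2 * Real.sin q.2.2) *
      F (sph q.2.1 q.2.2 q.1) = ∫⁻ φ in Ioo (-Real.pi) Real.pi, ∫⁻ w in Ioi (0 : ℝ) ×ˢ Ioo 0 Real.pi,
        ENNReal.ofReal (w.1 ^ 2 * Real.sin w.2) * F (sph w.1 w.2 φ) := by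
    refine setLIntegral_prod (μ := volume) (ν := volume) (fun q : ℝ × ℝ × ℝ =>
      ENNReal.ofReal (q.2.1 ^ 2 * Real.sin q.2.2) * F (sph q.2.1 q.2.2 q.1)) ?_
    refine Measurable.aemeasurable ?_
    refine (ENNReal.measurable_ofReal.comp ?_).mul (hF.comp continuous_sph.measurable)
    fun_prop
  rw [s2, s3]
  refine lintegral_congr fun φ => ?_
  rw [← lintegral_comp_polarCoord_symm]
  have : polarCoord.target = Ioi (0 : ℝ) ×ˢ Ioo (-Real.pi) Real.pi := rfl
  rw [this, ← lintegral_indicator (measurableSet_Ioi.prod measurableSet_Ioo),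
    ← lintegral_indicator (measurableSet_Ioi.prod measurableSet_Ioo)]
  refine lintegral_congr fun w => ?_
  by_cases hw : w ∈ Ioi (0 : ℝ) ×ˢ Ioo 0 Real.pi
  · have hw' : w ∈ Ioi (0 : ℝ) ×ˢ Ioo (-Real.pi) Real.pi :=
      ⟨hw.1, by linarith [hw.2.1], hw.2.2⟩
    rw [indicator_of_mem hw, indicator_of_mem hw', smul_eq_mul]
    simp only [polarCoord_symm_apply, hG]
    rw [← mul_assoc, ← ENNReal.ofReal_mul (le_of_lt hw.1)]
    have : w.1 ^ 2 * Real.sin w.2 = w.1 * (w.1 * Real.sin w.2) := by ring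
    rw [this]
    rfl
  · rw [indicator_of_notMem hw]
    by_cases hw' : w ∈ Ioi (0 : ℝ) ×ˢ Ioo (-Real.pi) Real.pi
    · rw [indicator_of_mem hw']
      -- The inner radius was extended to all of `ℝ`; for angles in `(-π, 0]` it is `ρ sin θ ≤ 0`,
      -- and truncation by `ENNReal.ofReal` kills the density.
      have h1 : w.2 ≤ 0 := by
        by_contra! h
        exact hw ⟨hw'.1, h, hw'.2.2⟩
      have h2 : Real.sin w.2 ≤ 0 := Real.sin_nonpos_of_nonpos_of_neg_pi_le h1 hw'.2.1.le
      simp only [polarCoord_symm_apply]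
      rw [ENNReal.ofReal_of_nonpos (p := w.1 * Real.sin w.2)
        (mul_nonpos_of_nonneg_of_nonpos (le_of_lt hw'.1) h2)]
      simp
    · rw [indicator_of_notMem hw']

/-- The volume density `ρ² sin θ dφ dρ dθ` of spherical coordinates. -/
def sphMeasure : Measure (ℝ × ℝ × ℝ) :=
  (volume.restrict sphDomain).withDensity fun q => ENNReal.ofReal (q.2.1 ^ 2 * Real.sin q.2.2)

theorem measurable_sphDensity :
    Measurable fun q : ℝ × ℝ × ℝ => ENNReal.ofReal (q.2.1 ^ 2 * Real.sin q.2.2) :=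
  ENNReal.measurable_ofReal.comp (by fun_prop)

theorem map_sphMeasure : sphMeasure.map (fun q => sph q.2.1 q.2.2 q.1) = volume := by
  refine Measure.ext_of_lintegral _ fun F hF => ?_
  rw [lintegral_map hF continuous_sph.measurable, lintegral_sph hF, sphMeasure,
    lintegral_withDensity_eq_lintegral_mul _ measurable_sphDensity
      (g := fun q => F (sph q.2.1 q.2.2 q.1)) (hF.comp continuous_sph.measurable)]
  rfl

theorem sphDensity_nonneg {q : ℝ × ℝ × ℝ} (hq : q ∈ sphDomain) :
    0 ≤ q.2.1 ^ 2 * Real.sin q.2.2 :=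
  mul_nonneg (sq_nonneg _) (sin_pos_of_mem hq.2.2).le

theorem integral_sph {F : E3 → ℝ} (hF : AEStronglyMeasurable F) :
    ∫ x, F x = ∫ q in sphDomain, q.2.1 ^ 2 * Real.sin q.2.2 * F (sph q.2.1 q.2.2 q.1) := by
  rw [← map_sphMeasure] at hF ⊢
  rw [integral_map continuous_sph.aemeasurable hF, sphMeasure,
    integral_withDensity_eq_integral_toReal_smul measurable_sphDensity
      (by simp)]
  refine setIntegral_congr_fun measurableSet_sphDomain fun q hq => ?_
  simp only [ENNReal.toReal_ofReal (sphDensity_nonneg hq), smul_eq_mul]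

theorem integrable_sph_iff {F : E3 → ℝ} (hF : AEStronglyMeasurable F) :
    Integrable F ↔ IntegrableOn (fun q => q.2.1 ^ 2 * Real.sin q.2.2 *
      F (sph q.2.1 q.2.2 q.1)) sphDomain := by
  rw [← map_sphMeasure] at hF ⊢
  rw [integrable_map_measure hF continuous_sph.aemeasurable, sphMeasure,
    integrable_withDensity_iff_integrable_smul' measurable_sphDensity (by simp)]
  refine integrableOn_congr_fun (fun q hq => ?_) measurableSet_sphDomain
  simp only [ENNReal.toReal_ofReal (sphDensity_nonneg hq), smul_eq_mul, Function.comp_apply]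

end

noncomputable section

/-! ### The area of a cone -/

/-- The inequality forces `f` to factor through `k` on `s` by a `K`-Lipschitz map. No injectivity of
`k` and no measurability of `s` is needed. -/
theorem euclideanHausdorffMeasure_image_le {α X Y : Type*} [MetricSpace X] [MeasurableSpace X]
    [BorelSpace X] [MetricSpace Y] [MeasurableSpace Y] [BorelSpace Y] {f : α → X} {k : α → Y}
    {s : Set α} {K : NNReal} (h : ∀ a ∈ s, ∀ b ∈ s, dist (f a) (f b) ≤ K * dist (k a) (k b)) :
    μHE[2] (f '' s) ≤ (K : ENNReal) ^ 2 * μHE[2] (k '' s) := by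
  rcases s.eq_empty_or_nonempty with rfl | ⟨a₀, ha₀⟩
  · simp
  have : Nonempty α := ⟨a₀⟩
  set F : Y → X := fun y => f (Function.invFunOn k s y) with hF
  have hinv : ∀ a ∈ s, Function.invFunOn k s (k a) ∈ s ∧ k (Function.invFunOn k s (k a)) = k a :=
    fun a ha => ⟨Function.invFunOn_mem ⟨a, ha, rfl⟩, Function.invFunOn_eq ⟨a, ha, rfl⟩⟩
  have hFk : ∀ a ∈ s, F (k a) = f a := fun a ha => by
    have := h _ (hinv a ha).1 a ha
    rw [(hinv a ha).2, dist_self, mul_zero] at this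
    exact dist_le_zero.1 this
  have himg : F '' (k '' s) = f '' s := by
    rw [image_image]
    exact image_congr hFk
  have hlip : LipschitzOnWith K F (k '' s) := by
    refine LipschitzOnWith.of_dist_le_mul ?_
    rintro _ ⟨a, ha, rfl⟩ _ ⟨b, hb, rfl⟩
    rw [hFk a ha, hFk b hb]
    exact h a ha b hb
  have := hlip.hausdorffMeasure_image_le (d := 2) zero_le_two
  rw [himg] at this
  simp only [Measure.euclideanHausdorffMeasure_def, Measure.smul_apply, Nat.cast_ofNat]
  rw [ENNReal.smul_def, ENNReal.smul_def, smul_eq_mul, smul_eq_mul, ← mul_assoc, mul_comm (_ ^ 2),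
    mul_assoc]
  gcongr
  exact_mod_cast this

/-- The parametrization `(φ, ρ) ↦ sph ρ θ φ` of a cone. -/
def coneMap (θ : ℝ) (q : ℝ × ℝ) : E3 := sph q.2 θ q.1

/-- The development of the cone in the plane. -/
def coneDevelop (s : ℝ) (q : ℝ × ℝ) : ℂ :=
  Complex.polarCoord.symm (q.2, s * q.1)

/-- The parameter domain `(φ, ρ) ∈ (-π, π] × (0, ∞)` of a cone. -/
def coneDomain : Set (ℝ × ℝ) := Ioc (-Real.pi) Real.pi ×ˢ Ioi 0

theorem measurableSet_coneDomain : MeasurableSet coneDomain := measurableSet_Ioc.prod measurableSet_Ioi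

theorem continuous_coneMap (θ : ℝ) : Continuous (coneMap θ) :=
  continuous_sph.comp (f := fun q : ℝ × ℝ => (q.1, q.2, θ)) (by fun_prop)

/-- Written as a chord formula, so that it differs from the planar sector in `dist_coneDevelop_sq`
only by replacing `sin (s x)` with `s sin x`, where `s = sin θ`. -/
theorem dist_coneMap_sq (θ : ℝ) (a b : ℝ × ℝ) :
    dist (coneMap θ a) (coneMap θ b) ^ 2 =
      (a.2 - b.2) ^ 2 + 4 * a.2 * b.2 * (Real.sin θ * Real.sin ((a.1 - b.1) / 2)) ^ 2 := by
  rw [dist_eq_norm, norm_sq_eq_sum]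
  simp only [coneMap, sph, PiLp.sub_apply]
  simp
  have h1 := Real.sin_sq_add_cos_sq θ
  have h2 := Real.sin_sq_add_cos_sq a.1
  have h3 := Real.sin_sq_add_cos_sq b.1
  have h4 : Real.sin ((a.1 - b.1) / 2) ^ 2 = (1 - Real.cos (a.1 - b.1)) / 2 := by
    rw [Real.sin_sq_eq_half_sub]
    ring_nf
  rw [mul_pow, h4, Real.cos_sub]
  linear_combination (a.2 - b.2) ^ 2 * h1 + a.2 ^ 2 * Real.sin θ ^ 2 * h2
    + b.2 ^ 2 * Real.sin θ ^ 2 * h3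

theorem dist_coneDevelop_sq (s : ℝ) (a b : ℝ × ℝ) :
    dist (coneDevelop s a) (coneDevelop s b) ^ 2 =
      (a.2 - b.2) ^ 2 + 4 * a.2 * b.2 * Real.sin (s * ((a.1 - b.1) / 2)) ^ 2 := by
  rw [dist_eq_norm, Complex.sq_norm, Complex.normSq_apply]
  simp only [coneDevelop, Complex.polarCoord_symm_apply]
  simp
  have h2 := Real.sin_sq_add_cos_sq (s * a.1)
  have h3 := Real.sin_sq_add_cos_sq (s * b.1)
  have h4 : Real.sin (s * ((a.1 - b.1) / 2)) ^ 2 = (1 - Real.cos (s * a.1 - s * b.1)) / 2 := by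
    rw [Real.sin_sq_eq_half_sub]
    ring_nf
  rw [h4, Real.cos_sub, ← Complex.ofReal_mul, ← Complex.ofReal_mul, Complex.cos_ofReal_re,
    Complex.cos_ofReal_re, Complex.sin_ofReal_re, Complex.sin_ofReal_re, Complex.cos_ofReal_im,
    Complex.cos_ofReal_im, Complex.sin_ofReal_im, Complex.sin_ofReal_im]
  linear_combination a.2 ^ 2 * h2 + b.2 ^ 2 * h3

/-- Concavity of the sine on `[0, π]`: chords on the cone are no longer than chords in its planar
development. -/
theorem abs_mul_sin_le {s x : ℝ} (hs : s ∈ Icc (0 : ℝ) 1) (hx : |x| ≤ Real.pi) :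
    |s * Real.sin x| ≤ |Real.sin (s * x)| := by
  have key : ∀ y ∈ Icc 0 Real.pi, s * Real.sin y ≤ Real.sin (s * y) := fun y hy => by
    have := strictConcaveOn_sin_Icc.concaveOn.2 hy ⟨le_rfl, Real.pi_pos.le⟩ hs.1
      (sub_nonneg.2 hs.2) (by ring)
    simpa using this
  have habs : ∀ y, 0 ≤ y → y ≤ Real.pi → |s * Real.sin y| ≤ |Real.sin (s * y)| := fun y h0 h1 => by
    rw [abs_of_nonneg (mul_nonneg hs.1 (Real.sin_nonneg_of_nonneg_of_le_pi h0 h1))]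
    exact (key y ⟨h0, h1⟩).trans (le_abs_self _)
  rcases le_total 0 x with h | h
  · exact habs x h ((le_abs_self x).trans hx)
  · have := habs (-x) (by linarith) ((neg_le_abs x).trans hx)
    rwa [Real.sin_neg, mul_neg, mul_neg, Real.sin_neg, abs_neg, abs_neg] at this

theorem exists_le_mul_sin {K : ℝ} (hK : 1 < K) :
    ∃ δ > 0, δ ≤ 1 ∧ ∀ x : ℝ, |x| ≤ δ → |x| ≤ K * |Real.sin x| := by
  -- Chosen so that the cubic bound `sin y ≥ y - y³/4` suffices for `|y| ≤ δ`.
  obtain ⟨δ, hδ0, hδ1, hδ⟩ : ∃ δ > 0, δ ≤ 1 ∧ 1 ≤ K * (1 - δ ^ 2 / 4) := by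
    refine ⟨min 1 (K - 1), lt_min one_pos (by linarith), min_le_left _ _, ?_⟩
    have h1 : min 1 (K - 1) ≤ 1 := min_le_left _ _
    have h2 : min 1 (K - 1) ≤ K - 1 := min_le_right _ _
    have h3 : 0 < min 1 (K - 1) := lt_min one_pos (by linarith)
    set m := min 1 (K - 1)
    have h4 : m ^ 2 ≤ m := by nlinarith
    have h5 : (K - 1) * m ^ 2 ≤ (K - 1) * 1 :=
      mul_le_mul_of_nonneg_left (h4.trans h1) (by linarith)
    nlinarith
  refine ⟨δ, hδ0, hδ1, ?_⟩
  have key : ∀ y, 0 < y → y ≤ δ → y ≤ K * Real.sin y := fun y h0 h1 => by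
    have h2 : y - y ^ 3 / 4 ≤ Real.sin y := by
      linarith [(Real.sin_gt_sub_cube h0).le, pow_pos h0 3]
    have h3 : y ^ 2 ≤ δ ^ 2 := by gcongr
    calc y ≤ K * (1 - δ ^ 2 / 4) * y := le_mul_of_one_le_left h0.le hδ
      _ ≤ K * (y - y ^ 3 / 4) := by nlinarith [mul_pos (by linarith : 0 < K) h0]
      _ ≤ K * Real.sin y := mul_le_mul_of_nonneg_left h2 (by linarith)
  intro x hx
  rcases lt_trichotomy x 0 with h | h | h
  · have := key (-x) (by linarith) ((neg_le_abs x).trans hx)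
    rw [abs_of_neg h]
    refine this.trans ?_
    rw [Real.sin_neg]
    exact mul_le_mul_of_nonneg_left (neg_le_abs _) (by linarith)
  · simp [h]
  · rw [abs_of_pos h]
    exact (key x h ((le_abs_self x).trans hx)).trans
      (mul_le_mul_of_nonneg_left (le_abs_self _) (by linarith))

theorem dist_coneMap_le {θ : ℝ} (hs : Real.sin θ ∈ Icc (0 : ℝ) 1) {a b : ℝ × ℝ} (ha : 0 < a.2)
    (hb : 0 < b.2) (hab : |(a.1 - b.1) / 2| ≤ Real.pi) :
    dist (coneMap θ a) (coneMap θ b) ≤ dist (coneDevelop (Real.sin θ) a)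
      (coneDevelop (Real.sin θ) b) := by
  refine le_of_sq_le_sq ?_ dist_nonneg
  rw [dist_coneMap_sq, dist_coneDevelop_sq]
  have h1 := sq_le_sq.2 (abs_mul_sin_le hs hab)
  gcongr

theorem dist_coneDevelop_le {θ K : ℝ} (hs : Real.sin θ ∈ Icc (0 : ℝ) 1) (hK : 1 ≤ K) {a b : ℝ × ℝ}
    (ha : 0 < a.2) (hb : 0 < b.2)
    (hab : |(a.1 - b.1) / 2| ≤ K * |Real.sin ((a.1 - b.1) / 2)|) :
    dist (coneDevelop (Real.sin θ) a) (coneDevelop (Real.sin θ) b) ≤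
      K * dist (coneMap θ a) (coneMap θ b) := by
  refine le_of_sq_le_sq ?_ (mul_nonneg (by linarith) dist_nonneg)
  rw [mul_pow, dist_coneMap_sq, dist_coneDevelop_sq]
  have h1 : |Real.sin (Real.sin θ * ((a.1 - b.1) / 2))| ≤
      |K * (Real.sin θ * Real.sin ((a.1 - b.1) / 2))| := by
    refine Real.abs_sin_le_abs.trans ?_
    rw [abs_mul, abs_mul, abs_mul, abs_of_nonneg hs.1, abs_of_nonneg (by linarith : 0 ≤ K)]
    calc _ ≤ Real.sin θ * (K * |Real.sin ((a.1 - b.1) / 2)|) := mul_le_mul_of_nonneg_left hab hs.1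
      _ = _ := by ring
  have h2 := sq_le_sq.2 h1
  rw [mul_pow] at h2
  have h3 : (a.2 - b.2) ^ 2 ≤ K ^ 2 * (a.2 - b.2) ^ 2 :=
    le_mul_of_one_le_left (sq_nonneg _) (one_le_pow₀ hK)
  have h4 : 0 < 4 * a.2 * b.2 := by positivity
  nlinarith [mul_le_mul_of_nonneg_left h2 h4.le]

theorem injOn_coneMap {θ : ℝ} (hs : 0 < Real.sin θ) : InjOn (coneMap θ) coneDomain := by
  intro a ha b hb hab
  have h := dist_coneMap_sq θ a b
  rw [hab, dist_self] at h
  have ha2 : 0 < a.2 := ha.2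
  have hb2 : 0 < b.2 := hb.2
  have h1 : (a.2 - b.2) ^ 2 = 0 := by
    nlinarith [sq_nonneg (a.2 - b.2), mul_nonneg (mul_nonneg (by linarith : 0 ≤ 4 * a.2) hb2.le)
      (sq_nonneg (Real.sin θ * Real.sin ((a.1 - b.1) / 2)))]
  have h2 : Real.sin ((a.1 - b.1) / 2) = 0 := by
    rw [h1] at h
    have h3 : 4 * a.2 * b.2 * (Real.sin θ * Real.sin ((a.1 - b.1) / 2)) ^ 2 = 0 := by linarith
    simpa [ha2.ne', hb2.ne', hs.ne'] using h3
  have h3 : (a.1 - b.1) / 2 = 0 :=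
    (Real.sin_eq_zero_iff_of_lt_of_lt (by linarith [ha.1.1, hb.1.2]) (by linarith [ha.1.2, hb.1.1])).1 h2
  exact Prod.ext (by linarith) (by linarith [pow_eq_zero_iff two_ne_zero |>.1 h1])

/-- The area density `sin θ ρ dφ dρ` on the cone of opening angle `θ`. -/
def coneMeasure (s : ℝ) : Measure (ℝ × ℝ) :=
  (volume.restrict coneDomain).withDensity fun q => ENNReal.ofReal (s * q.2)

/-- Because `s < 1`, the angles `s φ` stay inside `(-π, π)`, where planar polar coordinates are
injective. Rescaling the angle contributes the factor `s`. -/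
theorem volume_image_coneDevelop {s : ℝ} (hs0 : 0 < s) (hs1 : s < 1) {A : Set (ℝ × ℝ)}
    (hA : MeasurableSet A) (hAD : A ⊆ coneDomain) :
    volume (coneDevelop s '' A) = coneMeasure s A := by
  have hpi := Real.pi_pos
  have hdev : Measurable (coneDevelop s) := by
    have : coneDevelop s = fun q => (q.2 : ℂ) * (Real.cos (s * q.1) + Real.sin (s * q.1) * Complex.I) := by
      funext q; simp [coneDevelop]
    rw [this]
    fun_prop
  have htarget : ∀ q ∈ coneDomain, (q.2, s * q.1) ∈ Complex.polarCoord.target := fun q hq => by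
    rw [Complex.polarCoord_target]
    refine ⟨hq.2, ?_, ?_⟩
    · have := hq.1.1
      have : s * q.1 > s * -Real.pi := by gcongr
      show -Real.pi < s * q.1
      nlinarith
    · have := hq.1.2
      have : s * q.1 ≤ s * Real.pi := by gcongr
      show s * q.1 < Real.pi
      nlinarith
  have hmem : ∀ w ∈ Complex.polarCoord.target,
      (Complex.polarCoord.symm w ∈ coneDevelop s '' A ↔ (w.2 / s, w.1) ∈ A) := fun w hw => by
    constructor
    · rintro ⟨q, hq, hqw⟩
      have := Complex.polarCoord.symm.injOn (htarget q (hAD hq)) hw hqw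
      rw [← this]
      simpa [mul_div_cancel_left₀ _ hs0.ne'] using hq
    · intro h
      exact ⟨_, h, by simp only [coneDevelop]; rw [mul_div_cancel₀ _ hs0.ne']⟩
  have hinj : InjOn (coneDevelop s) A := fun a ha b hb hab => by
    have := Complex.polarCoord.symm.injOn (htarget a (hAD ha)) (htarget b (hAD hb)) hab
    have h1 := congrArg Prod.fst this
    have h2 := congrArg Prod.snd this
    exact Prod.ext (mul_left_cancel₀ hs0.ne' h2) h1
  have himg : MeasurableSet (coneDevelop s '' A) := hA.image_of_measurable_injOn hdev hinj
  rw [← lintegral_indicator_one himg, ← Complex.lintegral_comp_polarCoord_symm]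
  have hpre : Measurable fun w : ℝ × ℝ => (w.2 / s, w.1) := by fun_prop
  have e1 : ∫⁻ w in polarCoord.target, ENNReal.ofReal w.1 •
      (coneDevelop s '' A).indicator 1 (Complex.polarCoord.symm w) =
      ∫⁻ w : ℝ × ℝ, ENNReal.ofReal w.1 * A.indicator 1 (w.2 / s, w.1) := by
    rw [← lintegral_indicator polarCoord.open_target.measurableSet]
    refine lintegral_congr fun w => ?_
    by_cases hw : w ∈ polarCoord.target
    · rw [indicator_of_mem hw, smul_eq_mul]
      congr 1
      by_cases hwA : (w.2 / s, w.1) ∈ A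
      · rw [indicator_of_mem hwA, indicator_of_mem ((hmem w hw).2 hwA)]; rfl
      · rw [indicator_of_notMem hwA, indicator_of_notMem fun h => hwA ((hmem w hw).1 h)]
    · rw [indicator_of_notMem hw]
      have hwA : (w.2 / s, w.1) ∉ A := fun h => by
        have := htarget _ (hAD h)
        simp only [mul_div_cancel₀ _ hs0.ne'] at this
        exact hw this
      rw [indicator_of_notMem hwA, mul_zero]
  rw [e1, coneMeasure, withDensity_apply _ hA, Measure.restrict_restrict hA,
    inter_eq_left.2 hAD, ← lintegral_indicator hA, Measure.volume_eq_prod, lintegral_prod,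
    lintegral_prod_symm]
  · refine lintegral_congr fun r => ?_
    have hmeas : Measurable fun t : ℝ => A.indicator (fun q => ENNReal.ofReal (s * q.2)) (t, r) :=
      (Measurable.indicator (ENNReal.measurable_ofReal.comp (by fun_prop)) hA).comp
        measurable_prodMk_right
    have hmeas1 : Measurable fun t : ℝ => ENNReal.ofReal r * A.indicator 1 (t, r) :=
      measurable_const.mul ((measurable_one.indicator hA).comp measurable_prodMk_right)
    have hsc : Measure.map (fun v : ℝ => s⁻¹ * v) volume = ENNReal.ofReal s • volume := by
      rw [Real.map_volume_mul_left (inv_ne_zero hs0.ne'), inv_inv, abs_of_pos hs0]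
    have e2 : ∫⁻ v : ℝ, ENNReal.ofReal r * A.indicator 1 (v / s, r) =
        ENNReal.ofReal s * ∫⁻ t : ℝ, ENNReal.ofReal r * A.indicator 1 (t, r) := by
      rw [← smul_eq_mul (ENNReal.ofReal s), ← lintegral_smul_measure, ← hsc,
        lintegral_map hmeas1 (by fun_prop)]
      refine lintegral_congr fun v => ?_
      rw [div_eq_inv_mul]
    rw [e2, ← lintegral_const_mul _ hmeas1]
    refine lintegral_congr fun t => ?_
    by_cases ht : (t, r) ∈ A
    · rw [indicator_of_mem ht, indicator_of_mem ht, ENNReal.ofReal_mul hs0.le]; simp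
    · rw [indicator_of_notMem ht, indicator_of_notMem ht]; simp
  · exact (Measurable.indicator (ENNReal.measurable_ofReal.comp (by fun_prop)) hA).aemeasurable
  · refine Measurable.aemeasurable ?_
    exact (ENNReal.measurable_ofReal.comp measurable_fst).mul ((measurable_one.indicator hA).comp hpre)

theorem euclideanHausdorffMeasure_coneDevelop (s : ℝ) (A : Set (ℝ × ℝ)) :
    μHE[2] (coneDevelop s '' A) = volume (coneDevelop s '' A) := by
  rw [← InnerProductSpace.euclideanHausdorffMeasure_eq_volume (V := ℂ), Complex.finrank_real_complex]

/-- A cone is developable. Unrolling it into the plane never shortens distances, and on sufficiently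
thin sectors stretches them by at most `K`. Summing over countably many sectors and letting `K` tend
to 1 shows that the surface area is the area of the development. -/
theorem euclideanHausdorffMeasure_image_coneMap {θ : ℝ} (hs0 : 0 < Real.sin θ)
    (hs1 : Real.sin θ < 1) {A : Set (ℝ × ℝ)} (hA : MeasurableSet A) (hAD : A ⊆ coneDomain) :
    μHE[2] (coneMap θ '' A) = coneMeasure (Real.sin θ) A := by
  have hpi := Real.pi_pos
  have hs : Real.sin θ ∈ Icc (0 : ℝ) 1 := ⟨hs0.le, hs1.le⟩
  have hm : ∀ B ⊆ coneDomain, MeasurableSet B → MeasurableSet (coneMap θ '' B) := fun B hB hBm =>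
    hBm.image_of_measurable_injOn (continuous_coneMap θ).measurable ((injOn_coneMap hs0).mono hB)
  have key : ∀ K : NNReal, 1 < K → μHE[2] (coneMap θ '' A) ≤ coneMeasure (Real.sin θ) A ∧
      coneMeasure (Real.sin θ) A ≤ (K : ENNReal) ^ 2 * μHE[2] (coneMap θ '' A) := by
    intro K hK
    have hK' : (1 : ℝ) < K := by exact_mod_cast hK
    obtain ⟨δ, hδ0, hδ1, hδ⟩ := exists_le_mul_sin hK'
    -- thin sectors
    set B : ℤ → Set (ℝ × ℝ) := fun j => A ∩ (fun q : ℝ × ℝ => ⌊q.1 / δ⌋) ⁻¹' {j} with hB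
    have hBm : ∀ j, MeasurableSet (B j) := fun j =>
      hA.inter ((Int.measurable_floor.comp (by fun_prop)) (measurableSet_singleton j))
    have hBA : ∀ j, B j ⊆ coneDomain := fun j => inter_subset_left.trans hAD
    have hBd : Pairwise (Function.onFun Disjoint B) := fun i j hij => by
      refine disjoint_left.2 fun q hqi hqj => hij ?_
      have h1 : ⌊q.1 / δ⌋ = i := hqi.2
      have h2 : ⌊q.1 / δ⌋ = j := hqj.2
      exact h1.symm.trans h2
    have hU : A = ⋃ j, B j := by
      ext q
      simp [hB]
    have hsmall : ∀ j, ∀ a ∈ B j, ∀ b ∈ B j, |(a.1 - b.1) / 2| ≤ δ := fun j a ha b hb => by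
      have h1 : ⌊a.1 / δ⌋ = ⌊b.1 / δ⌋ := (show ⌊a.1 / δ⌋ = j from ha.2).trans
        (show ⌊b.1 / δ⌋ = j from hb.2).symm
      have h2 := (Int.abs_sub_lt_one_of_floor_eq_floor h1).le
      rw [← sub_div, abs_div, abs_of_pos hδ0, div_le_one hδ0] at h2
      rw [abs_div, abs_of_pos (two_pos : (0:ℝ) < 2)]
      linarith [abs_nonneg (a.1 - b.1)]
    have hle : ∀ j, μHE[2] (coneMap θ '' B j) ≤ coneMeasure (Real.sin θ) (B j) ∧
        coneMeasure (Real.sin θ) (B j) ≤ (K : ENNReal) ^ 2 * μHE[2] (coneMap θ '' B j) := by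
      intro j
      rw [← volume_image_coneDevelop hs0 hs1 (hBm j) (hBA j),
        ← euclideanHausdorffMeasure_coneDevelop]
      constructor
      · have := euclideanHausdorffMeasure_image_le (f := coneMap θ)
          (k := coneDevelop (Real.sin θ)) (s := B j) (K := 1) fun a ha b hb => by
            rw [NNReal.coe_one, one_mul]
            exact dist_coneMap_le hs (hBA j ha).2 (hBA j hb).2
              ((hsmall j a ha b hb).trans (by linarith [Real.pi_gt_three]))
        simpa using this
      · exact euclideanHausdorffMeasure_image_le fun a ha b hb =>
          dist_coneDevelop_le hs hK'.le (hBA j ha).2 (hBA j hb).2 (hδ _ (hsmall j a ha b hb))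
    have e1 : coneMeasure (Real.sin θ) A = ∑' j, coneMeasure (Real.sin θ) (B j) := by
      conv_lhs => rw [hU]
      exact measure_iUnion hBd hBm
    have e2 : μHE[2] (coneMap θ '' A) = ∑' j, μHE[2] (coneMap θ '' B j) := by
      conv_lhs => rw [hU, image_iUnion]
      refine measure_iUnion (fun i j hij => ?_) fun j => hm _ (hBA j) (hBm j)
      exact disjoint_image_image fun a ha b hb hab => disjoint_left.1 (hBd hij) ha
        (injOn_coneMap hs0 (hBA i ha) (hBA j hb) hab ▸ hb)
    rw [e1, e2, ← ENNReal.tsum_mul_left]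
    exact ⟨ENNReal.tsum_le_tsum fun j => (hle j).1, ENNReal.tsum_le_tsum fun j => (hle j).2⟩
  refine le_antisymm (key 2 one_lt_two).1 ?_
  -- The left factor tends to 1; since that limit is nonzero, the product converges even if the
  -- measure is infinite.
  have hlim : Tendsto (fun K : NNReal => (K : ENNReal) ^ 2 * μHE[2] (coneMap θ '' A))
      (𝓝[>] 1) (𝓝 (1 * μHE[2] (coneMap θ '' A))) := by
    refine Tendsto.mono_left ?_ nhdsWithin_le_nhds
    refine ENNReal.Tendsto.mul_const ?_ (Or.inl one_ne_zero)
    have : Continuous fun K : NNReal => (K : ENNReal) ^ 2 :=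
      (ENNReal.continuous_pow 2).comp ENNReal.continuous_coe
    have := this.tendsto 1
    simpa using this
  rw [one_mul] at hlim
  refine ge_of_tendsto hlim ?_
  filter_upwards [self_mem_nhdsWithin] with K hK using (key K hK).2

/-- The punctured cone of opening angle `θ`. -/
def coneSurface (θ : ℝ) : Set E3 := {x | x ≠ 0 ∧ x 2 = ‖x‖ * Real.cos θ}

theorem image_coneMap {θ : ℝ} (hs : 0 < Real.sin θ) : coneMap θ '' coneDomain = coneSurface θ := by
  ext x
  constructor
  · rintro ⟨q, hq, rfl⟩
    have hq2 : 0 < q.2 := hq.2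
    have hn : ‖coneMap θ q‖ = q.2 := norm_sph hq2.le θ q.1
    refine ⟨fun h => ?_, ?_⟩
    · rw [h, norm_zero] at hn
      exact hq2.ne hn
    · rw [hn]; exact sph_apply_two _ _ _
  · rintro ⟨hx0, hx⟩
    have hn := norm_pos_iff.2 hx0
    set z : ℂ := ⟨x 0, x 1⟩ with hz
    have hzn : ‖z‖ = ‖x‖ * Real.sin θ := by
      refine (pow_left_inj₀ (norm_nonneg _) (mul_nonneg hn.le hs.le) two_ne_zero).1 ?_
      have h1 := norm_sq_eq_sum x
      have h2 := Real.sin_sq_add_cos_sq θ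
      rw [Complex.sq_norm, Complex.normSq_apply, hz]
      rw [hx] at h1
      simp only
      linear_combination -h1 - ‖x‖ ^ 2 * h2
    refine ⟨(Complex.arg z, ‖x‖), ⟨⟨Complex.neg_pi_lt_arg z, Complex.arg_le_pi z⟩, hn⟩, ?_⟩
    have h0 := Complex.norm_mul_cos_arg z
    have h1 := Complex.norm_mul_sin_arg z
    rw [hzn] at h0 h1
    ext i
    fin_cases i
    · simpa [coneMap, sph] using h0
    · simpa [coneMap, sph] using h1
    · simpa [coneMap, sph] using hx.symm

theorem map_coneMeasure {θ : ℝ} (hs0 : 0 < Real.sin θ) (hs1 : Real.sin θ < 1) :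
    (coneMeasure (Real.sin θ)).map (coneMap θ) = μHE[2].restrict (coneSurface θ) := by
  ext B hB
  have hc := (continuous_coneMap θ).measurable
  have hpre := hc hB
  rw [Measure.map_apply hc hB, Measure.restrict_apply hB]
  have h1 : coneMeasure (Real.sin θ) (coneMap θ ⁻¹' B) =
      coneMeasure (Real.sin θ) (coneMap θ ⁻¹' B ∩ coneDomain) := by
    rw [coneMeasure, withDensity_apply _ hpre,
      withDensity_apply _ (hpre.inter measurableSet_coneDomain), Measure.restrict_restrict hpre,
      Measure.restrict_restrict (hpre.inter measurableSet_coneDomain), inter_assoc, inter_self]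
  rw [h1, ← euclideanHausdorffMeasure_image_coneMap hs0 hs1 (hpre.inter measurableSet_coneDomain)
    inter_subset_right, inter_comm, image_inter_preimage, image_coneMap hs0, inter_comm]

theorem integral_coneSurface {θ : ℝ} (hs0 : 0 < Real.sin θ) (hs1 : Real.sin θ < 1) {F : E3 → ℝ}
    (hF : AEStronglyMeasurable F (μHE[2].restrict (coneSurface θ))) :
    ∫ x in coneSurface θ, F x ∂(μHE[2]) =
      ∫ q in coneDomain, Real.sin θ * q.2 * F (sph q.2 θ q.1) := by
  rw [← map_coneMeasure hs0 hs1] at hF ⊢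
  have hm : Measurable fun q : ℝ × ℝ => ENNReal.ofReal (Real.sin θ * q.2) :=
    ENNReal.measurable_ofReal.comp (by fun_prop)
  rw [integral_map (continuous_coneMap θ).aemeasurable hF, coneMeasure,
    integral_withDensity_eq_integral_toReal_smul hm (by simp)]
  refine setIntegral_congr_fun measurableSet_coneDomain fun q hq => ?_
  simp only [ENNReal.toReal_ofReal (mul_nonneg hs0.le (le_of_lt hq.2)), smul_eq_mul]
  rfl

theorem integrableOn_coneSurface_iff {θ : ℝ} (hs0 : 0 < Real.sin θ) (hs1 : Real.sin θ < 1)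
    {F : E3 → ℝ} (hF : AEStronglyMeasurable F (μHE[2].restrict (coneSurface θ))) :
    IntegrableOn F (coneSurface θ) (μHE[2]) ↔
      IntegrableOn (fun q => Real.sin θ * q.2 * F (sph q.2 θ q.1)) coneDomain := by
  rw [IntegrableOn, ← map_coneMeasure hs0 hs1] at *
  have hm : Measurable fun q : ℝ × ℝ => ENNReal.ofReal (Real.sin θ * q.2) :=
    ENNReal.measurable_ofReal.comp (by fun_prop)
  rw [integrable_map_measure hF (continuous_coneMap θ).aemeasurable, coneMeasure,
    integrable_withDensity_iff_integrable_smul' hm (by simp)]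
  refine integrableOn_congr_fun (fun q hq => ?_) measurableSet_coneDomain
  simp only [ENNReal.toReal_ofReal (mul_nonneg hs0.le (le_of_lt hq.2)), smul_eq_mul,
    Function.comp_apply]
  rfl

theorem euclideanHausdorffMeasure_singleton (x : E3) : μHE[2] ({x} : Set E3) = 0 := by
  have : NullSingletonClass (μH[((2 : ℕ) : ℝ)] : Measure E3) :=
    Measure.nullSingletonClass_hausdorff E3 (by norm_num)
  rw [Measure.euclideanHausdorffMeasure_def, Measure.smul_apply, measure_singleton, smul_zero]

end

noncomputable section

/-! ### The spherical frame -/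

/-- The unit vector `x / |x|`. -/
def radialVec (x : E3) : E3 := ‖x‖⁻¹ • x

/-- The unit vector in the direction of increasing polar angle. -/
def angularVec (x : E3) : E3 :=
  (Real.sin (polarAngle x))⁻¹ • (Real.cos (polarAngle x) • radialVec x - basisVec 2)

/-- The vector with radial component `a` and polar component `b` at `x`. -/
def polarVec (x : E3) (a b : ℝ) : E3 := a • radialVec x + b • angularVec x

theorem abs_apply_two_le (x : E3) : |x 2| ≤ ‖x‖ := by
  simpa using PiLp.norm_apply_le x 2

theorem cos_polarAngle (x : E3) : Real.cos (polarAngle x) = x 2 / ‖x‖ := by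
  have h := abs_apply_two_le x
  have h1 : |x 2 / ‖x‖| ≤ 1 := by
    rw [abs_div, abs_norm]; exact div_le_one_of_le₀ h (norm_nonneg _)
  rw [polarAngle_eq, Real.cos_arccos (abs_le.1 h1).1 (abs_le.1 h1).2]

theorem apply_two_eq (x : E3) : x 2 = ‖x‖ * Real.cos (polarAngle x) := by
  rw [cos_polarAngle]
  rcases eq_or_ne x 0 with rfl | hx
  · simp
  · field_simp [norm_ne_zero_iff.2 hx]

theorem polarAngle_mem_Icc (x : E3) : polarAngle x ∈ Icc 0 Real.pi :=
  ⟨InnerProductGeometry.angle_nonneg _ _, InnerProductGeometry.angle_le_pi _ _⟩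

theorem inner_radialVec_self {x : E3} (hx : x ≠ 0) : ⟪radialVec x, radialVec x⟫ = 1 := by
  have := norm_ne_zero_iff.2 hx
  simp only [radialVec, inner_smul_left, inner_smul_right, real_inner_self_eq_norm_sq]
  simp; field_simp

theorem inner_radialVec_basis (x : E3) : ⟪radialVec x, basisVec 2⟫ = Real.cos (polarAngle x) := by
  rw [radialVec, inner_smul_left, inner_basisVec_two, cos_polarAngle]
  simp; ring

theorem inner_angularVec_radialVec {x : E3} (hx : x ≠ 0) : ⟪angularVec x, radialVec x⟫ = 0 := by
  simp only [angularVec, inner_smul_left, inner_sub_left, inner_radialVec_self hx]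
  rw [real_inner_comm, inner_radialVec_basis]; simp

theorem inner_angularVec_self {x : E3} (hx : x ≠ 0) (h : polarAngle x ∈ Ioo 0 Real.pi) :
    ⟪angularVec x, angularVec x⟫ = 1 := by
  have hs := (sin_pos_of_mem h).ne'
  have e2 : ⟪(basisVec 2 : E3), radialVec x⟫ = Real.cos (polarAngle x) := by
    rw [real_inner_comm, inner_radialVec_basis]
  have e3 : ⟪(basisVec 2 : E3), basisVec 2⟫ = 1 := by
    rw [real_inner_self_eq_norm_sq, norm_basisVec]; norm_num
  simp only [angularVec, inner_smul_left, inner_smul_right, inner_sub_left, inner_sub_right,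
    inner_radialVec_self hx, inner_radialVec_basis, e2, e3]
  simp
  field_simp
  nlinarith [Real.sin_sq_add_cos_sq (polarAngle x)]

theorem inner_polarVec {x : E3} (hx : x ≠ 0) (h : polarAngle x ∈ Ioo 0 Real.pi) (a b c d : ℝ) :
    ⟪polarVec x a b, polarVec x c d⟫ = a * c + b * d := by
  have e : ⟪radialVec x, angularVec x⟫ = 0 := by
    rw [real_inner_comm, inner_angularVec_radialVec hx]
  simp only [polarVec, inner_add_left, inner_add_right, inner_smul_left, inner_smul_right,
    inner_radialVec_self hx, inner_angularVec_radialVec hx, inner_angularVec_self hx h, e]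
  simp; ring

theorem norm_sq_polarVec {x : E3} (hx : x ≠ 0) (h : polarAngle x ∈ Ioo 0 Real.pi) (a b : ℝ) :
    ‖polarVec x a b‖ ^ 2 = a ^ 2 + b ^ 2 := by
  rw [← real_inner_self_eq_norm_sq, inner_polarVec hx h]; ring

theorem hasGradientAt_norm {x : E3} (hx : x ≠ 0) :
    HasGradientAt (fun y : E3 => ‖y‖) (radialVec x) x := by
  rw [hasGradientAt_iff_hasFDerivAt]
  have hn := norm_ne_zero_iff.2 hx
  have h1 := (hasStrictFDerivAt_norm_sq x).hasFDerivAt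
  have h2 := (Real.hasDerivAt_sqrt (x := ‖x‖ ^ 2) (by positivity)).comp_hasFDerivAt x h1
  have h3 : (Real.sqrt ∘ fun y : E3 => ‖y‖ ^ 2) = fun y => ‖y‖ := by
    ext y; simp [Real.sqrt_sq]
  rw [h3, Real.sqrt_sq (norm_nonneg _)] at h2
  convert! h2 using 1
  ext v
  simp [radialVec]
  field_simp

theorem hasGradientAt_polarAngle {x : E3} (hx : x ≠ 0) (h : polarAngle x ∈ Ioo 0 Real.pi) :
    HasGradientAt polarAngle (‖x‖⁻¹ • angularVec x) x := by
  have hn := norm_ne_zero_iff.2 hx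
  have hs := sin_pos_of_mem h
  have hc := cos_polarAngle x
  have hf : polarAngle = fun y : E3 => Real.arccos (y 2 / ‖y‖) := funext polarAngle_eq
  have hr : |x 2 / ‖x‖| < 1 := by
    rw [← hc, ← sq_lt_one_iff_abs_lt_one]
    nlinarith [Real.sin_sq_add_cos_sq (polarAngle x)]
  have h1 : HasFDerivAt (fun y : E3 => y 2) (EuclideanSpace.proj (2 : Fin 3) : E3 →L[ℝ] ℝ) x :=
    (EuclideanSpace.proj (2 : Fin 3) : E3 →L[ℝ] ℝ).hasFDerivAt
  have h2 := h1.mul ((hasDerivAt_inv hn).comp_hasFDerivAt x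
    ((hasGradientAt_iff_hasFDerivAt).1 (hasGradientAt_norm hx)))
  have h3 := (Real.hasDerivAt_arccos (abs_lt.1 hr).1.ne' (abs_lt.1 hr).2.ne).comp_hasFDerivAt x
    (f := fun y : E3 => y 2 / ‖y‖) (h2.congr_of_eventuallyEq
      (Eventually.of_forall fun y => by simp [div_eq_mul_inv]))
  have hsq : Real.sqrt (1 - (x 2 / ‖x‖) ^ 2) = Real.sin (polarAngle x) := by
    rw [polarAngle_eq, Real.sin_arccos]
  rw [hsq] at h3
  rw [hasGradientAt_iff_hasFDerivAt, hf]
  refine h3.congr_fderiv ?_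
  ext v
  have e4 : ⟪(basisVec 2 : E3), v⟫ = v 2 := by rw [real_inner_comm, inner_basisVec_two]
  simp [angularVec, radialVec, e4, hc]
  field_simp
  ring

/-- The gradient of `h(|x|) c(θ)`. -/
theorem hasGradientAt_polar {x : E3} (hx : x ≠ 0) (h : polarAngle x ∈ Ioo 0 Real.pi) {k c : ℝ → ℝ}
    {k' c' : ℝ} (hk : HasDerivAt k k' ‖x‖) (hc : HasDerivAt c c' (polarAngle x)) :
    HasGradientAt (fun y => k ‖y‖ * c (polarAngle y))
      (polarVec x (k' * c (polarAngle x)) (k ‖x‖ * c' / ‖x‖)) x := by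
  have h1 := hk.comp_hasFDerivAt x ((hasGradientAt_iff_hasFDerivAt).1 (hasGradientAt_norm hx))
  have h2 := hc.comp_hasFDerivAt x
    ((hasGradientAt_iff_hasFDerivAt).1 (hasGradientAt_polarAngle hx h))
  have h3 := h1.mul h2
  rw [hasGradientAt_iff_hasFDerivAt]
  refine h3.congr_fderiv ?_
  ext v
  simp [polarVec]
  ring

theorem contDiffAt_polarAngle {x : E3} (hx : x ≠ 0) (h : polarAngle x ∈ Ioo 0 Real.pi) {n : WithTop ℕ∞} :
    ContDiffAt ℝ n polarAngle x := by
  have hn := norm_ne_zero_iff.2 hx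
  have hs := sin_pos_of_mem h
  have hf : polarAngle = fun y : E3 => Real.arccos (y 2 / ‖y‖) := funext polarAngle_eq
  have hr : |x 2 / ‖x‖| < 1 := by
    rw [← cos_polarAngle x, ← sq_lt_one_iff_abs_lt_one]
    nlinarith [Real.sin_sq_add_cos_sq (polarAngle x)]
  rw [hf]
  refine ContDiffAt.comp (g := Real.arccos) (f := fun y : E3 => y 2 / ‖y‖) x
    (Real.contDiffAt_arccos (abs_lt.1 hr).1.ne' (abs_lt.1 hr).2.ne) ?_
  exact ((EuclideanSpace.proj (2 : Fin 3) : E3 →L[ℝ] ℝ).contDiff.contDiffAt).div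
    (contDiffAt_norm ℝ hx) hn

theorem continuousAt_polarAngle {x : E3} (hx : x ≠ 0) : ContinuousAt polarAngle x := by
  have h : ContinuousAt (fun y : E3 => Real.arccos (y 2 / ‖y‖)) x := by
    refine Real.continuous_arccos.continuousAt.comp ?_
    exact ((EuclideanSpace.proj (2 : Fin 3) : E3 →L[ℝ] ℝ).continuous.continuousAt).div
      continuous_norm.continuousAt (norm_ne_zero_iff.2 hx)
  rwa [show (fun y : E3 => Real.arccos (y 2 / ‖y‖)) = polarAngle from (funext polarAngle_eq).symm]
    at h

theorem sph_ne_zero {ρ : ℝ} (hρ : 0 < ρ) (θ φ : ℝ) : sph ρ θ φ ≠ 0 := by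
  rw [← norm_ne_zero_iff, norm_sph hρ.le]; exact hρ.ne'

theorem radialVec_sph {ρ : ℝ} (hρ : 0 < ρ) (θ φ : ℝ) : radialVec (sph ρ θ φ) = sph 1 θ φ := by
  rw [radialVec, norm_sph hρ.le]
  ext i
  fin_cases i <;> simp [sph] <;> field_simp

theorem angularVec_sph {ρ θ : ℝ} (hρ : 0 < ρ) (hθ : θ ∈ Ioo 0 Real.pi) (φ : ℝ) :
    angularVec (sph ρ θ φ) =
      !₂[Real.cos θ * Real.cos φ, Real.cos θ * Real.sin φ, - Real.sin θ] := by
  rw [angularVec, radialVec_sph hρ, polarAngle_sph hρ (Ioo_subset_Icc_self hθ)]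
  have hs := (sin_pos_of_mem hθ).ne'
  have := Real.sin_sq_add_cos_sq θ
  ext i
  fin_cases i <;> simp [sph, basisVec] <;> field_simp
  linear_combination this

theorem hasDerivAt_E3 {f : ℝ → E3} {f' : E3} {t : ℝ} (h : ∀ i, HasDerivAt (fun s => f s i) (f' i) t) :
    HasDerivAt f f' t := by
  have h1 := hasDerivAt_pi.2 h
  have := (PiLp.continuousLinearEquiv 2 ℝ (fun _ : Fin 3 => ℝ)).symm.hasFDerivAt.comp_hasDerivAt t h1
  convert! this using 1

theorem hasDerivAt_sph_angle {ρ θ : ℝ} (hρ : 0 < ρ) (hθ : θ ∈ Ioo 0 Real.pi) (φ : ℝ) :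
    HasDerivAt (fun t => sph ρ t φ) (ρ • angularVec (sph ρ θ φ)) θ := by
  rw [angularVec_sph hρ hθ]
  refine hasDerivAt_E3 fun i => ?_
  fin_cases i <;> simp [sph]
  · simpa [mul_assoc] using ((Real.hasDerivAt_sin θ).const_mul ρ).mul_const (Real.cos φ)
  · simpa [mul_assoc] using ((Real.hasDerivAt_sin θ).const_mul ρ).mul_const (Real.sin φ)
  · simpa using (Real.hasDerivAt_cos θ).const_mul ρ

theorem inner_gradient_eq {ζ : E3 → ℝ} (x v : E3) : ⟪gradient ζ x, v⟫ = fderiv ℝ ζ x v := by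
  simp [gradient]

theorem norm_gradient_eq (ζ : E3 → ℝ) (x : E3) : ‖gradient ζ x‖ = ‖fderiv ℝ ζ x‖ := by
  simp [gradient]

theorem continuous_gradient {ζ : E3 → ℝ} (hζ : ContDiff ℝ 1 ζ) : Continuous (gradient ζ) :=
  (InnerProductSpace.toDual ℝ E3).symm.continuous.comp (hζ.continuous_fderiv one_ne_zero)

end

noncomputable section

/-! ### The cone function -/

/-- The complement `|x₃| < |x| cos θ₀` of the closed double cone of opening `θ₀`. -/
def coneRegion (θ₀ : ℝ) : Set E3 := {x | |x 2| < Real.cos θ₀ * ‖x‖}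

theorem continuous_apply_two : Continuous fun x : E3 => x 2 :=
  (EuclideanSpace.proj (2 : Fin 3) : E3 →L[ℝ] ℝ).continuous

theorem isOpen_coneRegion (θ₀ : ℝ) : IsOpen (coneRegion θ₀) :=
  isOpen_lt continuous_apply_two.abs (continuous_const.mul continuous_norm)

theorem mem_coneRegion_iff {θ₀ : ℝ} (h0 : 0 < θ₀) (h1 : θ₀ < Real.pi / 2) {x : E3} :
    x ∈ coneRegion θ₀ ↔ x ≠ 0 ∧ polarAngle x ∈ Ioo θ₀ (Real.pi - θ₀) := by
  rcases eq_or_ne x 0 with rfl | hx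
  · simp [coneRegion]
  have hn := norm_pos_iff.2 hx
  have hI := polarAngle_mem_Icc x
  have hpi := Real.pi_pos
  have hm : θ₀ ∈ Icc 0 Real.pi := ⟨h0.le, by linarith⟩
  have hm' : Real.pi - θ₀ ∈ Icc 0 Real.pi := ⟨by linarith, by linarith⟩
  have e1 := Real.strictAntiOn_cos.lt_iff_gt hI hm
  have e2 := Real.strictAntiOn_cos.lt_iff_gt hm' hI
  rw [Real.cos_pi_sub] at e2
  have hx2 := apply_two_eq x
  simp only [coneRegion, mem_ofPred_eq, mem_Ioo, ← e1, ← e2, ne_eq, hx, not_false_eq_true, true_and,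
    abs_lt, hx2]
  constructor
  · rintro ⟨a, b⟩
    exact ⟨by nlinarith, by nlinarith⟩
  · rintro ⟨a, b⟩
    exact ⟨by nlinarith, by nlinarith⟩

theorem exists_horizontal (x : E3) :
    ∃ e : E3, ‖e‖ = 1 ∧ e 2 = 0 ∧ ⟪x, e⟫ = Real.sqrt (x 0 ^ 2 + x 1 ^ 2) := by
  by_cases h : x 0 ^ 2 + x 1 ^ 2 = 0
  · refine ⟨basisVec 0, norm_basisVec 0, by simp [basisVec], ?_⟩
    rw [h, Real.sqrt_zero]
    have : x 0 = 0 := by nlinarith [sq_nonneg (x 0), sq_nonneg (x 1)]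
    simp [basisVec, EuclideanSpace.inner_single_right, this]
  · have hp : 0 < x 0 ^ 2 + x 1 ^ 2 := lt_of_le_of_ne (by positivity) (Ne.symm h)
    have hs := Real.sqrt_pos.2 hp
    have hq := Real.sq_sqrt hp.le
    set s := Real.sqrt (x 0 ^ 2 + x 1 ^ 2)
    refine ⟨!₂[x 0 / s, x 1 / s, 0], ?_, by simp, ?_⟩
    · have : ‖(!₂[x 0 / s, x 1 / s, 0] : E3)‖ ^ 2 = 1 := by
        rw [norm_sq_eq_sum]
        simp
        field_simp
        linarith
      nlinarith [norm_nonneg (!₂[x 0 / s, x 1 / s, 0] : E3)]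
    · simp [PiLp.inner_apply, Fin.sum_univ_three]
      field_simp
      linarith

/-- Moving horizontally outwards from a point of the double cone. -/
theorem exists_outward {θ₀ : ℝ} (h0 : 0 < θ₀) (h1 : θ₀ < Real.pi / 2) {x : E3}
    (hx : |x 2| = Real.cos θ₀ * ‖x‖) : ∃ e : E3, ‖e‖ = 1 ∧ e 2 = 0 ∧
      ∀ t : ℝ, 0 ≤ t → ‖x‖ + Real.sin θ₀ * t ≤ ‖x + t • e‖ := by
  obtain ⟨e, he, he2, hxe⟩ := exists_horizontal x
  have hpi := Real.pi_pos
  have hs : 0 < Real.sin θ₀ := Real.sin_pos_of_pos_of_lt_pi h0 (by linarith)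
  refine ⟨e, he, he2, fun t ht => ?_⟩
  have h2 : x 0 ^ 2 + x 1 ^ 2 = (Real.sin θ₀ * ‖x‖) ^ 2 := by
    have a := norm_sq_eq_sum x
    have b : x 2 ^ 2 = (Real.cos θ₀ * ‖x‖) ^ 2 := by rw [← hx, sq_abs]
    have c := Real.sin_sq_add_cos_sq θ₀
    linear_combination -a - b - ‖x‖ ^ 2 * c
  rw [h2, Real.sqrt_sq (by positivity)] at hxe
  refine le_of_sq_le_sq ?_ (norm_nonneg _)
  rw [norm_add_sq_real, inner_smul_right, hxe, norm_smul, he, Real.norm_of_nonneg ht]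
  have : Real.sin θ₀ ^ 2 ≤ 1 := Real.sin_sq_le_one _
  nlinarith [mul_le_mul_of_nonneg_right this (sq_nonneg t)]

/-- One inclusion is continuity. For the other, moving horizontally outwards keeps `x₃` fixed and
increases `|x|`, so it enters the open region at once; this covers the vertex as well. -/
theorem frontier_coneRegion {θ₀ : ℝ} (h0 : 0 < θ₀) (h1 : θ₀ < Real.pi / 2) :
    frontier (coneRegion θ₀) = {x | |x 2| = Real.cos θ₀ * ‖x‖} := by
  have hpi := Real.pi_pos
  have hs : 0 < Real.sin θ₀ := Real.sin_pos_of_pos_of_lt_pi h0 (by linarith)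
  have hc : 0 < Real.cos θ₀ := Real.cos_pos_of_mem_Ioo ⟨by linarith, h1⟩
  rw [(isOpen_coneRegion θ₀).frontier_eq]
  ext x
  constructor
  · rintro ⟨hx, hn⟩
    have : closure (coneRegion θ₀) ⊆ {x | |x 2| ≤ Real.cos θ₀ * ‖x‖} :=
      closure_minimal (fun y (hy : |y 2| < _) => show |y 2| ≤ _ from hy.le)
        (isClosed_le continuous_apply_two.abs (continuous_const.mul continuous_norm))
    exact le_antisymm (this hx) (not_lt.1 hn)
  · intro hx
    refine ⟨?_, by simp only [coneRegion, mem_ofPred_eq, not_lt]; exact hx.ge⟩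
    obtain ⟨e, -, he2, he⟩ := exists_outward h0 h1 hx
    have hlim : Tendsto (fun t : ℝ => x + t • e) (𝓝[>] 0) (𝓝 x) := by
      have : Continuous fun t : ℝ => x + t • e := by fun_prop
      simpa using (this.tendsto 0).mono_left nhdsWithin_le_nhds
    refine mem_closure_of_tendsto hlim ?_
    filter_upwards [self_mem_nhdsWithin] with t ht
    have ht : 0 < t := ht
    have := he t ht.le
    have e2 : (x + t • e) 2 = x 2 := by simp [he2]
    show |(x + t • e) 2| < _
    rw [e2, show |x 2| = _ from hx]
    exact mul_lt_mul_of_pos_left (by nlinarith [mul_pos hs ht]) hc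

theorem not_mem_coneRegion_zero (θ₀ : ℝ) : (0 : E3) ∉ coneRegion θ₀ := by simp [coneRegion]

/-! ### The cone function: gradient, Lipschitz bound and growth. -/

namespace ConeProfile
variable {p θ₀ : ℝ} {g : ℝ → ℝ}

theorem coneFun_nonneg (x : E3) : 0 ≤ coneFun g θ₀ x := by
  unfold coneFun
  split_ifs
  · exact mul_nonneg (norm_nonneg _) (le_max_right _ _)
  · exact le_rfl

theorem mem_iff (h : ConeProfile p θ₀ g) {x : E3} :
    x ∈ coneRegion θ₀ ↔ x ≠ 0 ∧ polarAngle x ∈ Ioo θ₀ (Real.pi - θ₀) :=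
  mem_coneRegion_iff h.angle_pos h.angle_lt

theorem polarAngle_mem (h : ConeProfile p θ₀ g) {x : E3} (hx : x ∈ coneRegion θ₀) :
    polarAngle x ∈ Ioo 0 Real.pi := h.full_subset (Ioo_subset_Icc_self (h.mem_iff.1 hx).2)

theorem coneFun_of_mem (h : ConeProfile p θ₀ g) {x : E3} (hx : x ∈ coneRegion θ₀) :
    coneFun g θ₀ x = ‖x‖ * g (polarAngle x) := by
  have hm := h.polarAngle_mem hx
  have hp := (h.pos_iff hm).2 (h.mem_iff.1 hx).2
  rw [coneFun, if_pos hm, h.one, div_one, max_eq_left hp.le]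

theorem coneFun_of_not_mem (h : ConeProfile p θ₀ g) {x : E3} (hx : x ∉ coneRegion θ₀) :
    coneFun g θ₀ x = 0 := by
  rcases eq_or_ne x 0 with rfl | h0
  · simp [coneFun]
  unfold coneFun
  split_ifs with hm
  · have : ¬ 0 < g (polarAngle x) := fun hp => hx (h.mem_iff.2 ⟨h0, (h.pos_iff hm).1 hp⟩)
    rw [h.one, div_one, max_eq_right (not_lt.1 this), mul_zero]
  · rfl

theorem coneFun_pos_iff (h : ConeProfile p θ₀ g) {x : E3} :
    0 < coneFun g θ₀ x ↔ x ∈ coneRegion θ₀ := by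
  constructor
  · intro hp
    by_contra hx
    rw [h.coneFun_of_not_mem hx] at hp
    exact lt_irrefl _ hp
  · intro hx
    rw [h.coneFun_of_mem hx]
    exact mul_pos (norm_pos_iff.2 (h.mem_iff.1 hx).1)
      ((h.pos_iff (h.polarAngle_mem hx)).2 (h.mem_iff.1 hx).2)

theorem setOf_coneFun_pos (h : ConeProfile p θ₀ g) : {x | 0 < coneFun g θ₀ x} = coneRegion θ₀ :=
  Set.ext fun _ => h.coneFun_pos_iff

theorem coneFun_eventuallyEq (h : ConeProfile p θ₀ g) {x : E3} (hx : x ∈ coneRegion θ₀) :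
    coneFun g θ₀ =ᶠ[𝓝 x] fun y => ‖y‖ * g (polarAngle y) := by
  filter_upwards [(isOpen_coneRegion θ₀).mem_nhds hx] with y hy using h.coneFun_of_mem hy

theorem hasGradientAt_coneFun (h : ConeProfile p θ₀ g) {x : E3} (hx : x ∈ coneRegion θ₀) :
    HasGradientAt (coneFun g θ₀) (polarVec x (g (polarAngle x)) (deriv g (polarAngle x))) x := by
  have hx0 := (h.mem_iff.1 hx).1
  have := hasGradientAt_polar hx0 (h.polarAngle_mem hx) (hasDerivAt_id ‖x‖)
    (h.hasDerivAt _ (h.polarAngle_mem hx)).differentiableAt.hasDerivAt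
  rw [hasGradientAt_iff_hasFDerivAt] at this ⊢
  refine HasFDerivAt.congr_of_eventuallyEq ?_ (h.coneFun_eventuallyEq hx)
  have e : id ‖x‖ * deriv g (polarAngle x) / ‖x‖ = deriv g (polarAngle x) := by
    have := norm_ne_zero_iff.2 hx0
    simp only [id_eq]; field_simp
  rwa [one_mul, e] at this

theorem gradient_coneFun (h : ConeProfile p θ₀ g) {x : E3} (hx : x ∈ coneRegion θ₀) :
    gradient (coneFun g θ₀) x = polarVec x (g (polarAngle x)) (deriv g (polarAngle x)) :=
  (h.hasGradientAt_coneFun hx).gradient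

/-- Such a point is a minimum of the nonnegative function `u`. On the cone itself, where
differentiability may fail, the default value of the gradient is again 0, so no case distinction is
needed in the integrals. -/
theorem gradient_coneFun_of_not_mem (h : ConeProfile p θ₀ g) {x : E3} (hx : x ∉ coneRegion θ₀) :
    gradient (coneFun g θ₀) x = 0 := by
  have hmin : IsLocalMin (coneFun g θ₀) x := Eventually.of_forall fun y => by
    rw [h.coneFun_of_not_mem hx]; exact coneFun_nonneg y
  rw [gradient, hmin.fderiv_eq_zero, map_zero]

theorem norm_sq_gradient_coneFun (h : ConeProfile p θ₀ g) {x : E3} (hx : x ∈ coneRegion θ₀) :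
    ‖gradient (coneFun g θ₀) x‖ ^ 2 = gradSq g (polarAngle x) := by
  rw [h.gradient_coneFun hx, norm_sq_polarVec (h.mem_iff.1 hx).1 (h.polarAngle_mem hx), gradSq]

theorem norm_gradient_coneFun_le (h : ConeProfile p θ₀ g) (x : E3) :
    ‖gradient (coneFun g θ₀) x‖ ≤ 1 := by
  by_cases hx : x ∈ coneRegion θ₀
  · have := h.norm_sq_gradient_coneFun hx
    have h1 := h.gradSq_le_one (Ioo_subset_Icc_self (h.mem_iff.1 hx).2)
    nlinarith [norm_nonneg (gradient (coneFun g θ₀) x)]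
  · rw [h.gradient_coneFun_of_not_mem hx]; simp

theorem norm_rpow_gradient_coneFun (h : ConeProfile p θ₀ g) {x : E3} (hx : x ∈ coneRegion θ₀) :
    ‖gradient (coneFun g θ₀) x‖ ^ (p - 2) = pWeight p g (polarAngle x) := by
  rw [pWeight, ← h.norm_sq_gradient_coneFun hx, ← Real.rpow_natCast_mul (norm_nonneg _)]
  congr 1; push_cast; ring

theorem coneFun_le_norm (h : ConeProfile p θ₀ g) (x : E3) : coneFun g θ₀ x ≤ ‖x‖ := by
  by_cases hx : x ∈ coneRegion θ₀
  · rw [h.coneFun_of_mem hx]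
    have := h.abs_le_one (Ioo_subset_Icc_self (h.mem_iff.1 hx).2)
    nlinarith [norm_nonneg x, abs_le.1 this]
  · rw [h.coneFun_of_not_mem hx]; exact norm_nonneg x

/-- In the region `|∇u|² = S(θ)`; this extends continuously across the cone away from the vertex,
with value `S(θ₀) = S(π - θ₀) = 1` there. -/
theorem tendsto_norm_gradient (h : ConeProfile p θ₀ g) {x : E3}
    (hx : x ∈ frontier (coneRegion θ₀)) (h0 : x ≠ 0) :
    Tendsto (fun y => ‖gradient (coneFun g θ₀) y‖) (𝓝[coneRegion θ₀] x) (𝓝 1) := by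
  rw [frontier_coneRegion h.angle_pos h.angle_lt] at hx
  have hx : |x 2| = Real.cos θ₀ * ‖x‖ := hx
  have hn := norm_pos_iff.2 h0
  have hm := h.mem_angle
  have hS : polarAngle x ∈ Ioo 0 Real.pi ∧ gradSq g (polarAngle x) = 1 := by
    rcases abs_cases (x 2) with ⟨e, -⟩ | ⟨e, -⟩
    · have : polarAngle x = θ₀ := by
        rw [polarAngle_eq, ← e, hx, mul_div_cancel_right₀ _ hn.ne', Real.arccos_cos hm.1.le hm.2.le]
      rw [this]; exact ⟨hm, h.gradSq_zero⟩
    · have : polarAngle x = Real.pi - θ₀ := by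
        rw [polarAngle_eq, show x 2 = - (Real.cos θ₀ * ‖x‖) by linarith, neg_div,
          mul_div_cancel_right₀ _ hn.ne', Real.arccos_neg, Real.arccos_cos hm.1.le hm.2.le]
      rw [this]; exact ⟨reflect_mem hm, by rw [h.gradSq_reflect hm, h.gradSq_zero]⟩
  have hc : ContinuousAt (fun y => Real.sqrt (gradSq g (polarAngle y))) x :=
    Real.continuous_sqrt.continuousAt.comp
      (ContinuousAt.comp ((h.continuousOn_gradSq).continuousAt (Ioo_mem_nhds hS.1.1 hS.1.2))
        (continuousAt_polarAngle h0))
  have hl := hc.tendsto.mono_left (nhdsWithin_le_nhds (s := coneRegion θ₀))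
  rw [hS.2, Real.sqrt_one] at hl
  refine hl.congr' ?_
  filter_upwards [self_mem_nhdsWithin] with y hy
  rw [← h.norm_sq_gradient_coneFun hy, Real.sqrt_sq (norm_nonneg _)]

/-- The profile as a function of `cos θ`, extended by zero. -/
theorem exists_lipschitz_profile (h : ConeProfile p θ₀ g) : ∃ (K : ℝ → ℝ) (L : NNReal),
    LipschitzWith L K ∧ (∀ t, |K t| ≤ 1) ∧ ∀ x : E3, coneFun g θ₀ x = ‖x‖ * K (x 2 / ‖x‖) := by
  have hpi := Real.pi_pos
  have h0 := h.angle_pos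
  have h1 := h.angle_lt
  have hm := h.mem_angle
  have hs := sin_pos_of_mem hm
  set t₀ := Real.cos θ₀ with ht
  have ht0 : 0 < t₀ := Real.cos_pos_of_mem_Ioo ⟨by linarith, h1⟩
  have ht1 : t₀ < 1 := by nlinarith [Real.sin_sq_add_cos_sq θ₀]
  have hle : -t₀ ≤ t₀ := by linarith
  have hac : ∀ t ∈ Icc (-t₀) t₀, Real.arccos t ∈ Icc θ₀ (Real.pi - θ₀) := by
    intro t htt
    have e1 : Real.arccos t₀ = θ₀ := Real.arccos_cos hm.1.le hm.2.le
    have e2 : Real.arccos (-t₀) = Real.pi - θ₀ := by rw [Real.arccos_neg, e1]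
    exact ⟨e1 ▸ Real.arccos_le_arccos htt.2, e2 ▸ Real.arccos_le_arccos htt.1⟩
  have hlip : LipschitzOnWith (Real.toNNReal (1 / Real.sin θ₀)) (fun t => g (Real.arccos t))
      (Icc (-t₀) t₀) := by
    refine (convex_Icc _ _).lipschitzOnWith_of_nnnorm_hasDerivWithin_le
      (f' := fun t => deriv g (Real.arccos t) * -(1 / Real.sqrt (1 - t ^ 2))) (fun t htt => ?_)
      (fun t htt => ?_)
    · have hd := (h.hasDerivAt _ (h.full_subset (hac t htt)))
      exact (HasDerivAt.comp t hd (Real.hasDerivAt_arccos (by have := htt.1; intro e; linarith)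
        (by have := htt.2; intro e; linarith))).hasDerivWithinAt
    · rw [← NNReal.coe_le_coe, Real.coe_toNNReal _ (by positivity), coe_nnnorm, Real.norm_eq_abs,
        abs_mul, abs_neg]
      have hd := h.deriv_le_one (hac t htt)
      have hsq : Real.sin θ₀ ≤ Real.sqrt (1 - t ^ 2) := by
        refine Real.le_sqrt_of_sq_le ?_
        have := abs_le.2 htt
        have : t ^ 2 ≤ t₀ ^ 2 := sq_le_sq' htt.1 htt.2
        nlinarith [Real.sin_sq_add_cos_sq θ₀]
      have h3 : |1 / Real.sqrt (1 - t ^ 2)| ≤ 1 / Real.sin θ₀ := by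
        rw [abs_of_nonneg (by positivity)]
        exact one_div_le_one_div_of_le hs hsq
      calc _ ≤ 1 * (1 / Real.sin θ₀) := mul_le_mul hd h3 (abs_nonneg _) zero_le_one
        _ = _ := one_mul _
  -- Clamping `cos θ` to `[-cos θ₀, cos θ₀]` implements the extension by zero, since `g` vanishes at
  -- both clamped ends; it also avoids the poles, where `arccos` is not Lipschitz and `g` may blow
  -- up.
  refine ⟨fun t => g (Real.arccos (projIcc (-t₀) t₀ hle t)),
    Real.toNNReal (1 / Real.sin θ₀), ?_, fun t => ?_, fun x => ?_⟩
  · have := (hlip.to_restrict).comp (LipschitzWith.projIcc hle)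
    rw [mul_one] at this
    exact this
  · exact h.abs_le_one (hac _ (projIcc (-t₀) t₀ hle t).2)
  · rcases eq_or_ne x 0 with rfl | hx
    · simp [coneFun]
    have hn := norm_pos_iff.2 hx
    show coneFun g θ₀ x = ‖x‖ * g (Real.arccos (projIcc (-t₀) t₀ hle (x 2 / ‖x‖)))
    by_cases hE : x ∈ coneRegion θ₀
    · have : x 2 / ‖x‖ ∈ Icc (-t₀) t₀ := by
        have := abs_lt.1 (show |x 2| < t₀ * ‖x‖ from hE)
        rw [mem_Icc, le_div_iff₀ hn, div_le_iff₀ hn]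
        exact ⟨by linarith, by linarith⟩
      rw [h.coneFun_of_mem hE, polarAngle_eq, projIcc_of_mem hle this]
    · rw [h.coneFun_of_not_mem hE]
      have hE : t₀ * ‖x‖ ≤ |x 2| := not_lt.1 hE
      symm
      rcases le_or_gt 0 (x 2) with h2 | h2
      · rw [abs_of_nonneg h2] at hE
        rw [projIcc_of_right_le hle ((le_div_iff₀ hn).2 hE)]
        simp only [ht, Real.arccos_cos hm.1.le hm.2.le, h.zero, mul_zero]
      · rw [abs_of_neg h2] at hE
        rw [projIcc_of_le_left hle ((div_le_iff₀ hn).2 (by linarith))]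
        simp only [ht, Real.arccos_neg, Real.arccos_cos hm.1.le hm.2.le, h.zero_reflect, mul_zero]

/-- A function homogeneous of degree one with a bounded Lipschitz profile is Lipschitz: the factor
`|x|` compensates the singularity of `x₃/|x|` at the origin. -/
theorem exists_lipschitzWith (h : ConeProfile p θ₀ g) : ∃ L : NNReal, LipschitzWith L (coneFun g θ₀) := by
  obtain ⟨K, L, hK, hK1, hu⟩ := h.exists_lipschitz_profile
  refine ⟨1 + 2 * L, LipschitzWith.of_dist_le_mul fun x y => ?_⟩
  rw [Real.dist_eq, dist_eq_norm]
  have key : ∀ x y : E3, y ≠ 0 → |‖x‖ * K (x 2 / ‖x‖) - ‖y‖ * K (y 2 / ‖y‖)| ≤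
      (1 + 2 * L) * ‖x - y‖ := by
    intro x y hy
    have hny := norm_pos_iff.2 hy
    have e1 : |‖x‖ - ‖y‖| ≤ ‖x - y‖ := abs_norm_sub_norm_le x y
    have e2 := abs_apply_two_le (x - y)
    have e3 : |K (x 2 / ‖x‖) - K (y 2 / ‖y‖)| ≤ L * |x 2 / ‖x‖ - y 2 / ‖y‖| := by
      simpa [Real.dist_eq] using hK.dist_le_mul (x 2 / ‖x‖) (y 2 / ‖y‖)
    have e4 : ‖x‖ * |x 2 / ‖x‖ - y 2 / ‖y‖| ≤ 2 * ‖x - y‖ := by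
      rcases eq_or_ne x 0 with rfl | hx
      · simp
      have hnx := norm_pos_iff.2 hx
      rw [← abs_of_pos hnx, ← abs_mul, abs_of_pos hnx]
      have : ‖x‖ * (x 2 / ‖x‖ - y 2 / ‖y‖) = (x - y) 2 + (y 2 / ‖y‖) * (‖y‖ - ‖x‖) := by
        simp; field_simp; ring
      rw [this]
      have e5 : |y 2 / ‖y‖| ≤ 1 := by
        rw [abs_div, abs_norm]; exact div_le_one_of_le₀ (abs_apply_two_le y) hny.le
      calc _ ≤ |(x - y) 2| + |y 2 / ‖y‖| * |‖y‖ - ‖x‖| := by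
            rw [← abs_mul]; exact abs_add_le _ _
        _ ≤ ‖x - y‖ + 1 * ‖x - y‖ := by
            rw [abs_sub_comm ‖y‖]
            exact add_le_add e2 (mul_le_mul e5 e1 (abs_nonneg _) zero_le_one)
        _ = _ := by ring
    have e6 : ‖x‖ * K (x 2 / ‖x‖) - ‖y‖ * K (y 2 / ‖y‖) =
        ‖x‖ * (K (x 2 / ‖x‖) - K (y 2 / ‖y‖)) + (‖x‖ - ‖y‖) * K (y 2 / ‖y‖) := by ring
    rw [e6]
    calc _ ≤ ‖x‖ * |K (x 2 / ‖x‖) - K (y 2 / ‖y‖)| + |‖x‖ - ‖y‖| * |K (y 2 / ‖y‖)| := by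
          refine (abs_add_le _ _).trans_eq ?_
          rw [abs_mul, abs_mul, abs_norm]
      _ ≤ ‖x‖ * (L * |x 2 / ‖x‖ - y 2 / ‖y‖|) + ‖x - y‖ * 1 := by
          refine add_le_add (mul_le_mul_of_nonneg_left e3 (norm_nonneg _)) ?_
          exact mul_le_mul e1 (hK1 _) (abs_nonneg _) (norm_nonneg _)
      _ ≤ _ := by nlinarith [L.coe_nonneg]
  have key' : |coneFun g θ₀ x - coneFun g θ₀ y| ≤ (1 + 2 * L) * ‖x - y‖ := by
    rcases eq_or_ne y 0 with rfl | hy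
    · have e : coneFun g θ₀ 0 = 0 := h.coneFun_of_not_mem (not_mem_coneRegion_zero θ₀)
      rw [e, sub_zero, sub_zero, abs_of_nonneg (coneFun_nonneg x)]
      nlinarith [h.coneFun_le_norm x, L.coe_nonneg, norm_nonneg x, mul_nonneg L.coe_nonneg (norm_nonneg x)]
    · rw [hu x, hu y]; exact key x y hy
  exact_mod_cast key'

/-- Linear lower bound for `u` in terms of the distance to the cone. -/
theorem exists_lower_bound (h : ConeProfile p θ₀ g) :
    ∃ c : ℝ, 0 < c ∧ ∀ y : E3, c * (Real.cos θ₀ * ‖y‖ - |y 2|) ≤ coneFun g θ₀ y := by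
  have hpi := Real.pi_pos
  have h0 := h.angle_pos
  have h1 := h.angle_lt
  have hd : 0 < Real.pi / 2 - θ₀ := by linarith
  have hG : 0 < g (Real.pi / 2) := h.pos_half _ ⟨h1, le_rfl⟩
  -- Here `g'' = n - g ≤ 0`. The constant below is the slope of the chord of `g` from `θ₀` to the
  -- equator.
  have hconc : ConcaveOn ℝ (Icc θ₀ (Real.pi / 2)) g := by
    refine AntitoneOn.concaveOn_of_deriv (convex_Icc _ _) (h.continuousOn.mono h.half_subset)
      (fun x hx => ((h.hasDerivAt x (h.half_subset (interior_subset hx))).differentiableAt).differentiableWithinAt) ?_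
    refine antitoneOn_of_deriv_nonpos
      (convex_Icc _ _).interior (h.continuousOn_deriv.mono (interior_subset.trans h.half_subset))
      (fun x hx => ?_) (fun x hx => ?_)
    · exact (h.hasDerivAt_deriv x (h.half_subset (interior_subset
        (interior_subset hx)))).differentiableAt.differentiableWithinAt
    · have hx' := (interior_subset (interior_subset hx))
      rw [(h.hasDerivAt_deriv x (h.half_subset hx')).deriv]
      linarith [h.merCurv_nonpos hx', h.nonneg_half hx']
  refine ⟨g (Real.pi / 2) / (Real.pi / 2 - θ₀), by positivity, fun y => ?_⟩
  set c := g (Real.pi / 2) / (Real.pi / 2 - θ₀) with hc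
  have hcp : 0 < c := by positivity
  have hg : ∀ θ ∈ Icc θ₀ (Real.pi / 2), c * (Real.cos θ₀ - Real.cos θ) ≤ g θ := by
    intro θ hθ
    have ha : 0 ≤ (Real.pi / 2 - θ) / (Real.pi / 2 - θ₀) :=
      div_nonneg (by linarith [hθ.2]) hd.le
    have hb : 0 ≤ (θ - θ₀) / (Real.pi / 2 - θ₀) := div_nonneg (by linarith [hθ.1]) hd.le
    have h2 := hconc.2 (left_mem_Icc.2 h1.le) (right_mem_Icc.2 h1.le) ha hb
      (by rw [← add_div, show Real.pi / 2 - θ + (θ - θ₀) = Real.pi / 2 - θ₀ by ring, div_self hd.ne'])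
    rw [h.zero] at h2
    simp only [smul_eq_mul, mul_zero, zero_add] at h2
    have e : (Real.pi / 2 - θ) / (Real.pi / 2 - θ₀) * θ₀ +
        (θ - θ₀) / (Real.pi / 2 - θ₀) * (Real.pi / 2) = θ := by
      rw [div_mul_eq_mul_div, div_mul_eq_mul_div, ← add_div, div_eq_iff hd.ne']; ring
    rw [e] at h2
    have e2 : Real.cos θ₀ - Real.cos θ ≤ θ - θ₀ := by
      have := Real.abs_cos_sub_cos_le θ₀ θ 
      rw [abs_sub_comm θ₀, abs_of_nonneg (by linarith [hθ.1] : 0 ≤ θ - θ₀)] at this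
      exact (le_abs_self _).trans this
    calc _ ≤ c * (θ - θ₀) := mul_le_mul_of_nonneg_left e2 hcp.le
      _ = (θ - θ₀) / (Real.pi / 2 - θ₀) * g (Real.pi / 2) := by rw [hc]; ring
      _ ≤ _ := h2
  by_cases hE : y ∈ coneRegion θ₀
  · rw [h.coneFun_of_mem hE]
    have hI := (h.mem_iff.1 hE).2
    have hy := apply_two_eq y
    have : c * (Real.cos θ₀ - |Real.cos (polarAngle y)|) ≤ g (polarAngle y) := by
      rcases le_total (polarAngle y) (Real.pi / 2) with hle | hle
      · rw [abs_of_nonneg (Real.cos_nonneg_of_mem_Icc ⟨by linarith [hI.1], hle⟩)]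
        exact hg _ ⟨hI.1.le, hle⟩
      · have := hg (Real.pi - polarAngle y) ⟨by linarith [hI.2], by linarith⟩
        rw [h.symm _ (h.polarAngle_mem hE), Real.cos_pi_sub] at this
        rwa [abs_of_nonpos (Real.cos_nonpos_of_pi_div_two_le_of_le hle (by linarith [hI.2]))]
    rw [hy, abs_mul, abs_norm]
    nlinarith [norm_nonneg y]
  · rw [h.coneFun_of_not_mem hE]
    have : Real.cos θ₀ * ‖y‖ ≤ |y 2| := not_lt.1 hE
    nlinarith

/-- Nondegeneracy and linear growth at the free boundary. -/
theorem exists_growth (h : ConeProfile p θ₀ g) : ∃ c C : ℝ, 0 < c ∧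
    ∀ x ∈ frontier (coneRegion θ₀), ∀ r : ℝ, 0 < r →
      (∃ y ∈ Metric.ball x r, c * r ≤ coneFun g θ₀ y) ∧
        ∀ y ∈ Metric.ball x r, coneFun g θ₀ y ≤ C * r := by
  obtain ⟨c, hc, hlow⟩ := h.exists_lower_bound
  obtain ⟨L, hL⟩ := h.exists_lipschitzWith
  have hpi := Real.pi_pos
  have hs := sin_pos_of_mem h.mem_angle
  have ht : 0 < Real.cos θ₀ := Real.cos_pos_of_mem_Ioo ⟨by linarith [h.angle_pos], h.angle_lt⟩
  -- Moving a distance `r/2` horizontally outwards keeps `x₃` and increases `|x|` by at least `sin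
  -- θ₀ r/2`; `exists_lower_bound` then applies. The upper constant is the Lipschitz constant.
  refine ⟨c * (Real.cos θ₀ * (Real.sin θ₀ / 2)), L, by positivity, fun x hx r hr => ⟨?_, ?_⟩⟩
  · rw [frontier_coneRegion h.angle_pos h.angle_lt] at hx
    obtain ⟨e, he1, he2, he⟩ := exists_outward h.angle_pos h.angle_lt hx
    refine ⟨x + (r / 2) • e, ?_, ?_⟩
    · rw [Metric.mem_ball, dist_eq_norm, add_sub_cancel_left, norm_smul, he1, Real.norm_of_nonneg (by positivity)]
      linarith
    · have e1 := he (r / 2) (by positivity)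
      have e2 := hlow (x + (r / 2) • e)
      have e3 : (x + (r / 2) • e) 2 = x 2 := by simp [he2]
      rw [e3, show |x 2| = _ from hx] at e2
      refine le_trans ?_ e2
      rw [mul_assoc]
      refine mul_le_mul_of_nonneg_left ?_ hc.le
      nlinarith
  · intro y hy
    have h2 := hL.dist_le_mul y x
    have hx' : x ∉ coneRegion θ₀ := by
      rw [(isOpen_coneRegion θ₀).frontier_eq] at hx; exact hx.2
    rw [h.coneFun_of_not_mem hx', Real.dist_eq, sub_zero, abs_of_nonneg (coneFun_nonneg y)] at h2
    exact h2.trans (mul_le_mul_of_nonneg_left (le_of_lt hy) L.coe_nonneg)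

end ConeProfile

end

noncomputable section

/-! ### Integration over the cone region -/

/-- Spherical parameters `(φ, (ρ, θ))` of the cone region. -/
def coneRegionDomain (θ₀ : ℝ) : Set (ℝ × ℝ × ℝ) :=
  Ioo (-Real.pi) Real.pi ×ˢ (Ioi 0 ×ˢ Ioo θ₀ (Real.pi - θ₀))

theorem measurableSet_coneRegionDomain (θ₀ : ℝ) : MeasurableSet (coneRegionDomain θ₀) :=
  measurableSet_Ioo.prod (measurableSet_Ioi.prod measurableSet_Ioo)

theorem sph_mem_coneRegion_iff {θ₀ : ℝ} (h0 : 0 < θ₀) (h1 : θ₀ < Real.pi / 2) {q : ℝ × ℝ × ℝ}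
    (hq : q ∈ sphDomain) :
    sph q.2.1 q.2.2 q.1 ∈ coneRegion θ₀ ↔ q ∈ coneRegionDomain θ₀ := by
  have h2 : 0 < q.2.1 := hq.2.1
  rw [mem_coneRegion_iff h0 h1, polarAngle_sph h2 (Ioo_subset_Icc_self hq.2.2)]
  exact ⟨fun h => ⟨hq.1, h2, h.2⟩, fun h => ⟨sph_ne_zero h2 _ _, h.2.2⟩⟩

theorem coneRegionDomain_subset {θ₀ : ℝ} (h0 : 0 < θ₀) : coneRegionDomain θ₀ ⊆ sphDomain :=
  fun _ hq => ⟨hq.1, hq.2.1, by linarith [hq.2.2.1], by linarith [hq.2.2.2]⟩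

theorem indicator_coneRegion_sph {θ₀ : ℝ} (h0 : 0 < θ₀) (h1 : θ₀ < Real.pi / 2) (F : E3 → ℝ)
    {q : ℝ × ℝ × ℝ} (hq : q ∈ sphDomain) :
    q.2.1 ^ 2 * Real.sin q.2.2 * (coneRegion θ₀).indicator F (sph q.2.1 q.2.2 q.1) =
      (coneRegionDomain θ₀).indicator
        (fun q => q.2.1 ^ 2 * Real.sin q.2.2 * F (sph q.2.1 q.2.2 q.1)) q := by
  by_cases h : q ∈ coneRegionDomain θ₀
  · rw [indicator_of_mem h, indicator_of_mem ((sph_mem_coneRegion_iff h0 h1 hq).2 h)]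
  · rw [indicator_of_notMem h,
      indicator_of_notMem (fun h' => h ((sph_mem_coneRegion_iff h0 h1 hq).1 h')), mul_zero]

theorem integral_coneRegion {θ₀ : ℝ} (h0 : 0 < θ₀) (h1 : θ₀ < Real.pi / 2) {F : E3 → ℝ}
    (hF : AEStronglyMeasurable F (volume.restrict (coneRegion θ₀))) :
    ∫ x in coneRegion θ₀, F x =
      ∫ q in coneRegionDomain θ₀, q.2.1 ^ 2 * Real.sin q.2.2 * F (sph q.2.1 q.2.2 q.1) := by
  have hm := (isOpen_coneRegion θ₀).measurableSet
  rw [← integral_indicator hm, integral_sph ((aestronglyMeasurable_indicator_iff hm).2 hF),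
    setIntegral_congr_fun measurableSet_sphDomain fun q hq => indicator_coneRegion_sph h0 h1 F hq,
    setIntegral_indicator (measurableSet_coneRegionDomain θ₀),
    inter_eq_self_of_subset_right (coneRegionDomain_subset h0)]

theorem integrableOn_coneRegion_iff {θ₀ : ℝ} (h0 : 0 < θ₀) (h1 : θ₀ < Real.pi / 2) {F : E3 → ℝ}
    (hF : AEStronglyMeasurable F (volume.restrict (coneRegion θ₀))) :
    IntegrableOn F (coneRegion θ₀) ↔ IntegrableOn
      (fun q => q.2.1 ^ 2 * Real.sin q.2.2 * F (sph q.2.1 q.2.2 q.1)) (coneRegionDomain θ₀) := by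
  have hm := (isOpen_coneRegion θ₀).measurableSet
  rw [← integrable_indicator_iff hm,
    integrable_sph_iff ((aestronglyMeasurable_indicator_iff hm).2 hF),
    integrableOn_congr_fun (fun q hq => indicator_coneRegion_sph h0 h1 F hq)
      measurableSet_sphDomain, integrableOn_indicator_iff (measurableSet_coneRegionDomain θ₀),
    inter_eq_self_of_subset_left (coneRegionDomain_subset h0)]

theorem measurable_gradient (u : E3 → ℝ) : Measurable (gradient u) :=
  (InnerProductSpace.toDual ℝ E3).symm.continuous.measurable.comp (measurable_fderiv ℝ u)

theorem hasCompactSupport_gradient {ζ : E3 → ℝ} (hc : HasCompactSupport ζ) :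
    HasCompactSupport (gradient ζ) :=
  (hc.fderiv (𝕜 := ℝ)).comp_left (g := (InnerProductSpace.toDual ℝ E3).symm) (map_zero _)

theorem exists_forall_norm_eq_zero {ζ : E3 → ℝ} (hc : HasCompactSupport ζ) :
    ∃ R : ℝ, 0 < R ∧ ∀ x : E3, R ≤ ‖x‖ → ζ x = 0 := by
  obtain ⟨R, hR⟩ := hc.isCompact.isBounded.subset_ball 0
  refine ⟨max R 1, by positivity, fun x hx => image_eq_zero_of_notMem_tsupport fun h => ?_⟩
  have := hR h
  rw [mem_ball_zero_iff] at this
  exact absurd ((le_max_left R 1).trans hx) (not_le.2 this)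

/-- `|x|^{p-2} x` has norm at most one on the unit ball. -/
theorem rpow_sub_two_mul_le {p r : ℝ} (hp : 1 < p) (h0 : 0 ≤ r) (h1 : r ≤ 1) :
    r ^ (p - 2) * r ≤ 1 := by
  rcases h0.eq_or_lt with rfl | h
  · simp
  · rw [← Real.rpow_add_one h.ne']
    exact Real.rpow_le_one h0 h1 (by linarith)

/-! ### The flux identity -/

theorem hasDerivAt_sph_radius (ρ θ φ : ℝ) :
    HasDerivAt (fun r => sph r θ φ) (sph 1 θ φ) ρ := by
  refine hasDerivAt_E3 fun i => ?_
  fin_cases i <;> simp [sph]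
  · simpa using ((hasDerivAt_id ρ).mul_const (Real.sin θ)).mul_const (Real.cos φ)
  · simpa using ((hasDerivAt_id ρ).mul_const (Real.sin θ)).mul_const (Real.sin φ)
  · simpa using (hasDerivAt_id ρ).mul_const (Real.cos θ)

theorem contDiff_sph_slice (φ : ℝ) : ContDiff ℝ ∞ fun q : ℝ × ℝ => sph q.1 q.2 φ := by
  unfold sph
  refine (PiLp.contDiff_toLp (p := 2)).comp (contDiff_pi.2 fun i => ?_)
  fin_cases i <;> simp <;> fun_prop

namespace ConeProfile
variable {p θ₀ : ℝ} {g : ℝ → ℝ}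

/-- The flux identity in a meridian half plane. -/
theorem planar_flux (h : ConeProfile p θ₀ g) {Z : ℝ × ℝ → ℝ} (hZ : ContDiff ℝ 1 Z) {R : ℝ}
    (hR : 0 < R) (hZR : ∀ ρ θ, R ≤ ρ → Z (ρ, θ) = 0) :
    ∫ q in Ioi 0 ×ˢ Ioo θ₀ (Real.pi - θ₀), (q.1 ^ 2 * (pWeight p g q.2 * g q.2 * Real.sin q.2) *
        fderiv ℝ Z q (1, 0) + q.1 * (pWeight p g q.2 * deriv g q.2 * Real.sin q.2) *
        fderiv ℝ Z q (0, 1)) =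
      - ∫ ρ in Ioi (0 : ℝ), Real.sin θ₀ * ρ * (Z (ρ, θ₀) + Z (ρ, Real.pi - θ₀)) := by
  have hpi := Real.pi_pos
  have h1 := h.angle_lt
  have hm := h.mem_angle
  set a : ℝ → ℝ := fun θ => pWeight p g θ * g θ * Real.sin θ with ha
  set b : ℝ → ℝ := fun θ => pWeight p g θ * deriv g θ * Real.sin θ with hb
  have ha' : ∀ θ ∈ Ioo 0 Real.pi, ∃ a', HasDerivAt a a' θ := fun θ hθ =>
    ⟨_, ((h.hasDerivAt_pWeight hθ).mul (h.hasDerivAt θ hθ).differentiableAt.hasDerivAt).mul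
      (Real.hasDerivAt_sin θ)⟩
  have hb' : ∀ θ ∈ Ioo 0 Real.pi, HasDerivAt b (-(2 * a θ)) θ := fun θ hθ => by
    convert! h.hasDerivAt_flux hθ using 1
    simp only [ha]; ring
  have hZd : ∀ q, HasFDerivAt Z (fderiv ℝ Z q) q := fun q =>
    (hZ.differentiable one_ne_zero q).hasFDerivAt
  choose! a' ha' using ha'
  set P : ℝ × ℝ → ℝ := fun q => q.1 ^ 2 * a q.2 * fderiv ℝ Z q (1, 0) +
    q.1 * b q.2 * fderiv ℝ Z q (0, 1) with hP
  have hac : ContinuousOn a (Ioo 0 Real.pi) := fun θ hθ => (ha' θ hθ).continuousAt.continuousWithinAt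
  have hbc : ContinuousOn b (Ioo 0 Real.pi) := fun θ hθ => (hb' θ hθ).continuousAt.continuousWithinAt
  set K : Set (ℝ × ℝ) := Icc ((0 : ℝ), θ₀) (R, Real.pi - θ₀) with hK
  have hKsub : ∀ q ∈ K, q.2 ∈ Ioo 0 Real.pi := fun q hq => h.full_subset ⟨hq.1.2, hq.2.2⟩
  have hac2 : ContinuousOn (fun q : ℝ × ℝ => a q.2) K := hac.comp continuousOn_snd hKsub
  have hbc2 : ContinuousOn (fun q : ℝ × ℝ => b q.2) K := hbc.comp continuousOn_snd hKsub
  have hcf := hZ.continuous_fderiv one_ne_zero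
  have hPc : ContinuousOn P K := by
    have e1 : Continuous fun q => fderiv ℝ Z q (1, 0) := hcf.clm_apply continuous_const
    have e2 : Continuous fun q => fderiv ℝ Z q (0, 1) := hcf.clm_apply continuous_const
    exact (((continuousOn_fst.pow 2).mul hac2).mul e1.continuousOn).add
      ((continuousOn_fst.mul hbc2).mul e2.continuousOn)
  have hae : (Ioo 0 R ×ˢ Ioo θ₀ (Real.pi - θ₀) : Set (ℝ × ℝ)) =ᵐ[volume] K := by
    rw [hK, ← Icc_prod_Icc]
    exact Measure.set_prod_ae_eq Ioo_ae_eq_Icc Ioo_ae_eq_Icc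
  set f' : ℝ × ℝ → ℝ × ℝ →L[ℝ] ℝ := fun q => (q.1 ^ 2 * a q.2) • fderiv ℝ Z q +
    Z q • (q.1 ^ 2 • (a' q.2 • ContinuousLinearMap.snd ℝ ℝ ℝ) +
      a q.2 • ((2 * q.1) • ContinuousLinearMap.fst ℝ ℝ ℝ)) with hf'
  set k' : ℝ × ℝ → ℝ × ℝ →L[ℝ] ℝ := fun q => (q.1 * b q.2) • fderiv ℝ Z q +
    Z q • (q.1 • ((-(2 * a q.2)) • ContinuousLinearMap.snd ℝ ℝ ℝ) +
      b q.2 • ContinuousLinearMap.fst ℝ ℝ ℝ) with hk'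
  -- In the divergence of `(ρ² a Z, ρ b Z)` the terms `2 ρ a Z` and `ρ b' Z` cancel: this is the
  -- equation `b' = -2a`.
  have hval : ∀ q, f' q (1, 0) + k' q (0, 1) = P q := fun q => by
    simp [hf', hk', hP]; ring
  have key := integral_divergence_prod_Icc_of_hasFDerivAt_of_le
    (fun q : ℝ × ℝ => q.1 ^ 2 * a q.2 * Z q) (fun q : ℝ × ℝ => q.1 * b q.2 * Z q) f' k'
    (0, θ₀) (R, Real.pi - θ₀) ⟨hR.le, by show θ₀ ≤ Real.pi - θ₀; linarith⟩
    (((continuousOn_fst.pow 2).mul hac2).mul hZ.continuous.continuousOn)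
    ((continuousOn_fst.mul hbc2).mul hZ.continuous.continuousOn)
    (fun q hq => ?_) (fun q hq => ?_) ?_
  · simp only [hval] at key
    have hLHS : ∫ q in Ioi 0 ×ˢ Ioo θ₀ (Real.pi - θ₀), P q = ∫ q in K, P q := by
      rw [← setIntegral_congr_set hae]
      refine setIntegral_eq_of_subset_of_forall_sdiff_eq_zero
        (measurableSet_Ioi.prod measurableSet_Ioo)
        (prod_mono Ioo_subset_Ioi_self Subset.rfl) (fun q hq => ?_)
      have hq1 : R ≤ q.1 := by
        by_contra hlt
        exact hq.2 ⟨⟨hq.1.1, not_le.1 hlt⟩, hq.1.2⟩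
      have : fderiv ℝ Z q = 0 := by
        have hmax : ∀ ρ θ, R ≤ ρ → Z (ρ, θ) = 0 := hZR
        -- On the edge `ρ = R` the derivative vanishes by continuity, being zero for all larger `ρ`.
        rcases hq1.eq_or_lt with e | e
        · have hcl : q ∈ closure {q : ℝ × ℝ | R < q.1} := by
            have : closure (Ioi R ×ˢ (univ : Set ℝ)) = Ici R ×ˢ univ := by
              rw [closure_prod_eq, closure_Ioi, closure_univ]
            have e3 : {q : ℝ × ℝ | R < q.1} = Ioi R ×ˢ univ := by ext; simp
            rw [e3, this]
            exact ⟨hq1, mem_univ _⟩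
          have hcl2 : closure {q : ℝ × ℝ | R < q.1} ⊆ {q | fderiv ℝ Z q = 0} := by
            refine closure_minimal (fun q' hq' => ?_) (isClosed_eq hcf continuous_const)
            have : Z =ᶠ[𝓝 q'] fun _ => 0 := by
              filter_upwards [(isOpen_lt continuous_const continuous_fst).mem_nhds hq'] with q'' h''
              exact hZR q''.1 q''.2 (le_of_lt h'')
            show fderiv ℝ Z q' = 0
            rw [this.fderiv_eq]; simp
          exact hcl2 hcl
        · have : Z =ᶠ[𝓝 q] fun _ => 0 := by
            filter_upwards [(isOpen_lt continuous_const continuous_fst).mem_nhds e] with q'' h''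
            exact hZR q''.1 q''.2 (le_of_lt h'')
          rw [this.fderiv_eq]; simp
      simp [hP, this]
    rw [hLHS, key]
    have hb0 : b θ₀ = Real.sin θ₀ := by simp [hb, h.pWeight_zero, h.one]
    have hb1 : b (Real.pi - θ₀) = - Real.sin θ₀ := by
      simp [hb, h.pWeight_reflect hm, h.pWeight_zero, h.deriv_reflect hm, h.one]
    have hRHS : ∫ ρ in Ioi (0 : ℝ), Real.sin θ₀ * ρ * (Z (ρ, θ₀) + Z (ρ, Real.pi - θ₀)) =
        ∫ ρ in (0 : ℝ)..R, Real.sin θ₀ * ρ * (Z (ρ, θ₀) + Z (ρ, Real.pi - θ₀)) := by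
      rw [intervalIntegral.integral_of_le hR.le]
      refine setIntegral_eq_of_subset_of_forall_sdiff_eq_zero measurableSet_Ioi Ioc_subset_Ioi_self
        (fun ρ hρ => ?_)
      have : R ≤ ρ := by
        by_contra hlt
        exact hρ.2 ⟨hρ.1, (not_le.1 hlt).le⟩
      rw [hZR _ _ this, hZR _ _ this]; simp
    rw [hRHS]
    have hc1 : ∀ θ, Continuous fun ρ => Z (ρ, θ) := fun θ => hZ.continuous.comp (by fun_prop)
    simp only [hb0, hb1, hZR R _ le_rfl]
    rw [← intervalIntegral.integral_sub, ← intervalIntegral.integral_neg]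
    · simp only [mul_zero, intervalIntegral.integral_zero, add_zero, sub_zero, zero_pow two_ne_zero,
        zero_mul]
      congr 1
      ext ρ
      ring
    · exact (Continuous.intervalIntegrable (by have := hc1 (Real.pi - θ₀); fun_prop) _ _)
    · exact (Continuous.intervalIntegrable (by have := hc1 θ₀; fun_prop) _ _)
  · have hq2 := hKsub q ⟨⟨hq.1.1.le, hq.2.1.le⟩, ⟨hq.1.2.le, hq.2.2.le⟩⟩
    have e1 : HasFDerivAt (fun q : ℝ × ℝ => q.1 ^ 2) ((2 * q.1) • ContinuousLinearMap.fst ℝ ℝ ℝ) q := by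
      have := (hasDerivAt_pow 2 q.1).comp_hasFDerivAt q (f := Prod.fst)
        (hasFDerivAt_fst (𝕜 := ℝ) (E := ℝ) (F := ℝ))
      simpa using! this
    have e2 := (ha' _ hq2).comp_hasFDerivAt q (f := Prod.snd)
      (hasFDerivAt_snd (𝕜 := ℝ) (E := ℝ) (F := ℝ))
    exact (e1.mul e2).mul (hZd q)
  · have hq2 := hKsub q ⟨⟨hq.1.1.le, hq.2.1.le⟩, ⟨hq.1.2.le, hq.2.2.le⟩⟩
    have e2 := (hb' _ hq2).comp_hasFDerivAt q (f := Prod.snd)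
      (hasFDerivAt_snd (𝕜 := ℝ) (E := ℝ) (F := ℝ))
    exact ((hasFDerivAt_fst (𝕜 := ℝ) (E := ℝ) (F := ℝ)).mul e2).mul (hZd q)
  · simp only [hval]
    exact hPc.integrableOn_compact isCompact_Icc

theorem integrable_flux (h : ConeProfile p θ₀ g) {ζ : E3 → ℝ} (hζ : ContDiff ℝ 1 ζ)
    (hc : HasCompactSupport ζ) :
    Integrable fun x => ‖gradient (coneFun g θ₀) x‖ ^ (p - 2) *
      ⟪gradient (coneFun g θ₀) x, gradient ζ x⟫ := by
  have hi : Integrable fun x => ‖gradient ζ x‖ :=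
    ((continuous_gradient hζ).integrable_of_hasCompactSupport (hasCompactSupport_gradient hc)).norm
  refine hi.mono' ?_ (Eventually.of_forall fun x => ?_)
  · exact (((measurable_gradient _).norm.pow_const _).mul
      ((measurable_gradient _).inner (measurable_gradient ζ))).aestronglyMeasurable
  · rw [norm_mul, Real.norm_of_nonneg (by positivity)]
    have h1 := h.norm_gradient_coneFun_le x
    calc _ ≤ ‖gradient (coneFun g θ₀) x‖ ^ (p - 2) *
          (‖gradient (coneFun g θ₀) x‖ * ‖gradient ζ x‖) :=
          mul_le_mul_of_nonneg_left (norm_inner_le_norm _ _) (by positivity)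
      _ = (‖gradient (coneFun g θ₀) x‖ ^ (p - 2) * ‖gradient (coneFun g θ₀) x‖) *
          ‖gradient ζ x‖ := by ring
      _ ≤ 1 * ‖gradient ζ x‖ := mul_le_mul_of_nonneg_right
          (rpow_sub_two_mul_le h.one_lt (norm_nonneg _) h1) (norm_nonneg _)
      _ = _ := one_mul _

/-- For each fixed `φ` the bulk integral in spherical coordinates is the planar integral of
`planar_flux` for `ζ` restricted to that half plane; its edge terms are the area densities `sin θ₀
ρ` of the two nappes. -/
theorem integral_flux (h : ConeProfile p θ₀ g) {ζ : E3 → ℝ} (hζ : ContDiff ℝ 1 ζ)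
    (hc : HasCompactSupport ζ) :
    - ∫ x, ‖gradient (coneFun g θ₀) x‖ ^ (p - 2) *
        ⟪gradient (coneFun g θ₀) x, gradient ζ x⟫ =
      (∫ x in coneSurface θ₀, ζ x ∂(μHE[2])) +
        ∫ x in coneSurface (Real.pi - θ₀), ζ x ∂(μHE[2]) := by
  have hpi := Real.pi_pos
  have h0 := h.angle_pos
  have h1 := h.angle_lt
  have hm := h.mem_angle
  have hs0 := sin_pos_of_mem hm
  have hs1 : Real.sin θ₀ < 1 := by
    have : 0 < Real.cos θ₀ := Real.cos_pos_of_mem_Ioo ⟨by linarith, h1⟩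
    nlinarith [Real.sin_sq_add_cos_sq θ₀]
  have hs0' : 0 < Real.sin (Real.pi - θ₀) := by rwa [Real.sin_pi_sub]
  have hs1' : Real.sin (Real.pi - θ₀) < 1 := by rwa [Real.sin_pi_sub]
  have hζm : ∀ μ : Measure E3, AEStronglyMeasurable ζ μ := fun μ =>
    hζ.continuous.aestronglyMeasurable
  obtain ⟨R, hR, hζR⟩ := exists_forall_norm_eq_zero hc
  set F : E3 → ℝ := fun x => ‖gradient (coneFun g θ₀) x‖ ^ (p - 2) *
      ⟪gradient (coneFun g θ₀) x, gradient ζ x⟫ with hF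
  have hFi : Integrable F := h.integrable_flux hζ hc
  have hF0 : ∀ x ∉ coneRegion θ₀, F x = 0 := fun x hx => by
    simp [hF, h.gradient_coneFun_of_not_mem hx]
  -- the boundary terms
  have hbd : ∀ θ : ℝ, IntegrableOn (fun q : ℝ × ℝ => Real.sin θ₀ * q.2 * ζ (sph q.2 θ q.1))
      coneDomain := by
    intro θ
    have hcont : Continuous fun q : ℝ × ℝ => Real.sin θ₀ * q.2 * ζ (sph q.2 θ q.1) := by
      have := hζ.continuous.comp (continuous_coneMap θ)
      exact (continuous_const.mul continuous_snd).mul this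
    have hK : IntegrableOn (fun q : ℝ × ℝ => Real.sin θ₀ * q.2 * ζ (sph q.2 θ q.1))
        (Icc (-Real.pi) Real.pi ×ˢ Icc 0 R) :=
      hcont.continuousOn.integrableOn_compact (isCompact_Icc.prod isCompact_Icc)
    refine hK.of_forall_sdiff_eq_zero measurableSet_coneDomain fun q hq => ?_
    have hq2 : 0 < q.2 := hq.1.2
    have : R ≤ q.2 := by
      by_contra hlt
      exact hq.2 ⟨Ioc_subset_Icc_self hq.1.1, hq2.le, (not_le.1 hlt).le⟩
    rw [hζR _ (by rwa [norm_sph hq2.le]), mul_zero]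
  rw [integral_coneSurface hs0 hs1 (hζm _), integral_coneSurface hs0' hs1' (hζm _)]
  simp only [Real.sin_pi_sub]
  have hsum : IntegrableOn (fun q : ℝ × ℝ => Real.sin θ₀ * q.2 * ζ (sph q.2 θ₀ q.1) +
      Real.sin θ₀ * q.2 * ζ (sph q.2 (Real.pi - θ₀) q.1)) coneDomain :=
    (hbd θ₀).add (hbd (Real.pi - θ₀))
  rw [← integral_add (hbd θ₀) (hbd (Real.pi - θ₀)), coneDomain, Measure.volume_eq_prod,
    setIntegral_prod _ hsum, integral_Ioc_eq_integral_Ioo]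
  -- the bulk term
  rw [← setIntegral_eq_integral_of_forall_compl_eq_zero hF0,
    integral_coneRegion h0 h1 hFi.aestronglyMeasurable.restrict, coneRegionDomain,
    Measure.volume_eq_prod, setIntegral_prod _
      ((integrableOn_coneRegion_iff h0 h1 hFi.aestronglyMeasurable.restrict).1 hFi.integrableOn),
    ← integral_neg]
  refine integral_congr_ae (Eventually.of_forall fun φ => ?_)
  set Z : ℝ × ℝ → ℝ := fun q => ζ (sph q.1 q.2 φ) with hZ
  have hsl : ContDiff ℝ 1 fun q : ℝ × ℝ => sph q.1 q.2 φ :=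
    (contDiff_sph_slice φ).of_le (by exact_mod_cast le_top)
  have hZc : ContDiff ℝ 1 Z := hζ.comp hsl
  have hZR : ∀ ρ θ, R ≤ ρ → Z (ρ, θ) = 0 := fun ρ θ hρ =>
    hζR _ (by rwa [norm_sph (hR.le.trans hρ)])
  have key := h.planar_flux hZc hR hZR
  have hr : ∫ ρ in Ioi (0 : ℝ), (Real.sin θ₀ * ρ * ζ (sph ρ θ₀ φ) +
      Real.sin θ₀ * ρ * ζ (sph ρ (Real.pi - θ₀) φ)) =
      ∫ ρ in Ioi (0 : ℝ), Real.sin θ₀ * ρ * (Z (ρ, θ₀) + Z (ρ, Real.pi - θ₀)) := by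
    simp only [hZ, mul_add]
  show - _ = ∫ ρ in Ioi (0 : ℝ), (Real.sin θ₀ * ρ * ζ (sph ρ θ₀ φ) +
      Real.sin θ₀ * ρ * ζ (sph ρ (Real.pi - θ₀) φ))
  rw [hr, ← neg_eq_iff_eq_neg.2 key, neg_inj]
  refine setIntegral_congr_fun (measurableSet_Ioi.prod measurableSet_Ioo) fun q hq => ?_
  have hq1 : 0 < q.1 := hq.1
  have hq2 : q.2 ∈ Ioo 0 Real.pi := h.full_subset (Ioo_subset_Icc_self hq.2)
  have hE : sph q.1 q.2 φ ∈ coneRegion θ₀ := h.mem_iff.2 ⟨sph_ne_zero hq1 _ _, by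
    rw [polarAngle_sph hq1 (Ioo_subset_Icc_self hq2)]; exact hq.2⟩
  have hd := ((hζ.differentiable one_ne_zero (sph q.1 q.2 φ)).hasFDerivAt.comp q
    (hsl.differentiable one_ne_zero q).hasFDerivAt).fderiv
  have d1 : fderiv ℝ (fun q : ℝ × ℝ => sph q.1 q.2 φ) q (1, 0) = sph 1 q.2 φ := by
    have e := (hsl.differentiable one_ne_zero q).hasFDerivAt.comp_hasDerivAt q.1
      ((hasDerivAt_id q.1).prodMk (hasDerivAt_const q.1 q.2))
    exact e.unique (hasDerivAt_sph_radius q.1 q.2 φ)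
  have d2 : fderiv ℝ (fun q : ℝ × ℝ => sph q.1 q.2 φ) q (0, 1) =
      q.1 • angularVec (sph q.1 q.2 φ) := by
    have e := (hsl.differentiable one_ne_zero q).hasFDerivAt.comp_hasDerivAt q.2
      ((hasDerivAt_const q.2 q.1).prodMk (hasDerivAt_id q.2))
    exact e.unique (hasDerivAt_sph_angle hq1 hq2 φ)
  have hd1 : fderiv ℝ Z q (1, 0) = ⟪sph 1 q.2 φ, gradient ζ (sph q.1 q.2 φ)⟫ := by
    rw [real_inner_comm, inner_gradient_eq, ← d1]
    exact congrArg (fun T => T (1, 0)) hd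
  have hd2 : fderiv ℝ Z q (0, 1) = q.1 * ⟪angularVec (sph q.1 q.2 φ), gradient ζ (sph q.1 q.2 φ)⟫ := by
    rw [real_inner_comm, inner_gradient_eq, ← smul_eq_mul, ← map_smul, ← d2]
    exact congrArg (fun T => T (0, 1)) hd
  rw [hd1, hd2]
  simp only [hF]
  rw [h.norm_rpow_gradient_coneFun hE, h.gradient_coneFun hE, polarVec,
    polarAngle_sph hq1 (Ioo_subset_Icc_self hq2), radialVec_sph hq1, inner_add_left,
    inner_smul_left, inner_smul_left]
  simp
  ring

end ConeProfile

end

noncomputable section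

/-! ### Lipschitz functions and mollification -/

theorem LipschitzWith.norm_gradient_le {L : NNReal} {w : E3 → ℝ} (hw : LipschitzWith L w) (x : E3) :
    ‖gradient w x‖ ≤ L := by
  rw [norm_gradient_eq]; exact norm_fderiv_le_of_lipschitz ℝ hw

theorem LipschitzWith.locallyIntegrable_gradient {L : NNReal} {w : E3 → ℝ} (hw : LipschitzWith L w) :
    LocallyIntegrable (gradient w) := by
  refine (locallyIntegrable_const (L : ℝ)).mono (measurable_gradient w).aestronglyMeasurable
    (Eventually.of_forall fun x => ?_)
  rw [Real.norm_of_nonneg L.coe_nonneg]; exact hw.norm_gradient_le x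

theorem LipschitzWith.ae_lineDeriv_eq {L : NNReal} {w : E3 → ℝ} (hw : LipschitzWith L w) (e : E3) :
    ∀ᵐ x, lineDeriv ℝ w x e = ⟪gradient w x, e⟫ := by
  filter_upwards [hw.ae_differentiableAt (μ := volume)] with x hx
  rw [hx.lineDeriv_eq_fderiv, inner_gradient_eq]

/-- The classical gradient of a Lipschitz function is its weak gradient. -/
theorem LipschitzWith.hasWeakGradientOn {L : NNReal} {w : E3 → ℝ} (hw : LipschitzWith L w)
    (U : Set E3) : HasWeakGradientOn U w (gradient w) := by
  refine ⟨hw.continuous.locallyIntegrable.locallyIntegrableOn U,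
    hw.locallyIntegrable_gradient.locallyIntegrableOn U, fun ζ hζ e => ?_⟩
  obtain ⟨D, hD⟩ := (hζ.1.of_le (by exact_mod_cast le_top) : ContDiff ℝ 1 ζ).lipschitzWith_of_hasCompactSupport
    hζ.2.1 one_ne_zero
  have h1 := hw.integral_lineDeriv_mul_eq (μ := volume) hD hζ.2.1 e
  have h2 : ∫ x, lineDeriv ℝ w x e * ζ x = ∫ x, ζ x * ⟪gradient w x, e⟫ := by
    refine integral_congr_ae ?_
    filter_upwards [hw.ae_lineDeriv_eq e] with x hx
    rw [hx, mul_comm]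
  have h3 : ∀ x, lineDeriv ℝ ζ x (-e) = - fderiv ℝ ζ x e := fun x => by
    rw [((hζ.1.differentiable (by simp)) x).lineDeriv_eq_fderiv, map_neg]
  rw [← h2, h1, ← integral_neg]
  refine integral_congr_ae (Eventually.of_forall fun x => ?_)
  simp only [h3]; ring

theorem LipschitzWith.memW1p {p : ℝ} {L : NNReal} {w : E3 → ℝ} (hw : LipschitzWith L w)
    {U : Set E3} (hU : Bornology.IsBounded U) : MemW1p p U w (gradient w) := by
  obtain ⟨R, hR⟩ := hU.subset_closedBall 0
  have hfin : IsFiniteMeasure (volume.restrict U) :=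
    ⟨by rw [Measure.restrict_apply_univ]; exact hU.measure_lt_top⟩
  refine ⟨?_, ?_, hw.hasWeakGradientOn U⟩
  · refine (memLp_top_of_bound hw.continuous.aestronglyMeasurable (|w 0| + L * R)
      (ae_restrict_of_ae_restrict_of_subset hR
        (ae_restrict_of_forall_mem measurableSet_closedBall fun x hx => ?_))).mono_exponent le_top
    have h1 := hw.dist_le_mul x 0
    rw [Real.dist_eq] at h1
    have h2 : (L : ℝ) * dist x 0 ≤ L * R := mul_le_mul_of_nonneg_left hx L.coe_nonneg
    rw [Real.norm_eq_abs]
    linarith [abs_sub_abs_le_abs_sub (w x) (w 0)]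
  · exact (memLp_top_of_bound (measurable_gradient w).aestronglyMeasurable L
      (Eventually.of_forall hw.norm_gradient_le)).mono_exponent le_top

/-- The gradient of a mollification is the mollification of the gradient. -/
theorem gradient_convolution {L : NNReal} {w : E3 → ℝ} (hw : LipschitzWith L w)
    (φ : ContDiffBump (0 : E3)) (x : E3) :
    gradient (convolution (φ.normed volume) w (ContinuousLinearMap.lsmul ℝ ℝ) volume) x =
      convolution (φ.normed volume) (gradient w) (ContinuousLinearMap.lsmul ℝ ℝ) volume x := by
  set k : E3 → ℝ := φ.normed volume with hk
  have hki : Integrable k := φ.integrable_normed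
  have hkc : Continuous k := φ.continuous_normed
  have hkn : ∀ t, 0 ≤ k t := φ.nonneg_normed
  have hdiff : DifferentiableAt ℝ (convolution k w (ContinuousLinearMap.lsmul ℝ ℝ) volume) x :=
    ((φ.hasCompactSupport_normed.contDiff_convolution_left (n := 1) (ContinuousLinearMap.lsmul ℝ ℝ)
      φ.contDiff_normed hw.continuous.locallyIntegrable).differentiable one_ne_zero) x
  have hGi : Integrable fun t => k t • gradient w (x - t) := by
    refine (hki.mul_const (L : ℝ)).mono' (hkc.aestronglyMeasurable.smul
      ((measurable_gradient w).comp (measurable_const.sub measurable_id)).aestronglyMeasurable)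
      (Eventually.of_forall fun t => ?_)
    rw [norm_smul, Real.norm_of_nonneg (hkn t)]
    exact mul_le_mul_of_nonneg_left (hw.norm_gradient_le _) (hkn t)
  refine ext_inner_right ℝ fun e => ?_
  rw [inner_gradient_eq, convolution_lsmul, real_inner_comm, ← integral_inner hGi]
  -- differentiate along the line in direction `e`
  have hmp : MeasurePreserving (fun t : E3 => x - t) := Measure.measurePreserving_sub_left volume x
  have hae : ∀ᵐ t, DifferentiableAt ℝ w (x - t) :=
    hmp.quasiMeasurePreserving.ae (hw.ae_differentiableAt (μ := volume))
  have hint : Integrable fun t => k t * w (x - t) :=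
    (hkc.mul (hw.continuous.comp (continuous_const.sub continuous_id))).integrable_of_hasCompactSupport
      φ.hasCompactSupport_normed.mul_right
  -- Differentiation under the integral along the line `x + s e` needs only the Lipschitz bound and,
  -- by Rademacher, differentiability of `w` at almost every `x - t`.
  have key := (hasDerivAt_integral_of_dominated_loc_of_lip (μ := volume) (s := univ) (x₀ := (0 : ℝ))
    (F := fun s t => k t * w (x + s • e - t)) (F' := fun t => k t * fderiv ℝ w (x - t) e)
    (bound := fun t => k t * (L * ‖e‖)) univ_mem
    (Eventually.of_forall fun s => (hkc.mul (hw.continuous.comp (by fun_prop))).aestronglyMeasurable)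
    (by simpa using hint)
    (hkc.aestronglyMeasurable.mul ((measurable_fderiv_apply_const ℝ w e).comp
      (measurable_const.sub measurable_id)).aestronglyMeasurable)
    (Eventually.of_forall fun t => ?_) (hki.mul_const _) ?_).2
  · have h1 : HasDerivAt (fun s : ℝ => convolution k w (ContinuousLinearMap.lsmul ℝ ℝ) volume (x + s • e))
        (fderiv ℝ (convolution k w (ContinuousLinearMap.lsmul ℝ ℝ) volume) x e) 0 := by
      have hl : HasDerivAt (fun s : ℝ => x + s • e) e 0 := by
        simpa using ((hasDerivAt_id (0 : ℝ)).smul_const e).const_add x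
      have hd' : HasFDerivAt (convolution k w (ContinuousLinearMap.lsmul ℝ ℝ) volume)
          (fderiv ℝ (convolution k w (ContinuousLinearMap.lsmul ℝ ℝ) volume) x) (x + (0 : ℝ) • e) := by
        simpa using hdiff.hasFDerivAt
      exact hd'.comp_hasDerivAt (0 : ℝ) hl
    rw [h1.unique key]
    refine integral_congr_ae (Eventually.of_forall fun t => ?_)
    simp only [inner_smul_right]
    rw [real_inner_comm, inner_gradient_eq]
  · refine LipschitzWith.lipschitzOnWith (LipschitzWith.of_dist_le_mul fun s s' => ?_)
    have := hw.dist_le_mul (x + s • e - t) (x + s' • e - t)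
    have e1 : dist (x + s • e - t) (x + s' • e - t) = |s - s'| * ‖e‖ := by
      rw [dist_eq_norm, show x + s • e - t - (x + s' • e - t) = (s - s') • e by module, norm_smul,
        Real.norm_eq_abs]
    rw [e1, Real.dist_eq] at this
    have hb : 0 ≤ k t * (L * ‖e‖) := mul_nonneg (hkn t) (by positivity)
    rw [Real.coe_nnabs, abs_of_nonneg hb, Real.dist_eq, ← mul_sub, abs_mul, abs_of_nonneg (hkn t),
      Real.dist_eq]
    calc _ ≤ k t * (L * (|s - s'| * ‖e‖)) := mul_le_mul_of_nonneg_left this (hkn t)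
      _ = _ := by ring
  · filter_upwards [hae] with t ht
    refine HasDerivAt.const_mul _ ?_
    have hl : HasDerivAt (fun s : ℝ => x + s • e - t) e 0 := by
      simpa using (((hasDerivAt_id (0 : ℝ)).smul_const e).const_add x).sub_const t
    have hd' : HasFDerivAt w (fderiv ℝ w (x - t)) (x + (0 : ℝ) • e - t) := by
      simpa using ht.hasFDerivAt
    exact hd'.comp_hasDerivAt (0 : ℝ) hl

/-- Mollification of a compactly supported Lipschitz function. -/
theorem exists_mollification {L : NNReal} {w : E3 → ℝ} (hw : LipschitzWith L w)
    (hc : HasCompactSupport w) {U : Set E3} (hU : IsOpen U) (hsub : tsupport w ⊆ U) :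
    ∃ ζ : ℕ → E3 → ℝ, (∀ k, IsTestFunction U (ζ k)) ∧
      (∃ R : ℝ, 0 < R ∧ ∀ k x, R ≤ ‖x‖ → ζ k x = 0) ∧ (∀ k x, ‖gradient (ζ k) x‖ ≤ L) ∧
      (∀ k x, |ζ k x - w x| ≤ L) ∧ (∀ x, Tendsto (fun k => ζ k x) atTop (𝓝 (w x))) ∧
      ∀ᵐ x, Tendsto (fun k => gradient (ζ k) x) atTop (𝓝 (gradient w x)) := by
  obtain ⟨δ', hδ', hsubδ'⟩ := hc.isCompact.exists_cthickening_subset_open hU hsub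
  -- The cap at 1 turns the error `L δ` into the uniform bound `L`.
  set δ := min δ' 1 with hδdef
  have hδ : 0 < δ := by positivity
  have hsubδ : Metric.cthickening δ (tsupport w) ⊆ U :=
    (Metric.cthickening_mono (min_le_left _ _) _).trans hsubδ'
  have hpos : ∀ k : ℕ, 0 < δ / (k + 1) := fun k => by positivity
  -- Keeping the inner radius half of the outer one makes the kernels comparable with averages over
  -- balls, so that Lebesgue differentiation applies to the merely measurable gradient.
  let φ : ℕ → ContDiffBump (0 : E3) := fun k =>
    ⟨δ / (k + 1) / 2, δ / (k + 1), half_pos (hpos k), half_lt_self (hpos k)⟩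
  have hr : ∀ k, (φ k).rOut = δ / (k + 1) := fun k => rfl
  have hrδ : ∀ k, (φ k).rOut ≤ δ := fun k => by
    rw [hr]; exact div_le_self hδ.le (by linarith [(Nat.cast_nonneg k : (0 : ℝ) ≤ k)])
  have hr0 : Tendsto (fun k => (φ k).rOut) atTop (𝓝 0) := by
    simp only [hr]
    have := (tendsto_one_div_add_atTop_nhds_zero_nat (𝕜 := ℝ)).const_mul δ
    simpa [div_eq_mul_inv] using this
  set ζ : ℕ → E3 → ℝ := fun k =>
    convolution ((φ k).normed volume) w (ContinuousLinearMap.lsmul ℝ ℝ) volume with hζ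
  have hts : ∀ k, tsupport (ζ k) ⊆ Metric.cthickening δ (tsupport w) := by
    intro k
    refine closure_minimal ?_ Metric.isClosed_cthickening
    refine (support_convolution_subset _).trans ?_
    rw [(φ k).support_normed_eq]
    rintro _ ⟨a, ha, b, hb, rfl⟩
    refine Metric.mem_cthickening_of_dist_le _ b _ _ (subset_tsupport _ hb) ?_
    rw [dist_eq_norm, add_sub_cancel_right]
    exact (mem_ball_zero_iff.1 ha).le.trans (hrδ k)
  have hKc : IsCompact (Metric.cthickening δ (tsupport w)) := hc.isCompact.cthickening
  have hcs : ∀ k, HasCompactSupport (ζ k) := fun k =>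
    hKc.of_isClosed_subset (isClosed_tsupport _) (hts k)
  have hsm : ∀ k, ContDiff ℝ ∞ (ζ k) := fun k =>
    (φ k).hasCompactSupport_normed.contDiff_convolution_left _ (φ k).contDiff_normed
      hw.continuous.locallyIntegrable
  have hdist : ∀ k x, |ζ k x - w x| ≤ L * (φ k).rOut := by
    intro k x
    rw [← Real.dist_eq]
    refine (φ k).dist_normed_convolution_le hw.continuous.aestronglyMeasurable fun y hy => ?_
    exact (hw.dist_le_mul y x).trans (mul_le_mul_of_nonneg_left (le_of_lt hy) L.coe_nonneg)
  refine ⟨ζ, fun k => ⟨hsm k, hcs k, (hts k).trans hsubδ⟩, ?_, fun k x => ?_, fun k x => ?_,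
    fun x => ?_, ?_⟩
  · obtain ⟨R, hR⟩ := hKc.isBounded.subset_ball 0
    refine ⟨max R 1, by positivity, fun k x hx => image_eq_zero_of_notMem_tsupport fun h => ?_⟩
    have := hR (hts k h)
    rw [mem_ball_zero_iff] at this
    exact absurd ((le_max_left R 1).trans hx) (not_le.2 this)
  · rw [hζ, gradient_convolution hw, convolution_lsmul]
    have h1 : ∀ t, ‖(φ k).normed volume t • gradient w (x - t)‖ ≤ (φ k).normed volume t * L := by
      intro t
      rw [norm_smul, Real.norm_of_nonneg ((φ k).nonneg_normed t)]
      exact mul_le_mul_of_nonneg_left (hw.norm_gradient_le _) ((φ k).nonneg_normed t)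
    refine (norm_integral_le_of_norm_le ((φ k).integrable_normed.mul_const (L : ℝ))
      (Eventually.of_forall h1)).trans_eq ?_
    rw [integral_mul_const, (φ k).integral_normed, one_mul]
  · refine (hdist k x).trans (mul_le_of_le_one_right L.coe_nonneg ((hrδ k).trans (min_le_right _ _)))
  · rw [tendsto_iff_dist_tendsto_zero]
    refine squeeze_zero (fun _ => dist_nonneg) (fun k => ?_)
      (by simpa using hr0.const_mul (L : ℝ))
    rw [Real.dist_eq]; exact hdist k x
  · filter_upwards [ContDiffBump.ae_convolution_tendsto_right_of_locallyIntegrable (φ := φ)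
      (K := 2) (μ := volume) hr0 (Eventually.of_forall fun k => by
        show δ / (k + 1) ≤ 2 * (δ / (k + 1) / 2); linarith)
      hw.locallyIntegrable_gradient] with x hx
    refine hx.congr fun k => ?_
    rw [hζ, gradient_convolution hw]

/-- The area density is proportional to `ρ`, so a singularity `1/|x|` at the vertex is harmless;
this covers the curvature term. -/
theorem integrableOn_coneSurface_of_bound {θ : ℝ} (hs0 : 0 < Real.sin θ) (hs1 : Real.sin θ < 1)
    {F : E3 → ℝ} (hF : Measurable F) {C R : ℝ} (hb : ∀ x, |F x| * ‖x‖ ≤ C)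
    (h0 : ∀ x, R ≤ ‖x‖ → F x = 0) : IntegrableOn F (coneSurface θ) (μHE[2]) := by
  rw [integrableOn_coneSurface_iff hs0 hs1 hF.aestronglyMeasurable]
  have hm : Measurable fun q : ℝ × ℝ => Real.sin θ * q.2 * F (sph q.2 θ q.1) :=
    (measurable_const.mul measurable_snd).mul (hF.comp (continuous_coneMap θ).measurable)
  have hfin : volume (Ioc (-Real.pi) Real.pi ×ˢ Ioc 0 R) < ⊤ := by
    rw [Measure.volume_eq_prod, Measure.prod_prod]
    exact ENNReal.mul_lt_top (by simp) (by simp)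
  have hK : IntegrableOn (fun q : ℝ × ℝ => Real.sin θ * q.2 * F (sph q.2 θ q.1))
      (Ioc (-Real.pi) Real.pi ×ˢ Ioc 0 R) := by
    refine Measure.integrableOn_of_bounded (M := C) hfin.ne hm.aestronglyMeasurable
      (ae_restrict_of_forall_mem (measurableSet_Ioc.prod measurableSet_Ioc) fun q hq => ?_)
    have hq2 : 0 < q.2 := hq.2.1
    have := hb (sph q.2 θ q.1)
    rw [norm_sph hq2.le] at this
    rw [norm_mul, norm_mul, Real.norm_of_nonneg hs0.le, Real.norm_of_nonneg hq2.le, Real.norm_eq_abs]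
    have h3 : 0 ≤ |F (sph q.2 θ q.1)| * q.2 := by positivity
    nlinarith
  refine hK.of_forall_sdiff_eq_zero measurableSet_coneDomain fun q hq => ?_
  have hq2 : 0 < q.2 := hq.1.2
  have : R ≤ q.2 := by
    by_contra hlt
    exact hq.2 ⟨hq.1.1, hq2, (not_le.1 hlt).le⟩
  rw [h0 _ (by rwa [norm_sph hq2.le]), mul_zero]

theorem exists_bound_of_hasCompactSupport {w : E3 → ℝ} (hw : Continuous w) (hc : HasCompactSupport w) :
    ∃ C : ℝ, 0 ≤ C ∧ ∀ x, |w x| ≤ C := by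
  obtain ⟨C, hC⟩ := hc.exists_bound_of_continuous hw
  exact ⟨C, (norm_nonneg _).trans (hC 0), hC⟩

/-! ### The flux against Lipschitz functions and a bound for level layers. -/

namespace ConeProfile
variable {p θ₀ : ℝ} {g : ℝ → ℝ}

theorem sin_lt_one (h : ConeProfile p θ₀ g) : Real.sin θ₀ < 1 := by
  have : 0 < Real.cos θ₀ := Real.cos_pos_of_mem_Ioo
    ⟨by linarith [Real.pi_pos, h.angle_pos], h.angle_lt⟩
  nlinarith [Real.sin_sq_add_cos_sq θ₀]

theorem sin_pos (h : ConeProfile p θ₀ g) : 0 < Real.sin θ₀ := sin_pos_of_mem h.mem_angle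

/-- Since `|∇u| ≤ 1` and `p > 1`, `|∇u|^(p-1) ≤ 1`. The factor `|∇u|^(p-2)` is not estimated alone,
as the exponent may be negative. -/
theorem norm_flux_le (h : ConeProfile p θ₀ g) (x v : E3) :
    |‖gradient (coneFun g θ₀) x‖ ^ (p - 2) * ⟪gradient (coneFun g θ₀) x, v⟫| ≤ ‖v‖ := by
  rw [abs_mul, abs_of_nonneg (by positivity)]
  have h1 := h.norm_gradient_coneFun_le x
  calc _ ≤ ‖gradient (coneFun g θ₀) x‖ ^ (p - 2) *
        (‖gradient (coneFun g θ₀) x‖ * ‖v‖) :=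
        mul_le_mul_of_nonneg_left (abs_real_inner_le_norm _ _) (by positivity)
    _ = (‖gradient (coneFun g θ₀) x‖ ^ (p - 2) * ‖gradient (coneFun g θ₀) x‖) * ‖v‖ := by ring
    _ ≤ 1 * ‖v‖ := mul_le_mul_of_nonneg_right
        (rpow_sub_two_mul_le h.one_lt (norm_nonneg _) h1) (norm_nonneg _)
    _ = _ := one_mul _

theorem aestronglyMeasurable_flux (u ζ : E3 → ℝ) : AEStronglyMeasurable (fun x =>
    ‖gradient u x‖ ^ (p - 2) * ⟪gradient u x, gradient ζ x⟫) :=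
  (((measurable_gradient _).norm.pow_const _).mul
      ((measurable_gradient _).inner (measurable_gradient ζ))).aestronglyMeasurable

/-- Mollify and pass to the limit by dominated convergence. Almost everywhere convergence of the
gradients is enough in the bulk, but on the cone, a null set for the volume, pointwise convergence
of the functions everywhere is used. -/
theorem integral_flux_lipschitz (h : ConeProfile p θ₀ g) {L : NNReal} {w : E3 → ℝ}
    (hw : LipschitzWith L w) (hc : HasCompactSupport w) :
    - ∫ x, ‖gradient (coneFun g θ₀) x‖ ^ (p - 2) *
        ⟪gradient (coneFun g θ₀) x, gradient w x⟫ =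
      (∫ x in coneSurface θ₀, w x ∂(μHE[2])) +
        ∫ x in coneSurface (Real.pi - θ₀), w x ∂(μHE[2]) := by
  obtain ⟨ζ, hζ, ⟨R, hR, hζR⟩, hζL, hζw, hζt, hζg⟩ :=
    exists_mollification hw hc isOpen_univ (subset_univ _)
  obtain ⟨C, hC0, hC⟩ := exists_bound_of_hasCompactSupport hw.continuous hc
  have hbound : ∀ k x, |ζ k x| ≤ C + L := fun k x => by
    have := abs_sub_abs_le_abs_sub (ζ k x) (w x)
    linarith [hζw k x, hC x]
  set D : E3 → ℝ := (Metric.ball 0 R).indicator fun _ => C + L with hD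
  have hDm : Measurable D := measurable_const.indicator measurableSet_ball
  have hDb : ∀ k x, ‖ζ k x‖ ≤ D x := fun k x => by
    by_cases hx : x ∈ Metric.ball (0 : E3) R
    · rw [hD, indicator_of_mem hx]; exact hbound k x
    · rw [hζR k x (by simpa using hx), norm_zero]
      exact indicator_nonneg (fun _ _ => by positivity) x
  have hDi : ∀ θ, 0 < Real.sin θ → Real.sin θ < 1 → IntegrableOn D (coneSurface θ) (μHE[2]) := by
    intro θ a b
    refine integrableOn_coneSurface_of_bound a b hDm (C := (C + L) * R) (R := R) (fun x => ?_)
      (fun x hx => indicator_of_notMem (by simpa using hx) _)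
    by_cases hx : x ∈ Metric.ball (0 : E3) R
    · rw [hD, indicator_of_mem hx, abs_of_nonneg (by positivity)]
      exact mul_le_mul_of_nonneg_left (mem_ball_zero_iff.1 hx).le (by positivity)
    · rw [hD, indicator_of_notMem hx, abs_zero, zero_mul]; positivity
  have hS : ∀ θ, 0 < Real.sin θ → Real.sin θ < 1 →
      Tendsto (fun k => ∫ x in coneSurface θ, ζ k x ∂(μHE[2])) atTop
        (𝓝 (∫ x in coneSurface θ, w x ∂(μHE[2]))) := fun θ a b =>
    tendsto_integral_of_dominated_convergence D
      (fun k => (hζ k).1.continuous.aestronglyMeasurable) (hDi θ a b)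
      (fun k => Eventually.of_forall (hDb k)) (Eventually.of_forall hζt)
  have hflux : ∀ k, - ∫ x, ‖gradient (coneFun g θ₀) x‖ ^ (p - 2) *
        ⟪gradient (coneFun g θ₀) x, gradient (ζ k) x⟫ =
      (∫ x in coneSurface θ₀, ζ k x ∂(μHE[2])) +
        ∫ x in coneSurface (Real.pi - θ₀), ζ k x ∂(μHE[2]) := fun k =>
    h.integral_flux ((hζ k).1.of_le (by exact_mod_cast le_top)) (hζ k).2.1
  have hs0' : 0 < Real.sin (Real.pi - θ₀) := by rw [Real.sin_pi_sub]; exact h.sin_pos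
  have hs1' : Real.sin (Real.pi - θ₀) < 1 := by rw [Real.sin_pi_sub]; exact h.sin_lt_one
  have hl : Tendsto (fun k => ∫ x, ‖gradient (coneFun g θ₀) x‖ ^ (p - 2) *
        ⟪gradient (coneFun g θ₀) x, gradient (ζ k) x⟫) atTop
      (𝓝 (∫ x, ‖gradient (coneFun g θ₀) x‖ ^ (p - 2) *
        ⟪gradient (coneFun g θ₀) x, gradient w x⟫)) := by
    refine tendsto_integral_of_dominated_convergence
      ((Metric.closedBall 0 R).indicator fun _ => (L : ℝ))
      (fun k => aestronglyMeasurable_flux _ _)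
      ((integrable_indicator_iff measurableSet_closedBall).2
        (integrableOn_const (isCompact_closedBall 0 R).measure_lt_top.ne))
      (fun k => Eventually.of_forall fun x => (h.norm_flux_le x _).trans ?_) ?_
    · by_cases hx : x ∈ Metric.closedBall (0 : E3) R
      · rw [indicator_of_mem hx]; exact hζL k x
      · rw [indicator_of_notMem hx]
        have : ζ k =ᶠ[𝓝 x] fun _ => 0 := by
          filter_upwards [Metric.isClosed_closedBall.isOpen_compl.mem_nhds hx] with y hy
          refine hζR k y ?_
          simp only [mem_compl_iff, Metric.mem_closedBall, dist_zero_right, not_le] at hy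
          exact hy.le
        rw [norm_gradient_eq, this.fderiv_eq]; simp
    · filter_upwards [hζg] with x hx
      exact (tendsto_const_nhds.inner hx).const_mul _
  exact tendsto_nhds_unique (hl.neg.congr hflux)
    ((hS _ h.sin_pos h.sin_lt_one).add (hS _ hs0' hs1'))

theorem not_mem_coneRegion_of_mem_coneSurface (h : ConeProfile p θ₀ g) {x : E3}
    (hx : x ∈ coneSurface θ₀ ∪ coneSurface (Real.pi - θ₀)) : x ∉ coneRegion θ₀ := by
  have hc : 0 < Real.cos θ₀ := Real.cos_pos_of_mem_Ioo
    ⟨by linarith [Real.pi_pos, h.angle_pos], h.angle_lt⟩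
  intro hE
  have hE : |x 2| < Real.cos θ₀ * ‖x‖ := hE
  rcases hx with ⟨-, hx⟩ | ⟨-, hx⟩
  · rw [hx, abs_of_nonneg (by positivity), mul_comm] at hE
    exact lt_irrefl _ hE
  · rw [hx, Real.cos_pi_sub, mul_neg, abs_neg, abs_of_nonneg (by positivity), mul_comm] at hE
    exact lt_irrefl _ hE

theorem measurableSet_coneSurface (θ : ℝ) : MeasurableSet (coneSurface θ) :=
  (measurableSet_singleton (0 : E3)).compl.inter
    (isClosed_eq continuous_apply_two (continuous_norm.mul continuous_const)).measurableSet

/-- Functions vanishing outside of the positivity set are orthogonal to the flux. -/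
theorem integral_flux_eq_zero (h : ConeProfile p θ₀ g) {L : NNReal} {w : E3 → ℝ}
    (hw : LipschitzWith L w) (hc : HasCompactSupport w) (hz : ∀ x ∉ coneRegion θ₀, w x = 0) :
    ∫ x, ‖gradient (coneFun g θ₀) x‖ ^ (p - 2) *
        ⟪gradient (coneFun g θ₀) x, gradient w x⟫ = 0 := by
  have := h.integral_flux_lipschitz hw hc
  rw [setIntegral_congr_fun (measurableSet_coneSurface _) (g := fun _ => 0)
      (fun x hx => hz x (h.not_mem_coneRegion_of_mem_coneSurface (Or.inl hx))),
    setIntegral_congr_fun (measurableSet_coneSurface _) (g := fun _ => 0)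
      (fun x hx => hz x (h.not_mem_coneRegion_of_mem_coneSurface (Or.inr hx)))] at this
  simpa using this

theorem norm_gradient_pos (h : ConeProfile p θ₀ g) {x : E3} (hx : x ∈ coneRegion θ₀) :
    0 < ‖gradient (coneFun g θ₀) x‖ := by
  have h1 := h.norm_sq_gradient_coneFun hx
  have h2 := h.gradSq_pos _ (h.polarAngle_mem hx)
  rcases (norm_nonneg (gradient (coneFun g θ₀) x)).eq_or_lt with e | e
  · rw [← e] at h1; norm_num at h1; linarith
  · exact e

/-- The regularized characteristic function `u / (u + ε)` of the positivity set. -/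
def softPos (g : ℝ → ℝ) (θ₀ ε : ℝ) (x : E3) : ℝ := coneFun g θ₀ x / (coneFun g θ₀ x + ε)

theorem softPos_nonneg {ε : ℝ} (hε : 0 < ε) (x : E3) : 0 ≤ softPos g θ₀ ε x := by
  have := coneFun_nonneg (g := g) (θ₀ := θ₀) x
  exact div_nonneg this (by linarith)

theorem softPos_le_one {ε : ℝ} (hε : 0 < ε) (x : E3) : softPos g θ₀ ε x ≤ 1 := by
  have := coneFun_nonneg (g := g) (θ₀ := θ₀) x
  exact div_le_one_of_le₀ (by linarith) (by linarith)

theorem softPos_of_not_mem (h : ConeProfile p θ₀ g) {ε : ℝ} {x : E3} (hx : x ∉ coneRegion θ₀) :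
    softPos g θ₀ ε x = 0 := by
  rw [softPos, h.coneFun_of_not_mem hx, zero_div]

theorem exists_lipschitzWith_softPos (h : ConeProfile p θ₀ g) {ε : ℝ} (hε : 0 < ε) :
    ∃ L : NNReal, LipschitzWith L (softPos g θ₀ ε) := by
  obtain ⟨L, hu⟩ := h.exists_lipschitzWith
  refine ⟨L / ε.toNNReal, LipschitzWith.of_dist_le_mul fun x y => ?_⟩
  have ha := coneFun_nonneg (g := g) (θ₀ := θ₀) x
  have hb := coneFun_nonneg (g := g) (θ₀ := θ₀) y
  have e : softPos g θ₀ ε x - softPos g θ₀ ε y =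
      ε / ((coneFun g θ₀ x + ε) * (coneFun g θ₀ y + ε)) * (coneFun g θ₀ x - coneFun g θ₀ y) := by
    simp only [softPos]; field_simp; ring
  have h2 : ε / ((coneFun g θ₀ x + ε) * (coneFun g θ₀ y + ε)) ≤ 1 / ε := by
    rw [div_le_div_iff₀ (by positivity) hε]; nlinarith [mul_nonneg ha hb]
  have h3 := hu.dist_le_mul x y
  rw [Real.dist_eq] at h3
  rw [Real.dist_eq, e, abs_mul, abs_of_nonneg (by positivity)]
  push_cast
  rw [Real.coe_toNNReal _ hε.le]
  calc _ ≤ 1 / ε * (L * dist x y) := mul_le_mul h2 h3 (abs_nonneg _) (by positivity)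
    _ = _ := by ring

theorem hasGradientAt_softPos (h : ConeProfile p θ₀ g) {ε : ℝ} (hε : 0 < ε) {x : E3}
    (hx : x ∈ coneRegion θ₀) : HasGradientAt (softPos g θ₀ ε)
      ((ε / (coneFun g θ₀ x + ε) ^ 2) • gradient (coneFun g θ₀) x) x := by
  have h1 := (hasGradientAt_iff_hasFDerivAt).1 (h.hasGradientAt_coneFun hx)
  rw [← h.gradient_coneFun hx] at h1
  have hKd : HasDerivAt (fun t : ℝ => t / (t + ε)) (ε / (coneFun g θ₀ x + ε) ^ 2)
      (coneFun g θ₀ x) := by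
    have hne : coneFun g θ₀ x + ε ≠ 0 := by
      linarith [coneFun_nonneg (g := g) (θ₀ := θ₀) x]
    have := (hasDerivAt_id (coneFun g θ₀ x)).div ((hasDerivAt_id (coneFun g θ₀ x)).add_const ε) hne
    convert! this using 1
    simp
  have h2 := hKd.comp_hasFDerivAt x h1
  rw [hasGradientAt_iff_hasFDerivAt]
  refine h2.congr_fderiv ?_
  ext v
  simp

theorem gradient_softPos_of_not_mem (h : ConeProfile p θ₀ g) {ε : ℝ} (hε : 0 < ε) {x : E3}
    (hx : x ∉ coneRegion θ₀) : gradient (softPos g θ₀ ε) x = 0 := by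
  have hmin : IsLocalMin (softPos g θ₀ ε) x := Eventually.of_forall fun y => by
    rw [h.softPos_of_not_mem hx]; exact softPos_nonneg hε y
  rw [gradient, hmin.fderiv_eq_zero, map_zero]

theorem integrable_caccioppoli (h : ConeProfile p θ₀ g) {η : E3 → ℝ} (hη : ContDiff ℝ 1 η)
    (hc : HasCompactSupport η) {ε : ℝ} (hε : 0 < ε) : Integrable fun x =>
      η x * (ε / (coneFun g θ₀ x + ε) ^ 2 * ‖gradient (coneFun g θ₀) x‖ ^ p) := by
  obtain ⟨L, hu⟩ := h.exists_lipschitzWith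
  have hηi : Integrable η := hη.continuous.integrable_of_hasCompactSupport hc
  refine (hηi.norm.mul_const (1 / ε)).mono' (hη.continuous.measurable.mul ((measurable_const.div
    ((hu.continuous.measurable.add_const _).pow_const _)).mul
      ((measurable_gradient _).norm.pow_const _))).aestronglyMeasurable
    (Eventually.of_forall fun x => ?_)
  have ha := coneFun_nonneg (g := g) (θ₀ := θ₀) x
  have h2 : ε / (coneFun g θ₀ x + ε) ^ 2 ≤ 1 / ε := by
    rw [div_le_div_iff₀ (by positivity) hε]; nlinarith
  have h3 : ‖gradient (coneFun g θ₀) x‖ ^ p ≤ 1 :=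
    Real.rpow_le_one (norm_nonneg _) (h.norm_gradient_coneFun_le x) (by linarith [h.one_lt])
  rw [norm_mul, Real.norm_of_nonneg
    (by positivity : 0 ≤ ε / (coneFun g θ₀ x + ε) ^ 2 * ‖gradient (coneFun g θ₀) x‖ ^ p)]
  refine mul_le_mul_of_nonneg_left ?_ (norm_nonneg _)
  calc _ ≤ 1 / ε * 1 := mul_le_mul h2 h3 (by positivity) (by positivity)
    _ = _ := mul_one _

theorem lipschitzWith_mul {L₁ L₂ : NNReal} {f k : E3 → ℝ} (hf : LipschitzWith L₁ f)
    (hk : LipschitzWith L₂ k) {C D : ℝ} (hC : ∀ x, |f x| ≤ C) (hD : ∀ x, |k x| ≤ D) :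
    LipschitzWith (L₁ * D.toNNReal + C.toNNReal * L₂) fun x => f x * k x := by
  have hC0 : 0 ≤ C := (abs_nonneg _).trans (hC 0)
  have hD0 : 0 ≤ D := (abs_nonneg _).trans (hD 0)
  refine LipschitzWith.of_dist_le_mul fun x y => ?_
  have h1 := hf.dist_le_mul x y
  have h2 := hk.dist_le_mul x y
  rw [Real.dist_eq] at h1 h2 ⊢
  rw [show f x * k x - f y * k y = (f x - f y) * k x + f y * (k x - k y) by ring]
  push_cast
  rw [Real.coe_toNNReal _ hC0, Real.coe_toNNReal _ hD0]
  calc _ ≤ |f x - f y| * |k x| + |f y| * |k x - k y| := by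
        rw [← abs_mul, ← abs_mul]; exact abs_add_le _ _
    _ ≤ L₁ * dist x y * D + C * (L₂ * dist x y) :=
        add_le_add (mul_le_mul h1 (hD x) (abs_nonneg _) (by positivity))
          (mul_le_mul (hC y) h2 (abs_nonneg _) hC0)
    _ = _ := by ring

/-- Test the flux with `η u/(u + ε)`, which vanishes off the positivity set. The part of the
gradient falling on `u/(u + ε)` is the left side; the part falling on `η` is bounded by `|∇η|`
independently of `ε`. -/
theorem caccioppoli (h : ConeProfile p θ₀ g) {η : E3 → ℝ} (hη : ContDiff ℝ 1 η)
    (hc : HasCompactSupport η) {ε : ℝ} (hε : 0 < ε) :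
    ∫ x in coneRegion θ₀, η x * (ε / (coneFun g θ₀ x + ε) ^ 2 * ‖gradient (coneFun g θ₀) x‖ ^ p) ≤
      ∫ x, ‖gradient η x‖ := by
  obtain ⟨Lη, hLη⟩ := hη.lipschitzWith_of_hasCompactSupport hc one_ne_zero
  obtain ⟨C, hC0, hC⟩ := exists_bound_of_hasCompactSupport hη.continuous hc
  obtain ⟨LK, hKL⟩ := h.exists_lipschitzWith_softPos hε
  set u := coneFun g θ₀ with hudef
  set K := softPos g θ₀ ε with hK
  have hK0 : ∀ x, 0 ≤ K x := softPos_nonneg hε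
  have hK1 : ∀ x, |K x| ≤ 1 := fun x => by
    rw [abs_of_nonneg (hK0 x)]; exact softPos_le_one hε x
  have hwL := lipschitzWith_mul hLη hKL hC hK1
  have key := h.integral_flux_eq_zero hwL hc.mul_right
    (fun x hx => by simp [hK, h.softPos_of_not_mem hx])
  have hgw : ∀ x ∈ coneRegion θ₀, gradient (fun x => η x * K x) x =
      K x • gradient η x + (η x * (ε / (u x + ε) ^ 2)) • gradient u x := by
    intro x hx
    have h2 := (hasGradientAt_iff_hasFDerivAt).1 (h.hasGradientAt_softPos hε hx)
    have h3 := (hη.differentiable one_ne_zero x).hasFDerivAt.mul h2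
    refine HasGradientAt.gradient ?_
    rw [hasGradientAt_iff_hasFDerivAt]
    refine h3.congr_fderiv ?_
    ext v
    simp [hK]
    ring
  set A : E3 → ℝ := fun x => η x * (ε / (u x + ε) ^ 2 * ‖gradient u x‖ ^ p) with hA
  set B : E3 → ℝ := fun x => ‖gradient u x‖ ^ (p - 2) * ⟪gradient u x, K x • gradient η x⟫ with hB
  have hgm := measurable_gradient u
  have hgη : Integrable fun x => ‖gradient η x‖ :=
    ((continuous_gradient hη).integrable_of_hasCompactSupport (hasCompactSupport_gradient hc)).norm
  have hBb : ∀ x, ‖B x‖ ≤ ‖gradient η x‖ := fun x => by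
    refine (h.norm_flux_le x _).trans ?_
    rw [norm_smul]
    exact mul_le_of_le_one_left (norm_nonneg _) (hK1 x)
  have hBm : Measurable B := (hgm.norm.pow_const _).mul
    (hgm.inner (hKL.continuous.measurable.smul (measurable_gradient η)))
  have hBi : Integrable B := hgη.mono' hBm.aestronglyMeasurable (Eventually.of_forall hBb)
  have hAi : Integrable A := h.integrable_caccioppoli hη hc hε
  have hsplit : ∀ x ∈ coneRegion θ₀, ‖gradient u x‖ ^ (p - 2) * ⟪gradient u x,
      gradient (fun x => η x * K x) x⟫ = B x + A x := by
    intro x hx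
    have hpos := h.norm_gradient_pos hx
    have e : ‖gradient u x‖ ^ p = ‖gradient u x‖ ^ (p - 2) * ‖gradient u x‖ ^ 2 := by
      rw [← Real.rpow_natCast, ← Real.rpow_add hpos]; congr 1; push_cast; ring
    rw [hgw x hx, inner_add_right, inner_smul_right _ _ (η x * _), real_inner_self_eq_norm_sq]
    simp only [hA, hB, e]
    ring
  have hm := (isOpen_coneRegion θ₀).measurableSet
  rw [← setIntegral_eq_integral_of_forall_compl_eq_zero (s := coneRegion θ₀)
      (fun x hx => by rw [h.gradient_coneFun_of_not_mem hx]; simp),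
    setIntegral_congr_fun hm hsplit, integral_add hBi.integrableOn hAi.integrableOn] at key
  have hBle : - ∫ x in coneRegion θ₀, B x ≤ ∫ x, ‖gradient η x‖ := by
    calc _ ≤ |∫ x in coneRegion θ₀, B x| := neg_le_abs _
      _ ≤ ∫ x in coneRegion θ₀, ‖gradient η x‖ := by
        rw [← Real.norm_eq_abs]
        exact norm_integral_le_of_norm_le hgη.integrableOn (Eventually.of_forall hBb)
      _ ≤ _ := setIntegral_le_integral hgη (Eventually.of_forall fun _ => norm_nonneg _)
  linarith

end ConeProfile

end

noncomputable section

/-! ### The reduced boundary -/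

theorem finrank_E3 : Module.finrank ℝ E3 = 3 := by simp

/-- Rescaling to the unit ball turns the density in the definition of the reduced boundary into a
measure to which dominated convergence applies. -/
theorem volume_inter_ball_eq (A : Set E3) (x : E3) {r : ℝ} (hr : 0 < r) :
    (volume (A ∩ Metric.ball x r)).toReal / r ^ 3 =
      (volume ((fun z : E3 => x + r • z) ⁻¹' A ∩ Metric.ball 0 1)).toReal := by
  have e : (fun z : E3 => x + r • z) ⁻¹' A ∩ Metric.ball 0 1 =
      (r • ·) ⁻¹' ((x + ·) ⁻¹' (A ∩ Metric.ball x r)) := by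
    ext z
    simp only [mem_inter_iff, mem_preimage, Metric.mem_ball, dist_eq_norm, sub_zero,
      add_sub_cancel_left, norm_smul, Real.norm_of_nonneg hr.le]
    have : r * ‖z‖ < r ↔ ‖z‖ < 1 := by
      constructor <;> intro h <;> nlinarith
    rw [this]
  rw [e, Measure.addHaar_preimage_smul _ hr.ne', measure_preimage_add, finrank_E3,
    ENNReal.toReal_mul, ENNReal.toReal_ofReal (abs_nonneg _), abs_of_pos (by positivity)]
  field_simp

/-- A regular zero of a defining function belongs to the reduced boundary. -/
theorem mem_reducedBoundary_of_hasGradientAt {E : Set E3} (hE : MeasurableSet E) {φ : E3 → ℝ}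
    {x w : E3} (hφ : HasGradientAt φ w x) (hx : φ x = 0) (hw : w ≠ 0)
    (hEφ : ∀ᶠ y in 𝓝 x, y ∈ E ↔ 0 < φ y) : x ∈ reducedBoundary E := by
  have hwn := norm_pos_iff.2 hw
  refine ⟨-(‖w‖⁻¹ • w), ?_, ?_⟩
  · rw [norm_neg, norm_smul, norm_inv, norm_norm, inv_mul_cancel₀ hwn.ne']
  set ν : E3 := -(‖w‖⁻¹ • w) with hν
  set A : Set E3 := symmDiff E {y | ⟪y - x, ν⟫ < 0} with hA
  have hAm : MeasurableSet A := hE.symmDiff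
    (isOpen_lt (by fun_prop) continuous_const).measurableSet
  have hlim : Tendsto (fun r : ℝ => volume ((fun z : E3 => x + r • z) ⁻¹' A ∩ Metric.ball 0 1))
      (𝓝[>] 0) (𝓝 (volume (∅ : Set E3))) := by
    refine tendsto_measure_of_ae_tendsto_indicator (B := Metric.ball 0 1) _ MeasurableSet.empty
      (fun r => ?_) measurableSet_ball measure_ball_lt_top.ne
      (Eventually.of_forall fun r => inter_subset_right) ?_
    · exact ((by fun_prop : Continuous fun z : E3 => x + r • z).measurable hAm).inter
        measurableSet_ball
    have hnull : volume {z : E3 | ⟪w, z⟫ = 0} = 0 := by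
      have := Measure.addHaar_submodule (volume : Measure E3) (LinearMap.ker (innerₛₗ ℝ w)) (by
        intro htop
        have hmem : w ∈ LinearMap.ker (innerₛₗ ℝ w) := by rw [htop]; trivial
        rw [LinearMap.mem_ker, innerₛₗ_apply_apply, real_inner_self_eq_norm_sq] at hmem
        exact hwn.ne' (pow_eq_zero_iff two_ne_zero |>.1 hmem))
      convert! this using 2
    -- Off the tangent plane the sign of `φ (x + r z)` agrees with that of `⟪w, z⟫` for small `r`,
    -- so the blow-up of `E` agrees with the half space at almost every `z`.
    have hae : ∀ᵐ z : E3, ⟪w, z⟫ ≠ 0 := by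
      rw [ae_iff]; simpa using hnull
    filter_upwards [hae] with z hz
    have hline : HasDerivAt (fun r : ℝ => x + r • z) z 0 := by
      simpa using ((hasDerivAt_id (0 : ℝ)).smul_const z).const_add x
    have hd : HasDerivAt (fun r : ℝ => φ (x + r • z)) ⟪w, z⟫ 0 := by
      have h1 := hasGradientAt_iff_hasFDerivAt.1 hφ
      have h2 : HasFDerivAt φ ((InnerProductSpace.toDual ℝ E3) w) (x + (0 : ℝ) • z) := by
        simpa using h1
      simpa using! h2.comp_hasDerivAt (0 : ℝ) hline
    have hsl := hd.tendsto_slope_zero_right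
    simp only [zero_add, zero_smul, add_zero, hx, sub_zero, smul_eq_mul] at hsl
    have hcont : Tendsto (fun r : ℝ => x + r • z) (𝓝[>] 0) (𝓝 x) := by
      have := hline.continuousAt.tendsto
      simp only [zero_smul, add_zero] at this
      exact this.mono_left nhdsWithin_le_nhds
    have hinner : ∀ r : ℝ, ⟪x + r • z - x, ν⟫ = -(r * ‖w‖⁻¹ * ⟪w, z⟫) := fun r => by
      rw [add_sub_cancel_left, hν, inner_neg_right, inner_smul_left, inner_smul_right,
        real_inner_comm]
      simp; ring
    have hsign : ∀ᶠ r in 𝓝[>] (0 : ℝ), 0 < φ (x + r • z) ↔ 0 < ⟪w, z⟫ := by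
      rcases lt_or_gt_of_ne hz with hneg | hpos
      · filter_upwards [hsl.eventually_lt_const hneg, self_mem_nhdsWithin] with r hr hr0
        have hr0 : 0 < r := hr0
        refine ⟨fun h => absurd hr (not_lt.2 (by positivity)), fun h => absurd h (not_lt.2 hneg.le)⟩
      · filter_upwards [hsl.eventually_const_lt hpos, self_mem_nhdsWithin] with r hr hr0
        have hr0 : 0 < r⁻¹ := inv_pos.2 hr0
        exact ⟨fun _ => hpos, fun _ => pos_of_mul_pos_right hr hr0.le⟩
    filter_upwards [hcont.eventually hEφ, hsign, self_mem_nhdsWithin] with r h1 h2 hr0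
    have hr0 : 0 < r := hr0
    have h3 : ⟪x + r • z - x, ν⟫ < 0 ↔ 0 < ⟪w, z⟫ := by
      rw [hinner, neg_lt_zero]
      exact mul_pos_iff_of_pos_left (by positivity)
    simp only [mem_inter_iff, mem_preimage, mem_empty_iff_false, iff_false, not_and]
    intro hmem
    exfalso
    rw [hA, mem_symmDiff, mem_ofPred_eq, h3, h1, h2] at hmem
    tauto
  rw [measure_empty] at hlim
  have := (ENNReal.tendsto_toReal ENNReal.zero_ne_top).comp hlim
  rw [ENNReal.toReal_zero] at this
  refine this.congr' ?_
  filter_upwards [self_mem_nhdsWithin] with r hr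
  exact (volume_inter_ball_eq A x hr).symm

/-- If a small ball around `x` lies in `E` or in its complement, the symmetric difference with any
half space through `x` contains a ball of radius `r/2`, hence a fixed fraction of the ball of radius
`r`. -/
theorem reducedBoundary_subset_frontier (E : Set E3) : reducedBoundary E ⊆ frontier E := by
  rintro x ⟨ν, hν, hlim⟩
  by_contra hx
  rw [← mem_compl_iff, compl_frontier_eq_union_interior] at hx
  -- one of the half balls is contained in the symmetric difference
  obtain ⟨σ, hσ, hsub⟩ : ∃ σ : ℝ, |σ| = 1 ∧ ∀ᶠ r in 𝓝[>] (0 : ℝ),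
      Metric.ball (x + (r / 2) • (σ • ν)) (r / 2) ⊆
        symmDiff E {y | ⟪y - x, ν⟫ < 0} ∩ Metric.ball x r := by
    have hball : ∀ (σ : ℝ), |σ| = 1 → ∀ r : ℝ, 0 < r →
        ∀ y ∈ Metric.ball (x + (r / 2) • (σ • ν)) (r / 2),
          y ∈ Metric.ball x r ∧ 0 < σ * ⟪y - x, ν⟫ := by
      intro σ hσ r hr y hy
      rw [Metric.mem_ball, dist_eq_norm] at hy
      set d := y - (x + (r / 2) • (σ • ν)) with hd
      have hyx : y - x = d + (r / 2) • (σ • ν) := by rw [hd]; abel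
      have hn : ‖(r / 2) • (σ • ν)‖ = r / 2 := by
        rw [norm_smul, norm_smul, hν, Real.norm_eq_abs, Real.norm_eq_abs, hσ,
          abs_of_pos (by positivity)]; ring
      refine ⟨?_, ?_⟩
      · rw [Metric.mem_ball, dist_eq_norm, hyx]
        linarith [norm_add_le d ((r / 2) • (σ • ν))]
      · have h1 : |⟪d, ν⟫| ≤ ‖d‖ := by
          have := abs_real_inner_le_norm d ν
          rwa [hν, mul_one] at this
        have h2 : |σ * ⟪d, ν⟫| ≤ ‖d‖ := by rwa [abs_mul, hσ, one_mul]
        have h3 : σ ^ 2 = 1 := by rw [← sq_abs, hσ]; norm_num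
        rw [hyx, inner_add_left, inner_smul_left, inner_smul_left, real_inner_self_eq_norm_sq, hν]
        simp only [conj_trivial]
        have := neg_le_of_abs_le h2
        nlinarith
    have hnhds : ∀ s ∈ 𝓝 x, ∀ᶠ r in 𝓝[>] (0 : ℝ), Metric.ball x r ⊆ s := by
      intro s hs
      obtain ⟨ε, hε, hsub⟩ := Metric.mem_nhds_iff.1 hs
      filter_upwards [Ioo_mem_nhdsGT hε] with r hr
      exact (Metric.ball_subset_ball hr.2.le).trans hsub
    rcases hx with hx | hx
    · refine ⟨1, abs_one, ?_⟩
      filter_upwards [hnhds E (mem_interior_iff_mem_nhds.1 hx), self_mem_nhdsWithin] with r h1 hr y hy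
      obtain ⟨h2, h3⟩ := hball 1 abs_one r hr y hy
      exact ⟨Or.inl ⟨h1 h2, fun (hlt : ⟪y - x, ν⟫ < 0) => by linarith⟩, h2⟩
    · refine ⟨-1, by simp, ?_⟩
      filter_upwards [hnhds Eᶜ (mem_interior_iff_mem_nhds.1 hx), self_mem_nhdsWithin] with r h1 hr y hy
      obtain ⟨h2, h3⟩ := hball (-1) (by simp) r hr y hy
      exact ⟨Or.inr ⟨show ⟪y - x, ν⟫ < 0 by linarith, h1 h2⟩, h2⟩
  set c := (volume (Metric.ball (0 : E3) 1)).toReal with hc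
  have hcpos : 0 < c := ENNReal.toReal_pos (Metric.measure_ball_pos _ _ one_pos).ne'
    measure_ball_lt_top.ne
  have hge : ∀ᶠ r in 𝓝[>] (0 : ℝ), c / 8 ≤
      (volume (symmDiff E {y | ⟪y - x, ν⟫ < 0} ∩ Metric.ball x r)).toReal / r ^ 3 := by
    filter_upwards [hsub, self_mem_nhdsWithin] with r h1 hr
    have hr : 0 < r := hr
    have h2 := ENNReal.toReal_mono ((measure_mono inter_subset_right).trans_lt
      (measure_ball_lt_top (μ := volume) (x := x) (r := r))).ne (measure_mono (μ := volume) h1)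
    rw [Measure.addHaar_ball _ _ (by positivity), finrank_E3, ENNReal.toReal_mul,
      ENNReal.toReal_ofReal (by positivity), ← hc] at h2
    rw [le_div_iff₀ (by positivity)]
    calc c / 8 * r ^ 3 = (r / 2) ^ 3 * c := by ring
      _ ≤ _ := h2
  have := ge_of_tendsto hlim hge
  linarith

/-! ### The free boundary as a level set -/

/-- A defining function `t₀ |x| - σ x₃` of one nappe of the double cone. -/
def nappe (t σ : ℝ) (y : E3) : ℝ := t * ‖y‖ - σ * y 2

theorem hasGradientAt_nappe (t σ : ℝ) {x : E3} (hx : x ≠ 0) :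
    HasGradientAt (nappe t σ) (t • radialVec x - σ • basisVec 2) x := by
  rw [hasGradientAt_iff_hasFDerivAt]
  have h1 := ((hasGradientAt_iff_hasFDerivAt).1 (hasGradientAt_norm hx)).const_mul t
  have h2 := ((EuclideanSpace.proj (2 : Fin 3) : E3 →L[ℝ] ℝ).hasFDerivAt (x := x)).const_mul σ
  refine (h1.sub h2).congr_fderiv ?_
  ext v
  have e4 : ⟪(basisVec 2 : E3), v⟫ = v 2 := by rw [real_inner_comm, inner_basisVec_two]
  simp [e4]

theorem contDiffAt_nappe (t σ : ℝ) {x : E3} (hx : x ≠ 0) {n : WithTop ℕ∞} :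
    ContDiffAt ℝ n (nappe t σ) x :=
  (contDiffAt_const.mul (contDiffAt_norm ℝ hx)).sub
    (contDiffAt_const.mul (EuclideanSpace.proj (2 : Fin 3) : E3 →L[ℝ] ℝ).contDiff.contDiffAt)

/-- The Hessian of a nappe. -/
theorem fderiv_fderiv_nappe (t σ : ℝ) {x : E3} (hx : x ≠ 0) (a b : E3) :
    fderiv ℝ (fderiv ℝ (nappe t σ)) x a b =
      t / ‖x‖ * (⟪a, b⟫ - ⟪radialVec x, a⟫ * ⟪radialVec x, b⟫) := by
  have hn := norm_ne_zero_iff.2 hx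
  have hd : DifferentiableAt ℝ (fderiv ℝ (nappe t σ)) x :=
    ((contDiffAt_nappe t σ hx (n := 2)).fderiv_right (m := 1) le_rfl).differentiableAt one_ne_zero
  have h1 : fderiv ℝ (fderiv ℝ (nappe t σ)) x a b =
      fderiv ℝ (fun y => fderiv ℝ (nappe t σ) y b) x a := by
    rw [fderiv_clm_apply hd (differentiableAt_const b)]
    simp
  have h2 : (fun y => fderiv ℝ (nappe t σ) y b) =ᶠ[𝓝 x]
      fun y => t * (‖y‖⁻¹ * ⟪y, b⟫) - σ * b 2 := by
    filter_upwards [isOpen_ne.mem_nhds hx] with y hy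
    have e4 : ⟪(basisVec 2 : E3), b⟫ = b 2 := by rw [real_inner_comm, inner_basisVec_two]
    rw [← inner_gradient_eq, (hasGradientAt_nappe t σ hy).gradient, inner_sub_left, inner_smul_left,
      inner_smul_left, e4, radialVec, inner_smul_left]
    simp
  have h3 : HasFDerivAt (fun y : E3 => ⟪y, b⟫) (innerSL ℝ b) x := by
    have := (innerSL ℝ b).hasFDerivAt (x := x)
    exact this.congr_of_eventuallyEq (Eventually.of_forall fun y => by
      simp [real_inner_comm])
  have h4 := (((hasDerivAt_inv hn).comp_hasFDerivAt x
    ((hasGradientAt_iff_hasFDerivAt).1 (hasGradientAt_norm hx))).mul h3).const_mul t |>.sub_const (σ * b 2)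
  rw [h1, h2.fderiv_eq]
  rw [show fderiv ℝ (fun y : E3 => t * (‖y‖⁻¹ * ⟪y, b⟫) - σ * b 2) x = _ from h4.fderiv]
  have e1 : ⟪radialVec x, b⟫ = ‖x‖⁻¹ * ⟪x, b⟫ := by simp [radialVec, inner_smul_left]
  simp [real_inner_comm, e1]
  rw [real_inner_comm b a]
  field_simp
  ring

/-- On the cone the normal is orthogonal to the ruling `x/|x|`, which is the direction of zero
curvature. -/
theorem norm_sq_gradient_nappe {t σ : ℝ} (hσ : σ ^ 2 = 1) {x : E3} (hx : x ≠ 0)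
    (h2 : x 2 = σ * t * ‖x‖) :
    ‖t • radialVec x - σ • basisVec 2‖ ^ 2 = 1 - t ^ 2 ∧
      ⟪radialVec x, t • radialVec x - σ • basisVec 2⟫ = 0 := by
  have hn := norm_ne_zero_iff.2 hx
  have e1 := inner_radialVec_self hx
  have e2 : ⟪radialVec x, basisVec 2⟫ = σ * t := by
    rw [inner_radialVec_basis, cos_polarAngle, h2]; field_simp
  have e3 : ⟪(basisVec 2 : E3), basisVec 2⟫ = 1 := by
    rw [real_inner_self_eq_norm_sq, norm_basisVec]; norm_num
  have e4 : ⟪(basisVec 2 : E3), radialVec x⟫ = σ * t := by rw [real_inner_comm, e2]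
  constructor
  · rw [← real_inner_self_eq_norm_sq]
    simp only [inner_sub_left, inner_sub_right, inner_smul_left, inner_smul_right, e1, e2, e3, e4,
      conj_trivial]
    linear_combination (1 - 2 * t ^ 2) * hσ
  · simp only [inner_sub_right, inner_smul_right, e1, e2]
    linear_combination - t * hσ

theorem sum_sq_inner_basisVec (v : E3) : ∑ i, ⟪v, basisVec i⟫ * ⟪v, basisVec i⟫ = ‖v‖ ^ 2 := by
  rw [norm_sq_eq_sum, Fin.sum_univ_three]
  simp [basisVec, EuclideanSpace.inner_single_right, pow_two]

/-- Away from the vertex `x₃` has a locally constant sign `σ`, which removes the absolute value and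
leaves a smooth defining function. -/
theorem exists_nappe {θ₀ : ℝ} (h0 : 0 < θ₀) (h1 : θ₀ < Real.pi / 2) {x : E3} (hx : x ≠ 0)
    (hxΓ : |x 2| = Real.cos θ₀ * ‖x‖) : ∃ σ : ℝ, σ ^ 2 = 1 ∧ x 2 = σ * Real.cos θ₀ * ‖x‖ ∧
      nappe (Real.cos θ₀) σ x = 0 ∧ ∀ᶠ y in 𝓝 x, y ∈ coneRegion θ₀ ↔ 0 < nappe (Real.cos θ₀) σ y := by
  have hc : 0 < Real.cos θ₀ := Real.cos_pos_of_mem_Ioo ⟨by linarith [Real.pi_pos], h1⟩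
  have hn := norm_pos_iff.2 hx
  have hpos : 0 < |x 2| := by rw [hxΓ]; positivity
  rcases lt_or_gt_of_ne (abs_pos.1 hpos) with hneg | hp
  · rw [abs_of_neg hneg] at hxΓ
    refine ⟨-1, by norm_num, by linarith, by simp only [nappe]; linarith, ?_⟩
    filter_upwards [(isOpen_lt continuous_apply_two continuous_const).mem_nhds hneg] with y hy
    have hy : y 2 < 0 := hy
    simp only [coneRegion, mem_ofPred_eq, nappe, abs_of_neg hy]
    constructor <;> intro h <;> linarith
  · rw [abs_of_pos hp] at hxΓ
    refine ⟨1, by norm_num, by linarith, by simp only [nappe]; linarith, ?_⟩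
    filter_upwards [(isOpen_lt continuous_const continuous_apply_two).mem_nhds hp] with y hy
    have hy : 0 < y 2 := hy
    simp only [coneRegion, mem_ofPred_eq, nappe, abs_of_pos hy]
    constructor <;> intro h <;> linarith

theorem gradient_nappe_ne_zero {θ₀ σ : ℝ} (h0 : 0 < θ₀) (h1 : θ₀ < Real.pi / 2) (hσ : σ ^ 2 = 1)
    {x : E3} (hx : x ≠ 0) (h2 : x 2 = σ * Real.cos θ₀ * ‖x‖) :
    ‖Real.cos θ₀ • radialVec x - σ • basisVec 2‖ = Real.sin θ₀ := by
  have hs : 0 < Real.sin θ₀ := Real.sin_pos_of_pos_of_lt_pi h0 (by linarith [Real.pi_pos])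
  have h3 := (norm_sq_gradient_nappe hσ hx h2).1
  have : 1 - Real.cos θ₀ ^ 2 = Real.sin θ₀ ^ 2 := by linarith [Real.sin_sq_add_cos_sq θ₀]
  rw [this] at h3
  exact (pow_left_inj₀ (norm_nonneg _) hs.le two_ne_zero).1 h3

/-- The mean curvature of the double cone. -/
theorem hasMeanCurvatureAt_coneRegion {θ₀ : ℝ} (h0 : 0 < θ₀) (h1 : θ₀ < Real.pi / 2) {x : E3}
    (hx : x ≠ 0) (hxΓ : |x 2| = Real.cos θ₀ * ‖x‖) :
    HasMeanCurvatureAt (coneRegion θ₀) x (Real.cot θ₀ / ‖x‖) := by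
  obtain ⟨σ, hσ, h2, h3, h4⟩ := exists_nappe h0 h1 hx hxΓ
  have hs : 0 < Real.sin θ₀ := Real.sin_pos_of_pos_of_lt_pi h0 (by linarith [Real.pi_pos])
  have hg := (hasGradientAt_nappe (Real.cos θ₀) σ hx).gradient
  have hnorm := gradient_nappe_ne_zero h0 h1 hσ hx h2
  have hn := norm_ne_zero_iff.2 hx
  refine ⟨nappe (Real.cos θ₀) σ, contDiffAt_nappe _ _ hx, h3, ?_, h4, ?_⟩
  · rw [hg, ← norm_ne_zero_iff, hnorm]; exact hs.ne'
  · rw [hg]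
    -- The Hessian is `cos θ₀/|x|` times the projection orthogonal to `x/|x|`: its trace counts two
    -- directions and the normal removes one. Division by `|∇φ| = sin θ₀` gives `cot θ₀/|x|`.
    simp only [fderiv_fderiv_nappe _ _ hx, (norm_sq_gradient_nappe hσ hx h2).2,
      real_inner_self_eq_norm_sq, hnorm, norm_basisVec]
    rw [← Finset.mul_sum, Finset.sum_sub_distrib, sum_sq_inner_basisVec,
      ← real_inner_self_eq_norm_sq, inner_radialVec_self hx, Real.cot_eq_cos_div_sin]
    simp
    field_simp
    norm_num

theorem mem_reducedBoundary_coneRegion {θ₀ : ℝ} (h0 : 0 < θ₀) (h1 : θ₀ < Real.pi / 2) {x : E3}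
    (hx : x ≠ 0) (hxΓ : |x 2| = Real.cos θ₀ * ‖x‖) : x ∈ reducedBoundary (coneRegion θ₀) := by
  obtain ⟨σ, hσ, h2, h3, h4⟩ := exists_nappe h0 h1 hx hxΓ
  have hs : 0 < Real.sin θ₀ := Real.sin_pos_of_pos_of_lt_pi h0 (by linarith [Real.pi_pos])
  refine mem_reducedBoundary_of_hasGradientAt (isOpen_coneRegion θ₀).measurableSet
    (hasGradientAt_nappe (Real.cos θ₀) σ hx) h3 ?_ h4
  rw [← norm_ne_zero_iff, gradient_nappe_ne_zero h0 h1 hσ hx h2]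
  exact hs.ne'

end

noncomputable section

/-! ### The weak solution property -/

theorem fderiv_apply_coord {X : E3 → E3} {x : E3} (hX : DifferentiableAt ℝ X x) (i : Fin 3) (e : E3) :
    fderiv ℝ (fun y => X y i) x e = (fderiv ℝ X x e) i := by
  have := (EuclideanSpace.proj (i : Fin 3) : E3 →L[ℝ] ℝ).hasFDerivAt.comp x hX.hasFDerivAt
  rw [show fderiv ℝ (fun y => X y i) x = _ from this.fderiv]
  rfl

theorem isTestFunction_coord {X : E3 → E3} (hX : ContDiff ℝ ∞ X) (hc : HasCompactSupport X)
    (i : Fin 3) : IsTestFunction univ fun y => X y i :=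
  ⟨(EuclideanSpace.proj (i : Fin 3) : E3 →L[ℝ] ℝ).contDiff.comp hX,
    hc.comp_left (g := fun v : E3 => v i) rfl, subset_univ _⟩

theorem continuous_divergence {X : E3 → E3} (hX : ContDiff ℝ 1 X) : Continuous (divergence X) := by
  unfold divergence
  refine continuous_finsetSum _ fun i _ => ?_
  exact (EuclideanSpace.proj (i : Fin 3) : E3 →L[ℝ] ℝ).continuous.comp
    ((hX.continuous_fderiv one_ne_zero).clm_apply continuous_const)

theorem hasCompactSupport_divergence {X : E3 → E3} (hc : HasCompactSupport X) :
    HasCompactSupport (divergence X) :=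
  (hc.fderiv (𝕜 := ℝ)).comp_left (g := fun T : E3 →L[ℝ] E3 => ∑ i, (T (basisVec i)) i) (by simp)

theorem sum_coord_mul_inner (v w : E3) : ∑ i, v i * ⟪w, basisVec i⟫ = ⟪w, v⟫ := by
  simp [basisVec, PiLp.inner_apply]

/-- Integration by parts of a Lipschitz function against a divergence. -/
theorem LipschitzWith.integral_mul_divergence {L : NNReal} {w : E3 → ℝ} (hw : LipschitzWith L w)
    {X : E3 → E3} (hX : ContDiff ℝ ∞ X) (hc : HasCompactSupport X) :
    ∫ x, w x * divergence X x = - ∫ x, ⟪gradient w x, X x⟫ := by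
  have hX1 : ContDiff ℝ 1 X := hX.of_le (by exact_mod_cast le_top)
  have hi : ∀ i : Fin 3, Integrable fun x => w x * fderiv ℝ (fun y => X y i) x (basisVec i) := by
    intro i
    have ht := isTestFunction_coord hX hc i
    refine (hw.continuous.mul (((ht.1.of_le (by exact_mod_cast le_top) :
      ContDiff ℝ 1 _).continuous_fderiv one_ne_zero).clm_apply
        continuous_const)).integrable_of_hasCompactSupport ?_
    exact HasCompactSupport.mul_left ((ht.2.1.fderiv (𝕜 := ℝ)).comp_left
      (g := fun T : E3 →L[ℝ] ℝ => T (basisVec i)) (by simp))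
  have hj : ∀ i : Fin 3, Integrable fun x => X x i * ⟪gradient w x, basisVec i⟫ := by
    intro i
    have ht := isTestFunction_coord hX hc i
    refine ((ht.1.continuous.integrable_of_hasCompactSupport ht.2.1).norm.mul_const (L : ℝ)).mono'
      (ht.1.continuous.measurable.mul
        ((measurable_gradient w).inner measurable_const)).aestronglyMeasurable
      (Eventually.of_forall fun x => ?_)
    rw [norm_mul]
    refine mul_le_mul_of_nonneg_left ?_ (norm_nonneg _)
    refine (norm_inner_le_norm _ _).trans ?_
    rw [norm_basisVec, mul_one]; exact hw.norm_gradient_le x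
  have e1 : ∀ x, w x * divergence X x = ∑ i, w x * fderiv ℝ (fun y => X y i) x (basisVec i) := by
    intro x
    rw [divergence, Finset.mul_sum]
    exact Finset.sum_congr rfl fun i _ => by
      rw [fderiv_apply_coord (hX1.differentiable one_ne_zero x)]
  simp only [e1]
  rw [integral_finsetSum _ fun i _ => hi i]
  have e2 : ∀ i : Fin 3, ∫ x, w x * fderiv ℝ (fun y => X y i) x (basisVec i) =
      - ∫ x, X x i * ⟪gradient w x, basisVec i⟫ := fun i =>
    (hw.hasWeakGradientOn univ).2.2 _ (isTestFunction_coord hX hc i) (basisVec i)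
  simp only [e2, Finset.sum_neg_distrib]
  rw [← integral_finsetSum _ fun i _ => hj i]
  simp only [sum_coord_mul_inner]

namespace ConeProfile
variable {p θ₀ : ℝ} {g : ℝ → ℝ}

/-- A uniform bound `|∇u| ≤ μ |∇u|^p` on the positivity set. -/
theorem exists_norm_gradient_le_rpow (h : ConeProfile p θ₀ g) : ∃ μ : ℝ, 0 ≤ μ ∧
    ∀ x ∈ coneRegion θ₀, ‖gradient (coneFun g θ₀) x‖ ≤ μ * ‖gradient (coneFun g θ₀) x‖ ^ p := by
  have hs := h.gradSq_pos _ h.half_mem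
  set s := Real.sqrt (gradSq g (Real.pi / 2)) with hsdef
  have hs0 : 0 < s := Real.sqrt_pos.2 hs
  refine ⟨(s ^ p)⁻¹, by positivity, fun x hx => ?_⟩
  have h1 : s ≤ ‖gradient (coneFun g θ₀) x‖ := by
    refine Real.sqrt_le_iff.2 ⟨norm_nonneg _, ?_⟩
    rw [h.norm_sq_gradient_coneFun hx]
    exact h.gradSq_half_le (Ioo_subset_Icc_self (h.mem_iff.1 hx).2)
  have h2 : s ^ p ≤ ‖gradient (coneFun g θ₀) x‖ ^ p :=
    Real.rpow_le_rpow hs0.le h1 (by linarith [h.one_lt])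
  have h3 : 0 < s ^ p := by positivity
  calc _ ≤ 1 := h.norm_gradient_coneFun_le x
    _ = (s ^ p)⁻¹ * s ^ p := (inv_mul_cancel₀ h3.ne').symm
    _ ≤ _ := mul_le_mul_of_nonneg_left h2 (by positivity)

/-- The functions `u/(u + ε)` converge to the characteristic function of the positivity set. Their
gradients are bounded in `L¹_loc` by `caccioppoli`, using that `|∇u|` and `|∇u|^p` are comparable
there; the perimeter bound passes to the limit. -/
theorem hasLocallyFinitePerimeter (h : ConeProfile p θ₀ g) :
    HasLocallyFinitePerimeter (coneRegion θ₀) := by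
  intro D hD hDb
  obtain ⟨R, hR⟩ := hDb.subset_ball 0
  set R' := max R 1
  have hR' : 0 < R' := by positivity
  let φ : ContDiffBump (0 : E3) := ⟨R', R' + 1, hR', by linarith⟩
  obtain ⟨μ, hμ0, hμ⟩ := h.exists_norm_gradient_le_rpow
  have hφ1 : ContDiff ℝ 1 φ := φ.contDiff
  have hφc : HasCompactSupport φ := φ.hasCompactSupport
  refine ⟨μ * ∫ x, ‖gradient φ x‖, fun X hX hc hXD hX1 => ?_⟩
  have hX1' : ContDiff ℝ 1 X := hX.of_le (by exact_mod_cast le_top)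
  have hdi : Integrable (divergence X) :=
    (continuous_divergence hX1').integrable_of_hasCompactSupport (hasCompactSupport_divergence hc)
  have hm := (isOpen_coneRegion θ₀).measurableSet
  set ε : ℕ → ℝ := fun k => 1 / ((k : ℝ) + 1) with hε
  have hε0 : ∀ k, 0 < ε k := fun k => by positivity
  have hεt : Tendsto ε atTop (𝓝 0) := tendsto_one_div_add_atTop_nhds_zero_nat
  have hlim : Tendsto (fun k => ∫ x, softPos g θ₀ (ε k) x * divergence X x) atTop
      (𝓝 (∫ x in coneRegion θ₀, divergence X x)) := by
    rw [← integral_indicator hm]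
    refine tendsto_integral_of_dominated_convergence (fun x => ‖divergence X x‖) (fun k => ?_)
      hdi.norm (fun k => Eventually.of_forall fun x => ?_) (Eventually.of_forall fun x => ?_)
    · obtain ⟨L, hL⟩ := h.exists_lipschitzWith_softPos (hε0 k)
      exact (hL.continuous.mul (continuous_divergence hX1')).aestronglyMeasurable
    · rw [norm_mul, Real.norm_of_nonneg (softPos_nonneg (hε0 k) x)]
      exact mul_le_of_le_one_left (norm_nonneg _) (softPos_le_one (hε0 k) x)
    · by_cases hx : x ∈ coneRegion θ₀
      · rw [indicator_of_mem hx]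
        have hu := (h.coneFun_pos_iff).2 hx
        have : Tendsto (fun k => coneFun g θ₀ x / (coneFun g θ₀ x + ε k)) atTop
            (𝓝 (coneFun g θ₀ x / (coneFun g θ₀ x + 0))) :=
          tendsto_const_nhds.div (tendsto_const_nhds.add hεt) (by linarith)
        rw [add_zero, div_self hu.ne'] at this
        simpa [softPos] using this.mul_const (divergence X x)
      · rw [indicator_of_notMem hx]
        simp only [h.softPos_of_not_mem hx, zero_mul]
        exact tendsto_const_nhds
  refine le_of_tendsto hlim (Eventually.of_forall fun k => ?_)
  obtain ⟨L, hL⟩ := h.exists_lipschitzWith_softPos (hε0 k)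
  rw [hL.integral_mul_divergence hX hc, ← setIntegral_eq_integral_of_forall_compl_eq_zero
    (s := coneRegion θ₀) (fun x hx => by rw [h.gradient_softPos_of_not_mem (hε0 k) hx, inner_zero_left])]
  have hca := h.caccioppoli hφ1 hφc (hε0 k)
  have hci := h.integrable_caccioppoli hφ1 hφc (hε0 k)
  refine le_trans ?_ (mul_le_mul_of_nonneg_left hca hμ0)
  rw [← integral_const_mul]
  refine (neg_le_abs _).trans ?_
  rw [← Real.norm_eq_abs]
  refine norm_integral_le_of_norm_le (hci.const_mul μ).integrableOn
    (ae_restrict_of_forall_mem hm fun x hx => ?_)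
  by_cases hxD : x ∈ D
  · have hφx : φ x = 1 := φ.one_of_mem_closedBall (by
      have := hR hxD
      rw [mem_ball_zero_iff] at this
      rw [mem_closedBall_zero_iff]
      exact this.le.trans (le_max_left _ _))
    have hq : 0 ≤ ε k / (coneFun g θ₀ x + ε k) ^ 2 := div_nonneg (hε0 k).le (sq_nonneg _)
    rw [(h.hasGradientAt_softPos (hε0 k) hx).gradient, hφx, one_mul]
    refine (norm_inner_le_norm _ _).trans ?_
    rw [norm_smul, Real.norm_of_nonneg hq]
    calc _ ≤ ε k / (coneFun g θ₀ x + ε k) ^ 2 * ‖gradient (coneFun g θ₀) x‖ * 1 :=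
          mul_le_mul_of_nonneg_left (hX1 x) (by positivity)
      _ ≤ ε k / (coneFun g θ₀ x + ε k) ^ 2 * (μ * ‖gradient (coneFun g θ₀) x‖ ^ p) := by
          rw [mul_one]; exact mul_le_mul_of_nonneg_left (hμ x hx) hq
      _ = _ := by ring
  · have : X x = 0 := image_eq_zero_of_notMem_tsupport fun hx => hxD (hXD hx)
    rw [this, inner_zero_right, norm_zero]
    have := φ.nonneg (x := x)
    have hε' := (hε0 k).le
    positivity

theorem frontier_eq_union (h : ConeProfile p θ₀ g) :
    frontier (coneRegion θ₀) \ {0} = coneSurface θ₀ ∪ coneSurface (Real.pi - θ₀) := by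
  rw [frontier_coneRegion h.angle_pos h.angle_lt]
  have hc : 0 < Real.cos θ₀ := Real.cos_pos_of_mem_Ioo
    ⟨by linarith [Real.pi_pos, h.angle_pos], h.angle_lt⟩
  ext x
  simp only [Set.mem_sdiff, mem_ofPred_eq, mem_singleton_iff, coneSurface, mem_union, Real.cos_pi_sub]
  have hn : 0 ≤ Real.cos θ₀ * ‖x‖ := by positivity
  constructor
  · rintro ⟨hx, h0⟩
    rcases (abs_eq hn).1 hx with e | e
    · exact Or.inl ⟨h0, by rw [e]; ring⟩
    · exact Or.inr ⟨h0, by rw [e]; ring⟩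
  · rintro (⟨h0, e⟩ | ⟨h0, e⟩)
    · exact ⟨(abs_eq hn).2 (Or.inl (by rw [e]; ring)), h0⟩
    · exact ⟨(abs_eq hn).2 (Or.inr (by rw [e]; ring)), h0⟩

theorem disjoint_coneSurface (h : ConeProfile p θ₀ g) :
    Disjoint (coneSurface θ₀) (coneSurface (Real.pi - θ₀)) := by
  have hc : 0 < Real.cos θ₀ := Real.cos_pos_of_mem_Ioo
    ⟨by linarith [Real.pi_pos, h.angle_pos], h.angle_lt⟩
  rw [Set.disjoint_left]
  rintro x ⟨h0, e⟩ ⟨-, e'⟩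
  have := norm_pos_iff.2 h0
  rw [e, Real.cos_pi_sub] at e'
  nlinarith [mul_pos this hc]

/-- Every point of the cone except the vertex is regular, and a point has no area; whether the
vertex belongs to the reduced boundary is irrelevant. -/
theorem reducedBoundary_ae_eq (h : ConeProfile p θ₀ g) :
    reducedBoundary (coneRegion θ₀) =ᵐ[μHE[2]]
      (coneSurface θ₀ ∪ coneSurface (Real.pi - θ₀) : Set E3) := by
  have hae : ∀ᵐ x : E3 ∂(μHE[2]), x ≠ 0 := by
    rw [ae_iff]; simpa using! euclideanHausdorffMeasure_singleton 0
  filter_upwards [hae] with x hx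
  refine propext ⟨fun hr => ?_, fun hr => ?_⟩
  · exact h.frontier_eq_union ▸ ⟨reducedBoundary_subset_frontier _ hr, hx⟩
  · have : x ∈ frontier (coneRegion θ₀) \ {0} := h.frontier_eq_union ▸ hr
    rw [frontier_coneRegion h.angle_pos h.angle_lt] at this
    exact mem_reducedBoundary_coneRegion h.angle_pos h.angle_lt hx this.1

theorem frontier_ae_eq (h : ConeProfile p θ₀ g) :
    frontier (coneRegion θ₀) =ᵐ[μHE[2]]
      (coneSurface θ₀ ∪ coneSurface (Real.pi - θ₀) : Set E3) := by
  have hae : ∀ᵐ x : E3 ∂(μHE[2]), x ≠ 0 := by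
    rw [ae_iff]; simpa using! euclideanHausdorffMeasure_singleton 0
  filter_upwards [hae] with x hx
  refine propext ⟨fun hr => h.frontier_eq_union ▸ ⟨hr, hx⟩, fun hr => ?_⟩
  have : x ∈ frontier (coneRegion θ₀) \ {0} := h.frontier_eq_union ▸ hr
  exact this.1

theorem integrableOn_union_of_bound (h : ConeProfile p θ₀ g)
    {F : E3 → ℝ} (hF : Measurable F) {C R : ℝ} (hb : ∀ x, |F x| * ‖x‖ ≤ C)
    (h0 : ∀ x, R ≤ ‖x‖ → F x = 0) :
    IntegrableOn F (coneSurface θ₀) (μHE[2]) ∧ IntegrableOn F (coneSurface (Real.pi - θ₀)) (μHE[2]) :=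
  ⟨integrableOn_coneSurface_of_bound h.sin_pos h.sin_lt_one hF hb h0,
    integrableOn_coneSurface_of_bound (by rw [Real.sin_pi_sub]; exact h.sin_pos)
      (by rw [Real.sin_pi_sub]; exact h.sin_lt_one) hF hb h0⟩

theorem isWeakSolution (h : ConeProfile p θ₀ g) : IsWeakSolution p 1 (coneFun g θ₀) := by
  obtain ⟨L, hL⟩ := h.exists_lipschitzWith
  refine ⟨coneFun_nonneg, hL.continuous, fun D _ _ => ?_, ?_, gradient (coneFun g θ₀),
    fun R _ => hL.memW1p Metric.isBounded_ball, fun ζ hζ => ?_, fun ζ hζ => ?_⟩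
  · obtain ⟨c, C, hc, hg⟩ := h.exists_growth
    refine ⟨c, C, hc, fun x hx r hr _ => hg x ?_ r hr⟩
    rwa [← h.setOf_coneFun_pos]
  · rw [h.setOf_coneFun_pos]; exact h.hasLocallyFinitePerimeter
  · rw [h.setOf_coneFun_pos] at hζ
    obtain ⟨L', hL'⟩ := (hζ.1.of_le (by exact_mod_cast le_top) :
      ContDiff ℝ 1 ζ).lipschitzWith_of_hasCompactSupport hζ.2.1 one_ne_zero
    exact h.integral_flux_eq_zero hL' hζ.2.1 fun x hx =>
      image_eq_zero_of_notMem_tsupport fun hx' => hx (hζ.2.2 hx')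
  · rw [h.setOf_coneFun_pos, Real.one_rpow, one_mul]
    have hζ1 : ContDiff ℝ 1 ζ := hζ.1.of_le (by exact_mod_cast le_top)
    obtain ⟨R, hR, hζR⟩ := exists_forall_norm_eq_zero hζ.2.1
    obtain ⟨C, hC0, hC⟩ := exists_bound_of_hasCompactSupport hζ.1.continuous hζ.2.1
    have hb : ∀ x, |ζ x| * ‖x‖ ≤ C * R := fun x => by
      rcases le_or_gt R ‖x‖ with hx | hx
      · rw [hζR x hx]; simp; positivity
      · exact mul_le_mul (hC x) hx.le (norm_nonneg _) hC0
    obtain ⟨i1, i2⟩ := h.integrableOn_union_of_bound hζ.1.continuous.measurable hb hζR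
    refine ⟨(i1.union i2).congr_set_ae h.reducedBoundary_ae_eq, ?_⟩
    rw [h.integral_flux hζ1 hζ.2.1, setIntegral_congr_set h.reducedBoundary_ae_eq,
      setIntegral_union h.disjoint_coneSurface (measurableSet_coneSurface _) i1 i2]

end ConeProfile

end

noncomputable section

/-! ### Radial functions almost attaining Hardy's inequality -/

/-- The substitution `ρ = e^t`, which makes the scale-invariant Hardy quotient translation
invariant. -/
theorem integral_Ioi_inv_mul_log (F : ℝ → ℝ) :
    ∫ ρ in Ioi (0 : ℝ), ρ⁻¹ * F (Real.log ρ) = ∫ t, F t := by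
  have := integral_image_eq_integral_abs_deriv_smul (s := univ) MeasurableSet.univ
    (fun t _ => (Real.hasDerivAt_exp t).hasDerivWithinAt) Real.exp_injective.injOn
    (fun ρ => ρ⁻¹ * F (Real.log ρ))
  rw [image_univ, Real.range_exp] at this
  rw [this, setIntegral_univ]
  refine integral_congr_ae (Eventually.of_forall fun t => ?_)
  simp only [abs_of_pos (Real.exp_pos t), Real.log_exp, smul_eq_mul]
  rw [← mul_assoc, mul_inv_cancel₀ (Real.exp_pos t).ne', one_mul]

theorem integral_mul_deriv_self {k : ℝ → ℝ} (hk : ContDiff ℝ 1 k) (hc : HasCompactSupport k) :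
    ∫ t, k t * deriv k t = 0 := by
  have hd : ∀ t, HasDerivAt k (deriv k t) t := fun t => (hk.differentiable one_ne_zero t).hasDerivAt
  have hi : Integrable (fun t => k t * deriv k t) :=
    (hk.continuous.mul (hk.continuous_deriv le_rfl)).integrable_of_hasCompactSupport hc.mul_right
  have h := integral_mul_deriv_eq_deriv_mul_of_integrable (u := k) (v := k) (u' := deriv k)
    (v' := deriv k) (fun t _ => hd t) (fun t _ => hd t) hi (by simpa [mul_comm] using! hi)
    ((hk.continuous.mul hk.continuous).integrable_of_hasCompactSupport hc.mul_right)
  have e : ∫ t, deriv k t * k t = ∫ t, k t * deriv k t := by simp only [mul_comm]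
  rw [e] at h
  linarith

theorem exists_log_bump {δ : ℝ} (hδ : 0 < δ) (b : ℝ) : ∃ k : ℝ → ℝ, ContDiff ℝ ∞ k ∧ (∀ t, 0 ≤ k t) ∧
    HasCompactSupport k ∧ (∀ t, b ≤ t → k t = 0) ∧ 0 < ∫ t, k t ^ 2 ∧
    ∫ t, deriv k t ^ 2 ≤ δ * ∫ t, k t ^ 2 := by
  let f : ContDiffBump (0 : ℝ) := ⟨1, 2, one_pos, one_lt_two⟩
  have hf1 : ContDiff ℝ 1 f := f.contDiff
  have hfc : HasCompactSupport f := f.hasCompactSupport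
  have hfi : Integrable fun t => f t ^ 2 := (hf1.continuous.pow 2).integrable_of_hasCompactSupport
    (by simpa [pow_two] using! hfc.mul_right (f' := f))
  have hpos : 0 < ∫ t, f t ^ 2 := by
    refine (integral_pos_iff_support_of_nonneg (fun t => sq_nonneg _) hfi).2 ?_
    refine (Metric.measure_ball_pos volume (0 : ℝ) one_pos).trans_le (measure_mono fun t ht => ?_)
    have : f t = 1 := f.one_of_mem_closedBall (Metric.ball_subset_closedBall ht)
    simp [this]
  set A := ∫ t, f t ^ 2
  set B := ∫ t, deriv f t ^ 2
  have hB : 0 ≤ B := integral_nonneg fun t => sq_nonneg _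
  -- Stretching by `M` multiplies `∫ k²` by `M` and divides `∫ k'²` by `M`. The centre `b - 2M`
  -- chosen below puts the support to the left of `b`.
  obtain ⟨M, hM1, hM⟩ : ∃ M : ℝ, 1 ≤ M ∧ B ≤ δ * A * M := by
    refine ⟨max 1 (B / (δ * A)), le_max_left _ _, ?_⟩
    rw [← div_le_iff₀' (by positivity)]
    exact le_max_right _ _
  have hM0 : 0 < M := by linarith
  set T := b - 2 * M
  set k : ℝ → ℝ := fun t => f ((t - T) / M) with hk
  have hkd : ∀ t, deriv k t = deriv f ((t - T) / M) / M := fun t => by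
    have h1 : HasDerivAt (fun t : ℝ => (t - T) / M) (1 / M) t :=
      ((hasDerivAt_id t).sub_const T).div_const M
    have h2 := ((hf1.differentiable one_ne_zero _).hasDerivAt (x := (t - T) / M)).comp t h1
    rw [show deriv k t = _ from h2.deriv]; ring
  have hsc : ∀ G : ℝ → ℝ, ∫ t, G ((t - T) / M) = M * ∫ t, G t := fun G => by
    rw [integral_sub_right_eq_self (fun t => G (t / M)) T, Measure.integral_comp_div,
      abs_of_pos hM0, smul_eq_mul]
  have e1 : ∫ t, k t ^ 2 = M * A := hsc fun t => f t ^ 2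
  have e2 : ∫ t, deriv k t ^ 2 = M⁻¹ * B := by
    simp only [hkd, div_pow]
    rw [integral_div, hsc fun t => deriv f t ^ 2]
    field_simp
    rfl
  have hsupp : ∀ t, k t ≠ 0 → |t - T| < 2 * M := fun t ht => by
    have : (t - T) / M ∈ Metric.ball (0 : ℝ) 2 := by
      rw [show (2 : ℝ) = f.rOut from rfl, ← f.support_eq]; exact ht
    rw [mem_ball_zero_iff, Real.norm_eq_abs, abs_div, abs_of_pos hM0, div_lt_iff₀ hM0] at this
    exact this
  refine ⟨k, f.contDiff.comp (by fun_prop), fun t => f.nonneg, ?_, fun t ht => ?_, ?_, ?_⟩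
  · refine HasCompactSupport.of_support_subset_isCompact (isCompact_closedBall T (2 * M)) fun t ht => ?_
    rw [Metric.mem_closedBall, Real.dist_eq]
    exact (hsupp t ht).le
  · by_contra hne
    have := (abs_lt.1 (hsupp t hne)).2
    simp only [T] at this
    linarith
  · rw [e1]; positivity
  · rw [e1, e2, inv_mul_le_iff₀ hM0]
    nlinarith [mul_pos hδ hpos]

/-- Radial test functions near the vertex almost attaining Hardy's inequality. -/
theorem exists_radial {δ r : ℝ} (hδ : 0 < δ) (hr : 0 < r) : ∃ κ : ℝ → ℝ, ContDiff ℝ ∞ κ ∧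
    (∀ ρ, 0 ≤ κ ρ) ∧ HasCompactSupport κ ∧ tsupport κ ⊆ Ioo 0 r ∧
    0 < ∫ ρ in Ioi (0 : ℝ), κ ρ ^ 2 ∧
    ∫ ρ in Ioi (0 : ℝ), ρ ^ 2 * deriv κ ρ ^ 2 ≤ (1 / 4 + δ) * ∫ ρ in Ioi (0 : ℝ), κ ρ ^ 2 := by
  obtain ⟨k, hk, hk0, hkc, hkb, hkpos, hkle⟩ := exists_log_bump hδ (Real.log (r / 2))
  have hk1 : ContDiff ℝ 1 k := hk.of_le (by exact_mod_cast le_top)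
  obtain ⟨a, ha⟩ : ∃ a, ∀ t, t ≤ a → k t = 0 := by
    obtain ⟨R, hR⟩ := hkc.isCompact.isBounded.subset_ball 0
    refine ⟨-R, fun t ht => image_eq_zero_of_notMem_tsupport fun h => ?_⟩
    have := hR h
    rw [mem_ball_zero_iff, Real.norm_eq_abs] at this
    linarith [(abs_lt.1 this).1]
  -- This is `ρ^(-1/2) k(log ρ)`, so `∫ κ² = ∫ k²` and `∫ ρ² κ'² = ∫ (k' - k/2)²`. The mixed term
  -- integrates to zero, leaving Hardy's constant `1/4` plus `∫ k'²`.
  set κ : ℝ → ℝ := fun ρ => if 0 < ρ then Real.exp (-(Real.log ρ) / 2) * k (Real.log ρ) else 0 with hκ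
  have hpos : ∀ ρ, 0 < ρ → κ ρ = Real.exp (-(Real.log ρ) / 2) * k (Real.log ρ) := fun ρ h => by
    simp only [hκ, if_pos h]
  have hev : ∀ ρ, 0 < ρ → κ =ᶠ[𝓝 ρ] fun ρ => Real.exp (-(Real.log ρ) / 2) * k (Real.log ρ) :=
    fun ρ h => by
      filter_upwards [Ioi_mem_nhds h] with s hs using hpos s hs
  have hzero : ∀ ρ, ρ ≤ Real.exp a → κ ρ = 0 := fun ρ h => by
    by_cases h0 : 0 < ρ
    · rw [hpos ρ h0, ha _ ((Real.log_le_iff_le_exp h0).2 h), mul_zero]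
    · simp only [hκ, if_neg h0]
  have hsupp : Function.support κ ⊆ Icc (Real.exp a) (r / 2) := fun ρ h => by
    constructor
    · by_contra hlt
      exact h (hzero ρ (not_le.1 hlt).le)
    · by_contra hlt
      have hρ : 0 < ρ := by linarith [not_le.1 hlt]
      refine h ?_
      rw [hpos ρ hρ, hkb _ (Real.log_le_log (by positivity) (not_le.1 hlt).le), mul_zero]
  have hts : tsupport κ ⊆ Icc (Real.exp a) (r / 2) := closure_minimal hsupp isClosed_Icc
  have hsmooth : ContDiff ℝ ∞ κ := by
    rw [contDiff_iff_contDiffAt]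
    intro ρ
    by_cases h : 0 < ρ
    · refine ContDiffAt.congr_of_eventuallyEq ?_ (hev ρ h)
      have hl : ContDiffAt ℝ ∞ Real.log ρ := Real.contDiffAt_log.2 h.ne'
      exact (Real.contDiff_exp.contDiffAt.comp ρ (hl.neg.div_const 2)).mul (hk.contDiffAt.comp ρ hl)
    · refine (contDiffAt_const (c := (0 : ℝ))).congr_of_eventuallyEq ?_
      have : ρ < Real.exp a := (not_lt.1 h).trans_lt (Real.exp_pos a)
      filter_upwards [Iio_mem_nhds this] with s hs using hzero s (le_of_lt hs)
  have hexp : ∀ ρ : ℝ, 0 < ρ → Real.exp (-(Real.log ρ) / 2) ^ 2 = ρ⁻¹ := fun ρ h => by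
    rw [← Real.exp_nat_mul, ← Real.exp_log (inv_pos.2 h), Real.log_inv]
    congr 1; push_cast; ring
  have hsq : ∫ ρ in Ioi (0 : ℝ), κ ρ ^ 2 = ∫ t, k t ^ 2 := by
    rw [← integral_Ioi_inv_mul_log fun t => k t ^ 2]
    refine setIntegral_congr_fun measurableSet_Ioi fun ρ hρ => ?_
    simp only [hpos ρ hρ, mul_pow, hexp ρ hρ]
  have hder : ∀ ρ, 0 < ρ → deriv κ ρ =
      Real.exp (-(Real.log ρ) / 2) * ρ⁻¹ * (deriv k (Real.log ρ) - k (Real.log ρ) / 2) := fun ρ h => by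
    rw [(hev ρ h).deriv_eq]
    have hl := Real.hasDerivAt_log h.ne'
    have h1 := (hl.neg.div_const 2).exp
    have h2 := ((hk1.differentiable one_ne_zero _).hasDerivAt (x := Real.log ρ)).comp ρ hl
    have h3 := h1.mul h2
    rw [show deriv (fun ρ => Real.exp (-(Real.log ρ) / 2) * k (Real.log ρ)) ρ = _ from h3.deriv]
    simp only [Function.comp_apply, Pi.neg_apply]
    ring
  have hsq' : ∫ ρ in Ioi (0 : ℝ), ρ ^ 2 * deriv κ ρ ^ 2 = ∫ t, (deriv k t - k t / 2) ^ 2 := by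
    rw [← integral_Ioi_inv_mul_log fun t => (deriv k t - k t / 2) ^ 2]
    refine setIntegral_congr_fun measurableSet_Ioi fun ρ hρ => ?_
    have hρ0 : (0 : ℝ) < ρ := hρ
    simp only [hder ρ hρ, mul_pow, hexp ρ hρ]
    field_simp
  have hkd := hk1.continuous_deriv le_rfl
  have i1 : Integrable fun t => deriv k t ^ 2 := (hkd.pow 2).integrable_of_hasCompactSupport
    (by simpa [pow_two] using! hkc.deriv.mul_right (f' := deriv k))
  have i2 : Integrable fun t => k t * deriv k t :=
    (hk1.continuous.mul hkd).integrable_of_hasCompactSupport hkc.mul_right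
  have i3 : Integrable fun t => k t ^ 2 := (hk1.continuous.pow 2).integrable_of_hasCompactSupport
    (by simpa [pow_two] using! hkc.mul_right (f' := k))
  have hexpand : ∫ t, (deriv k t - k t / 2) ^ 2 = (∫ t, deriv k t ^ 2) + (1 / 4) * ∫ t, k t ^ 2 := by
    have e : ∀ t, (deriv k t - k t / 2) ^ 2 =
        deriv k t ^ 2 - k t * deriv k t + (1 / 4) * k t ^ 2 := fun t => by ring
    simp only [e]
    have i12 : Integrable fun t => deriv k t ^ 2 - k t * deriv k t := i1.sub i2
    rw [integral_add i12 (i3.const_mul _), integral_sub i1 i2,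
      integral_mul_deriv_self hk1 hkc, integral_const_mul, sub_zero]
  refine ⟨κ, hsmooth, fun ρ => ?_, ?_, ?_, ?_, ?_⟩
  · simp only [hκ]
    split_ifs
    · exact mul_nonneg (Real.exp_pos _).le (hk0 _)
    · exact le_rfl
  · exact isCompact_Icc.of_isClosed_subset (isClosed_tsupport _) hts
  · exact hts.trans fun ρ hρ => ⟨(Real.exp_pos a).trans_le hρ.1, by linarith [hρ.2]⟩
  · rw [hsq]; exact hkpos
  · rw [hsq, hsq', hexpand]; linarith

end

noncomputable section

/-! ### The second variation along `κ(ρ) c(θ)` -/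

theorem setIntegral_coneRegionDomain_mul (θ₀ : ℝ) (f k : ℝ → ℝ) :
    ∫ q in coneRegionDomain θ₀, f q.2.1 * k q.2.2 =
      2 * Real.pi * ((∫ ρ in Ioi (0 : ℝ), f ρ) * ∫ θ in Ioo θ₀ (Real.pi - θ₀), k θ) := by
  have h1 := setIntegral_prod_mul (μ := (volume : Measure ℝ)) (ν := (volume : Measure (ℝ × ℝ)))
    (fun _ : ℝ => (1 : ℝ)) (fun r : ℝ × ℝ => f r.1 * k r.2) (Ioo (-Real.pi) Real.pi)
    (Ioi 0 ×ˢ Ioo θ₀ (Real.pi - θ₀))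
  have h2 := setIntegral_prod_mul (μ := (volume : Measure ℝ)) (ν := (volume : Measure ℝ)) f k (Ioi 0)
    (Ioo θ₀ (Real.pi - θ₀))
  simp only [one_mul] at h1
  rw [coneRegionDomain, Measure.volume_eq_prod, h1, Measure.volume_eq_prod, h2]
  congr 1
  have := Real.pi_pos
  rw [setIntegral_const, smul_eq_mul, mul_one, Real.volume_real_Ioo_of_le (by linarith)]
  ring

theorem integrableOn_coneRegionDomain_mul {θ₀ : ℝ} {f k : ℝ → ℝ} (hf : IntegrableOn f (Ioi 0))
    (hk : IntegrableOn k (Ioo θ₀ (Real.pi - θ₀))) :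
    IntegrableOn (fun q : ℝ × ℝ × ℝ => f q.2.1 * k q.2.2) (coneRegionDomain θ₀) := by
  have h1 : IntegrableOn (fun r : ℝ × ℝ => f r.1 * k r.2) (Ioi 0 ×ˢ Ioo θ₀ (Real.pi - θ₀)) := by
    rw [IntegrableOn, Measure.volume_eq_prod, ← Measure.prod_restrict]
    exact hf.mul_prod hk
  have h0 : IntegrableOn (fun _ : ℝ => (1 : ℝ)) (Ioo (-Real.pi) Real.pi) :=
    integrableOn_const (by simp)
  rw [IntegrableOn, coneRegionDomain, Measure.volume_eq_prod, ← Measure.prod_restrict]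
  simpa using! h0.mul_prod h1

theorem setIntegral_coneDomain (f : ℝ → ℝ) :
    ∫ q in coneDomain, f q.2 = 2 * Real.pi * ∫ ρ in Ioi (0 : ℝ), f ρ := by
  have h1 := setIntegral_prod_mul (μ := (volume : Measure ℝ)) (ν := (volume : Measure ℝ))
    (fun _ : ℝ => (1 : ℝ)) f (Ioc (-Real.pi) Real.pi) (Ioi 0)
  simp only [one_mul] at h1
  rw [coneDomain, Measure.volume_eq_prod, h1]
  congr 1
  have := Real.pi_pos
  rw [setIntegral_const, smul_eq_mul, mul_one, Real.volume_real_Ioc_of_le (by linarith)]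
  ring

theorem measurable_stabilityDensity (p : ℝ) (u ψ : E3 → ℝ) : Measurable (stabilityDensity p u ψ) := by
  have h1 := measurable_gradient u
  have h2 := measurable_gradient ψ
  exact (h1.norm.pow_const _).mul ((h2.norm.pow_const _).add
    ((((h1.inner h2).pow_const _).div (h1.norm.pow_const _)).const_mul _))

namespace ConeProfile
variable {p θ₀ : ℝ} {g : ℝ → ℝ}

theorem continuousOn_dirForm (h : ConeProfile p θ₀ g) {a b : ℝ → ℝ}
    (ha : ContinuousOn a (Ioo 0 Real.pi)) (hb : ContinuousOn b (Ioo 0 Real.pi)) :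
    ContinuousOn (fun θ => dirForm p g θ (a θ) (b θ)) (Ioo 0 Real.pi) := by
  refine ((ha.pow 2).add (hb.pow 2)).add (ContinuousOn.const_mul ?_ _)
  exact (((h.continuousOn.mul ha).add (h.continuousOn_deriv.mul hb)).pow 2).div
    h.continuousOn_gradSq fun θ hθ => (h.gradSq_pos θ hθ).ne'

theorem integrableOn_meridian (h : ConeProfile p θ₀ g) {F : ℝ → ℝ}
    (hF : ContinuousOn F (Ioo 0 Real.pi)) : IntegrableOn F (Ioo θ₀ (Real.pi - θ₀)) :=
  ((hF.mono h.full_subset).integrableOn_compact isCompact_Icc).mono_set Ioo_subset_Icc_self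

theorem integral_meridian (h : ConeProfile p θ₀ g) {F : ℝ → ℝ} (hF : ContinuousOn F (Ioo 0 Real.pi))
    (hsymm : ∀ θ ∈ Ioo 0 Real.pi, F (Real.pi - θ) = F θ) :
    ∫ θ in Ioo θ₀ (Real.pi - θ₀), F θ = 2 * ∫ θ in θ₀..Real.pi / 2, F θ := by
  rw [← h.integral_full hF hsymm, intervalIntegral.integral_of_le (by linarith [h.angle_lt]),
    integral_Ioc_eq_integral_Ioo]

theorem stabilityDensity_eq (h : ConeProfile p θ₀ g) {ψ : E3 → ℝ} {x : E3}
    (hx : x ∈ coneRegion θ₀) {a b : ℝ} (hψ : gradient ψ x = polarVec x a b) :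
    stabilityDensity p (coneFun g θ₀) ψ x =
      pWeight p g (polarAngle x) * dirForm p g (polarAngle x) a b := by
  have h0 := (h.mem_iff.1 hx).1
  have hm := h.polarAngle_mem hx
  rw [stabilityDensity, h.norm_rpow_gradient_coneFun hx, h.norm_sq_gradient_coneFun hx, hψ,
    h.gradient_coneFun hx, inner_polarVec h0 hm, norm_sq_polarVec h0 hm, dirForm]

/-- The bulk term of the second variation in spherical coordinates. -/
theorem integral_stabilityDensity (h : ConeProfile p θ₀ g) {c α β : ℝ → ℝ}
    (hc : ContDiffOn ℝ ∞ c (Ioo 0 Real.pi))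
    (i1 : IntegrableOn (fun ρ => ρ ^ 2 * α ρ ^ 2) (Ioi 0))
    (i2 : IntegrableOn (fun ρ => ρ * (α ρ * β ρ)) (Ioi 0))
    (i3 : IntegrableOn (fun ρ => β ρ ^ 2) (Ioi 0)) {ψ : E3 → ℝ}
    (hψ : ∀ᵐ x ∂volume.restrict (coneRegion θ₀), gradient ψ x = polarVec x
      (α ‖x‖ * c (polarAngle x)) (β ‖x‖ * deriv c (polarAngle x) / ‖x‖)) :
    IntegrableOn (stabilityDensity p (coneFun g θ₀) ψ) (coneRegion θ₀) ∧
      ∫ x in coneRegion θ₀, stabilityDensity p (coneFun g θ₀) ψ x = 2 * Real.pi *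
        ((∫ ρ in Ioi (0 : ℝ), ρ ^ 2 * α ρ ^ 2) *
          (∫ θ in Ioo θ₀ (Real.pi - θ₀), pWeight p g θ * dirForm p g θ (c θ) 0 * Real.sin θ) +
        (∫ ρ in Ioi (0 : ℝ), ρ * (α ρ * β ρ)) *
          (∫ θ in Ioo θ₀ (Real.pi - θ₀), 2 * (pWeight p g θ * dirForm p g θ (c θ) 0 * Real.sin θ / 4 +
            pWeight p g θ * dirForm p g θ 0 (deriv c θ) * Real.sin θ - angForm p g c θ)) +
        (∫ ρ in Ioi (0 : ℝ), β ρ ^ 2) *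
          (∫ θ in Ioo θ₀ (Real.pi - θ₀),
            pWeight p g θ * dirForm p g θ 0 (deriv c θ) * Real.sin θ)) := by
  have hm := (isOpen_coneRegion θ₀).measurableSet
  have hcc := hc.continuousOn
  have hcd : ContinuousOn (deriv c) (Ioo 0 Real.pi) :=
    hc.continuousOn_deriv_of_isOpen isOpen_Ioo (by simp)
  have hsin := Real.continuous_sin.continuousOn (s := Ioo 0 Real.pi)
  set w1 : ℝ → ℝ := fun θ => pWeight p g θ * dirForm p g θ (c θ) 0 * Real.sin θ with hw1
  set w3 : ℝ → ℝ := fun θ => pWeight p g θ * dirForm p g θ 0 (deriv c θ) * Real.sin θ with hw3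
  -- The mixed term of the quadratic form, recovered by polarization from its value at the Hardy
  -- exponent, where the radial component is `-c/2`.
  set w2 : ℝ → ℝ := fun θ => 2 * (w1 θ / 4 + w3 θ - angForm p g c θ) with hw2
  have c1 : ContinuousOn w1 (Ioo 0 Real.pi) :=
    (h.continuousOn_pWeight.mul (h.continuousOn_dirForm hcc continuousOn_const)).mul hsin
  have c3 : ContinuousOn w3 (Ioo 0 Real.pi) :=
    (h.continuousOn_pWeight.mul (h.continuousOn_dirForm continuousOn_const hcd)).mul hsin
  have c2 : ContinuousOn w2 (Ioo 0 Real.pi) :=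
    (((c1.div_const 4).add c3).sub (h.continuousOn_angForm hc)).const_mul 2
  set G : E3 → ℝ := fun x => pWeight p g (polarAngle x) * dirForm p g (polarAngle x)
    (α ‖x‖ * c (polarAngle x)) (β ‖x‖ * deriv c (polarAngle x) / ‖x‖) with hG
  have hFG : stabilityDensity p (coneFun g θ₀) ψ =ᵐ[volume.restrict (coneRegion θ₀)] G := by
    filter_upwards [hψ, ae_restrict_mem hm] with x hx hxE
    exact h.stabilityDensity_eq hxE hx
  have hGm : AEStronglyMeasurable G (volume.restrict (coneRegion θ₀)) :=
    (measurable_stabilityDensity _ _ _).aestronglyMeasurable.congr hFG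
  have hpull : ∀ q ∈ coneRegionDomain θ₀, q.2.1 ^ 2 * Real.sin q.2.2 * G (sph q.2.1 q.2.2 q.1) =
      (q.2.1 ^ 2 * α q.2.1 ^ 2) * w1 q.2.2 + (q.2.1 * (α q.2.1 * β q.2.1)) * w2 q.2.2 +
        β q.2.1 ^ 2 * w3 q.2.2 := by
    intro q hq
    have hq1 : 0 < q.2.1 := hq.2.1
    have hq2 := h.full_subset (Ioo_subset_Icc_self hq.2.2)
    have hS := (h.gradSq_pos _ hq2).ne'
    simp only [hG, polarAngle_sph hq1 (Ioo_subset_Icc_self hq2), norm_sph hq1.le, hw1, hw2, hw3,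
      dirForm, angForm]
    field_simp
    ring
  have j1 := integrableOn_coneRegionDomain_mul i1 (h.integrableOn_meridian c1)
  have j2 := integrableOn_coneRegionDomain_mul i2 (h.integrableOn_meridian c2)
  have j3 := integrableOn_coneRegionDomain_mul i3 (h.integrableOn_meridian c3)
  have j12 : IntegrableOn (fun q : ℝ × ℝ × ℝ => (q.2.1 ^ 2 * α q.2.1 ^ 2) * w1 q.2.2 +
      (q.2.1 * (α q.2.1 * β q.2.1)) * w2 q.2.2) (coneRegionDomain θ₀) := j1.add j2
  have j123 : IntegrableOn (fun q : ℝ × ℝ × ℝ => (q.2.1 ^ 2 * α q.2.1 ^ 2) * w1 q.2.2 +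
      (q.2.1 * (α q.2.1 * β q.2.1)) * w2 q.2.2 + β q.2.1 ^ 2 * w3 q.2.2) (coneRegionDomain θ₀) :=
    j12.add j3
  have hmD := measurableSet_coneRegionDomain θ₀
  constructor
  · refine IntegrableOn.congr_fun_ae ?_ hFG.symm
    rw [integrableOn_coneRegion_iff h.angle_pos h.angle_lt hGm,
      integrableOn_congr_fun hpull hmD]
    exact j123
  · rw [integral_congr_ae hFG, integral_coneRegion h.angle_pos h.angle_lt hGm,
      setIntegral_congr_fun hmD hpull, integral_add j12 j3, integral_add j1 j2,
      setIntegral_coneRegionDomain_mul θ₀ (fun ρ => ρ ^ 2 * α ρ ^ 2) w1,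
      setIntegral_coneRegionDomain_mul θ₀ (fun ρ => ρ * (α ρ * β ρ)) w2,
      setIntegral_coneRegionDomain_mul θ₀ (fun ρ => β ρ ^ 2) w3]
    ring

/-- The boundary term of the second variation. -/
theorem integral_curvature (h : ConeProfile p θ₀ g) {ψ : E3 → ℝ} {β : ℝ → ℝ} {c₀ C R : ℝ}
    (hψm : Measurable ψ) (hψb : ∀ x, |ψ x| ≤ C) (hψR : ∀ x, R ≤ ‖x‖ → ψ x = 0)
    (hψ : ∀ x ∈ coneSurface θ₀ ∪ coneSurface (Real.pi - θ₀), ψ x = β ‖x‖ * c₀) :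
    IntegrableOn (fun x => Real.cot θ₀ / ‖x‖ * ψ x ^ 2) (frontier (coneRegion θ₀)) (μHE[2]) ∧
      ∫ x in frontier (coneRegion θ₀), Real.cot θ₀ / ‖x‖ * ψ x ^ 2 ∂(μHE[2]) =
        4 * Real.pi * (Real.cos θ₀ * c₀ ^ 2 * ∫ ρ in Ioi (0 : ℝ), β ρ ^ 2) := by
  have hs := h.sin_pos
  have hFm : Measurable fun x : E3 => Real.cot θ₀ / ‖x‖ * ψ x ^ 2 :=
    (measurable_const.div measurable_norm).mul (hψm.pow_const 2)
  have hC0 : 0 ≤ C := (abs_nonneg _).trans (hψb 0)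
  obtain ⟨i1, i2⟩ := h.integrableOn_union_of_bound hFm (C := |Real.cot θ₀| * C ^ 2) (R := R)
    (fun x => by
      rw [abs_mul, abs_div, abs_norm, abs_of_nonneg (sq_nonneg (ψ x))]
      rcases eq_or_ne x 0 with rfl | hx
      · simp; positivity
      · have hn := norm_ne_zero_iff.2 hx
        have : ψ x ^ 2 ≤ C ^ 2 := by rw [← sq_abs]; exact pow_le_pow_left₀ (abs_nonneg _) (hψb x) 2
        calc _ = |Real.cot θ₀| * ψ x ^ 2 := by field_simp
          _ ≤ _ := mul_le_mul_of_nonneg_left this (abs_nonneg _))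
    (fun x hx => by rw [hψR x hx]; ring)
  have hsurf : ∀ θ, Real.sin θ = Real.sin θ₀ → (∀ x ∈ coneSurface θ, ψ x = β ‖x‖ * c₀) →
      ∫ x in coneSurface θ, Real.cot θ₀ / ‖x‖ * ψ x ^ 2 ∂(μHE[2]) =
        2 * Real.pi * (Real.cos θ₀ * c₀ ^ 2 * ∫ ρ in Ioi (0 : ℝ), β ρ ^ 2) := by
    intro θ hθ hψθ
    rw [integral_coneSurface (by rw [hθ]; exact hs) (by rw [hθ]; exact h.sin_lt_one)
      hFm.aestronglyMeasurable, ← integral_const_mul,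
      ← setIntegral_coneDomain fun ρ => Real.cos θ₀ * c₀ ^ 2 * β ρ ^ 2]
    refine setIntegral_congr_fun measurableSet_coneDomain fun q hq => ?_
    have hq2 : 0 < q.2 := hq.2
    have hmem : sph q.2 θ q.1 ∈ coneSurface θ := by
      rw [← image_coneMap (by rw [hθ]; exact hs)]
      exact ⟨q, hq, rfl⟩
    simp only [hψθ _ hmem, norm_sph hq2.le, hθ, Real.cot_eq_cos_div_sin]
    field_simp
  refine ⟨(i1.union i2).congr_set_ae h.frontier_ae_eq, ?_⟩
  rw [setIntegral_congr_set h.frontier_ae_eq,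
    setIntegral_union h.disjoint_coneSurface (measurableSet_coneSurface _) i1 i2,
    hsurf θ₀ rfl fun x hx => hψ x (Or.inl hx),
    hsurf (Real.pi - θ₀) (Real.sin_pi_sub _) fun x hx => hψ x (Or.inr hx)]
  ring

end ConeProfile

end

noncomputable section

/-! ### Destabilizing test functions -/

/-- Integration of `(ρ κ²)'`. Hence the mixed term of the second variation depends only on `∫ κ²`,
as if `κ` were `ρ^(-1/2)`. -/
theorem integral_mul_mul_deriv {κ : ℝ → ℝ} (hκ : ContDiff ℝ 1 κ) (hc : HasCompactSupport κ)
    (hs : tsupport κ ⊆ Ioi 0) :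
    ∫ ρ in Ioi (0 : ℝ), ρ * (deriv κ ρ * κ ρ) = -(1 / 2) * ∫ ρ in Ioi (0 : ℝ), κ ρ ^ 2 := by
  have hd : ∀ t, HasDerivAt κ (deriv κ t) t := fun t => (hκ.differentiable one_ne_zero t).hasDerivAt
  have hcd := hκ.continuous_deriv le_rfl
  have i1 : Integrable fun ρ => ρ * (deriv κ ρ * κ ρ) :=
    (continuous_id.mul (hcd.mul hκ.continuous)).integrable_of_hasCompactSupport
      (HasCompactSupport.mul_left (HasCompactSupport.mul_left hc))
  have i2 : Integrable fun ρ => κ ρ ^ 2 := (hκ.continuous.pow 2).integrable_of_hasCompactSupport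
    (by simpa [pow_two] using! hc.mul_right (f' := κ))
  have hz : ∀ ρ : ℝ, ρ ∉ Ioi (0 : ℝ) → κ ρ = 0 := fun ρ h =>
    image_eq_zero_of_notMem_tsupport fun h' => h (hs h')
  rw [setIntegral_eq_integral_of_forall_compl_eq_zero (fun ρ h => by rw [hz ρ h]; ring),
    setIntegral_eq_integral_of_forall_compl_eq_zero (fun ρ h => by rw [hz ρ h]; ring)]
  have i3 : Integrable fun ρ => ρ * κ ρ ^ 2 :=
    (continuous_id.mul (hκ.continuous.pow 2)).integrable_of_hasCompactSupport
      (HasCompactSupport.mul_left (by simpa [pow_two] using! hc.mul_right (f' := κ)))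
  have key := integral_eq_zero_of_hasDerivAt_of_integrable (f := fun ρ => ρ * κ ρ ^ 2)
    (f' := fun ρ => κ ρ ^ 2 + 2 * (ρ * (deriv κ ρ * κ ρ)))
    (fun ρ => by
      convert! (hasDerivAt_id ρ).mul ((hd ρ).pow 2) using 1
      simp; ring) (i2.add (i1.const_mul 2)) i3
  rw [integral_add i2 (i1.const_mul 2), integral_const_mul] at key
  linarith

/-- Functions `κ(|x|) χ(θ)` with `χ` supported away from the poles are smooth. -/
theorem contDiff_polar {κ χ : ℝ → ℝ} (hκ : ContDiff ℝ ∞ κ) (hκs : tsupport κ ⊆ Ioi 0)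
    (hχ : ContDiff ℝ ∞ χ) (hχs : tsupport χ ⊆ Ioo 0 Real.pi) :
    ContDiff ℝ ∞ fun x : E3 => κ ‖x‖ * χ (polarAngle x) := by
  rw [contDiff_iff_contDiffAt]
  intro x
  rcases eq_or_ne x 0 with rfl | hx
  · have h0 : (0 : ℝ) ∉ tsupport κ := fun h => lt_irrefl (0 : ℝ) (show (0 : ℝ) < 0 from hκs h)
    have hev := (notMem_tsupport_iff_eventuallyEq.1 h0)
    have hn : Tendsto (fun x : E3 => ‖x‖) (𝓝 0) (𝓝 0) := by simpa using (continuous_norm (E := E3)).tendsto 0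
    refine (contDiffAt_const (c := (0 : ℝ))).congr_of_eventuallyEq ?_
    filter_upwards [hn.eventually hev] with y hy
    rw [hy]; simp
  by_cases hm : polarAngle x ∈ Ioo 0 Real.pi
  · exact (hκ.contDiffAt.comp x (contDiffAt_norm ℝ hx)).mul
      (hχ.contDiffAt.comp x (contDiffAt_polarAngle hx hm))
  · have hev := notMem_tsupport_iff_eventuallyEq.1 fun h => hm (hχs h)
    refine (contDiffAt_const (c := (0 : ℝ))).congr_of_eventuallyEq ?_
    filter_upwards [(continuousAt_polarAngle hx).eventually hev] with y hy
    rw [hy]; simp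

theorem tsupport_polar_subset {κ χ : ℝ → ℝ} {a b : ℝ} (hκ : tsupport κ ⊆ Icc a b) :
    tsupport (fun x : E3 => κ ‖x‖ * χ (polarAngle x)) ⊆ {x | ‖x‖ ∈ Icc a b} := by
  refine closure_minimal (fun x hx => hκ (subset_tsupport _ ?_))
    (isClosed_Icc.preimage continuous_norm)
  exact left_ne_zero_of_mul hx

/-- Smooth functions on `(0, π)` can be cut off near the poles. -/
theorem exists_cutoff_poles {a : ℝ} (ha : 0 < a) (ha2 : a < Real.pi / 2) {c : ℝ → ℝ}
    (hc : ContDiffOn ℝ ∞ c (Ioo 0 Real.pi)) (hc0 : ∀ θ ∈ Ioo 0 Real.pi, 0 < c θ) :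
    ∃ χ : ℝ → ℝ, ContDiff ℝ ∞ χ ∧ tsupport χ ⊆ Ioo 0 Real.pi ∧ (∀ θ, 0 ≤ χ θ) ∧
      ∀ θ ∈ Icc a (Real.pi - a), χ θ = c θ := by
  let f : ContDiffBump (Real.pi / 2) := ⟨Real.pi / 2 - a, Real.pi / 2 - a / 2, by linarith, by linarith⟩
  have hfs : tsupport f ⊆ Ioo 0 Real.pi := by
    rw [f.tsupport_eq]
    intro θ hθ
    rw [Metric.mem_closedBall, Real.dist_eq, abs_le] at hθ
    have h1 : f.rOut = Real.pi / 2 - a / 2 := rfl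
    rw [h1] at hθ
    constructor <;> linarith [hθ.1, hθ.2]
  have hts : tsupport (fun θ => f θ * c θ) ⊆ tsupport f := tsupport_mul_subset_left
  refine ⟨fun θ => f θ * c θ, ?_, hts.trans hfs, fun θ => ?_, fun θ hθ => ?_⟩
  · rw [contDiff_iff_contDiffAt]
    intro θ
    by_cases h : θ ∈ Ioo 0 Real.pi
    · exact f.contDiff.contDiffAt.mul (hc.contDiffAt (Ioo_mem_nhds h.1 h.2))
    · refine (contDiffAt_const (c := (0 : ℝ))).congr_of_eventuallyEq ?_
      exact notMem_tsupport_iff_eventuallyEq.1 fun h' => h (hfs (hts h'))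
  · by_cases h : θ ∈ Ioo 0 Real.pi
    · exact mul_nonneg f.nonneg (hc0 θ h).le
    · have : f θ = 0 := image_eq_zero_of_notMem_tsupport fun h' => h (hfs h')
      simp [this]
  · have : f θ = 1 := f.one_of_mem_closedBall (by
      rw [Metric.mem_closedBall, Real.dist_eq, abs_le]
      have h1 : f.rIn = Real.pi / 2 - a := rfl
      rw [h1]
      constructor <;> linarith [hθ.1, hθ.2])
    simp [this]

namespace ConeProfile
variable {p θ₀ : ℝ} {g : ℝ → ℝ}

theorem dirForm_reflect (h : ConeProfile p θ₀ g) {θ : ℝ} (hθ : θ ∈ Ioo 0 Real.pi) (a b : ℝ) :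
    dirForm p g (Real.pi - θ) a (-b) = dirForm p g θ a b := by
  rw [dirForm, dirForm, h.symm θ hθ, h.deriv_reflect hθ, h.gradSq_reflect hθ]
  ring

/-- Cauchy–Schwarz bounds the rank-one term by `a² + b²`, and its coefficient exceeds `-1` because
`p > 1`. -/
theorem dirForm_nonneg (h : ConeProfile p θ₀ g) {θ : ℝ} (hθ : θ ∈ Ioo 0 Real.pi) (a b : ℝ) :
    0 ≤ dirForm p g θ a b := by
  have hS := h.gradSq_pos θ hθ
  have hp := h.one_lt
  have hcs : (g θ * a + deriv g θ * b) ^ 2 / gradSq g θ ≤ a ^ 2 + b ^ 2 := by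
    rw [div_le_iff₀ hS, gradSq]
    nlinarith [sq_nonneg (g θ * b - deriv g θ * a)]
  have h0 : 0 ≤ (g θ * a + deriv g θ * b) ^ 2 / gradSq g θ := by positivity
  rw [dirForm]
  nlinarith

theorem angForm_reflect (h : ConeProfile p θ₀ g) {c : ℝ → ℝ} (hc : ContDiffOn ℝ ∞ c (Ioo 0 Real.pi))
    (hcs : ∀ θ ∈ Ioo 0 Real.pi, c (Real.pi - θ) = c θ) {θ : ℝ} (hθ : θ ∈ Ioo 0 Real.pi) :
    angForm p g c (Real.pi - θ) = angForm p g c θ := by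
  have hd : ∀ θ ∈ Ioo 0 Real.pi, HasDerivAt c (deriv c θ) θ := fun θ hθ =>
    ((hc.contDiffAt (Ioo_mem_nhds hθ.1 hθ.2)).differentiableAt (by simp)).hasDerivAt
  rw [angForm, angForm, h.pWeight_reflect hθ, hcs θ hθ, _root_.deriv_reflect hd hcs hθ,
    h.dirForm_reflect hθ, Real.sin_pi_sub]

/-- A compactly supported test function violating the stability inequality. -/
theorem exists_unstable (h : ConeProfile p θ₀ g) {r : ℝ} (hr : 0 < r) :
    ∃ (κ c : ℝ → ℝ) (ψ : E3 → ℝ), ContDiff ℝ ∞ κ ∧ (∀ ρ, 0 ≤ κ ρ) ∧ HasCompactSupport κ ∧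
      tsupport κ ⊆ Ioo 0 r ∧ ContinuousOn c (Ioo 0 Real.pi) ∧ (∀ θ ∈ Ioo 0 Real.pi, 0 < c θ) ∧
      (∀ θ ∈ Ioo 0 Real.pi, c (Real.pi - θ) = c θ) ∧
      ContDiff ℝ ∞ ψ ∧ HasCompactSupport ψ ∧ tsupport ψ ⊆ Metric.ball 0 r \ {0} ∧ (∀ x, 0 ≤ ψ x) ∧
      (∀ x ∈ coneRegion θ₀, ψ x = κ ‖x‖ * c (polarAngle x)) ∧
      (∀ x ∈ coneSurface θ₀ ∪ coneSurface (Real.pi - θ₀), ψ x = κ ‖x‖ * c θ₀) ∧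
      IntegrableOn (stabilityDensity p (coneFun g θ₀) ψ) (coneRegion θ₀) ∧
      ∫ x in coneRegion θ₀, stabilityDensity p (coneFun g θ₀) ψ x <
        4 * Real.pi * (Real.cos θ₀ * c θ₀ ^ 2 * ∫ ρ in Ioi (0 : ℝ), κ ρ ^ 2) := by
  obtain ⟨c, hc, hc0, hcs, hneg⟩ := h.exists_angular
  have hcc := hc.continuousOn
  have hcd : ContinuousOn (deriv c) (Ioo 0 Real.pi) :=
    hc.continuousOn_deriv_of_isOpen isOpen_Ioo (by simp)
  have hpi := Real.pi_pos
  -- the constants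
  set W1 := ∫ θ in Ioo θ₀ (Real.pi - θ₀), pWeight p g θ * dirForm p g θ (c θ) 0 * Real.sin θ with hW1
  set A := ∫ θ in θ₀..Real.pi / 2, angForm p g c θ with hA
  set d := Real.cos θ₀ * c θ₀ ^ 2 - A with hd
  have hd0 : 0 < d := by linarith
  -- The Hardy error enters as `δ W1`; this choice keeps it below twice the angular gap `d`.
  set δ := d / (|W1| + 1) with hδ
  have hδ0 : 0 < δ := by positivity
  have hδW : W1 * δ < 2 * d := by
    have h1 : W1 * δ ≤ |W1| * δ := mul_le_mul_of_nonneg_right (le_abs_self _) hδ0.le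
    have h2 : (|W1| + 1) * δ = d := by rw [hδ]; field_simp
    nlinarith
  obtain ⟨κ, hκ, hκ0, hκc, hκs, hκpos, hκle⟩ := exists_radial hδ0 hr
  obtain ⟨χ, hχ, hχs, hχ0, hχc⟩ := exists_cutoff_poles h.angle_pos h.angle_lt hc hc0
  have hκs0 : tsupport κ ⊆ Ioi 0 := hκs.trans Ioo_subset_Ioi_self
  have hκ1 : ContDiff ℝ 1 κ := hκ.of_le (by exact_mod_cast le_top)
  have hκd := hκ1.continuous_deriv le_rfl
  -- the support
  obtain ⟨a, b, ha, hb, hab⟩ : ∃ a b : ℝ, 0 < a ∧ b < r ∧ tsupport κ ⊆ Icc a b := by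
    have hne : (tsupport κ).Nonempty := by
      by_contra hemp
      rw [not_nonempty_iff_eq_empty, tsupport_eq_empty_iff] at hemp
      rw [hemp] at hκpos
      simp at hκpos
    obtain ⟨a, ha, hal⟩ := hκc.isCompact.exists_isLeast hne
    obtain ⟨b, hb, hbl⟩ := hκc.isCompact.exists_isGreatest hne
    exact ⟨a, b, (hκs ha).1, (hκs hb).2, fun x hx => ⟨hal hx, hbl hx⟩⟩
  set ψ : E3 → ℝ := fun x => κ ‖x‖ * χ (polarAngle x) with hψ
  have hψs : tsupport ψ ⊆ {x | ‖x‖ ∈ Icc a b} := tsupport_polar_subset hab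
  have hE : ∀ x ∈ coneRegion θ₀, ψ x = κ ‖x‖ * c (polarAngle x) := fun x hx => by
    simp only [hψ, hχc _ (Ioo_subset_Icc_self (h.mem_iff.1 hx).2)]
  have hgrad : ∀ x ∈ coneRegion θ₀, gradient ψ x = polarVec x (deriv κ ‖x‖ * c (polarAngle x))
      (κ ‖x‖ * deriv c (polarAngle x) / ‖x‖) := by
    intro x hx
    have hm := h.polarAngle_mem hx
    have h1 := hasGradientAt_polar (h.mem_iff.1 hx).1 hm
      (hκ1.differentiable one_ne_zero _).hasDerivAt
      ((hc.contDiffAt (Ioo_mem_nhds hm.1 hm.2)).differentiableAt (by simp)).hasDerivAt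
    refine HasGradientAt.gradient ?_
    rw [hasGradientAt_iff_hasFDerivAt] at h1 ⊢
    refine h1.congr_of_eventuallyEq ?_
    filter_upwards [(isOpen_coneRegion θ₀).mem_nhds hx] with y hy using hE y hy
  have i1 : IntegrableOn (fun ρ => ρ ^ 2 * deriv κ ρ ^ 2) (Ioi 0) :=
    (((continuous_id.pow 2).mul (hκd.pow 2)).integrable_of_hasCompactSupport
      (HasCompactSupport.mul_left (by
        simpa [pow_two] using! hκc.deriv.mul_right (f' := deriv κ)))).integrableOn
  have i2 : IntegrableOn (fun ρ => ρ * (deriv κ ρ * κ ρ)) (Ioi 0) :=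
    ((continuous_id.mul (hκd.mul hκ1.continuous)).integrable_of_hasCompactSupport
      (HasCompactSupport.mul_left (HasCompactSupport.mul_left hκc))).integrableOn
  have i3 : IntegrableOn (fun ρ => κ ρ ^ 2) (Ioi 0) :=
    ((hκ1.continuous.pow 2).integrable_of_hasCompactSupport
      (by simpa [pow_two] using! hκc.mul_right (f' := κ))).integrableOn
  obtain ⟨hI, hval⟩ := h.integral_stabilityDensity hc i1 i2 i3
    (ae_restrict_of_forall_mem (isOpen_coneRegion θ₀).measurableSet hgrad)
  refine ⟨κ, c, ψ, hκ, hκ0, hκc, hκs, hcc, hc0, hcs, contDiff_polar hκ hκs0 hχ hχs, ?_, ?_,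
    fun x => mul_nonneg (hκ0 _) (hχ0 _), hE, ?_, hI, ?_⟩
  · refine (isCompact_closedBall (0 : E3) b).of_isClosed_subset (isClosed_tsupport _)
      (hψs.trans fun x hx => ?_)
    simpa using hx.2
  · refine hψs.trans fun x hx => ⟨?_, ?_⟩
    · rw [mem_ball_zero_iff]; exact hx.2.trans_lt hb
    · rintro rfl
      have := hx.1
      simp at this
      linarith
  · have hle : θ₀ ≤ Real.pi - θ₀ := by linarith [h.angle_lt]
    rintro x (⟨hx, e⟩ | ⟨hx, e⟩)
    · have : polarAngle x = θ₀ := by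
        rw [polarAngle_eq, e, mul_div_cancel_left₀ _ (norm_ne_zero_iff.2 hx),
          Real.arccos_cos h.mem_angle.1.le h.mem_angle.2.le]
      simp only [hψ, this, hχc θ₀ ⟨le_rfl, hle⟩]
    · have : polarAngle x = Real.pi - θ₀ := by
        rw [polarAngle_eq, e, mul_div_cancel_left₀ _ (norm_ne_zero_iff.2 hx),
          Real.arccos_cos (by linarith [h.angle_lt]) (by linarith [h.angle_pos])]
      simp only [hψ, this, hχc _ ⟨hle, le_rfl⟩, hcs θ₀ h.mem_angle]
  · rw [hval, integral_mul_mul_deriv hκ1 hκc hκs0]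
    have hsin := Real.continuous_sin.continuousOn (s := Ioo 0 Real.pi)
    have c1 : ContinuousOn (fun θ => pWeight p g θ * dirForm p g θ (c θ) 0 * Real.sin θ)
        (Ioo 0 Real.pi) :=
      (h.continuousOn_pWeight.mul (h.continuousOn_dirForm hcc continuousOn_const)).mul hsin
    have c3 : ContinuousOn (fun θ => pWeight p g θ * dirForm p g θ 0 (deriv c θ) * Real.sin θ)
        (Ioo 0 Real.pi) :=
      (h.continuousOn_pWeight.mul (h.continuousOn_dirForm continuousOn_const hcd)).mul hsin
    have hang : ∫ θ in Ioo θ₀ (Real.pi - θ₀), angForm p g c θ = 2 * A :=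
      h.integral_meridian (h.continuousOn_angForm hc) fun θ hθ => h.angForm_reflect hc hcs hθ
    have m1 := (h.integrableOn_meridian c1).div_const 4
    have m3 := h.integrableOn_meridian c3
    have m2 := h.integrableOn_meridian (h.continuousOn_angForm hc)
    have m13 : IntegrableOn (fun θ => pWeight p g θ * dirForm p g θ (c θ) 0 * Real.sin θ / 4 +
        pWeight p g θ * dirForm p g θ 0 (deriv c θ) * Real.sin θ) (Ioo θ₀ (Real.pi - θ₀)) :=
      m1.add m3
    have hW1n : 0 ≤ W1 := setIntegral_nonneg measurableSet_Ioo fun θ hθ => by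
      have hm := h.full_subset (Ioo_subset_Icc_self hθ)
      exact mul_nonneg (mul_nonneg (h.pWeight_pos hm).le (h.dirForm_nonneg hm _ _))
        (sin_pos_of_mem hm).le
    rw [integral_const_mul, integral_sub m13 m2, integral_add m1 m3, integral_div, hang, ← hW1]
    set W3 := ∫ θ in Ioo θ₀ (Real.pi - θ₀), pWeight p g θ * dirForm p g θ 0 (deriv c θ) * Real.sin θ
    set b2 := ∫ ρ in Ioi (0 : ℝ), κ ρ ^ 2
    set b1 := ∫ ρ in Ioi (0 : ℝ), ρ ^ 2 * deriv κ ρ ^ 2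
    have e1 : W1 * b1 ≤ W1 * ((1 / 4 + δ) * b2) := mul_le_mul_of_nonneg_left hκle hW1n
    have e2 : W1 * δ * b2 < 2 * d * b2 := mul_lt_mul_of_pos_right hδW hκpos
    -- The `W3` terms cancel and the left side is `W1 (b1 - b2/4) + 2 A b2`: Hardy deficit plus
    -- angular form.
    have e3 : b1 * W1 + -(1 / 2) * b2 * (2 * (W1 / 4 + W3 - 2 * A)) + b2 * W3 <
        2 * (Real.cos θ₀ * c θ₀ ^ 2 * b2) := by
      rw [hd] at e2
      nlinarith
    have := mul_lt_mul_of_pos_left e3 (by positivity : 0 < 2 * Real.pi)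
    linarith

end ConeProfile

end

noncomputable section

/-! ### Violation of the stability inequality -/

theorem integral_one_div_sq {δ b : ℝ} (hδ : 0 < δ) (hb : δ ≤ b) :
    ∫ ρ in δ..b, 1 / ρ ^ 2 = 1 / δ - 1 / b := by
  have hpos : ∀ ρ ∈ uIcc δ b, 0 < ρ := fun ρ hρ => by
    rw [uIcc_of_le hb] at hρ; exact hδ.trans_le hρ.1
  have hd : ∀ ρ ∈ uIcc δ b, HasDerivAt (fun ρ : ℝ => -(1 / ρ)) (1 / ρ ^ 2) ρ := fun ρ hρ => by
    simpa using! (hasDerivAt_inv (hpos ρ hρ).ne').neg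
  rw [intervalIntegral.integral_eq_sub_of_hasDerivAt hd
    (ContinuousOn.div continuousOn_const (continuousOn_id.pow 2)
      fun ρ hρ => (pow_pos (hpos ρ hρ) 2).ne').intervalIntegrable]
  ring

theorem integrableOn_Ioi_of_bound {f : ℝ → ℝ} {C R : ℝ} (hf : Measurable f) (hC : ∀ ρ, |f ρ| ≤ C)
    (hR : ∀ ρ, R < ρ → f ρ = 0) : IntegrableOn f (Ioi 0) := by
  have h1 : IntegrableOn f (Ioc 0 R) :=
    Measure.integrableOn_of_bounded (M := C) (by simp) hf.aestronglyMeasurable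
      (Eventually.of_forall hC)
  refine h1.of_forall_sdiff_eq_zero measurableSet_Ioi fun x hx => hR x ?_
  by_contra h
  exact hx.2 ⟨hx.1, not_lt.1 h⟩

namespace ConeProfile
variable {p θ₀ : ℝ} {g : ℝ → ℝ}

theorem exists_stabilityNegative (h : ConeProfile p θ₀ g) :
    ∃ ψ : E3 → ℝ, IsTestFunction {x : E3 | x ≠ 0} ψ ∧
      StabilityNegative p (coneFun g θ₀) (fun x => Real.cot θ₀ / ‖x‖) ψ := by
  obtain ⟨κ, c, ψ, -, -, -, -, -, -, -, hψ, hψc, hψs, -, -, hψΓ, hI, hlt⟩ :=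
    h.exists_unstable one_pos
  obtain ⟨C, hC⟩ := hψ.continuous.bounded_above_of_compact_support hψc
  obtain ⟨j, hj⟩ := h.integral_curvature hψ.continuous.measurable (C := C) (R := 1) hC
    (fun x hx => image_eq_zero_of_notMem_tsupport fun h' => by
      have := (hψs h').1
      rw [mem_ball_zero_iff] at this
      linarith) hψΓ
  refine ⟨ψ, ⟨hψ, hψc, fun x hx => (hψs hx).2⟩, ?_⟩
  rw [StabilityNegative, h.setOf_coneFun_pos]
  exact ⟨hI, j, by rw [hj]; linarith⟩

/-- Truncations of the fundamental solution violate the stability inequality for `2 ≤ p < 5`. -/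
theorem eventually_stabilityNegative (h : ConeProfile p θ₀ g) (hp2 : 2 ≤ p) (hp5 : p < 5)
    {ξ : ℝ → ℝ} (hξ : IsCutoff ξ) {δ : ℝ} (hδ : 0 < δ) :
    ∀ᶠ R in atTop, StabilityNegative p (coneFun g θ₀) (fun x => Real.cot θ₀ / ‖x‖)
      (truncatedFundamental ξ δ R) := by
  obtain ⟨hξ, hξ01, hξ1, hξs⟩ := hξ
  have hdξ : ContDiff ℝ 1 ξ := hξ.of_le (by exact_mod_cast le_top)
  have hξd : ∀ t, HasDerivAt ξ (deriv ξ t) t := fun t =>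
    (hdξ.differentiable one_ne_zero t).hasDerivAt
  have hξc : HasCompactSupport ξ :=
    (isCompact_Icc (a := (-1 : ℝ)) (b := 1)).of_isClosed_subset (isClosed_tsupport _)
      (hξs.trans Ioo_subset_Icc_self)
  have hξd' := hdξ.continuous_deriv le_rfl
  obtain ⟨M, hM⟩ := hξd'.bounded_above_of_compact_support hξc.deriv
  have hM0 : 0 ≤ M := (norm_nonneg _).trans (hM 0)
  have hξ0 : ∀ t, 1 ≤ t → ξ t = 0 := fun t ht =>
    image_eq_zero_of_notMem_tsupport fun h' => absurd (hξs h').2 (not_lt.2 ht)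
  have hξd0 : ∀ t, 1 ≤ t → deriv ξ t = 0 := fun t ht =>
    image_eq_zero_of_notMem_tsupport fun h' =>
      absurd (hξs (tsupport_deriv_subset h')).2 (not_lt.2 ht)
  have hξd1 : ∀ t, 0 ≤ t → t < 1 / 2 → deriv ξ t = 0 := fun t h0 h1 => by
    have : ξ =ᶠ[𝓝 t] fun _ => 1 := by
      filter_upwards [Ioo_mem_nhds (show -(1 / 2) < t by linarith) h1] with s hs
      exact hξ1 s (abs_le.2 ⟨hs.1.le, hs.2.le⟩)
    rw [this.deriv_eq]; simp
  set W1 := ∫ θ in Ioo θ₀ (Real.pi - θ₀), pWeight p g θ * dirForm p g θ 1 0 * Real.sin θ with hW1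
  have c1 : ContinuousOn (fun θ => pWeight p g θ * dirForm p g θ 1 0 * Real.sin θ)
      (Ioo 0 Real.pi) :=
    (h.continuousOn_pWeight.mul (h.continuousOn_dirForm continuousOn_const continuousOn_const)).mul
      Real.continuous_sin.continuousOn
  have hW1lt : W1 < 4 * Real.cos θ₀ := by
    rw [hW1, h.integral_meridian c1 fun θ hθ => by
      have := h.dirForm_reflect hθ 1 0
      rw [neg_zero] at this
      rw [h.pWeight_reflect hθ, this, Real.sin_pi_sub]]
    linarith [h.integral_radial_lt hp2 hp5]
  have hW1n : 0 ≤ W1 := setIntegral_nonneg measurableSet_Ioo fun θ hθ => by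
    have hm := h.full_subset (Ioo_subset_Icc_self hθ)
    exact mul_nonneg (mul_nonneg (h.pWeight_pos hm).le (h.dirForm_nonneg hm _ _))
      (sin_pos_of_mem hm).le
  -- In the limit this is `W1 < 4 cos θ₀`: the radial energy of the truncation tends to `1/δ`, while
  -- `∫ β²` tends to `2/δ`, half from `|x| ≤ δ` and half from outside.
  have hlim : ∀ᶠ R : ℝ in atTop,
      (1 / δ + (4 * M + M ^ 2) * R⁻¹) * W1 < 2 * Real.cos θ₀ * (2 / δ - 2 * R⁻¹) := by
    have t1 := tendsto_inv_atTop_zero (𝕜 := ℝ)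
    refine (((t1.const_mul (4 * M + M ^ 2)).const_add (1 / δ)).mul_const W1).eventually_lt
      (((t1.const_mul 2).const_sub (2 / δ)).const_mul (2 * Real.cos θ₀)) ?_
    have := mul_lt_mul_of_pos_right hW1lt (by positivity : 0 < 1 / δ)
    simp only [mul_zero, add_zero, sub_zero]
    calc 1 / δ * W1 = W1 * (1 / δ) := by ring
      _ < 4 * Real.cos θ₀ * (1 / δ) := this
      _ = _ := by ring
  filter_upwards [hlim, eventually_gt_atTop (2 * δ)] with R hR hRδ
  have hR0 : 0 < R := by linarith
  -- Since `R > 2δ`, the cutoff is 1 up to radius `δ`, so the derivative `α` vanishes in the inner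
  -- ball.
  set β : ℝ → ℝ := fun ρ => (if δ < ρ then 1 / ρ else 1 / δ) * ξ (ρ / R) with hβ
  set α : ℝ → ℝ := fun ρ => if δ < ρ then -(1 / ρ ^ 2) * ξ (ρ / R) + 1 / ρ * (deriv ξ (ρ / R) / R)
    else 0 with hα
  have hψβ : ∀ x, truncatedFundamental ξ δ R x = β ‖x‖ := fun x => rfl
  have hβm : Measurable β := by
    refine (Measurable.ite measurableSet_Ioi (by fun_prop) measurable_const).mul
      (hξ.continuous.measurable.comp (by fun_prop))
  have hαm : Measurable α := by
    refine Measurable.ite measurableSet_Ioi ?_ measurable_const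
    have := hξ.continuous.measurable
    have := hξd'.measurable
    fun_prop
  have hβb : ∀ ρ, |β ρ| ≤ 1 / δ := by
    intro ρ
    have h1 : |ξ (ρ / R)| ≤ 1 := by rw [abs_of_nonneg (hξ01 _).1]; exact (hξ01 _).2
    have h2 : |if δ < ρ then 1 / ρ else 1 / δ| ≤ 1 / δ := by
      split_ifs with hc
      · rw [abs_of_pos (by have := hδ.trans hc; positivity)]
        exact one_div_le_one_div_of_le hδ hc.le
      · rw [abs_of_pos (by positivity)]
    simp only [hβ]
    rw [abs_mul]
    calc _ ≤ 1 / δ * 1 := mul_le_mul h2 h1 (abs_nonneg _) (by positivity)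
      _ = _ := mul_one _
  have hβR : ∀ ρ, R ≤ ρ → β ρ = 0 := fun ρ hρ => by
    simp only [hβ]; rw [hξ0 _ ((one_le_div hR0).2 hρ), mul_zero]
  have hαR : ∀ ρ, R ≤ ρ → α ρ = 0 := fun ρ hρ => by
    simp only [hα]; rw [hξ0 _ ((one_le_div hR0).2 hρ), hξd0 _ ((one_le_div hR0).2 hρ)]; simp
  have hαb : ∀ ρ, δ < ρ → ρ ^ 2 * α ρ ^ 2 ≤ 1 / ρ ^ 2 + (4 * M + M ^ 2) / R ^ 2 := by
    intro ρ hρ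
    have hρ0 : 0 < ρ := hδ.trans hρ
    simp only [hα, if_pos hρ]
    set s := ξ (ρ / R) with hs
    have hs0 := (hξ01 (ρ / R)).1
    have hs1 := (hξ01 (ρ / R)).2
    have e1 : ρ ^ 2 * (-(1 / ρ ^ 2) * s + 1 / ρ * (deriv ξ (ρ / R) / R)) ^ 2 =
        s ^ 2 * (1 / ρ ^ 2) + (-2 * s * deriv ξ (ρ / R)) * (1 / (ρ * R)) +
          deriv ξ (ρ / R) ^ 2 / R ^ 2 := by
      field_simp; ring
    have e2 : s ^ 2 * (1 / ρ ^ 2) ≤ 1 / ρ ^ 2 :=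
      mul_le_of_le_one_left (by positivity) (pow_le_one₀ hs0 hs1)
    have hdM := hM (ρ / R)
    rw [Real.norm_eq_abs, abs_le] at hdM
    have e3 : deriv ξ (ρ / R) ^ 2 / R ^ 2 ≤ M ^ 2 / R ^ 2 := by
      exact div_le_div_of_nonneg_right (sq_le_sq' hdM.1 hdM.2) (by positivity)
    -- The mixed term lives on `ρ ≥ R/2`, where `ξ'` may be nonzero, and there `1/(ρR) ≤ 2/R²`.
    have e4 : (-2 * s * deriv ξ (ρ / R)) * (1 / (ρ * R)) ≤ 4 * M / R ^ 2 := by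
      rcases lt_or_ge (ρ / R) (1 / 2) with hlt | hge
      · rw [hξd1 _ (by positivity) hlt]
        simp; positivity
      · have hge' : R / 2 ≤ ρ := by rw [le_div_iff₀ hR0] at hge; linarith
        calc (-2 * s * deriv ξ (ρ / R)) * (1 / (ρ * R)) ≤ (2 * M) * (1 / (ρ * R)) := by
              have h1 : s * (-deriv ξ (ρ / R)) ≤ 1 * M :=
                (mul_le_mul_of_nonneg_left (by linarith) hs0).trans
                  (mul_le_mul_of_nonneg_right hs1 hM0)
              exact mul_le_mul_of_nonneg_right (by linarith) (by positivity)
          _ ≤ (2 * M) * (1 / (R / 2 * R)) := by gcongr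
          _ = _ := by field_simp; ring
    rw [e1]
    have : (4 * M + M ^ 2) / R ^ 2 = 4 * M / R ^ 2 + M ^ 2 / R ^ 2 := add_div _ _ _
    linarith
  have hα0 : ∀ ρ, ¬ δ < ρ → α ρ = 0 := fun ρ hρ => by simp only [hα, if_neg hρ]
  have i1 : IntegrableOn (fun ρ => ρ ^ 2 * α ρ ^ 2) (Ioi 0) := by
    refine integrableOn_Ioi_of_bound (C := 1 / δ ^ 2 + (4 * M + M ^ 2) / R ^ 2) (R := R)
      ((measurable_id.pow_const 2).mul (hαm.pow_const 2)) (fun ρ => ?_) fun ρ hρ => by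
        rw [hαR ρ hρ.le]; ring
    rw [abs_of_nonneg (by positivity)]
    by_cases hc : δ < ρ
    · refine (hαb ρ hc).trans (by gcongr)
    · rw [hα0 ρ hc]; simp; positivity
  have i3 : IntegrableOn (fun ρ => β ρ ^ 2) (Ioi 0) := by
    refine integrableOn_Ioi_of_bound (C := (1 / δ) ^ 2) (R := R) (hβm.pow_const 2) (fun ρ => ?_)
      fun ρ hρ => by rw [hβR ρ hρ.le]; ring
    rw [abs_of_nonneg (by positivity), ← sq_abs]
    exact pow_le_pow_left₀ (abs_nonneg _) (hβb ρ) 2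
  have i2 : IntegrableOn (fun ρ => ρ * (α ρ * β ρ)) (Ioi 0) := by
    refine Integrable.mono' (i1.add i3)
      (measurable_id.mul (hαm.mul hβm)).aestronglyMeasurable (Eventually.of_forall fun ρ => ?_)
    simp only [Pi.add_apply, Real.norm_eq_abs]
    rw [abs_le]
    constructor <;> nlinarith [sq_nonneg (ρ * α ρ + β ρ), sq_nonneg (ρ * α ρ - β ρ),
      sq_nonneg (ρ * α ρ), sq_nonneg (β ρ)]
  have hβd : ∀ ρ, 0 < ρ → ρ ≠ δ → HasDerivAt β (α ρ) ρ := by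
    intro ρ hρ hne
    rcases lt_or_gt_of_ne hne with hlt | hgt
    · rw [hα0 ρ (not_lt.2 hlt.le)]
      refine (hasDerivAt_const ρ (1 / δ)).congr_of_eventuallyEq ?_
      filter_upwards [Ioo_mem_nhds hρ hlt] with s hs
      simp only [hβ, if_neg (not_lt.2 hs.2.le)]
      have hsR : s / R ≤ 1 / 2 := by rw [div_le_iff₀ hR0]; linarith [hs.2]
      have hsR0 : 0 ≤ s / R := div_nonneg hs.1.le hR0.le
      rw [hξ1 _ (abs_le.2 ⟨by linarith, hsR⟩), mul_one]
    · have h1 : HasDerivAt (fun s : ℝ => 1 / s) (-(1 / ρ ^ 2)) ρ := by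
        simpa using! hasDerivAt_inv hρ.ne'
      have h2 : HasDerivAt (fun s : ℝ => ξ (s / R)) (deriv ξ (ρ / R) / R) ρ := by
        simpa [div_eq_mul_inv] using! (hξd (ρ / R)).comp ρ ((hasDerivAt_id ρ).div_const R)
      simp only [hα, if_pos hgt]
      refine (h1.mul h2).congr_of_eventuallyEq ?_
      filter_upwards [Ioi_mem_nhds hgt] with s hs
      simp only [hβ, if_pos (show δ < s from hs), Pi.mul_apply]
  -- the bulk term
  have hψ : ∀ᵐ x ∂volume.restrict (coneRegion θ₀), gradient (truncatedFundamental ξ δ R) x =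
      polarVec x (α ‖x‖ * (fun _ : ℝ => (1 : ℝ)) (polarAngle x))
        (β ‖x‖ * deriv (fun _ : ℝ => (1 : ℝ)) (polarAngle x) / ‖x‖) := by
    -- The truncation has a kink on this sphere, a null set for the bulk integral.
    have hsph : ∀ᵐ x : E3, ‖x‖ ≠ δ := by
      have := Measure.addHaar_sphere (volume : Measure E3) 0 δ
      filter_upwards [compl_mem_ae_iff.2 this] with x hx hxδ
      exact hx (mem_sphere_zero_iff_norm.2 hxδ)
    filter_upwards [ae_restrict_of_ae hsph, ae_restrict_mem (isOpen_coneRegion θ₀).measurableSet]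
      with x hx hxE
    have h0 := (h.mem_iff.1 hxE).1
    have := (hasGradientAt_polar h0 (h.polarAngle_mem hxE) (hβd _ (norm_pos_iff.2 h0) hx)
      (hasDerivAt_const (polarAngle x) (1 : ℝ))).gradient
    simpa [hψβ, funext hψβ] using! this
  obtain ⟨hI, hval⟩ := h.integral_stabilityDensity contDiffOn_const i1 i2 i3 hψ
  have hd0 : ∀ θ : ℝ, dirForm p g θ 0 0 = 0 := fun θ => by simp [dirForm]
  -- For a radial test function the mixed and angular coefficients both vanish, leaving only `W1`.
  have hang : ∀ θ, angForm p g (fun _ => 1) θ =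
      pWeight p g θ * dirForm p g θ 1 0 * Real.sin θ / 4 := fun θ => by
    simp only [angForm, dirForm, deriv_const]; ring
  simp only [deriv_const, hd0, hang, mul_zero, zero_mul, add_zero, sub_self, integral_zero,
    ← hW1] at hval
  obtain ⟨hJ, hJval⟩ := h.integral_curvature (ψ := truncatedFundamental ξ δ R) (β := β) (c₀ := 1)
    (C := 1 / δ) (R := R) (hβm.comp measurable_norm) (fun x => hβb ‖x‖) (fun x hx => hβR ‖x‖ hx)
    fun x _ => by rw [hψβ, mul_one]
  rw [StabilityNegative, h.setOf_coneFun_pos]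
  refine ⟨hI, hJ, ?_⟩
  rw [hval, hJval]
  -- the radial integrals
  have b1 : ∫ ρ in Ioi (0 : ℝ), ρ ^ 2 * α ρ ^ 2 ≤ 1 / δ + (4 * M + M ^ 2) * R⁻¹ := by
    have e1 : ∫ ρ in Ioi (0 : ℝ), ρ ^ 2 * α ρ ^ 2 = ∫ ρ in Ioc δ R, ρ ^ 2 * α ρ ^ 2 := by
      refine setIntegral_eq_of_subset_of_forall_sdiff_eq_zero measurableSet_Ioi
        (fun ρ hρ => hδ.trans hρ.1) fun ρ hρ => ?_
      by_cases hc : δ < ρ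
      · rw [hαR ρ (not_lt.1 fun h' => hρ.2 ⟨hc, h'.le⟩)]; ring
      · rw [hα0 ρ hc]; ring
    have hc2 : IntervalIntegrable (fun ρ : ℝ => 1 / ρ ^ 2) volume δ R :=
      (ContinuousOn.div continuousOn_const (continuousOn_id.pow 2) fun ρ hρ => by
        rw [uIcc_of_le (by linarith)] at hρ
        exact (pow_pos (hδ.trans_le hρ.1) 2).ne').intervalIntegrable
    have hc3 : IntervalIntegrable (fun _ : ℝ => (4 * M + M ^ 2) / R ^ 2) volume δ R :=
      intervalIntegrable_const
    have hc4 : IntervalIntegrable (fun ρ : ℝ => 1 / ρ ^ 2 + (4 * M + M ^ 2) / R ^ 2) volume δ R :=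
      hc2.add hc3
    rw [e1]
    calc ∫ ρ in Ioc δ R, ρ ^ 2 * α ρ ^ 2
        ≤ ∫ ρ in Ioc δ R, (1 / ρ ^ 2 + (4 * M + M ^ 2) / R ^ 2) :=
          setIntegral_mono_on (i1.mono_set fun ρ hρ => hδ.trans hρ.1)
            ((intervalIntegrable_iff_integrableOn_Ioc_of_le (by linarith)).1 hc4) measurableSet_Ioc
            fun ρ hρ => hαb ρ hρ.1
      _ = 1 / δ - 1 / R + (R - δ) * ((4 * M + M ^ 2) / R ^ 2) := by
          rw [← intervalIntegral.integral_of_le (by linarith), intervalIntegral.integral_add hc2 hc3,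
            integral_one_div_sq hδ (by linarith), intervalIntegral.integral_const, smul_eq_mul]
      _ ≤ 1 / δ + R * ((4 * M + M ^ 2) / R ^ 2) := by
          have : 0 ≤ (4 * M + M ^ 2) / R ^ 2 := by positivity
          have : 0 ≤ 1 / R := by positivity
          nlinarith
      _ = _ := by field_simp
  have b3 : 2 / δ - 2 * R⁻¹ ≤ ∫ ρ in Ioi (0 : ℝ), β ρ ^ 2 := by
    have hξR : ∀ ρ, 0 < ρ → ρ ≤ R / 2 → ξ (ρ / R) = 1 := fun ρ h0 h1 => by
      have : 0 < ρ / R := by positivity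
      have h2 : ρ / R ≤ 1 / 2 := by rw [div_le_iff₀ hR0]; linarith
      exact hξ1 _ (abs_le.2 ⟨by linarith, h2⟩)
    have hsub : Ioc 0 (R / 2) ⊆ Ioi (0 : ℝ) := fun ρ hρ => hρ.1
    have hu : Ioc 0 (R / 2) = Ioc 0 δ ∪ Ioc δ (R / 2) :=
      (Ioc_union_Ioc_eq_Ioc hδ.le (by linarith)).symm
    have hdisj : Disjoint (Ioc 0 δ) (Ioc δ (R / 2)) :=
      Set.disjoint_left.2 fun ρ h1 h2 => not_lt.2 h1.2 h2.1
    have e1 : ∫ ρ in Ioc 0 δ, β ρ ^ 2 = 1 / δ := by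
      rw [setIntegral_congr_fun (g := fun _ => (1 / δ) ^ 2) measurableSet_Ioc fun ρ hρ => by
        simp only [hβ, if_neg (not_lt.2 hρ.2), hξR ρ hρ.1 (by linarith [hρ.2]), mul_one]]
      rw [setIntegral_const, smul_eq_mul, Real.volume_real_Ioc_of_le hδ.le]
      field_simp; ring
    have e2 : ∫ ρ in Ioc δ (R / 2), β ρ ^ 2 = 1 / δ - 1 / (R / 2) := by
      rw [← integral_one_div_sq hδ (by linarith), intervalIntegral.integral_of_le (by linarith)]
      refine setIntegral_congr_fun measurableSet_Ioc fun ρ hρ => ?_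
      simp only [hβ, if_pos hρ.1, hξR ρ (hδ.trans hρ.1) hρ.2, mul_one, div_pow, one_pow]
    calc 2 / δ - 2 * R⁻¹ = 1 / δ + (1 / δ - 1 / (R / 2)) := by field_simp; ring
      _ = ∫ ρ in Ioc 0 (R / 2), β ρ ^ 2 := by
          rw [hu, setIntegral_union hdisj measurableSet_Ioc
            (i3.mono_set fun ρ hρ => hρ.1) (i3.mono_set fun ρ hρ => hδ.trans hρ.1), e1, e2]
      _ ≤ _ := setIntegral_mono_set i3 (Eventually.of_forall fun ρ => sq_nonneg (β ρ))
          hsub.eventuallyLE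
  have hcos : 0 < Real.cos θ₀ := Real.cos_pos_of_mem_Ioo
    ⟨by linarith [h.angle_pos, Real.pi_pos], h.angle_lt⟩
  have f1 := mul_le_mul_of_nonneg_right b1 hW1n
  have f2 := mul_le_mul_of_nonneg_left b3 (by positivity : 0 ≤ 2 * Real.cos θ₀)
  have f3 := mul_lt_mul_of_pos_left ((f1.trans_lt hR).trans_le f2)
    (by have := Real.pi_pos; positivity : 0 < 2 * Real.pi)
  linarith

end ConeProfile

end

noncomputable section

/-! ### Lipschitz competitors -/

theorem integrable_smul_of_tsupport_subset {U : Set E3} {V : E3 → E3}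
    (hV : LocallyIntegrableOn V U) {ζ : E3 → ℝ} (hζ : IsTestFunction U ζ) :
    Integrable fun x => ζ x • V x := by
  have h1 : IntegrableOn V (tsupport ζ) := hV.integrableOn_compact_subset hζ.2.2 hζ.2.1
  have h2 : IntegrableOn (fun x => ζ x • V x) (tsupport ζ) :=
    h1.continuousOn_smul hζ.1.continuous.continuousOn hζ.2.1
  refine (integrableOn_iff_integrable_of_support_subset fun x hx => ?_).1 h2
  exact subset_tsupport ζ (left_ne_zero_of_smul hx)

/-- Weak gradients are unique. -/
theorem HasWeakGradientOn.ae_eq {U : Set E3} (hU : IsOpen U) {v : E3 → ℝ} {V W : E3 → E3}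
    (hV : HasWeakGradientOn U v V) (hW : HasWeakGradientOn U v W) :
    V =ᵐ[volume.restrict U] W := by
  have key := hU.ae_eq_zero_of_integral_contDiff_smul_eq_zero (μ := volume) (hV.2.1.sub hW.2.1)
    fun ζ h1 h2 h3 => by
      have hζ : IsTestFunction U ζ := ⟨h1, h2, h3⟩
      have iV := integrable_smul_of_tsupport_subset hV.2.1 hζ
      have iW := integrable_smul_of_tsupport_subset hW.2.1 hζ
      simp only [Pi.sub_apply, smul_sub]
      rw [integral_sub iV iW, sub_eq_zero]
      refine ext_inner_left ℝ fun e => ?_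
      rw [← integral_inner iV, ← integral_inner iW]
      simp only [inner_smul_right]
      have a := hV.2.2 ζ hζ e
      have b := hW.2.2 ζ hζ e
      simp only [real_inner_comm] at a b ⊢
      linarith
  refine (ae_restrict_iff' hU.measurableSet).2 ?_
  filter_upwards [key] with x hx hxU
  exact sub_eq_zero.1 (hx hxU)

theorem MemW1p.congr {p : ℝ} {U : Set E3} (hU : IsOpen U) {v : E3 → ℝ} {V W : E3 → E3}
    (hV : MemW1p p U v V) (h : V =ᵐ[volume.restrict U] W) : MemW1p p U v W := by
  refine ⟨hV.1, hV.2.1.ae_eq h, hV.2.2.1, hV.2.2.2.1.congr h, fun ζ hζ e => ?_⟩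
  rw [hV.2.2.2.2 ζ hζ e]
  congr 1
  refine integral_congr_ae ?_
  filter_upwards [(ae_restrict_iff' hU.measurableSet).1 h] with x hx
  by_cases hxU : x ∈ U
  · rw [hx hxU]
  · simp [image_eq_zero_of_notMem_tsupport fun h' => hxU (hζ.2.2 h')]

theorem tendsto_eLpNorm_zero_of_bound {F : Type*} [NormedAddCommGroup F] {p C : ℝ} (hp : 0 < p)
    {U : Set E3} (hU : volume U ≠ ⊤) {f : ℕ → E3 → F}
    (hf : ∀ k, AEStronglyMeasurable (f k) (volume.restrict U))
    (hC : ∀ k x, ‖f k x‖ ≤ C)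
    (h0 : ∀ᵐ x ∂volume.restrict U, Tendsto (fun k => f k x) atTop (𝓝 0)) :
    Tendsto (fun k => eLpNorm (f k) (ENNReal.ofReal p) (volume.restrict U)) atTop (𝓝 0) := by
  have hp0 : ENNReal.ofReal p ≠ 0 := by simpa using hp
  have e : ∀ k, eLpNorm (f k) (ENNReal.ofReal p) (volume.restrict U) =
      (∫⁻ x in U, ‖f k x‖ₑ ^ p) ^ (1 / p) := fun k => by
    rw [eLpNorm_eq_lintegral_rpow_enorm_toReal hp0 ENNReal.ofReal_ne_top,
      ENNReal.toReal_ofReal hp.le]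
  simp only [e]
  have t : Tendsto (fun k => ∫⁻ x in U, ‖f k x‖ₑ ^ p) atTop (𝓝 (∫⁻ _ in U, 0)) := by
    refine tendsto_lintegral_of_dominated_convergence' (fun _ => ENNReal.ofReal C ^ p)
      (fun k => (hf k).enorm.pow_const p) (fun k => Eventually.of_forall fun x => ?_) ?_ ?_
    · refine ENNReal.rpow_le_rpow ?_ hp.le
      rw [← ofReal_norm]
      exact ENNReal.ofReal_le_ofReal (hC k x)
    · rw [setLIntegral_const]
      exact ENNReal.mul_ne_top (ENNReal.rpow_ne_top_of_nonneg hp.le ENNReal.ofReal_ne_top) hU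
    · filter_upwards [h0] with x hx
      have := (ENNReal.continuous_rpow_const (y := p)).tendsto 0
      rw [ENNReal.zero_rpow_of_pos hp] at this
      exact this.comp (by simpa using hx.enorm)
  rw [lintegral_zero] at t
  have := (ENNReal.continuous_rpow_const (y := 1 / p)).tendsto 0
  rw [ENNReal.zero_rpow_of_pos (by positivity)] at this
  exact this.comp t

/-- Mollifications of `w` are admissible test functions. They and their gradients are uniformly
bounded, so almost everywhere convergence upgrades to `L^p` on the bounded set. -/
theorem LipschitzWith.memW1pZero {p : ℝ} (hp : 0 < p) {L : NNReal} {w : E3 → ℝ}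
    (hw : LipschitzWith L w) (hc : HasCompactSupport w) {U : Set E3} (hU : IsOpen U)
    (hb : Bornology.IsBounded U) (hsub : tsupport w ⊆ U) : MemW1pZero p U w (gradient w) := by
  obtain ⟨ζ, hζ, -, hg, hd, ht, htg⟩ := exists_mollification hw hc hU hsub
  refine ⟨hw.memW1p hb, ζ, hζ, ?_, ?_⟩
  · refine tendsto_eLpNorm_zero_of_bound hp hb.measure_lt_top.ne
      (fun k => ((hζ k).1.continuous.sub hw.continuous).aestronglyMeasurable) hd
      (Eventually.of_forall fun x => ?_)
    simpa using (ht x).sub_const (w x)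
  · refine tendsto_eLpNorm_zero_of_bound (C := L + L) hp hb.measure_lt_top.ne
      (fun k => ((measurable_gradient _).sub (measurable_gradient _)).aestronglyMeasurable)
      (fun k x => (_root_.norm_sub_le _ _).trans (add_le_add (hg k x) (hw.norm_gradient_le x)))
      (ae_restrict_of_ae ?_)
    filter_upwards [htg] with x hx
    simpa using hx.sub_const (gradient w x)

theorem energy_congr {p : ℝ} {U : Set E3} {v : E3 → ℝ} {V W : E3 → E3}
    (h : V =ᵐ[volume.restrict U] W) : energy p U v V = energy p U v W := by
  refine integral_congr_ae ?_
  filter_upwards [h] with x hx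
  rw [hx]

/-- Minimality speaks of some weak gradient. Uniqueness of weak gradients lets the classical
gradients of Lipschitz functions be used for both the minimizer and the competitor. -/
theorem IsMinimizer.energy_le {p : ℝ} (hp : 0 < p) {U : Set E3} (hU : IsOpen U)
    (hb : Bornology.IsBounded U) {u w : E3 → ℝ} (hmin : IsMinimizer p U u) {L L' : NNReal}
    (hu : LipschitzWith L u) (hw : LipschitzWith L' w) (hc : HasCompactSupport w)
    (hsub : tsupport w ⊆ U) :
    energy p U u (gradient u) ≤ energy p U (fun x => u x + w x) (gradient fun x => u x + w x) := by
  obtain ⟨Du, hDu, hle⟩ := hmin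
  have hDu' : gradient u =ᵐ[volume.restrict U] Du := (hu.hasWeakGradientOn U).ae_eq hU hDu.2.2
  have hv := hu.add hw
  have hD : gradient (fun x => u x + w x) =ᵐ[volume.restrict U] fun x => Du x + gradient w x := by
    filter_upwards [hDu', ae_restrict_of_ae (hu.ae_differentiableAt (μ := volume)),
      ae_restrict_of_ae (hw.ae_differentiableAt (μ := volume))] with x hx h1 h2
    rw [← hx]
    simp only [gradient]
    rw [fderiv_fun_add h1 h2, map_add]
  have := hle (fun x => u x + w x) (fun x => Du x + gradient w x) ((hv.memW1p hb).congr hU hD)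
    (by simpa using hw.memW1pZero hp hc hU hb hsub)
  rwa [← energy_congr hD, ← energy_congr hDu'] at this

end

noncomputable section

/-! ### Second order expansion of the energy density -/

section Expansion

variable {q a b d : ℝ}

theorem hasDerivAt_quadratic_rpow {t : ℝ} (h : 0 < a - 2 * t * b + t ^ 2 * d) :
    HasDerivAt (fun t => (a - 2 * t * b + t ^ 2 * d) ^ q)
      (q * (a - 2 * t * b + t ^ 2 * d) ^ (q - 1) * (-2 * b + 2 * t * d)) t := by
  have h1 : HasDerivAt (fun t : ℝ => a - 2 * t * b + t ^ 2 * d) (-2 * b + 2 * t * d) t := by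
    have e1 := ((hasDerivAt_id t).const_mul 2).mul_const b
    have e2 := ((hasDerivAt_id t).pow 2).mul_const d
    convert! (e1.const_sub a).add e2 using 1
    simp
  convert! h1.rpow_const (p := q) (Or.inl h.ne') using 1
  ring

theorem hasDerivAt_quadratic_rpow_deriv {t : ℝ} (h : 0 < a - 2 * t * b + t ^ 2 * d) :
    HasDerivAt (fun t => q * (a - 2 * t * b + t ^ 2 * d) ^ (q - 1) * (-2 * b + 2 * t * d))
      (q * (q - 1) * (a - 2 * t * b + t ^ 2 * d) ^ (q - 2) * (-2 * b + 2 * t * d) ^ 2 +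
        2 * q * d * (a - 2 * t * b + t ^ 2 * d) ^ (q - 1)) t := by
  have h1 := (hasDerivAt_quadratic_rpow (q := q - 1) h).const_mul q
  have h2 : HasDerivAt (fun t : ℝ => -2 * b + 2 * t * d) (2 * d) t := by
    convert! (((hasDerivAt_id t).const_mul 2).mul_const d).const_add (-2 * b) using 1
    simp
  convert! h1.mul h2 using 1
  rw [show q - 1 - 1 = q - 2 by ring]
  ring

/-- The second order Taylor coefficient of `|V - tΞ|^(2q)`, with `a = |V|²`, `b = V·Ξ`, `d = |Ξ|²`.
-/
theorem tendsto_quadratic_rpow (ha : 0 < a) :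
    Tendsto (fun t => ((a - 2 * t * b + t ^ 2 * d) ^ q - a ^ q + 2 * q * t * b * a ^ (q - 1)) / t ^ 2)
      (𝓝[>] 0) (𝓝 (q * a ^ (q - 1) * (d + (2 * q - 2) * (b ^ 2 / a)))) := by
  have hev : ∀ᶠ t : ℝ in 𝓝 0, 0 < a - 2 * t * b + t ^ 2 * d := by
    have hc : Continuous fun t : ℝ => a - 2 * t * b + t ^ 2 * d := by fun_prop
    exact (hc.tendsto 0).eventually (lt_mem_nhds (by simpa using ha))
  -- After one application the quotient is half the difference quotient at 0 of the first
  -- derivative, so a second derivative at 0 suffices.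
  refine HasDerivAt.lhopital_zero_nhdsGT
    (f' := fun t => q * (a - 2 * t * b + t ^ 2 * d) ^ (q - 1) * (-2 * b + 2 * t * d) +
      2 * q * b * a ^ (q - 1)) (g' := fun t => 2 * t) ?_ ?_ ?_ ?_ ?_ ?_
  · filter_upwards [hev.filter_mono nhdsWithin_le_nhds] with t ht
    have e2 : HasDerivAt (fun t : ℝ => 2 * q * t * b * a ^ (q - 1)) (2 * q * b * a ^ (q - 1)) t := by
      convert! (((hasDerivAt_id t).const_mul (2 * q)).mul_const b).mul_const (a ^ (q - 1)) using 1
      simp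
    exact ((hasDerivAt_quadratic_rpow ht).sub_const _).add e2
  · exact Eventually.of_forall fun t => by simpa using hasDerivAt_pow 2 t
  · filter_upwards [self_mem_nhdsWithin] with t ht
    have : (0 : ℝ) < t := ht
    positivity
  · have h0 := (hasDerivAt_quadratic_rpow (q := q) (a := a) (b := b) (d := d) (t := 0)
      (by simpa using ha)).continuousAt.tendsto
    have e2 : Tendsto (fun t : ℝ => 2 * q * t * b * a ^ (q - 1)) (𝓝 0) (𝓝 0) := by
      have hc : Continuous fun t : ℝ => 2 * q * t * b * a ^ (q - 1) := by fun_prop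
      simpa using hc.tendsto 0
    have := (h0.sub_const (a ^ q)).add e2
    simp only [mul_zero, zero_mul, sub_zero, ne_eq, OfNat.ofNat_ne_zero, not_false_eq_true, zero_pow,
      add_zero, sub_self] at this
    exact this.mono_left nhdsWithin_le_nhds
  · have hc : Continuous fun t : ℝ => t ^ 2 := by fun_prop
    have := hc.tendsto 0
    simp only [ne_eq, OfNat.ofNat_ne_zero, not_false_eq_true, zero_pow] at this
    exact this.mono_left nhdsWithin_le_nhds
  · have h0 := (hasDerivAt_quadratic_rpow_deriv (q := q) (a := a) (b := b) (d := d) (t := 0)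
      (by simpa using ha)).tendsto_slope
    have h1 := (h0.mono_left (nhdsWithin_mono _ fun t (ht : (0 : ℝ) < t) => ht.ne')).div_const 2
    refine (h1.congr' ?_).trans_eq ?_
    · filter_upwards [self_mem_nhdsWithin] with t ht
      have : t ≠ 0 := (show (0 : ℝ) < t from ht).ne'
      simp only [slope, vsub_eq_sub, smul_eq_mul, mul_zero, zero_mul, sub_zero, ne_eq,
        OfNat.ofNat_ne_zero, not_false_eq_true, zero_pow, add_zero]
      field_simp
      ring
    · congr 1
      have e : a ^ (q - 2) = a ^ (q - 1) / a := by
        rw [← Real.rpow_sub_one ha.ne']; congr 1; ring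
      simp only [mul_zero, zero_mul, sub_zero, ne_eq, OfNat.ofNat_ne_zero, not_false_eq_true,
        zero_pow, add_zero, e]
      field_simp
      ring

theorem exists_bound_quadratic_rpow (q : ℝ) {s M : ℝ} (hs : 0 < s) (hM : 0 < M) :
    ∃ C ε₀ : ℝ, 0 < ε₀ ∧ ∀ a b d : ℝ, s ≤ a → a ≤ 1 → |b| ≤ M → 0 ≤ d → d ≤ M ^ 2 →
      ∀ t : ℝ, 0 ≤ t → t ≤ ε₀ →
        |(a - 2 * t * b + t ^ 2 * d) ^ q - a ^ q + 2 * q * t * b * a ^ (q - 1)| ≤ C * t ^ 2 := by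
  have hcont : ∀ r : ℝ, ContinuousOn (fun y : ℝ => y ^ r) (Icc (s / 2) 4) := fun r y hy =>
    (Real.continuousAt_rpow_const y r (Or.inl (by linarith [hy.1]))).continuousWithinAt
  obtain ⟨B1, hB1⟩ := isCompact_Icc.exists_bound_of_continuousOn (hcont (q - 2))
  obtain ⟨B2, hB2⟩ := isCompact_Icc.exists_bound_of_continuousOn (hcont (q - 1))
  set C := |q * (q - 1)| * B1 * (4 * M) ^ 2 + 2 * |q| * M ^ 2 * B2 with hC
  -- This range keeps the base of the power in `[s/2, 4]`, so negative exponents are harmless; the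
  -- mean value inequality is then applied twice.
  refine ⟨C, min (s / (4 * M)) (1 / M), by positivity, fun a b d hsa ha1 hb hd0 hdM t ht htε => ?_⟩
  rw [abs_le] at hb
  have hN : ∀ τ ∈ Icc 0 t, a - 2 * τ * b + τ ^ 2 * d ∈ Icc (s / 2) 4 ∧
      |-2 * b + 2 * τ * d| ≤ 4 * M := by
    intro τ hτ
    have h1 : τ * M ≤ s / 4 := by
      have := hτ.2.trans (htε.trans (min_le_left _ _))
      rw [le_div_iff₀ (by positivity)] at this
      linarith
    have h2 : τ * M ≤ 1 := by
      have := hτ.2.trans (htε.trans (min_le_right _ _))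
      rwa [le_div_iff₀ hM] at this
    have h3 : τ * b ≤ τ * M := mul_le_mul_of_nonneg_left hb.2 hτ.1
    have h4 : τ * -M ≤ τ * b := mul_le_mul_of_nonneg_left hb.1 hτ.1
    have h5 : 0 ≤ τ ^ 2 * d := by positivity
    have h6 : τ ^ 2 * d ≤ (τ * M) ^ 2 := by
      rw [mul_pow]; exact mul_le_mul_of_nonneg_left hdM (by positivity)
    have h0 : 0 ≤ τ * M := mul_nonneg hτ.1 hM.le
    have h7 : (τ * M) ^ 2 ≤ 1 := pow_le_one₀ h0 h2
    have h8 : τ * d ≤ M := by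
      calc τ * d ≤ τ * M ^ 2 := mul_le_mul_of_nonneg_left hdM hτ.1
        _ = (τ * M) * M := by ring
        _ ≤ 1 * M := mul_le_mul_of_nonneg_right h2 hM.le
        _ = M := one_mul _
    have h9 : 0 ≤ τ * d := mul_nonneg hτ.1 hd0
    refine ⟨⟨by linarith, by linarith⟩, abs_le.2 ⟨by linarith, by linarith⟩⟩
  have hpos : ∀ τ ∈ Icc 0 t, 0 < a - 2 * τ * b + τ ^ 2 * d := fun τ hτ => by
    linarith [(hN τ hτ).1.1]
  have hsec : ∀ τ ∈ Icc 0 t, ‖q * (q - 1) * (a - 2 * τ * b + τ ^ 2 * d) ^ (q - 2) *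
      (-2 * b + 2 * τ * d) ^ 2 + 2 * q * d * (a - 2 * τ * b + τ ^ 2 * d) ^ (q - 1)‖ ≤ C := by
    intro τ hτ
    obtain ⟨h1, h2⟩ := hN τ hτ
    have b1 := hB1 _ h1
    have b2 := hB2 _ h1
    refine (norm_add_le _ _).trans (add_le_add ?_ ?_)
    · rw [norm_mul, norm_mul, norm_pow, Real.norm_eq_abs, Real.norm_eq_abs (-2 * b + 2 * τ * d)]
      have := (norm_nonneg _).trans b1
      gcongr
    · rw [norm_mul, norm_mul, norm_mul, Real.norm_of_nonneg hd0, Real.norm_eq_abs q, Real.norm_two]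
      have := (norm_nonneg _).trans b2
      gcongr
  have hC0 : 0 ≤ C := (norm_nonneg _).trans (hsec 0 ⟨le_rfl, ht⟩)
  set φ' : ℝ → ℝ := fun t => q * (a - 2 * t * b + t ^ 2 * d) ^ (q - 1) * (-2 * b + 2 * t * d) with hφ'
  have hfirst : ∀ τ ∈ Icc 0 t, ‖φ' τ + 2 * q * b * a ^ (q - 1)‖ ≤ C * t := by
    intro τ hτ
    have := (convex_Icc 0 t).norm_image_sub_le_of_norm_hasDerivWithin_le (f := φ')
      (fun x hx => (hasDerivAt_quadratic_rpow_deriv (hpos x hx)).hasDerivWithinAt) hsec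
      ⟨le_rfl, ht⟩ hτ
    have e0 : φ' 0 = -(2 * q * b * a ^ (q - 1)) := by simp only [hφ']; simp; ring
    rw [e0, sub_neg_eq_add, sub_zero, Real.norm_of_nonneg hτ.1] at this
    exact this.trans (mul_le_mul_of_nonneg_left hτ.2 hC0)
  have := (convex_Icc 0 t).norm_image_sub_le_of_norm_hasDerivWithin_le
    (f := fun t => (a - 2 * t * b + t ^ 2 * d) ^ q + 2 * q * b * a ^ (q - 1) * t)
    (f' := fun τ => φ' τ + 2 * q * b * a ^ (q - 1))
    (fun x hx => ((hasDerivAt_quadratic_rpow (hpos x hx)).add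
      (by simpa using (hasDerivAt_id x).const_mul (2 * q * b * a ^ (q - 1)))).hasDerivWithinAt) hfirst
    ⟨le_rfl, ht⟩ ⟨ht, le_rfl⟩
  rw [Real.norm_eq_abs, sub_zero, Real.norm_of_nonneg ht] at this
  calc _ = |(a - 2 * t * b + t ^ 2 * d) ^ q + 2 * q * b * a ^ (q - 1) * t -
        ((a - 2 * 0 * b + 0 ^ 2 * d) ^ q + 2 * q * b * a ^ (q - 1) * 0)| := by
        congr 1; simp; ring
    _ ≤ C * t * t := this
    _ = _ := by ring

end Expansion

/-- The second order remainder of `|V - ε Ξ|^p` at `ε = 0`. -/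
def energyRemainder (p : ℝ) (V Ξ : E3) (ε : ℝ) : ℝ :=
  (‖V - ε • Ξ‖ ^ 2) ^ (p / 2) - (‖V‖ ^ 2) ^ (p / 2) + p * (ε * (‖V‖ ^ (p - 2) * ⟪V, Ξ⟫))

theorem energyRemainder_eq (p : ℝ) (V Ξ : E3) (ε : ℝ) :
    energyRemainder p V Ξ ε = (‖V‖ ^ 2 - 2 * ε * ⟪V, Ξ⟫ + ε ^ 2 * ‖Ξ‖ ^ 2) ^ (p / 2) -
      (‖V‖ ^ 2) ^ (p / 2) + 2 * (p / 2) * ε * ⟪V, Ξ⟫ * (‖V‖ ^ 2) ^ (p / 2 - 1) := by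
  have e1 : ‖V - ε • Ξ‖ ^ 2 = ‖V‖ ^ 2 - 2 * ε * ⟪V, Ξ⟫ + ε ^ 2 * ‖Ξ‖ ^ 2 := by
    rw [norm_sub_sq_real, inner_smul_right, norm_smul, mul_pow, Real.norm_eq_abs, sq_abs]; ring
  have e2 : (‖V‖ ^ 2) ^ (p / 2 - 1) = ‖V‖ ^ (p - 2) := by
    rw [← Real.rpow_natCast_mul (norm_nonneg _)]; congr 1; push_cast; ring
  rw [energyRemainder, e1, e2]
  ring

theorem tendsto_energyRemainder (p : ℝ) {V : E3} (hV : V ≠ 0) (Ξ : E3) :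
    Tendsto (fun ε => energyRemainder p V Ξ ε / ε ^ 2) (𝓝[>] 0)
      (𝓝 (p / 2 * (‖V‖ ^ (p - 2) * (‖Ξ‖ ^ 2 + (p - 2) * (⟪V, Ξ⟫ ^ 2 / ‖V‖ ^ 2))))) := by
  have hV' : 0 < ‖V‖ ^ 2 := by positivity
  have e2 : (‖V‖ ^ 2) ^ (p / 2 - 1) = ‖V‖ ^ (p - 2) := by
    rw [← Real.rpow_natCast_mul (norm_nonneg _)]; congr 1; push_cast; ring
  have := tendsto_quadratic_rpow (q := p / 2) (b := ⟪V, Ξ⟫) (d := ‖Ξ‖ ^ 2) hV'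
  simp only [energyRemainder_eq]
  convert this using 2
  rw [e2]
  ring

theorem exists_bound_energyRemainder (p : ℝ) {s M : ℝ} (hs : 0 < s) (hM : 0 < M) :
    ∃ C ε₀ : ℝ, 0 < ε₀ ∧ ∀ V Ξ : E3, s ≤ ‖V‖ ^ 2 → ‖V‖ ≤ 1 → ‖Ξ‖ ≤ M → ∀ ε : ℝ, 0 ≤ ε → ε ≤ ε₀ →
      |energyRemainder p V Ξ ε| ≤ C * ε ^ 2 := by
  obtain ⟨C, ε₀, h0, h⟩ := exists_bound_quadratic_rpow (p / 2) hs hM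
  refine ⟨C, ε₀, h0, fun V Ξ hV hV1 hΞ ε hε hε0 => ?_⟩
  rw [energyRemainder_eq]
  refine h _ _ _ hV (pow_le_one₀ (norm_nonneg _) hV1) ?_ (by positivity)
    (pow_le_pow_left₀ (norm_nonneg _) hΞ 2) ε hε hε0
  calc |⟪V, Ξ⟫| ≤ ‖V‖ * ‖Ξ‖ := abs_real_inner_le_norm _ _
    _ ≤ 1 * M := mul_le_mul hV1 hΞ (norm_nonneg _) zero_le_one
    _ = M := one_mul _

end

noncomputable section

/-! ### The energy gained in the boundary layer -/

theorem integrableOn_coneRegionDomain_snd {θ₀ : ℝ} {G : ℝ × ℝ → ℝ}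
    (hG : IntegrableOn G (Ioi 0 ×ˢ Ioo θ₀ (Real.pi - θ₀))) :
    IntegrableOn (fun q : ℝ × ℝ × ℝ => G q.2) (coneRegionDomain θ₀) := by
  have h0 : IntegrableOn (fun _ : ℝ => (1 : ℝ)) (Ioo (-Real.pi) Real.pi) :=
    integrableOn_const (by simp)
  rw [IntegrableOn, coneRegionDomain, Measure.volume_eq_prod, ← Measure.prod_restrict]
  simpa using! h0.mul_prod hG

theorem setIntegral_coneRegionDomain_snd {θ₀ : ℝ} {G : ℝ × ℝ → ℝ}
    (hG : IntegrableOn G (Ioi 0 ×ˢ Ioo θ₀ (Real.pi - θ₀))) :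
    ∫ q in coneRegionDomain θ₀, G q.2 =
      2 * Real.pi * ∫ ρ in Ioi (0 : ℝ), ∫ θ in Ioo θ₀ (Real.pi - θ₀), G (ρ, θ) := by
  have h1 := setIntegral_prod_mul (μ := (volume : Measure ℝ)) (ν := (volume : Measure (ℝ × ℝ)))
    (fun _ : ℝ => (1 : ℝ)) G (Ioo (-Real.pi) Real.pi) (Ioi 0 ×ˢ Ioo θ₀ (Real.pi - θ₀))
  simp only [one_mul] at h1
  rw [Measure.volume_eq_prod] at hG
  rw [coneRegionDomain, Measure.volume_eq_prod, h1, Measure.volume_eq_prod, setIntegral_prod _ hG]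
  congr 1
  have := Real.pi_pos
  rw [setIntegral_const, smul_eq_mul, mul_one, Real.volume_real_Ioo_of_le (by linarith)]
  ring

/-- The distance function to the left end point, cut off at height `t`. -/
theorem setIntegral_layer_left {a b t : ℝ} (ht : 0 ≤ t) (hb : a + t < b) :
    ∫ θ in Ioo a b, (if θ - a ≤ t then θ - a else 0) = t ^ 2 / 2 := by
  have e : ∀ θ ∈ Ioo a b, (if θ - a ≤ t then θ - a else 0) =
      (Ioc a (a + t)).indicator (fun θ => θ - a) θ := fun θ hθ => by
    by_cases h : θ - a ≤ t
    · rw [if_pos h, indicator_of_mem (show θ ∈ Ioc a (a + t) from ⟨hθ.1, by linarith⟩)]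
    · rw [if_neg h, indicator_of_notMem fun h' => h (by linarith [h'.2])]
  rw [setIntegral_congr_fun measurableSet_Ioo e, setIntegral_indicator measurableSet_Ioc,
    inter_eq_self_of_subset_right (show Ioc a (a + t) ⊆ Ioo a b from
      fun θ hθ => ⟨hθ.1, hθ.2.trans_lt hb⟩),
    ← intervalIntegral.integral_of_le (by linarith),
    intervalIntegral.integral_comp_sub_right (fun x => x), integral_id]
  ring

theorem setIntegral_layer_right {a b t : ℝ} (ht : 0 ≤ t) (hb : a < b - t) :
    ∫ θ in Ioo a b, (if b - θ ≤ t then b - θ else 0) = t ^ 2 / 2 := by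
  have e : ∀ θ ∈ Ioo a b, (if b - θ ≤ t then b - θ else 0) =
      (Ico (b - t) b).indicator (fun θ => b - θ) θ := fun θ hθ => by
    by_cases h : b - θ ≤ t
    · rw [if_pos h, indicator_of_mem (show θ ∈ Ico (b - t) b from ⟨by linarith, hθ.2⟩)]
    · rw [if_neg h, indicator_of_notMem fun h' => h (by linarith [h'.1])]
  rw [setIntegral_congr_fun measurableSet_Ioo e, setIntegral_indicator measurableSet_Ico,
    inter_eq_self_of_subset_right (show Ico (b - t) b ⊆ Ioo a b from
      fun θ hθ => ⟨hb.trans_le hθ.1, hθ.2⟩),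
    integral_Ico_eq_integral_Ioo, ← integral_Ioc_eq_integral_Ioo,
    ← intervalIntegral.integral_of_le (by linarith),
    intervalIntegral.integral_comp_sub_left (fun x => x), integral_id]
  ring

namespace ConeProfile
variable {p θ₀ : ℝ} {g : ℝ → ℝ}

/-- On the cone the equation forces `g + g'' = -cot θ₀/(p - 1)`. This is where the curvature enters
the first order behaviour of `1 - |∇u|^p`. -/
theorem hasDerivAt_energy_defect (h : ConeProfile p θ₀ g) :
    HasDerivAt (fun θ => (1 - gradSq g θ ^ (p / 2)) * Real.sin θ) (p * Real.cos θ₀ / (p - 1)) θ₀ := by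
  have hp := h.one_lt
  have hs := h.sin_pos
  have h1 := (h.hasDerivAt_gradSq h.mem_angle).rpow_const (p := p / 2)
    (Or.inl (h.gradSq_pos _ h.mem_angle).ne')
  convert! (h1.const_sub 1).mul (Real.hasDerivAt_sin θ₀) using 1
  simp only [h.gradSq_zero, Real.one_rpow, merCurv, latCurv, ellipSq, h.zero, h.one,
    Real.cot_eq_cos_div_sin, ne_eq, OfNat.ofNat_ne_zero, not_false_eq_true, zero_pow, one_pow, mul_one,
    zero_add]
  have : p - 1 ≠ 0 := by linarith
  field_simp
  ring

theorem eventually_energy_defect (h : ConeProfile p θ₀ g) {lam : ℝ} (hlam : lam < 1) :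
    ∀ᶠ θ in 𝓝[>] θ₀, lam * (p * Real.cos θ₀ / (p - 1)) * (θ - θ₀) ≤
      (1 - gradSq g θ ^ (p / 2)) * Real.sin θ := by
  have hp := h.one_lt
  have hcos : 0 < Real.cos θ₀ := Real.cos_pos_of_mem_Ioo
    ⟨by linarith [h.angle_pos, Real.pi_pos], h.angle_lt⟩
  have hD : 0 < p * Real.cos θ₀ / (p - 1) := div_pos (by positivity) (by linarith)
  have h0 := h.hasDerivAt_energy_defect.tendsto_slope.mono_left
    (nhdsWithin_mono _ fun t (ht : θ₀ < t) => ht.ne')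
  have hlt : lam * (p * Real.cos θ₀ / (p - 1)) < p * Real.cos θ₀ / (p - 1) := by nlinarith
  filter_upwards [h0.eventually (lt_mem_nhds hlt), self_mem_nhdsWithin] with θ h1 h2
  have h2' : 0 < θ - θ₀ := sub_pos.2 h2
  simp only [slope, vsub_eq_sub, smul_eq_mul, h.gradSq_zero, Real.one_rpow, sub_self, zero_mul,
    sub_zero] at h1
  rw [inv_mul_eq_div, lt_div_iff₀ h2'] at h1
  exact h1.le

theorem sph_mem_coneRegion (h : ConeProfile p θ₀ g) {q : ℝ × ℝ × ℝ} (hq : q ∈ coneRegionDomain θ₀) :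
    sph q.2.1 q.2.2 q.1 ∈ coneRegion θ₀ := by
  have hq2 := h.full_subset (Ioo_subset_Icc_self hq.2.2)
  have hq1 : 0 < q.2.1 := hq.2.1
  refine h.mem_iff.2 ⟨sph_ne_zero hq1 _ _, ?_⟩
  rw [polarAngle_sph hq1 (Ioo_subset_Icc_self hq2)]
  exact hq.2.2

/-- The Dirichlet energy lost in the layer `{0 < u ≤ ε ψ}`. -/
theorem eventually_layer_le (h : ConeProfile p θ₀ g) {κ c : ℝ → ℝ} {ψ : E3 → ℝ} {lam R : ℝ}
    (hκ : Continuous κ) (hκ0 : ∀ ρ, 0 ≤ κ ρ) (hκc : HasCompactSupport κ)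
    (hκs : tsupport κ ⊆ Ioi 0) (hcc : ContinuousOn c (Ioo 0 Real.pi))
    (hc0 : ∀ θ ∈ Ioo 0 Real.pi, 0 < c θ) (hcs : ∀ θ ∈ Ioo 0 Real.pi, c (Real.pi - θ) = c θ)
    (hψ : Continuous ψ) (hψR : ∀ x, R ≤ ‖x‖ → ψ x = 0)
    (hψE : ∀ x ∈ coneRegion θ₀, ψ x = κ ‖x‖ * c (polarAngle x)) (hlam0 : 0 < lam) (hlam1 : lam < 1) :
    ∀ᶠ ε in 𝓝[>] (0 : ℝ), 2 * Real.pi * (lam ^ 3 * (p / (p - 1)) * (Real.cos θ₀ * c θ₀ ^ 2 *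
        ∫ ρ in Ioi (0 : ℝ), κ ρ ^ 2)) * ε ^ 2 ≤
      ∫ x in coneRegion θ₀, if ε * ψ x < coneFun g θ₀ x then 0
        else 1 - (‖gradient (coneFun g θ₀) x‖ ^ 2) ^ (p / 2) := by
  have hp := h.one_lt
  have hpi := Real.pi_pos
  have hcos : 0 < Real.cos θ₀ := Real.cos_pos_of_mem_Ioo ⟨by linarith [h.angle_pos], h.angle_lt⟩
  have hc00 := hc0 θ₀ h.mem_angle
  -- The factor `lam < 1` absorbs the error of linearization at `θ₀`. It enters once here and twice
  -- through the thickness of the layer, hence the cube.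
  set K := lam * (p * Real.cos θ₀ / (p - 1)) with hK
  have hK0 : 0 < K := mul_pos hlam0 (div_pos (by positivity) (by linarith))
  -- a neighbourhood of the end point
  have hev : ∀ᶠ θ in 𝓝[>] θ₀, K * (θ - θ₀) ≤ (1 - gradSq g θ ^ (p / 2)) * Real.sin θ ∧
      lam * c θ₀ ≤ c θ := by
    refine (h.eventually_energy_defect hlam1).and ?_
    have := (hcc.continuousAt (Ioo_mem_nhds h.mem_angle.1 h.mem_angle.2)).eventually
      (lt_mem_nhds (show lam * c θ₀ < c θ₀ by nlinarith))
    filter_upwards [this.filter_mono nhdsWithin_le_nhds] with θ hθ using hθ.le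
  obtain ⟨b, hb, hbs⟩ := (mem_nhdsGT_iff_exists_Ioc_subset).1 hev
  have hb' : θ₀ < b := hb
  -- Small enough that the linear bounds hold within `η` of `θ₀` and that the layers at the two
  -- nappes stay disjoint.
  set η := min (b - θ₀) ((Real.pi / 2 - θ₀) / 2) with hη
  have hη0 : 0 < η := lt_min (by linarith) (by linarith [h.angle_lt])
  have hη1 : η < Real.pi / 2 - θ₀ := (min_le_right _ _).trans_lt (by linarith [h.angle_lt])
  have hnear : ∀ θ ∈ Ioc θ₀ (θ₀ + η), K * (θ - θ₀) ≤ (1 - gradSq g θ ^ (p / 2)) * Real.sin θ ∧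
      lam * c θ₀ ≤ c θ := fun θ hθ => hbs ⟨hθ.1, hθ.2.trans (by
        have := min_le_left (b - θ₀) ((Real.pi / 2 - θ₀) / 2); linarith)⟩
  -- bound for the thickness of the layer
  obtain ⟨B, hB⟩ := hκc.isCompact.exists_bound_of_continuousOn (f := fun ρ => κ ρ / ρ)
    (hκ.continuousOn.div continuousOn_id fun ρ hρ => (show (0 : ℝ) < ρ from hκs hρ).ne')
  have hB' : ∀ ρ, 0 < ρ → κ ρ / ρ ≤ |B| := fun ρ hρ => by
    by_cases hm : ρ ∈ tsupport κ
    · exact (le_abs_self _).trans ((hB ρ hm).trans (le_abs_self _))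
    · rw [image_eq_zero_of_notMem_tsupport hm, zero_div]; exact abs_nonneg _
  have hsmall : ∀ᶠ ε in 𝓝[>] (0 : ℝ), ε * (lam * c θ₀ * |B|) < η := by
    have hc : Continuous fun ε : ℝ => ε * (lam * c θ₀ * |B|) := by fun_prop
    exact ((hc.tendsto 0).eventually (gt_mem_nhds (by simpa using hη0))).filter_mono
      nhdsWithin_le_nhds
  obtain ⟨R', hR'⟩ := hκc.isCompact.isBounded.subset_closedBall 0
  have hκR : ∀ ρ, |R'| < ρ → κ ρ = 0 := fun ρ hρ => image_eq_zero_of_notMem_tsupport fun hm => by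
    have := hR' hm
    rw [mem_closedBall_zero_iff, Real.norm_eq_abs] at this
    linarith [le_abs_self ρ, le_abs_self R']
  filter_upwards [hsmall, self_mem_nhdsWithin] with ε hε hε0
  have hε0 : 0 < ε := hε0
  set u := coneFun g θ₀ with hu
  obtain ⟨Lu, hLu⟩ := h.exists_lipschitzWith
  -- A lower bound for the angular thickness of `{u ≤ εψ}` at radius `ρ`, since `u ≤ ρ (θ - θ₀)`.
  set t : ℝ → ℝ := fun ρ => ε * (lam * c θ₀) * (κ ρ / ρ) with ht
  have ht0 : ∀ ρ, 0 < ρ → 0 ≤ t ρ := fun ρ hρ => mul_nonneg (by positivity) (div_nonneg (hκ0 ρ) hρ.le)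
  have htη : ∀ ρ, 0 < ρ → t ρ ≤ η := fun ρ hρ => by
    refine le_trans ?_ hε.le
    calc ε * (lam * c θ₀) * (κ ρ / ρ) ≤ ε * (lam * c θ₀) * |B| :=
          mul_le_mul_of_nonneg_left (hB' ρ hρ) (by positivity)
      _ = _ := by ring
  -- the integrand in the layer
  set F : E3 → ℝ := fun x => if ε * ψ x < u x then 0 else 1 - (‖gradient u x‖ ^ 2) ^ (p / 2) with hF
  have hone : ∀ x, (‖gradient u x‖ ^ 2) ^ (p / 2) ≤ 1 := fun x =>
    Real.rpow_le_one (by positivity) (pow_le_one₀ (norm_nonneg _) (h.norm_gradient_coneFun_le x))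
      (by linarith)
  have hF0 : ∀ x, 0 ≤ F x := fun x => by
    simp only [hF]; split_ifs
    · exact le_rfl
    · linarith [hone x]
  have hF1 : ∀ x, F x ≤ 1 := fun x => by
    have : 0 ≤ (‖gradient u x‖ ^ 2) ^ (p / 2) := by positivity
    simp only [hF]; split_ifs <;> linarith
  have hFm : Measurable F := Measurable.ite
    (measurableSet_lt (hψ.measurable.const_mul ε) hLu.continuous.measurable) measurable_const
    (((measurable_gradient u).norm.pow_const 2).pow_const (p / 2) |>.const_sub 1)
  have hFi : IntegrableOn F (coneRegion θ₀) := by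
    have h1 : IntegrableOn F (coneRegion θ₀ ∩ Metric.closedBall 0 R) := by
      refine Measure.integrableOn_of_bounded (M := 1) ?_ hFm.aestronglyMeasurable
        (Eventually.of_forall fun x => ?_)
      · exact (measure_mono inter_subset_right).trans_lt
          (isCompact_closedBall (0 : E3) R).measure_lt_top |>.ne
      · rw [Real.norm_of_nonneg (hF0 x)]; exact hF1 x
    refine h1.of_forall_sdiff_eq_zero (isOpen_coneRegion θ₀).measurableSet fun x hx => ?_
    have hxR : R ≤ ‖x‖ := by
      by_contra hlt
      exact hx.2 ⟨hx.1, by rw [mem_closedBall_zero_iff]; linarith⟩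
    have : 0 < u x := h.coneFun_pos_iff.2 hx.1
    simp only [hF, hψR x hxR, mul_zero, if_pos this]
  -- the comparison function
  set G : ℝ × ℝ → ℝ := fun r => K * r.1 ^ 2 * ((if r.2 - θ₀ ≤ t r.1 then r.2 - θ₀ else 0) +
    if Real.pi - θ₀ - r.2 ≤ t r.1 then Real.pi - θ₀ - r.2 else 0) with hG
  have htm : Measurable t := ((hκ.measurable.div measurable_id).const_mul _)
  have hGm : Measurable G := by
    refine (((measurable_fst.pow_const 2).const_mul K)).mul (Measurable.add ?_ ?_)
    · exact Measurable.ite (measurableSet_le (measurable_snd.sub_const _) (htm.comp measurable_fst))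
        (measurable_snd.sub_const _) measurable_const
    · exact Measurable.ite (measurableSet_le (measurable_snd.const_sub _) (htm.comp measurable_fst))
        (measurable_snd.const_sub _) measurable_const
  have hGi : IntegrableOn G (Ioi 0 ×ˢ Ioo θ₀ (Real.pi - θ₀)) := by
    have h1 : IntegrableOn G (Ioc 0 |R'| ×ˢ Ioo θ₀ (Real.pi - θ₀)) := by
      refine Measure.integrableOn_of_bounded (M := K * |R'| ^ 2 * (Real.pi + Real.pi)) ?_
        hGm.aestronglyMeasurable
        (ae_restrict_of_forall_mem (measurableSet_Ioc.prod measurableSet_Ioo) fun r hr => ?_)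
      · rw [Measure.volume_eq_prod, Measure.prod_prod]
        exact ENNReal.mul_ne_top (by simp) (by simp)
      · have a1 : 0 < r.2 - θ₀ := sub_pos.2 hr.2.1
        have a2 : 0 < Real.pi - θ₀ - r.2 := sub_pos.2 hr.2.2
        have a3 : r.2 - θ₀ ≤ Real.pi := by linarith [h.angle_pos]
        have a4 : Real.pi - θ₀ - r.2 ≤ Real.pi := by linarith [h.angle_pos]
        have a5 : r.1 ≤ |R'| := hr.1.2
        have a6 : 0 < r.1 := hr.1.1
        have b1 : 0 ≤ (if r.2 - θ₀ ≤ t r.1 then r.2 - θ₀ else 0) := by split_ifs <;> linarith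
        have b2 : (if r.2 - θ₀ ≤ t r.1 then r.2 - θ₀ else 0) ≤ Real.pi := by split_ifs <;> linarith
        have b3 : 0 ≤ (if Real.pi - θ₀ - r.2 ≤ t r.1 then Real.pi - θ₀ - r.2 else 0) := by
          split_ifs <;> linarith
        have b4 : (if Real.pi - θ₀ - r.2 ≤ t r.1 then Real.pi - θ₀ - r.2 else 0) ≤ Real.pi := by
          split_ifs <;> linarith
        rw [Real.norm_of_nonneg (mul_nonneg (by positivity) (add_nonneg b1 b3))]
        gcongr
    refine h1.of_forall_sdiff_eq_zero (measurableSet_Ioi.prod measurableSet_Ioo) fun r hr => ?_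
    have hr1 : |R'| < r.1 := by
      by_contra hle
      exact hr.2 ⟨⟨hr.1.1, not_lt.1 hle⟩, hr.1.2⟩
    have hz : t r.1 = 0 := by simp only [ht, hκR _ hr1, zero_div, mul_zero]
    have a1 : 0 < r.2 - θ₀ := sub_pos.2 hr.1.2.1
    have a2 : 0 < Real.pi - θ₀ - r.2 := sub_pos.2 hr.1.2.2
    simp only [hG, hz, if_neg (not_le.2 a1), if_neg (not_le.2 a2), add_zero, mul_zero]
  have hpull : ∀ q ∈ coneRegionDomain θ₀,
      G q.2 ≤ q.2.1 ^ 2 * Real.sin q.2.2 * F (sph q.2.1 q.2.2 q.1) := by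
    intro q hq
    have hq1 : 0 < q.2.1 := hq.2.1
    have hqE := h.sph_mem_coneRegion hq
    have hq2 := h.full_subset (Ioo_subset_Icc_self hq.2.2)
    have hsin := sin_pos_of_mem hq2
    have hθ := polarAngle_sph hq1 (Ioo_subset_Icc_self hq2) q.1
    have hu' : u (sph q.2.1 q.2.2 q.1) = q.2.1 * g q.2.2 := by
      rw [hu, h.coneFun_of_mem hqE, hθ, norm_sph hq1.le]
    have hψ' : ψ (sph q.2.1 q.2.2 q.1) = κ q.2.1 * c q.2.2 := by
      rw [hψE _ hqE, hθ, norm_sph hq1.le]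
    have hS : ‖gradient u (sph q.2.1 q.2.2 q.1)‖ ^ 2 = gradSq g q.2.2 := by
      rw [hu, h.norm_sq_gradient_coneFun hqE, hθ]
    -- Formulated for an angle `ϑ` near `θ₀` with the same data, so that both nappes are covered:
    -- `ϑ` is either the angle or its reflection.
    have key : ∀ ϑ, ϑ ∈ Ioo θ₀ (Real.pi - θ₀) → g q.2.2 = g ϑ → c q.2.2 = c ϑ →
        gradSq g q.2.2 = gradSq g ϑ → Real.sin q.2.2 = Real.sin ϑ → ϑ - θ₀ ≤ t q.2.1 →
        K * q.2.1 ^ 2 * (ϑ - θ₀) ≤ q.2.1 ^ 2 * Real.sin q.2.2 * F (sph q.2.1 q.2.2 q.1) := by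
      intro ϑ hϑ e1 e2 e3 e4 hle
      obtain ⟨n1, n2⟩ := hnear ϑ ⟨hϑ.1, by linarith [htη _ hq1]⟩
      have hg := h.le_sub_angle (Ioo_subset_Icc_self hϑ)
      have hcond : ¬ ε * ψ (sph q.2.1 q.2.2 q.1) < u (sph q.2.1 q.2.2 q.1) := by
        rw [hu', hψ', e1, e2, not_lt]
        calc q.2.1 * g ϑ ≤ q.2.1 * t q.2.1 := mul_le_mul_of_nonneg_left (hg.trans hle) hq1.le
          _ = ε * (κ q.2.1 * (lam * c θ₀)) := by simp only [ht]; field_simp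
          _ ≤ _ := by
            refine mul_le_mul_of_nonneg_left (mul_le_mul_of_nonneg_left n2 (hκ0 _)) hε0.le
      simp only [hF, if_neg hcond, hS, e3, e4]
      calc K * q.2.1 ^ 2 * (ϑ - θ₀) = q.2.1 ^ 2 * (K * (ϑ - θ₀)) := by ring
        _ ≤ q.2.1 ^ 2 * ((1 - gradSq g ϑ ^ (p / 2)) * Real.sin ϑ) :=
            mul_le_mul_of_nonneg_left n1 (by positivity)
        _ = _ := by ring
    have hnn : 0 ≤ q.2.1 ^ 2 * Real.sin q.2.2 * F (sph q.2.1 q.2.2 q.1) :=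
      mul_nonneg (by positivity) (hF0 _)
    simp only [hG]
    by_cases h1 : q.2.2 - θ₀ ≤ t q.2.1
    · have h2 : ¬ Real.pi - θ₀ - q.2.2 ≤ t q.2.1 := fun h2 => by linarith [htη _ hq1]
      rw [if_pos h1, if_neg h2, add_zero]
      exact key q.2.2 hq.2.2 rfl rfl rfl rfl h1
    · by_cases h2 : Real.pi - θ₀ - q.2.2 ≤ t q.2.1
      · rw [if_neg h1, if_pos h2, zero_add]
        have := key (Real.pi - q.2.2) ⟨by linarith [hq.2.2.2], by linarith [hq.2.2.1]⟩
          (h.symm _ hq2).symm (hcs _ hq2).symm (h.gradSq_reflect hq2).symm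
          (Real.sin_pi_sub _).symm (by linarith)
        rwa [show Real.pi - q.2.2 - θ₀ = Real.pi - θ₀ - q.2.2 by ring] at this
      · rw [if_neg h1, if_neg h2, add_zero, mul_zero]
        exact hnn
  have hmD := measurableSet_coneRegionDomain θ₀
  have hFi' := (integrableOn_coneRegion_iff h.angle_pos h.angle_lt hFm.aestronglyMeasurable).1 hFi
  rw [integral_coneRegion h.angle_pos h.angle_lt hFm.aestronglyMeasurable]
  refine le_trans (le_of_eq ?_)
    (setIntegral_mono_on (integrableOn_coneRegionDomain_snd hGi) hFi' hmD hpull)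
  rw [setIntegral_coneRegionDomain_snd hGi]
  -- Each nappe contributes `t²/2`; the factor `ρ²` in `G` cancels the `ρ⁻²` in `t²`.
  have hinner : ∀ ρ ∈ Ioi (0 : ℝ), ∫ θ in Ioo θ₀ (Real.pi - θ₀), G (ρ, θ) =
      K * ε ^ 2 * (lam * c θ₀) ^ 2 * κ ρ ^ 2 := by
    intro ρ hρ
    have hρ : 0 < ρ := hρ
    have l1 := setIntegral_layer_left (a := θ₀) (b := Real.pi - θ₀) (ht0 ρ hρ)
      (by linarith [htη ρ hρ])
    have l2 := setIntegral_layer_right (a := θ₀) (b := Real.pi - θ₀) (ht0 ρ hρ)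
      (by linarith [htη ρ hρ])
    have hb : ∀ f : ℝ → ℝ, Measurable f → (∀ θ ∈ Ioo θ₀ (Real.pi - θ₀), |f θ| ≤ Real.pi) →
        IntegrableOn f (Ioo θ₀ (Real.pi - θ₀)) := fun f hf hb =>
      Measure.integrableOn_of_bounded (M := Real.pi) (by simp) hf.aestronglyMeasurable
        (ae_restrict_of_forall_mem measurableSet_Ioo hb)
    have i1 : IntegrableOn (fun θ => if θ - θ₀ ≤ t ρ then θ - θ₀ else 0) (Ioo θ₀ (Real.pi - θ₀)) :=
      hb _ (Measurable.ite (measurableSet_le (by fun_prop) measurable_const) (by fun_prop)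
        measurable_const) fun θ hθ => by
          have := h.angle_pos
          split_ifs
          · rw [abs_le]; constructor <;> linarith [hθ.1, hθ.2]
          · simpa using hpi.le
    have i2 : IntegrableOn (fun θ => if Real.pi - θ₀ - θ ≤ t ρ then Real.pi - θ₀ - θ else 0)
        (Ioo θ₀ (Real.pi - θ₀)) :=
      hb _ (Measurable.ite (measurableSet_le (by fun_prop) measurable_const) (by fun_prop)
        measurable_const) fun θ hθ => by
          have := h.angle_pos
          split_ifs
          · rw [abs_le]; constructor <;> linarith [hθ.1, hθ.2]
          · simpa using hpi.le
    simp only [hG]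
    rw [integral_const_mul, integral_add i1 i2, l1, l2]
    simp only [ht]
    field_simp
    ring
  rw [setIntegral_congr_fun measurableSet_Ioi hinner, integral_const_mul, hK]
  have : p - 1 ≠ 0 := by linarith
  field_simp

end ConeProfile

end

noncomputable section

/-! ### The cone solution is not a minimizer -/

theorem LipschitzWith.integrableOn_energy {p : ℝ} (hp : 0 < p) {L : NNReal} {v : E3 → ℝ}
    (hv : LipschitzWith L v) {U : Set E3} (hb : Bornology.IsBounded U) :
    IntegrableOn (fun x => (‖gradient v x‖ ^ 2) ^ (p / 2) +
      (p - 1) * indicator {y | 0 < v y} (fun _ => (1 : ℝ)) x) U := by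
  have hS : MeasurableSet {y | 0 < v y} := measurableSet_lt measurable_const hv.continuous.measurable
  refine Measure.integrableOn_of_bounded (M := ((L : ℝ) ^ 2) ^ (p / 2) + |p - 1| * 1)
    hb.measure_lt_top.ne ((((measurable_gradient v).norm.pow_const 2).pow_const (p / 2)).add
      ((measurable_const.indicator hS).const_mul _)).aestronglyMeasurable
    (Eventually.of_forall fun x => ?_)
  refine (norm_add_le _ _).trans (add_le_add ?_ ?_)
  · rw [Real.norm_of_nonneg (by positivity)]
    exact Real.rpow_le_rpow (by positivity)
      (pow_le_pow_left₀ (norm_nonneg _) (hv.norm_gradient_le x) 2) (by positivity)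
  · rw [norm_mul, Real.norm_eq_abs]
    refine mul_le_mul_of_nonneg_left ?_ (abs_nonneg _)
    by_cases hx : x ∈ {y | 0 < v y}
    · simp [indicator_of_mem hx]
    · simp [indicator_of_notMem hx]

theorem measurable_energyRemainder (p : ℝ) (u ψ : E3 → ℝ) (ε : ℝ) :
    Measurable fun x => energyRemainder p (gradient u x) (gradient ψ x) ε := by
  have h1 := measurable_gradient u
  have h2 := measurable_gradient ψ
  exact ((((h1.sub (h2.const_smul ε)).norm.pow_const 2).pow_const _).sub
    ((h1.norm.pow_const 2).pow_const _)).add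
    ((((h1.norm.pow_const _).mul (h1.inner h2)).const_mul ε).const_mul p)

namespace ConeProfile
variable {p θ₀ : ℝ} {g : ℝ → ℝ}

/-- The energy balance for the competitor `max (u - ε ψ, 0)`. -/
theorem energy_balance (h : ConeProfile p θ₀ g) {U : Set E3} (hU : IsOpen U)
    (hb : Bornology.IsBounded U) (hmin : IsMinimizer p U (coneFun g θ₀)) {ψ : E3 → ℝ}
    (hψ : ContDiff ℝ 1 ψ) (hψc : HasCompactSupport ψ) (hψU : tsupport ψ ⊆ U) (hψ0 : ∀ x, 0 ≤ ψ x)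
    {ε : ℝ} (hε : 0 < ε) :
    (p - 1) * (∫ x in coneRegion θ₀, if ε * ψ x < coneFun g θ₀ x then 0
        else 1 - (‖gradient (coneFun g θ₀) x‖ ^ 2) ^ (p / 2)) ≤
      ∫ x in coneRegion θ₀, if ε * ψ x < coneFun g θ₀ x then
        energyRemainder p (gradient (coneFun g θ₀) x) (gradient ψ x) ε else 0 := by
  have hp := h.one_lt
  obtain ⟨L, hu⟩ := h.exists_lipschitzWith
  have hEm := (isOpen_coneRegion θ₀).measurableSet
  have hpos : ∀ x, x ∈ coneRegion θ₀ → 0 < coneFun g θ₀ x := fun x hx => h.coneFun_pos_iff.2 hx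
  have hoff : ∀ x, x ∉ coneRegion θ₀ → coneFun g θ₀ x = 0 := fun x hx => h.coneFun_of_not_mem hx
  have hgoff : ∀ x, x ∉ coneRegion θ₀ → gradient (coneFun g θ₀) x = 0 := fun x hx =>
    h.gradient_coneFun_of_not_mem hx
  have hgpos : ∀ x, x ∈ coneRegion θ₀ → 0 < ‖gradient (coneFun g θ₀) x‖ := fun x hx =>
    h.norm_gradient_pos hx
  have hεψ : ContDiff ℝ 1 fun x => ε * ψ x := contDiff_const.mul hψ
  have hεψc : HasCompactSupport fun x => ε * ψ x := hψc.mul_left (f' := ψ)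
  obtain ⟨L₁, hL₁⟩ := hεψ.lipschitzWith_of_hasCompactSupport hεψc one_ne_zero
  have hflux := @integral_flux_eq_zero p θ₀ g h
  have hfi := @aestronglyMeasurable_flux p (coneFun g θ₀)
  have hfl := @norm_flux_le p θ₀ g h
  have hu0 : ∀ x, 0 ≤ coneFun g θ₀ x := coneFun_nonneg
  set u := coneFun g θ₀ with hudef
  -- Then `u + w = max(u - εψ, 0)`, and `w` vanishes off the positivity set, so it is orthogonal to
  -- the flux.
  set w : E3 → ℝ := fun x => -min (u x) (ε * ψ x) with hw
  set v : E3 → ℝ := fun x => u x + w x with hv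
  have hwψ : ∀ x, ψ x = 0 → w x = 0 := fun x hx => by
    simp only [hw, hx, mul_zero, min_eq_right (hu0 x), neg_zero]
  have hsupp : tsupport w ⊆ tsupport ψ := closure_mono fun x hx h' => hx (hwψ x h')
  have hwc : HasCompactSupport w := hψc.of_isClosed_subset (isClosed_tsupport _) hsupp
  have hwL : LipschitzWith (max L L₁) w := (hu.min hL₁).neg
  have hvL : LipschitzWith (L + max L L₁) v := hu.add hwL
  have hle := hmin.energy_le (by linarith) hU hb hu hwL hwc (hsupp.trans hψU)
  have hv0 : ∀ x, 0 ≤ v x := fun x => by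
    simp only [hv, hw]; linarith [min_le_left (u x) (ε * ψ x)]
  have hvz : ∀ x, u x ≤ ε * ψ x → v x = 0 := fun x hx => by
    simp only [hv, hw, min_eq_left hx, add_neg_cancel]
  have hvp : ∀ x, ε * ψ x < u x → v x = u x - ε * ψ x := fun x hx => by
    simp only [hv, hw, min_eq_right hx.le]; ring
  have hgz : ∀ x, v x = 0 → gradient v x = 0 := fun x hx => by
    have hm : IsLocalMin v x := Eventually.of_forall fun y => by rw [hx]; exact hv0 y
    rw [gradient, hm.fderiv_eq_zero, map_zero]
  set S : Set E3 := {x | ε * ψ x < u x} with hS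
  have hSo : IsOpen S := isOpen_lt (continuous_const.mul hψ.continuous) hu.continuous
  -- The change of energy density minus `p` times the flux against `w`. In the layer, where the
  -- competitor vanishes and `∇w = -∇u`, the terms `-|∇u|^p - (p-1) + p|∇u|^p` combine to `-(p-1)(1
  -- - |∇u|^p)`.
  set Q : E3 → ℝ := fun x => if ε * ψ x < u x then
      energyRemainder p (gradient u x) (gradient ψ x) ε
    else -((p - 1) * (1 - (‖gradient u x‖ ^ 2) ^ (p / 2))) with hQ
  have hvi : IntegrableOn (fun x => (‖gradient v x‖ ^ 2) ^ (p / 2) +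
      (p - 1) * indicator {y | 0 < v y} (fun _ => (1 : ℝ)) x) U :=
    hvL.integrableOn_energy (by linarith) hb
  have hui : IntegrableOn (fun x => (‖gradient u x‖ ^ 2) ^ (p / 2) +
      (p - 1) * indicator {y | 0 < u y} (fun _ => (1 : ℝ)) x) U :=
    hu.integrableOn_energy (by linarith) hb
  set fl : E3 → ℝ := fun x => ‖gradient u x‖ ^ (p - 2) * ⟪gradient u x, gradient w x⟫ with hfldef
  have hfli : IntegrableOn fl U := by
    refine Measure.integrableOn_of_bounded (M := (max L L₁ : NNReal)) hb.measure_lt_top.ne (hfi w)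
      (Eventually.of_forall fun x => ?_)
    exact (hfl x _).trans (hwL.norm_gradient_le x)
  have hfl0 : ∫ x in U, fl x = 0 := by
    rw [setIntegral_eq_integral_of_forall_compl_eq_zero]
    · exact hflux hwL hwc fun x hx => by
        simp only [hw, hoff x hx, min_eq_left (mul_nonneg hε.le (hψ0 x)), neg_zero]
    · intro x hx
      have hx' : x ∉ tsupport w := fun h' => hx (hψU (hsupp h'))
      have : gradient w x = 0 := by
        have := notMem_tsupport_iff_eventuallyEq.1 hx'
        rw [gradient, this.fderiv_eq]
        simp [Pi.zero_def]
      simp only [hfldef, this, inner_zero_right, mul_zero]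
  -- the pointwise identity
  have hae : ∀ᵐ x : E3, (‖gradient v x‖ ^ 2) ^ (p / 2) +
        (p - 1) * indicator {y | 0 < v y} (fun _ => (1 : ℝ)) x -
        ((‖gradient u x‖ ^ 2) ^ (p / 2) + (p - 1) * indicator {y | 0 < u y} (fun _ => (1 : ℝ)) x) -
        p * fl x = (coneRegion θ₀).indicator Q x := by
    filter_upwards [hu.ae_differentiableAt (μ := volume), hwL.ae_differentiableAt (μ := volume)]
      with x hxu hxw
    have hsum : gradient v x = gradient u x + gradient w x := by
      simp only [gradient]
      rw [show fderiv ℝ v x = fderiv ℝ u x + fderiv ℝ w x from fderiv_fun_add hxu hxw, map_add]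
    by_cases hxE : x ∈ coneRegion θ₀
    · have hux := hpos x hxE
      rw [indicator_of_mem hxE, indicator_of_mem (show x ∈ {y | 0 < u y} from hux)]
      by_cases hc : ε * ψ x < u x
      · have hvx : 0 < v x := by rw [hvp x hc]; linarith
        have hwg : gradient w x = -(ε • gradient ψ x) := by
          have hev : w =ᶠ[𝓝 x] fun y => -(ε * ψ y) := by
            filter_upwards [hSo.mem_nhds (show x ∈ S from hc)] with y hy
            have hy : ε * ψ y < u y := hy
            simp only [hw, min_eq_right hy.le]
          rw [gradient, hev.fderiv_eq, fderiv_fun_neg,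
            fderiv_const_mul ((hψ.differentiable one_ne_zero) x), map_neg, gradient, map_smul]
        rw [indicator_of_mem (show x ∈ {y | 0 < v y} from hvx), hsum]
        simp only [hQ, if_pos hc, hfldef, hwg, energyRemainder, inner_neg_right, inner_smul_right,
          ← sub_eq_add_neg]
        ring
      · have hvx : v x = 0 := hvz x (not_lt.1 hc)
        have hwg : gradient w x = -gradient u x := by
          rw [hgz x hvx] at hsum
          exact (neg_eq_of_add_eq_zero_right hsum.symm).symm
        have hgp := hgpos x hxE
        have hpow : ‖gradient u x‖ ^ (p - 2) * ‖gradient u x‖ ^ 2 = (‖gradient u x‖ ^ 2) ^ (p / 2) := by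
          rw [← Real.rpow_natCast_mul hgp.le, ← Real.rpow_natCast, ← Real.rpow_add hgp]
          congr 1; push_cast; ring
        rw [indicator_of_notMem (show x ∉ {y | 0 < v y} from fun h' => (ne_of_gt h') hvx), hgz x hvx]
        simp only [hQ, if_neg hc, hfldef, hwg, inner_neg_right, real_inner_self_eq_norm_sq, norm_zero,
          ne_eq, OfNat.ofNat_ne_zero, not_false_eq_true, zero_pow,
          Real.zero_rpow (show p / 2 ≠ 0 by linarith)]
        rw [mul_neg, hpow]
        ring
    · have hux := hoff x hxE
      have hvx : v x = 0 := hvz x (by rw [hux]; exact mul_nonneg hε.le (hψ0 x))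
      rw [indicator_of_notMem hxE,
        indicator_of_notMem (show x ∉ {y | 0 < v y} from fun h' => (ne_of_gt h') hvx),
        indicator_of_notMem (show x ∉ {y | 0 < u y} from fun h' => (ne_of_gt h') hux), hgz x hvx]
      simp only [hfldef, hgoff x hxE, inner_zero_left]
      ring
  have hdi : IntegrableOn (fun x => (‖gradient v x‖ ^ 2) ^ (p / 2) +
        (p - 1) * indicator {y | 0 < v y} (fun _ => (1 : ℝ)) x -
        ((‖gradient u x‖ ^ 2) ^ (p / 2) + (p - 1) * indicator {y | 0 < u y} (fun _ => (1 : ℝ)) x)) U :=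
    hvi.sub hui
  have hdi' : IntegrableOn (fun x => (‖gradient v x‖ ^ 2) ^ (p / 2) +
        (p - 1) * indicator {y | 0 < v y} (fun _ => (1 : ℝ)) x -
        ((‖gradient u x‖ ^ 2) ^ (p / 2) + (p - 1) * indicator {y | 0 < u y} (fun _ => (1 : ℝ)) x) -
        p * fl x) U := hdi.sub (hfli.const_mul p)
  have hQU : IntegrableOn ((coneRegion θ₀).indicator Q) U :=
    hdi'.congr_fun_ae (ae_restrict_of_ae hae)
  have hQ0 : ∀ x, x ∉ U → (coneRegion θ₀).indicator Q x = 0 := by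
    intro x hx
    have hx' : x ∉ tsupport ψ := fun h' => hx (hψU h')
    by_cases hxE : x ∈ coneRegion θ₀
    · have h1 : gradient ψ x = 0 := by
        rw [gradient, (notMem_tsupport_iff_eventuallyEq.1 hx').fderiv_eq]
        simp [Pi.zero_def]
      have h2 : ε * ψ x < u x := by
        rw [image_eq_zero_of_notMem_tsupport hx', mul_zero]; exact hpos x hxE
      rw [indicator_of_mem hxE]
      simp only [hQ, if_pos h2, h1, energyRemainder, smul_zero, sub_zero, sub_self, inner_zero_right,
        mul_zero, add_zero]
    · exact indicator_of_notMem hxE _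
  have hQE : IntegrableOn Q (coneRegion θ₀) := by
    rw [← integrable_indicator_iff hEm]
    exact integrableOn_iff_integrable_of_support_subset (fun x hx => by
      by_contra h'; exact hx (hQ0 x h')) |>.1 hQU
  have hint : 0 ≤ ∫ x in coneRegion θ₀, Q x := by
    rw [← integral_indicator hEm, ← setIntegral_eq_integral_of_forall_compl_eq_zero hQ0,
      ← integral_congr_ae (ae_restrict_of_ae hae), integral_sub hdi (hfli.const_mul p),
      integral_const_mul, hfl0, mul_zero, sub_zero, integral_sub hvi hui, sub_nonneg]
    exact hle
  set A : E3 → ℝ := fun x => if ε * ψ x < u x then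
      energyRemainder p (gradient u x) (gradient ψ x) ε else 0 with hA
  set T : E3 → ℝ := fun x => if ε * ψ x < u x then 0
      else 1 - (‖gradient u x‖ ^ 2) ^ (p / 2) with hT
  have hAi : IntegrableOn A (coneRegion θ₀) := by
    refine (hQE.indicator hSo.measurableSet).congr (Eventually.of_forall fun x => ?_)
    by_cases hc : ε * ψ x < u x
    · rw [indicator_of_mem (show x ∈ S from hc)]; simp only [hQ, hA, if_pos hc]
    · rw [indicator_of_notMem (show x ∉ S from hc)]; simp only [hA, if_neg hc]
  have hTi : IntegrableOn (fun x => (p - 1) * T x) (coneRegion θ₀) := by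
    refine (hAi.sub hQE).congr (Eventually.of_forall fun x => ?_)
    simp only [Pi.sub_apply, hQ, hA, hT]
    split_ifs <;> ring
  have hsplit : ∫ x in coneRegion θ₀, Q x =
      (∫ x in coneRegion θ₀, A x) - (p - 1) * ∫ x in coneRegion θ₀, T x := by
    rw [← integral_const_mul, ← integral_sub hAi hTi]
    refine integral_congr_ae (Eventually.of_forall fun x => ?_)
    simp only [hQ, hA, hT]
    split_ifs <;> ring
  rw [hsplit] at hint
  linarith

/-- The second order expansion of the bulk energy. -/
theorem tendsto_integral_energyRemainder (h : ConeProfile p θ₀ g) {ψ : E3 → ℝ}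
    (hψ : ContDiff ℝ 1 ψ) (hψc : HasCompactSupport ψ) :
    Tendsto (fun ε => (∫ x in coneRegion θ₀, if ε * ψ x < coneFun g θ₀ x then
        energyRemainder p (gradient (coneFun g θ₀) x) (gradient ψ x) ε else 0) / ε ^ 2)
      (𝓝[>] 0)
      (𝓝 (p / 2 * ∫ x in coneRegion θ₀, stabilityDensity p (coneFun g θ₀) ψ x)) := by
  obtain ⟨L, hu⟩ := h.exists_lipschitzWith
  have hEm := (isOpen_coneRegion θ₀).measurableSet
  obtain ⟨M, hM⟩ := (continuous_gradient hψ).bounded_above_of_compact_support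
    (hasCompactSupport_gradient hψc)
  obtain ⟨R, hR⟩ := hψc.isCompact.isBounded.subset_closedBall 0
  have hs := h.gradSq_pos _ h.half_mem
  obtain ⟨C, ε₀, hε₀, hC⟩ := exists_bound_energyRemainder p hs
    (show 0 < |M| + 1 by positivity)
  set u := coneFun g θ₀ with hudef
  simp only [← integral_div, ← integral_const_mul]
  refine tendsto_integral_filter_of_dominated_convergence
    ((Metric.closedBall (0 : E3) R).indicator fun _ => C) ?_ ?_ ?_ ?_
  · refine Eventually.of_forall fun ε => Measurable.aestronglyMeasurable ?_
    exact (Measurable.ite (measurableSet_lt (hψ.continuous.measurable.const_mul ε)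
      hu.continuous.measurable) (measurable_energyRemainder p u ψ ε) measurable_const).div_const _
  · filter_upwards [Ioc_mem_nhdsGT hε₀] with ε hε
    refine ae_restrict_of_forall_mem hEm fun x hx => ?_
    have hε2 : 0 < ε ^ 2 := by have := hε.1; positivity
    have hV : gradSq g (Real.pi / 2) ≤ ‖gradient u x‖ ^ 2 := by
      rw [hudef, h.norm_sq_gradient_coneFun hx]
      exact h.gradSq_half_le (Ioo_subset_Icc_self (h.mem_iff.1 hx).2)
    have hrem := hC _ (gradient ψ x) hV (h.norm_gradient_coneFun_le x)
      ((hM x).trans (by linarith [le_abs_self M])) ε hε.1.le hε.2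
    have hC0 : 0 ≤ C := by
      have := (abs_nonneg _).trans hrem
      exact nonneg_of_mul_nonneg_left this hε2
    rw [norm_div, Real.norm_eq_abs, Real.norm_of_nonneg hε2.le, div_le_iff₀ hε2]
    by_cases hxR : x ∈ Metric.closedBall (0 : E3) R
    · rw [indicator_of_mem hxR]
      split_ifs
      · exact hrem
      · simpa using mul_nonneg hC0 hε2.le
    · have hx' : x ∉ tsupport ψ := fun h' => hxR (hR h')
      have h1 : gradient ψ x = 0 := by
        rw [gradient, (notMem_tsupport_iff_eventuallyEq.1 hx').fderiv_eq]
        simp [Pi.zero_def]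
      rw [indicator_of_notMem hxR, h1]
      simp [energyRemainder]
  · exact ((integrable_indicator_iff measurableSet_closedBall).2
      (integrableOn_const (isCompact_closedBall (0 : E3) R).measure_lt_top.ne)).integrableOn
  · refine ae_restrict_of_forall_mem hEm fun x hx => ?_
    have hux : 0 < u x := h.coneFun_pos_iff.2 hx
    have hc : Continuous fun ε : ℝ => ε * ψ x := by fun_prop
    have hev : ∀ᶠ ε in 𝓝[>] (0 : ℝ), ε * ψ x < u x :=
      ((hc.tendsto 0).eventually (gt_mem_nhds (by simpa using hux))).filter_mono nhdsWithin_le_nhds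
    refine (tendsto_energyRemainder p (norm_pos_iff.1 (h.norm_gradient_pos hx)) (gradient ψ x)).congr' ?_
    filter_upwards [hev] with ε hε
    rw [if_pos hε]

/-- The unstable `ψ` can be supported in an arbitrarily small ball around the vertex, hence inside
`U`. To second order in `ε`, the balance for a minimizer would make the second variation nonnegative
along it. -/
theorem not_isMinimizer (h : ConeProfile p θ₀ g) {U : Set E3} (hU : IsOpen U)
    (hb : Bornology.IsBounded U) (h0 : (0 : E3) ∈ U) : ¬ IsMinimizer p U (coneFun g θ₀) := by
  intro hmin
  have hp := h.one_lt
  obtain ⟨r, hr, hrU⟩ := Metric.isOpen_iff.1 hU 0 h0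
  obtain ⟨κ, c, ψ, hκ, hκ0, hκc, hκs, hcc, hc0, hcs, hψ, hψc, hψs, hψ0, hψE, -, -, hlt⟩ :=
    h.exists_unstable hr
  have hψ1 : ContDiff ℝ 1 ψ := hψ.of_le (by exact_mod_cast le_top)
  set X := Real.cos θ₀ * c θ₀ ^ 2 * ∫ ρ in Ioi (0 : ℝ), κ ρ ^ 2 with hX
  set I := ∫ x in coneRegion θ₀, stabilityDensity p (coneFun g θ₀) ψ x with hI
  -- Instability is strict, so there is room for the factor `lam³` lost in the layer estimate.
  obtain ⟨lam, hlam, hlam0, hlam1⟩ : ∃ lam : ℝ, I < lam ^ 3 * (4 * Real.pi * X) ∧ 0 < lam ∧ lam < 1 := by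
    have hcont : Continuous fun lam : ℝ => lam ^ 3 * (4 * Real.pi * X) := by fun_prop
    have h1 := (hcont.tendsto 1).eventually (lt_mem_nhds (show I < 1 ^ 3 * (4 * Real.pi * X) by linarith))
    have h2 := (h1.filter_mono nhdsWithin_le_nhds).and
      (Ioo_mem_nhdsLT (show (0 : ℝ) < 1 by norm_num))
    obtain ⟨lam, ha, hb⟩ := h2.exists
    exact ⟨lam, ha, hb.1, hb.2⟩
  have hbulk := (h.tendsto_integral_energyRemainder hψ1 hψc).eventually (gt_mem_nhds
    (show p / 2 * I < p / 2 * (lam ^ 3 * (4 * Real.pi * X)) from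
      mul_lt_mul_of_pos_left hlam (by linarith)))
  have hlayer := h.eventually_layer_le (R := r) hκ.continuous hκ0 hκc
    (hκs.trans Ioo_subset_Ioi_self) hcc hc0 hcs hψ.continuous (fun x hx =>
      image_eq_zero_of_notMem_tsupport fun h' => by
        have := (hψs h').1
        rw [mem_ball_zero_iff] at this
        linarith) hψE hlam0 hlam1
  obtain ⟨ε, ⟨e1, e2⟩, hε⟩ := ((hbulk.and hlayer).and self_mem_nhdsWithin).exists
  have hε : 0 < ε := hε
  have e3 := h.energy_balance hU hb hmin hψ1 hψc
    (fun x hx => hrU (hψs hx).1) hψ0 hε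
  rw [div_lt_iff₀ (by positivity)] at e1
  have e4 := mul_le_mul_of_nonneg_left e2 (show 0 ≤ p - 1 by linarith)
  have hp1 : p - 1 ≠ 0 := by linarith
  -- The normalization `λ² = p - 1` cancels the denominator from the slope of `1 - |∇u|^p`; bulk and
  -- layer then carry the same factor `p/2`.
  have e5 : (p - 1) * (2 * Real.pi * (lam ^ 3 * (p / (p - 1)) * X) * ε ^ 2) =
      p / 2 * (lam ^ 3 * (4 * Real.pi * X)) * ε ^ 2 := by
    field_simp; ring
  linarith

end ConeProfile

end

/-! ### Assembly of the theorem. -/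

theorem mainTheorem5 (p : ℝ) (hp : 1 < p) (f : ℝ → ℝ) (θ₀ : ℝ)
    (hf : SolvesPLegendre p f)
    (hsymm : ∀ θ ∈ Set.Ioo 0 Real.pi, f (Real.pi - θ) = f θ)
    (hθ₀ : θ₀ ∈ Set.Ioc 0 (Real.pi / 2)) (hzero : f θ₀ = 0)
    (honly : ∀ θ ∈ Set.Ioc 0 (Real.pi / 2), f θ = 0 → θ = θ₀) :
    -- `u` is a weak solution, and `|∇u| = 1` on the free boundary away from the vertex
    IsWeakSolution p 1 (coneFun f θ₀) ∧
    (∀ x ∈ frontier {y : E3 | 0 < coneFun f θ₀ y}, x ≠ 0 →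
      Filter.Tendsto (fun y => ‖gradient (coneFun f θ₀) y‖)
        (nhdsWithin x {y : E3 | 0 < coneFun f θ₀ y}) (nhds 1)) ∧
    -- the free boundary is a (nondegenerate) double cone
    θ₀ < Real.pi / 2 ∧
    frontier {x : E3 | 0 < coneFun f θ₀ x} = {x : E3 | |x 2| = Real.cos θ₀ * ‖x‖} ∧
    -- `u` is not a minimizer in any bounded open set containing the vertex
    (∀ U : Set E3, IsOpen U → Bornology.IsBounded U → (0 : E3) ∈ U →
      ¬ IsMinimizer p U (coneFun f θ₀)) ∧
    -- the stability inequality is violated; here `H` is the mean curvature of the free boundary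
    (∃ H : E3 → ℝ,
      (∀ x ∈ frontier {y : E3 | 0 < coneFun f θ₀ y}, x ≠ 0 →
        HasMeanCurvatureAt {y : E3 | 0 < coneFun f θ₀ y} x (H x)) ∧
      (∃ ψ : E3 → ℝ, IsTestFunction {x : E3 | x ≠ 0} ψ ∧
        StabilityNegative p (coneFun f θ₀) H ψ) ∧
      (2 ≤ p → p < 5 → ∀ ξ : ℝ → ℝ, IsCutoff ξ → ∀ δ : ℝ, 0 < δ →
        ∀ᶠ R in Filter.atTop,
          StabilityNegative p (coneFun f θ₀) H (truncatedFundamental ξ δ R))) := by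
  have h := coneProfile_of_solvesPLegendre hp hf hsymm hθ₀ hzero honly
  rw [h.coneFun_eq rfl, h.setOf_coneFun_pos]
  have hΓ := frontier_coneRegion h.angle_pos h.angle_lt
  refine ⟨h.isWeakSolution, fun x hx h0 => h.tendsto_norm_gradient hx h0, h.angle_lt, hΓ,
    fun U hU hb h0 => h.not_isMinimizer hU hb h0, fun x => Real.cot θ₀ / ‖x‖, fun x hx h0 => ?_,
    h.exists_stabilityNegative, fun hp2 hp5 ξ hξ δ hδ => h.eventually_stabilityNegative hp2 hp5 hξ hδ⟩
  rw [hΓ] at hx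
  exact hasMeanCurvatureAt_coneRegion h.angle_pos h.angle_lt h0 hx
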